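/- Let $0<\beta<1/3$ and put $$m_\beta(k)=\sqrt{(1+\beta k^2)\frac{\tanh k}{k}}\quad(m_\beta(0)=1),\qquad \gamma_\beta=\frac{1-3\beta}{6},\qquad \sigma_\beta(X)=\frac{1-3\beta}{4}\,\mathrm{sech}^2\!\left(\frac X2\right).$$ For $\epsilon>0$ let $\mathcal L_\epsilon$ be the Fourier multiplier operator on $\mathbb R$ with symbol $$l_\epsilon(K)=\epsilon^{-2}\left(m_\beta(\epsilon K)-1-\gamma_\beta\epsilon^2\right).$$ For $r\ge0$ and $q>0$ let $E^r_q$ be the space of real-valued even functions $f\in L^2(\mathbb R)$ with $\cosh^q(\cdot)f\in H^r(\mathbb R)$, normed by $\|f\|_{r,q}=\|\cosh^q(\cdot)f\|_{H^r(\mathbb R)}$. There exist $\epsilon_0>0$ and $q_0>0$ (depending only on $\beta$) such that for all $r\ge0$ and $q\in(0,q_0]$ there is a constant $C_{r,q}>0$ for which the following holds for every $\epsilon\in(0,\epsilon_0]$. There is exactly one $K_\epsilon>0$ with $l_\epsilon(K_\epsilon)=0$, and there are bounded linear maps $$\mathcal R_\epsilon:E^r_q\to E^{r+1/2}_q,\qquad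 \mathcal A_\epsilon:E^r_q\to\mathbb R$$ such that for all $R\in E^{r+1/2}_q$, $a\in\mathbb R$ and $G\in E^r_q$, $$\mathcal L_\epsilon R+2\sigma_\beta R+2a\,\sigma_\beta\cos(K_\epsilon X)=G\quad\Longleftrightarrow\quad R=\mathcal R_\epsilon G\ \text{ and }\ a=\mathcal A_\epsilon G.$$ Moreover $$\|\mathcal R_\epsilon\|_{B(E^r_q,E^{r+1/2}_q)}\le C_{r,q},\qquad \|\mathcal A_\epsilon\|_{B(E^r_q,\mathbb R)}\le C_{r,q}\,\epsilon^r.$$ -/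

import Mathlib

open MeasureTheory FourierTransform

noncomputable section

namespace Whitham

/-! ### The Whitham symbol and the linearized operator -/

/-- The phase speed `m_β(k) = √((1 + β k²) tanh k / k)`, with its continuous value `1` at `k = 0`. -/
def phaseSpeed (β k : ℝ) : ℝ :=
  if k = 0 then 1 else Real.sqrt ((1 + β * k ^ 2) * (Real.tanh k / k))

/-- The constant `γ_β = (1 - 3 β) / 6`. -/
def gammaCoeff (β : ℝ) : ℝ := (1 - 3 * β) / 6

/-- The symbol `l_ε(K) = ε⁻² (m_β(ε K) - 1 - γ_β ε²)` of the operator `L_ε`. -/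
def linSymbol (β ε K : ℝ) : ℝ :=
  (phaseSpeed β (ε * K) - 1 - gammaCoeff β * ε ^ 2) / ε ^ 2

/-- The KdV solitary wave `σ_β(X) = ((1 - 3 β) / 4) sech²(X / 2)`. -/
def soliton (β X : ℝ) : ℝ := (1 - 3 * β) / 4 * (1 / Real.cosh (X / 2)) ^ 2

/-- A real square-integrable function seen as a complex one. -/
def toComplexL2 (f : Lp ℝ 2 (volume : Measure ℝ)) : Lp ℂ 2 (volume : Measure ℝ) :=
  Complex.ofRealCLM.compLp f

/-- `v = M u`, where `M` is the Fourier multiplier with symbol `m`. Mathlib's Fourier transform is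
`𝓕 u ξ = ∫ u(x) exp(-2π i x ξ) dx`, so its variable `ξ` is the wave number `k = 2π ξ`. For given
`m` and `u` there is at most one such `v`, as `𝓕` is injective on `L²`. -/
def IsMultiplierImage (m : ℝ → ℝ) (u v : Lp ℂ 2 (volume : Measure ℝ)) : Prop :=
  ∀ᵐ ξ : ℝ, (𝓕 v : Lp ℂ 2 (volume : Measure ℝ)) ξ
    = (m (2 * Real.pi * ξ) : ℂ) * (𝓕 u : Lp ℂ 2 (volume : Measure ℝ)) ξ

/-! ### Weighted Sobolev spaces of even functions -/

open Classical in
/-- The `L²` Fourier transform of a square-integrable function (only used for such functions;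
`0` otherwise). -/
def fourierL2 (g : ℝ → ℂ) : Lp ℂ 2 (volume : Measure ℝ) :=
  if h : MemLp g 2 volume then 𝓕 (h.toLp g) else 0

/-- The function `⟨k⟩^r ĝ` with `k = 2π ξ` and `⟨k⟩ = √(1 + k²)`, whose `L²` norm is the norm of
`g` in `H^r(ℝ)`. -/
def besselFourier (r : ℝ) (g : ℝ → ℂ) (ξ : ℝ) : ℂ :=
  (((1 + (2 * Real.pi * ξ) ^ 2) ^ (r / 2) : ℝ) : ℂ) * fourierL2 g ξ

/-- Membership in the Sobolev space `H^r(ℝ)`, `r ≥ 0`. -/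
def MemH (r : ℝ) (g : ℝ → ℂ) : Prop :=
  MemLp g 2 volume ∧ MemLp (besselFourier r g) 2 volume

/-- The function `cosh(x)^q f(x)`. -/
def coshWeighted (q : ℝ) (f : Lp ℝ 2 (volume : Measure ℝ)) (x : ℝ) : ℂ :=
  ((Real.cosh x ^ q * f x : ℝ) : ℂ)

lemma fourierL2_congr {g h : ℝ → ℂ} (hgh : g =ᵐ[volume] h) : fourierL2 g = fourierL2 h := by
  unfold fourierL2
  by_cases hg : MemLp g 2 volume
  · have hh : MemLp h 2 volume := (memLp_congr_ae hgh).1 hg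
    rw [dif_pos hg, dif_pos hh, (MemLp.toLp_eq_toLp_iff hg hh).2 hgh]
  · have hh : ¬ MemLp h 2 volume := fun hh => hg ((memLp_congr_ae hgh).2 hh)
    rw [dif_neg hg, dif_neg hh]

lemma fourierL2_add {g h : ℝ → ℂ} (hg : MemLp g 2 volume) (hh : MemLp h 2 volume) :
    fourierL2 (g + h) = fourierL2 g + fourierL2 h := by
  unfold fourierL2
  rw [dif_pos hg, dif_pos hh, dif_pos (hg.add hh), MemLp.toLp_add, FourierTransform.fourier_add]

lemma fourierL2_smul (c : ℂ) {g : ℝ → ℂ} (hg : MemLp g 2 volume) :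
    fourierL2 (c • g) = c • fourierL2 g := by
  unfold fourierL2
  rw [dif_pos hg, dif_pos (hg.const_smul c), MemLp.toLp_const_smul,
    FourierTransform.fourier_smul]

lemma besselFourier_congr (r : ℝ) {g h : ℝ → ℂ} (hgh : g =ᵐ[volume] h) :
    besselFourier r g = besselFourier r h := by
  unfold besselFourier
  rw [fourierL2_congr hgh]

lemma besselFourier_add (r : ℝ) {g h : ℝ → ℂ} (hg : MemLp g 2 volume) (hh : MemLp h 2 volume) :
    besselFourier r (g + h) =ᵐ[volume] besselFourier r g + besselFourier r h := by
  filter_upwards [Lp.coeFn_add (fourierL2 g) (fourierL2 h)] with ξ hξ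
  simp only [besselFourier, fourierL2_add hg hh, hξ, Pi.add_apply, mul_add]

lemma besselFourier_smul (r : ℝ) (c : ℂ) {g : ℝ → ℂ} (hg : MemLp g 2 volume) :
    besselFourier r (c • g) =ᵐ[volume] c • besselFourier r g := by
  filter_upwards [Lp.coeFn_smul c (fourierL2 g)] with ξ hξ
  simp only [besselFourier, fourierL2_smul c hg, hξ, Pi.smul_apply, smul_eq_mul]
  ring

lemma MemH.congr {r : ℝ} {g h : ℝ → ℂ} (hg : MemH r g) (hgh : g =ᵐ[volume] h) : MemH r h :=
  ⟨(memLp_congr_ae hgh).1 hg.1, besselFourier_congr r hgh ▸ hg.2⟩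

lemma MemH.add {r : ℝ} {g h : ℝ → ℂ} (hg : MemH r g) (hh : MemH r h) : MemH r (g + h) :=
  ⟨hg.1.add hh.1, (memLp_congr_ae (besselFourier_add r hg.1 hh.1)).2 (hg.2.add hh.2)⟩

lemma MemH.smul {r : ℝ} (c : ℂ) {g : ℝ → ℂ} (hg : MemH r g) : MemH r (c • g) :=
  ⟨hg.1.const_smul c, (memLp_congr_ae (besselFourier_smul r c hg.1)).2 (hg.2.const_smul c)⟩

lemma coshWeighted_add (q : ℝ) (f g : Lp ℝ 2 (volume : Measure ℝ)) :
    coshWeighted q f + coshWeighted q g =ᵐ[volume] coshWeighted q (f + g) := by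
  filter_upwards [Lp.coeFn_add f g] with x hx
  simp only [coshWeighted, hx, Pi.add_apply]
  push_cast
  ring

lemma coshWeighted_smul (q c : ℝ) (f : Lp ℝ 2 (volume : Measure ℝ)) :
    (c : ℂ) • coshWeighted q f =ᵐ[volume] coshWeighted q (c • f) := by
  filter_upwards [Lp.coeFn_smul c f] with x hx
  simp only [coshWeighted, hx, Pi.smul_apply, smul_eq_mul]
  push_cast
  ring

/-- The real vector space of the even functions `f ∈ L²(ℝ)` with `cosh^q f ∈ H^r(ℝ)`. -/
def evenSobolevSubmodule (r q : ℝ) : Submodule ℝ (Lp ℝ 2 (volume : Measure ℝ)) where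
  carrier := {f | (∀ᵐ x : ℝ, f (-x) = f x) ∧ MemH r (coshWeighted q f)}
  add_mem' := by
    rintro f g ⟨hf, hf'⟩ ⟨hg, hg'⟩
    refine ⟨?_, (hf'.add hg').congr (coshWeighted_add q f g)⟩
    have h := Lp.coeFn_add f g
    have h' := (Measure.measurePreserving_neg (volume : Measure ℝ)).quasiMeasurePreserving.ae h
    filter_upwards [hf, hg, h, h'] with x h1 h2 h3 h4
    rw [h3, h4, Pi.add_apply, Pi.add_apply, h1, h2]
  zero_mem' := by
    have h := Lp.coeFn_zero ℝ 2 (volume : Measure ℝ)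
    have h' := (Measure.measurePreserving_neg (volume : Measure ℝ)).quasiMeasurePreserving.ae h
    refine ⟨by filter_upwards [h, h'] with x h3 h4; rw [h3, h4]; rfl, ?_⟩
    have hz : coshWeighted q 0 =ᵐ[volume] 0 := by
      filter_upwards [h] with x hx
      simp only [coshWeighted, hx, Pi.zero_apply, mul_zero, Complex.ofReal_zero]
    have hF : fourierL2 0 = 0 := by simpa using fourierL2_smul 0 (MemLp.zero' (ε := ℂ))
    have hB : besselFourier r 0 =ᵐ[volume] 0 := by
      filter_upwards [Lp.coeFn_zero ℂ 2 (volume : Measure ℝ)] with ξ hξ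
      simp only [besselFourier, hF, hξ, Pi.zero_apply, mul_zero]
    exact MemH.congr ⟨MemLp.zero, (memLp_congr_ae hB).2 MemLp.zero⟩ hz.symm
  smul_mem' := by
    rintro c f ⟨hf, hf'⟩
    refine ⟨?_, (hf'.smul (c : ℂ)).congr (coshWeighted_smul q c f)⟩
    have h := Lp.coeFn_smul c f
    have h' := (Measure.measurePreserving_neg (volume : Measure ℝ)).quasiMeasurePreserving.ae h
    filter_upwards [hf, h, h'] with x h1 h3 h4
    rw [h3, h4, Pi.smul_apply, Pi.smul_apply, h1]

/-- The space `E^r_q`. It is a type of its own, so as not to carry the norm of `L²(ℝ)`. -/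
def EvenSobolev (r q : ℝ) : Type := evenSobolevSubmodule r q

instance (r q : ℝ) : AddCommGroup (EvenSobolev r q) :=
  inferInstanceAs (AddCommGroup (evenSobolevSubmodule r q))

instance (r q : ℝ) : Module ℝ (EvenSobolev r q) :=
  inferInstanceAs (Module ℝ (evenSobolevSubmodule r q))

/-- The underlying square-integrable function of an element of `E^r_q`. -/
def EvenSobolev.fn {r q : ℝ} (f : EvenSobolev r q) : Lp ℝ 2 (volume : Measure ℝ) := Subtype.val f

lemma EvenSobolev.memH {r q : ℝ} (f : EvenSobolev r q) : MemH r (coshWeighted q f.fn) :=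
  f.property.2

/-- The map `f ↦ ⟨k⟩^r (cosh^q f)^`, from `E^r_q` to `L²`. -/
def EvenSobolev.toL2 (r q : ℝ) : EvenSobolev r q →ₗ[ℝ] Lp ℂ 2 (volume : Measure ℝ) where
  toFun f := f.memH.2.toLp (besselFourier r (coshWeighted q f.fn))
  map_add' f g := by
    rw [← MemLp.toLp_add, MemLp.toLp_eq_toLp_iff]
    exact (Filter.EventuallyEq.of_eq
      (besselFourier_congr r (coshWeighted_add q f.fn g.fn).symm)).trans
      (besselFourier_add r f.memH.1 g.memH.1)
  map_smul' c f := by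
    have h : (c • f).memH.2.toLp (besselFourier r (coshWeighted q (c • f).fn))
        = (f.memH.2.const_smul (c : ℂ)).toLp ((c : ℂ) • besselFourier r (coshWeighted q f.fn)) := by
      rw [MemLp.toLp_eq_toLp_iff]
      exact (Filter.EventuallyEq.of_eq
        (besselFourier_congr r (coshWeighted_smul q c f.fn).symm)).trans
        (besselFourier_smul r (c : ℂ) f.memH.1)
    exact h.trans (MemLp.toLp_const_smul (c : ℂ) f.memH.2)

lemma EvenSobolev.toL2_injective (r q : ℝ) : Function.Injective (EvenSobolev.toL2 r q) := by
  rw [injective_iff_map_eq_zero]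
  intro f hf
  have h0 : besselFourier r (coshWeighted q f.fn) =ᵐ[volume] 0 :=
    (MemLp.toLp_eq_toLp_iff f.memH.2 MemLp.zero).1 (hf.trans (MemLp.toLp_zero _).symm)
  have h1 : fourierL2 (coshWeighted q f.fn) = 0 := by
    refine Lp.ext ?_
    filter_upwards [h0, Lp.coeFn_zero ℂ 2 (volume : Measure ℝ)] with ξ hξ hz
    have hpos : (0 : ℝ) < (1 + (2 * Real.pi * ξ) ^ 2) ^ (r / 2) := by positivity
    rw [hz]
    exact (mul_eq_zero.1 hξ).resolve_left (Complex.ofReal_ne_zero.2 hpos.ne')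
  have h2 : coshWeighted q f.fn =ᵐ[volume] 0 := by
    unfold fourierL2 at h1
    rw [dif_pos f.memH.1] at h1
    have h3 : f.memH.1.toLp (coshWeighted q f.fn) = 0 :=
      (Lp.fourierTransformₗᵢ ℝ ℂ).map_eq_zero_iff.1 h1
    exact (MemLp.toLp_eq_toLp_iff f.memH.1 MemLp.zero).1 (h3.trans (MemLp.toLp_zero _).symm)
  refine Subtype.ext (Lp.ext ?_)
  filter_upwards [h2, Lp.coeFn_zero ℝ 2 (volume : Measure ℝ)] with x hx hz
  have hpos : (0 : ℝ) < Real.cosh x ^ q := Real.rpow_pos_of_pos (Real.cosh_pos x) q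
  have hx' : Real.cosh x ^ q * f.fn x = 0 := Complex.ofReal_eq_zero.1 hx
  exact ((mul_eq_zero.1 hx').resolve_left hpos.ne').trans hz.symm

/-- The norm `‖f‖_{r,q} = ‖cosh^q f‖_{H^r} = ‖⟨k⟩^r (cosh^q f)^‖_{L²}` on `E^r_q`. -/
instance (r q : ℝ) : NormedAddCommGroup (EvenSobolev r q) :=
  NormedAddCommGroup.induced (EvenSobolev r q) (Lp ℂ 2 (volume : Measure ℝ))
    (EvenSobolev.toL2 r q) (EvenSobolev.toL2_injective r q)

instance (r q : ℝ) : NormedSpace ℝ (EvenSobolev r q) :=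
  NormedSpace.induced ℝ (EvenSobolev r q) (Lp ℂ 2 (volume : Measure ℝ)) (EvenSobolev.toL2 r q)

/-! ### The linear problem -/

/-- The equation `L_ε R + 2 σ_β R + 2 a σ_β cos(K X) = G`, almost everywhere on `ℝ`. -/
def LinearProblem (β ε K : ℝ) (R : Lp ℝ 2 (volume : Measure ℝ)) (a : ℝ)
    (G : Lp ℝ 2 (volume : Measure ℝ)) : Prop :=
  ∃ LR : Lp ℂ 2 (volume : Measure ℝ),
    IsMultiplierImage (linSymbol β ε) (toComplexL2 R) LR ∧
    ∀ᵐ X : ℝ, LR X + ((2 * soliton β X * R X : ℝ) : ℂ)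
      + ((2 * a * soliton β X * Real.cos (K * X) : ℝ) : ℂ) = ((G X : ℝ) : ℂ)

end Whitham

end

/-!
# Solvability of the linearized Whitham equation around the KdV soliton

Write `γ` for `gammaCoeff β`, so that `2σ(x) = 3γ sech²(x/2)`. As `ε → 0` the symbol `l_ε(k)` tends to
the KdV symbol `-γ(1 + k²)`, but it also has two simple zeros `±K_ε` with `K_ε` of order `1/ε`. The term
`2aσ cos(K_ε x)` compensates for them: `l_ε(D) R = Φ` has an exponentially decaying solution only if the
Fourier transform of `Φ` vanishes at `±K_ε`, and for even functions that is a single condition, which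
determines `a`.

*The symbol.* `l_ε` extends holomorphically to a strip. The squared phase speed at `k` equals `b` iff
`criticalBeta b k = β`, and `criticalBeta b` is decreasing, so there is a unique positive zero and it is
simple. Together with the long-wave expansion of `tanh` this gives `exists_linSymbol_bounds`: off the
real axis `1/l_ε` decays like `|k|^{-1/2}` uniformly in `ε`, and on `|Im k| = 1/2` it is within `O(ε)` of
`-1/(γ(1 + k²))`.

*The multiplier.* If the Fourier transform of an exponentially localized `Φ` vanishes at `±K_ε`, its
quotient by `l_ε` is holomorphic in the strip, and shifting the contour shows that the quotient is the
transform of a function with the same decay (`exists_multiplier_image_of_zeros`). On the exponentially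
weighted functions only the values of `1/l_ε` off the real axis enter, so the zeros do no harm to the
estimates (`multiplier_expW`, `glueOp`).

*The limit.* Inverting `l_ε(D)` turns the problem into `(1 + S_ε) R = R₀` on `L²`, and `S_ε` converges
in norm to `-3(1 - ∂²)⁻¹ sech²(x/2)` on the even functions (`exists_perturbedOp`). The linearized KdV
operator `1 - ∂² - 3 sech²(x/2)` is bounded below on even functions: its two factorizations through
first-order operators express a combination of `∫ (Lw)²`, `∫ w Lw` and `∫ w²` as the integral of a
square (`ladder_nonneg`); evenness excludes its kernel, spanned by the derivative of the soliton. Being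
self-adjoint after symmetrization, the limit of `1 + S_ε` is invertible (`isUnit_one_add_limitOp`), and
hence so is `1 + S_ε` for small `ε`, with a uniform bound (`exists_isSolver`).

*Regularity.* Smooth bounded functions multiply `H^r` for every real `r ≥ 0` (`exists_hNorm_mul_le`), so
the norm of `E^r_q` is equivalent to the `H^r` norms of `e^{qx} f` and `e^{-qx} f`, in which `1/l_ε(D)`
gains half a derivative. Iterating the gain leads from `L²` to `H^{r+1/2}`. The coefficient `a` is of
order `K_ε^{-r}`, since a function in `E^r_q` has a Fourier transform of that size at `K_ε`; this
compensates for the `H^r` norm of `cos(K_ε x)` and yields the factor `ε^r` (`exists_regularity`).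
-/

noncomputable section

namespace Whitham

open Filter Topology SchwartzMap
open scoped ENNReal

section

open scoped ContDiff

/-! ### The Fourier transform on `L²` as a map of functions -/

lemma fourierL2_eq {g : ℝ → ℂ} (hg : MemLp g 2 volume) : fourierL2 g = 𝓕 (hg.toLp g) := by
  unfold fourierL2
  rw [dif_pos hg]

lemma fourierL2_coe (f : Lp ℂ 2 (volume : Measure ℝ)) : fourierL2 f = 𝓕 f := by
  rw [fourierL2_eq (Lp.memLp f), Lp.toLp_coeFn]

/-- Plancherel. -/
lemma eLpNorm_fourierL2 {g : ℝ → ℂ} (hg : MemLp g 2 volume) :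
    eLpNorm (fourierL2 g) 2 volume = eLpNorm g 2 volume := by
  have h : ‖fourierL2 g‖ = ‖hg.toLp g‖ := by rw [fourierL2_eq hg, Lp.norm_fourier_eq]
  rw [Lp.norm_def, Lp.norm_toLp] at h
  exact (ENNReal.toReal_eq_toReal_iff' (Lp.eLpNorm_ne_top _) hg.2.ne).1 h

lemma fourierL2_injective {g h : ℝ → ℂ} (hg : MemLp g 2 volume) (hh : MemLp h 2 volume)
    (hgh : fourierL2 g =ᵐ[volume] fourierL2 h) : g =ᵐ[volume] h := by
  have h1 : fourierL2 g = fourierL2 h := Lp.ext hgh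
  rw [fourierL2_eq hg, fourierL2_eq hh] at h1
  exact (MemLp.toLp_eq_toLp_iff hg hh).1 ((Lp.fourierTransformₗᵢ ℝ ℂ).injective h1)

lemma exists_fourierL2_eq {h : ℝ → ℂ} (hh : MemLp h 2 volume) :
    ∃ g : Lp ℂ 2 (volume : Measure ℝ), fourierL2 g =ᵐ[volume] h ∧ g = 𝓕⁻ (hh.toLp h) := by
  refine ⟨𝓕⁻ (hh.toLp h), ?_, rfl⟩
  rw [fourierL2_coe, FourierTransform.fourier_fourierInv_eq]
  exact hh.coeFn_toLp

lemma fourierL2_sub {g h : ℝ → ℂ} (hg : MemLp g 2 volume) (hh : MemLp h 2 volume) :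
    fourierL2 (g - h) = fourierL2 g - fourierL2 h := by
  have h1 := fourierL2_add hg (hh.const_smul (-1 : ℂ))
  rw [fourierL2_smul _ hh] at h1
  rw [sub_eq_add_neg, sub_eq_add_neg, ← neg_one_smul ℂ h, h1, neg_one_smul]

/-- On `L¹ ∩ L²` the `L²` Fourier transform is given by the Fourier integral: both are the
Fourier transform in the sense of tempered distributions. -/
lemma fourierL2_ae_eq_fourier {g : ℝ → ℂ} (hg : MemLp g 2 volume) (hg1 : Integrable g) :
    fourierL2 g =ᵐ[volume] 𝓕 g := by
  have key : ∀ φ : 𝓢(ℝ, ℂ), ∫ x, φ x • fourierL2 g x = ∫ x, φ x • 𝓕 g x := by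
    intro φ
    have h1 := Lp.fourier_toTemperedDistribution_eq (hg.toLp g)
    have h2 := congrArg (fun T => T φ) h1
    simp only [TemperedDistribution.fourier_apply, Lp.toTemperedDistribution_apply] at h2
    rw [fourierL2_eq hg, ← h2]
    have h3 := VectorFourier.integral_fourierIntegral_smul_eq_flip (μ := volume) (ν := volume)
      (L := innerₗ ℝ) Real.continuous_fourierChar continuous_inner (φ.integrable (μ := volume)) hg1
    calc ∫ x, (𝓕 φ) x • (hg.toLp g) x = ∫ x, (𝓕 φ) x • g x := by
          refine integral_congr_ae ?_
          filter_upwards [hg.coeFn_toLp] with x hx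
          rw [hx]
      _ = _ := by
          rw [flip_innerₗ] at h3
          exact h3
  refine ae_eq_of_integral_contDiff_smul_eq ((Lp.memLp _).locallyIntegrable (by norm_num)) ?_ ?_
  · have : Continuous (𝓕 g) :=
      VectorFourier.fourierIntegral_continuous Real.continuous_fourierChar
        (by exact continuous_inner) hg1
    exact this.locallyIntegrable
  · intro u hu hc
    have hg₁ : HasCompactSupport (Complex.ofRealCLM ∘ u) := hc.comp_left rfl
    have hg₂ : ContDiff ℝ ∞ (Complex.ofRealCLM ∘ u) := by fun_prop
    simpa using key (hg₁.toSchwartzMap hg₂)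

/-- The corresponding statement for the inverse transform. -/
lemma ae_eq_fourierInv {g h : ℝ → ℂ} (hg : MemLp g 2 volume) (hgh : fourierL2 g =ᵐ[volume] h)
    (hh1 : Integrable h) : g =ᵐ[volume] 𝓕⁻ h := by
  have hh : MemLp h 2 volume := (memLp_congr_ae hgh).1 (Lp.memLp _)
  have h0 : hh.toLp h = fourierL2 g := Lp.ext (hh.coeFn_toLp.trans hgh.symm)
  have hG : hg.toLp g = 𝓕⁻ (hh.toLp h) := by
    rw [h0, fourierL2_eq hg, FourierTransform.fourierInv_fourier_eq]
  have key : ∀ φ : 𝓢(ℝ, ℂ), ∫ x, φ x • g x = ∫ x, φ x • 𝓕⁻ h x := by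
    intro φ
    have h1 := Lp.fourierInv_toTemperedDistribution_eq (hh.toLp h)
    have h2 := congrArg (fun T => T φ) h1
    simp only [TemperedDistribution.fourierInv_apply, Lp.toTemperedDistribution_apply] at h2
    rw [← hG] at h2
    have h3 := VectorFourier.integral_fourierIntegral_smul_eq_flip (μ := volume) (ν := volume)
      (L := -innerₗ ℝ) Real.continuous_fourierChar (by simp only [LinearMap.neg_apply, innerₗ_apply_apply]; fun_prop)
      (φ.integrable (μ := volume)) hh1
    calc ∫ x, φ x • g x = ∫ x, φ x • (hg.toLp g) x := by
          refine integral_congr_ae ?_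
          filter_upwards [hg.coeFn_toLp] with x hx
          rw [hx]
      _ = ∫ x, (𝓕⁻ φ) x • (hh.toLp h) x := h2.symm
      _ = ∫ x, (𝓕⁻ φ) x • h x := by
          refine integral_congr_ae ?_
          filter_upwards [hh.coeFn_toLp] with x hx
          rw [hx]
      _ = _ := by
          have h4 : (-innerₗ ℝ : ℝ →ₗ[ℝ] ℝ →ₗ[ℝ] ℝ).flip = -innerₗ ℝ := by
            ext; simp
          rw [h4] at h3
          have e1 : ((𝓕⁻ φ : 𝓢(ℝ, ℂ)) : ℝ → ℂ)
              = VectorFourier.fourierIntegral Real.fourierChar volume (-innerₗ ℝ) φ := by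
            rw [SchwartzMap.fourierInv_coe]; rfl
          rw [e1]
          exact h3
  refine ae_eq_of_integral_contDiff_smul_eq (hg.locallyIntegrable (by norm_num)) ?_ ?_
  · have : Continuous (𝓕⁻ h) :=
      VectorFourier.fourierIntegral_continuous (L := -innerₗ ℝ) Real.continuous_fourierChar
        (by simp only [LinearMap.neg_apply, innerₗ_apply_apply]; fun_prop) hh1
    exact this.locallyIntegrable
  · intro u hu hc
    have hg₁ : HasCompactSupport (Complex.ofRealCLM ∘ u) := hc.comp_left rfl
    have hg₂ : ContDiff ℝ ∞ (Complex.ofRealCLM ∘ u) := by fun_prop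
    simpa using key (hg₁.toSchwartzMap hg₂)

end

/-! ### Convergence in `L²` -/

lemma eLpNorm_two_sq {g : ℝ → ℂ} :
    eLpNorm g 2 volume ^ 2 = ∫⁻ x, ‖g x‖ₑ ^ 2 := by
  rw [eLpNorm_eq_lintegral_rpow_enorm_toReal (by norm_num) (by norm_num)]
  simp only [ENNReal.toReal_ofNat, ENNReal.rpow_ofNat, one_div]
  rw [← ENNReal.rpow_natCast, ← ENNReal.rpow_mul]
  norm_num

/-- Dominated convergence for a bounded sequence of multipliers. -/
lemma tendsto_eLpNorm_mul_zero {g : ℝ → ℂ} (hg : MemLp g 2 volume) {φ : ℕ → ℝ → ℂ} {C : ℝ}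
    (hφm : ∀ j, AEStronglyMeasurable (φ j) volume) (hφb : ∀ j, ∀ᵐ x, ‖φ j x‖ ≤ C)
    (hφ : ∀ᵐ x, Tendsto (fun j => φ j x) atTop (𝓝 0)) :
    Tendsto (fun j => eLpNorm (fun x => φ j x * g x) 2 volume) atTop (𝓝 0) := by
  have h1 : Tendsto (fun j => ∫⁻ x, ‖φ j x * g x‖ₑ ^ 2) atTop (𝓝 (∫⁻ _ : ℝ, (0 : ℝ≥0∞))) := by
    refine tendsto_lintegral_of_dominated_convergence'
      (fun x => ENNReal.ofReal C ^ 2 * ‖g x‖ₑ ^ 2) ?_ ?_ ?_ ?_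
    · exact fun j => (((hφm j).mul hg.1).enorm).pow_const 2
    · intro j
      filter_upwards [hφb j] with x hx
      rw [enorm_mul, mul_pow]
      gcongr
      rw [← ofReal_norm]
      exact ENNReal.ofReal_le_ofReal hx
    · rw [lintegral_const_mul' _ _ (by simp), ← eLpNorm_two_sq]
      exact ENNReal.mul_ne_top (by simp) (by simp [hg.2.ne])
    · filter_upwards [hφ] with x hx
      have h2 : Tendsto (fun j => φ j x * g x) atTop (𝓝 0) := by simpa using hx.mul_const (g x)
      have h3 := (ENNReal.continuous_pow 2).tendsto _ |>.comp (continuous_enorm.tendsto _ |>.comp h2)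
      simpa [Function.comp_def] using h3
  rw [lintegral_zero] at h1
  have h2 : Tendsto (fun j => (∫⁻ x, ‖φ j x * g x‖ₑ ^ 2) ^ (2⁻¹ : ℝ)) atTop (𝓝 0) := by
    have := (ENNReal.continuous_rpow_const (y := (2⁻¹ : ℝ))).tendsto 0 |>.comp h1
    simpa [Function.comp_def] using this
  refine h2.congr fun j => ?_
  rw [← eLpNorm_two_sq, ← ENNReal.rpow_natCast, ← ENNReal.rpow_mul]
  norm_num

/-- If `uⱼ → u` and `vⱼ → v` in `L²` and `vⱼ = wⱼ uⱼ` with `wⱼ → w` pointwise, then `v = w u`. -/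
lemma ae_eq_mul_of_tendsto {u v : ℝ → ℂ} {us vs : ℕ → ℝ → ℂ} {w : ℝ → ℂ} {ws : ℕ → ℝ → ℂ}
    (hus : ∀ j, AEStronglyMeasurable (us j) volume) (hu : AEStronglyMeasurable u volume)
    (hvs : ∀ j, AEStronglyMeasurable (vs j) volume) (hv : AEStronglyMeasurable v volume)
    (htu : Tendsto (fun j => eLpNorm (us j - u) 2 volume) atTop (𝓝 0))
    (htv : Tendsto (fun j => eLpNorm (vs j - v) 2 volume) atTop (𝓝 0))
    (hw : ∀ᵐ x, Tendsto (fun j => ws j x) atTop (𝓝 (w x)))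
    (hvu : ∀ j, vs j =ᵐ[volume] fun x => ws j x * us j x) : v =ᵐ[volume] fun x => w x * u x := by
  obtain ⟨ns, hns, h1⟩ :=
    (tendstoInMeasure_of_tendsto_eLpNorm (by norm_num) hus hu htu).exists_seq_tendsto_ae
  obtain ⟨ms, hms, h2⟩ :=
    (tendstoInMeasure_of_tendsto_eLpNorm (by norm_num) (fun j => hvs (ns j)) hv
      (htv.comp hns.tendsto_atTop)).exists_seq_tendsto_ae
  have h3 := ae_all_iff.2 hvu
  filter_upwards [h1, h2, h3, hw] with x hx1 hx2 hx3 hx4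
  have h5 := ((hx4.comp hns.tendsto_atTop).mul hx1).comp hms.tendsto_atTop
  refine tendsto_nhds_unique hx2 (h5.congr fun j => ?_)
  simp only [Function.comp]
  exact (hx3 _).symm

/-! ### Exponential weights -/

/-- The function `e^{η x} F(x)`. -/
def expW (η : ℝ) (F : ℝ → ℂ) (x : ℝ) : ℂ := (Real.exp (η * x) : ℂ) * F x

/-- The two-sided weighted space: `e^{q x} F` and `e^{-q x} F` are square-integrable. -/
def ExpL2 (q : ℝ) (F : ℝ → ℂ) : Prop := MemLp (expW q F) 2 volume ∧ MemLp (expW (-q) F) 2 volume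

lemma expW_expW (a b : ℝ) (F : ℝ → ℂ) : expW a (expW b F) = expW (a + b) F := by
  funext x
  simp only [expW]
  rw [← mul_assoc, ← Complex.ofReal_mul, ← Real.exp_add, add_mul]

lemma expW_zero (F : ℝ → ℂ) : expW 0 F = F := by
  funext x
  simp [expW]

lemma ExpL2.aesm {q : ℝ} {F : ℝ → ℂ} (hF : ExpL2 q F) : AEStronglyMeasurable F volume := by
  have h1 : F = fun x => (Real.exp (-q * x) : ℂ) * expW q F x := by
    have := expW_expW (-q) q F
    rw [neg_add_cancel, expW_zero] at this
    exact this.symm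
  rw [h1]
  refine AEStronglyMeasurable.mul (Continuous.aestronglyMeasurable ?_) hF.1.1
  fun_prop

lemma aesm_expW (η : ℝ) {F : ℝ → ℂ} (hF : AEStronglyMeasurable F volume) :
    AEStronglyMeasurable (expW η F) volume := by
  refine AEStronglyMeasurable.mul (Continuous.aestronglyMeasurable ?_) hF
  fun_prop

lemma norm_expW (η : ℝ) (F : ℝ → ℂ) (x : ℝ) : ‖expW η F x‖ = Real.exp (η * x) * ‖F x‖ := by
  rw [expW, norm_mul, Complex.norm_real, Real.norm_of_nonneg (Real.exp_pos _).le]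

lemma exp_le_exp_add_exp {η q : ℝ} (h : |η| ≤ q) (x : ℝ) :
    Real.exp (η * x) ≤ Real.exp (q * x) + Real.exp (-q * x) := by
  have h1 : η * x ≤ q * |x| := (le_abs_self _).trans (by rw [abs_mul]; gcongr)
  rcases abs_cases x with ⟨hx, _⟩ | ⟨hx, _⟩
  · rw [hx] at h1
    linarith [Real.exp_le_exp.2 h1, Real.exp_pos (-q * x)]
  · rw [hx] at h1
    have : Real.exp (η * x) ≤ Real.exp (-q * x) := Real.exp_le_exp.2 (by linarith)
    linarith [Real.exp_pos (q * x)]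

lemma ExpL2.memLp {q η : ℝ} {F : ℝ → ℂ} (hF : ExpL2 q F) (h : |η| ≤ q) :
    MemLp (expW η F) 2 volume := by
  refine MemLp.mono' (hF.1.norm.add hF.2.norm) (aesm_expW η hF.aesm) (Eventually.of_forall ?_)
  intro x
  simp only [Pi.add_apply, norm_expW, ← add_mul]
  gcongr
  exact exp_le_exp_add_exp h x

lemma one_add_sq_le_exp {a : ℝ} (ha : 0 < a) (x : ℝ) :
    1 + x ^ 2 ≤ (1 + 2 / a ^ 2) * Real.exp (a * |x|) := by
  have h1 := Real.quadratic_le_exp_of_nonneg (x := a * |x|) (by positivity)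
  have h2 : (a * |x|) ^ 2 = a ^ 2 * x ^ 2 := by rw [mul_pow, sq_abs]
  have h3 : 1 ≤ Real.exp (a * |x|) := Real.one_le_exp (by positivity)
  have h4 : x ^ 2 ≤ 2 / a ^ 2 * Real.exp (a * |x|) := by
    rw [div_mul_eq_mul_div, le_div_iff₀ (by positivity)]
    nlinarith [abs_nonneg x, mul_nonneg ha.le (abs_nonneg x)]
  linarith

lemma memLp_inv_one_add_sq : MemLp (fun x : ℝ => (1 + x ^ 2)⁻¹) 2 volume := by
  have h1 : Integrable (fun x : ℝ => (1 + x ^ 2)⁻¹) := integrable_inv_one_add_sq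
  refine (memLp_two_iff_integrable_sq h1.1).2 ?_
  refine Integrable.mono' h1 (h1.1.pow 2) (Eventually.of_forall fun x => ?_)
  have h2 : (1 + x ^ 2)⁻¹ ≤ 1 := inv_le_one_of_one_le₀ (by nlinarith [sq_nonneg x])
  have h3 : 0 ≤ (1 + x ^ 2)⁻¹ := by positivity
  rw [Real.norm_of_nonneg (by positivity)]
  nlinarith

/-- Strictly inside the strip, the weighted functions are integrable, with one more polynomial
factor to spare. -/
lemma ExpL2.integrable_add {q η : ℝ} {F : ℝ → ℂ} (hF : ExpL2 q F) (h : |η| < q) :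
    Integrable (fun x => (1 + x ^ 2) * ‖expW η F x‖) := by
  obtain ⟨a, ha, haq⟩ : ∃ a, 0 < a ∧ |η| + 2 * a = q := ⟨(q - |η|) / 2, by linarith, by ring⟩
  set C := (1 + 2 / a ^ 2) with hC
  have hCpos : 0 < C := by positivity
  have hb : Integrable (fun x => (1 + x ^ 2)⁻¹ * (‖expW q F x‖ + ‖expW (-q) F x‖)) :=
    (memLp_inv_one_add_sq).integrable_mul (hF.1.norm.add hF.2.norm)
  refine Integrable.mono' (hb.const_mul (C ^ 2)) ?_ (Eventually.of_forall fun x => ?_)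
  · exact (Continuous.aestronglyMeasurable (by fun_prop)).mul (aesm_expW η hF.aesm).norm
  · have h0 : 0 < 1 + x ^ 2 := by positivity
    rw [Real.norm_of_nonneg (by positivity)]
    have h1 : (1 + x ^ 2) ^ 2 * Real.exp (η * x)
        ≤ C ^ 2 * (Real.exp (q * x) + Real.exp (-q * x)) := by
      have h2 := one_add_sq_le_exp ha x
      have h3 : (1 + x ^ 2) ^ 2 ≤ C ^ 2 * Real.exp (2 * a * |x|) := by
        calc (1 + x ^ 2) ^ 2 ≤ (C * Real.exp (a * |x|)) ^ 2 := by gcongr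
          _ = _ := by rw [mul_pow, ← Real.exp_nat_mul]; congr 2; push_cast; ring
      have h4 : Real.exp (2 * a * |x|) * Real.exp (η * x)
          ≤ Real.exp (q * x) + Real.exp (-q * x) := by
        have h5 : η * x ≤ |η| * |x| := (le_abs_self _).trans (abs_mul η x).le
        have h6 : Real.exp (2 * a * |x|) * Real.exp (η * x) ≤ Real.exp (q * |x|) := by
          rw [← Real.exp_add, ← haq]
          exact Real.exp_le_exp.2 (by linarith)
        refine h6.trans ?_
        rcases abs_cases x with ⟨hx, _⟩ | ⟨hx, _⟩
        · rw [hx]; linarith [Real.exp_pos (-q * x)]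
        · rw [hx, mul_neg, ← neg_mul]; linarith [Real.exp_pos (q * x)]
      calc (1 + x ^ 2) ^ 2 * Real.exp (η * x)
          ≤ C ^ 2 * Real.exp (2 * a * |x|) * Real.exp (η * x) := by gcongr
        _ = C ^ 2 * (Real.exp (2 * a * |x|) * Real.exp (η * x)) := by ring
        _ ≤ _ := by gcongr
    simp only [norm_expW]
    rw [← add_mul]
    calc (1 + x ^ 2) * (Real.exp (η * x) * ‖F x‖)
        = (1 + x ^ 2)⁻¹ * (((1 + x ^ 2) ^ 2 * Real.exp (η * x)) * ‖F x‖) := by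
          field_simp
      _ ≤ (1 + x ^ 2)⁻¹ * ((C ^ 2 * (Real.exp (q * x) + Real.exp (-q * x))) * ‖F x‖) := by gcongr
      _ = _ := by ring

lemma ExpL2.integrable {q η : ℝ} {F : ℝ → ℂ} (hF : ExpL2 q F) (h : |η| < q) :
    Integrable (expW η F) := by
  refine Integrable.mono' (hF.integrable_add h) (aesm_expW η hF.aesm)
    (Eventually.of_forall fun x => ?_)
  nlinarith [norm_nonneg (expW η F x), sq_nonneg x, mul_nonneg (sq_nonneg x) (norm_nonneg (expW η F x))]

/-- The Fourier integral `∫ F(x) e^{-i z x} dx` at a complex wave number `z`. -/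
def cft (F : ℝ → ℂ) (z : ℂ) : ℂ := ∫ x : ℝ, Complex.exp (-(Complex.I * z * x)) * F x

lemma cft_line (F : ℝ → ℂ) (η ξ : ℝ) :
    cft F ((2 * Real.pi * ξ : ℝ) + η * Complex.I) = 𝓕 (expW η F) ξ := by
  rw [Real.fourier_real_eq_integral_exp_smul, cft]
  congr 1
  funext x
  rw [expW, smul_eq_mul, ← mul_assoc, Complex.ofReal_exp, ← Complex.exp_add]
  congr 2
  push_cast
  linear_combination (-(η : ℂ) * x) * Complex.I_sq

lemma norm_exp_mul (z : ℂ) (x : ℝ) (w : ℂ) :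
    ‖Complex.exp (-(Complex.I * z * x)) * w‖ = Real.exp (z.im * x) * ‖w‖ := by
  rw [norm_mul, Complex.norm_exp]
  simp

lemma norm_cft_le {q : ℝ} {F : ℝ → ℂ} (hF : ExpL2 q F) {η : ℝ} (hη : η < q) :
    ∃ M, ∀ z : ℂ, |z.im| ≤ η → ‖cft F z‖ ≤ M := by
  refine ⟨∫ x, (‖expW η F x‖ + ‖expW (-η) F x‖), fun z hz => ?_⟩
  have h0 : 0 ≤ η := (abs_nonneg _).trans hz
  have h1 : |η| < q := by rwa [abs_of_nonneg h0]
  refine norm_integral_le_of_norm_le ((hF.integrable h1).norm.add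
    (hF.integrable (by rwa [abs_neg])).norm) (Eventually.of_forall fun x => ?_)
  rw [norm_exp_mul]
  simp only [norm_expW]
  rw [← add_mul]
  gcongr
  exact exp_le_exp_add_exp hz x

/-- Exponential decay of `F` makes its Fourier transform holomorphic in a strip. -/
lemma differentiableOn_cft {q : ℝ} {F : ℝ → ℂ} (hF : ExpL2 q F) :
    DifferentiableOn ℂ (cft F) {z | |z.im| < q} := by
  intro z hz
  obtain ⟨η, hη1, hη2⟩ := exists_between (show |z.im| < q from hz)
  have h0 : 0 < η := (abs_nonneg _).trans_lt hη1
  have hop : IsOpen {w : ℂ | |w.im| < η} := isOpen_lt (by fun_prop) (by fun_prop)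
  have hηq : |η| < q := by rwa [abs_of_pos h0]
  have key := hasDerivAt_integral_of_dominated_loc_of_deriv_le (μ := volume)
    (F := fun (w : ℂ) (x : ℝ) => Complex.exp (-(Complex.I * w * x)) * F x)
    (F' := fun (w : ℂ) (x : ℝ) => Complex.exp (-(Complex.I * w * x)) * (-(Complex.I * x) * F x))
    (bound := fun x => (1 + x ^ 2) * ‖expW η F x‖ + (1 + x ^ 2) * ‖expW (-η) F x‖)
    (x₀ := z) (hop.mem_nhds hη1) ?_ ?_ ?_ ?_ ?_ ?_
  · exact key.2.differentiableAt.differentiableWithinAt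
  · exact Eventually.of_forall fun w =>
      (Continuous.aestronglyMeasurable (by fun_prop)).mul hF.aesm
  · have h2 := (hF.integrable (η := z.im) hz)
    refine Integrable.mono h2 ((Continuous.aestronglyMeasurable (by fun_prop)).mul hF.aesm)
      (Eventually.of_forall fun x => ?_)
    rw [norm_exp_mul, norm_expW]
  · exact (Continuous.aestronglyMeasurable (by fun_prop)).mul
      ((Continuous.aestronglyMeasurable (by fun_prop)).mul hF.aesm)
  · refine Eventually.of_forall fun x w hw => ?_
    have hx : ‖-(Complex.I * (x : ℂ)) * F x‖ ≤ (1 + x ^ 2) * ‖F x‖ := by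
      rw [norm_mul, norm_neg, norm_mul, Complex.norm_I, one_mul, Complex.norm_real]
      gcongr
      rw [Real.norm_eq_abs]
      nlinarith [sq_abs x, sq_nonneg (|x| - 1)]
    rw [norm_exp_mul]
    simp only [norm_expW]
    calc Real.exp (w.im * x) * ‖-(Complex.I * (x : ℂ)) * F x‖
        ≤ (Real.exp (η * x) + Real.exp (-η * x)) * ((1 + x ^ 2) * ‖F x‖) := by
          gcongr
          exact exp_le_exp_add_exp (le_of_lt hw) x
      _ = _ := by ring
  · exact (hF.integrable_add hηq).add (hF.integrable_add (by rwa [abs_neg]))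
  · refine Eventually.of_forall fun x w hw => ?_
    have h3 : HasDerivAt (fun w : ℂ => -(Complex.I * w * x)) (-(Complex.I * x)) w := by
      simpa using (((hasDerivAt_id w).const_mul Complex.I).mul_const (x : ℂ)).fun_neg
    simpa [mul_assoc] using h3.cexp.mul_const (F x)

/-! ### Shifting the contour -/

/-- Cauchy's theorem for a strip: the integrals over two horizontal lines agree. -/
lemma integral_line_shift {G : ℂ → ℂ} {a : ℝ} (hG : DifferentiableOn ℂ G {z | |z.im| ≤ |a|})
    (h0 : Integrable fun x : ℝ => G x) (h1 : Integrable fun x : ℝ => G (x + a * Complex.I))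
    {b : ℝ → ℝ} (hb : Tendsto b (cocompact ℝ) (𝓝 0))
    (hGb : ∀ z : ℂ, |z.im| ≤ |a| → ‖G z‖ ≤ b z.re) :
    ∫ x : ℝ, G x = ∫ x : ℝ, G (x + a * Complex.I) := by
  have hbT : Tendsto b atTop (𝓝 0) := hb.mono_left atTop_le_cocompact
  have hbB : Tendsto (fun T : ℝ => b (-T)) atTop (𝓝 0) :=
    (hb.mono_left atBot_le_cocompact).comp tendsto_neg_atTop_atBot
  have hy : ∀ y ∈ Set.uIoc 0 a, |y| ≤ |a| := by
    intro y hy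
    rcases le_total 0 a with h | h
    · rw [Set.uIoc_of_le h] at hy
      rw [abs_of_nonneg hy.1.le, abs_of_nonneg h]
      exact hy.2
    · rw [Set.uIoc_of_ge h] at hy
      rw [abs_of_nonpos hy.2, abs_of_nonpos h]
      linarith [hy.1]
  -- Cauchy's theorem on the rectangle `[-T, T] × [0, a]`; its vertical sides vanish as `T → ∞`
  have hrect : ∀ T : ℝ, (∫ x in (-T)..T, G x) - ∫ x in (-T)..T, G (x + a * Complex.I)
      = Complex.I * (∫ y in (0 : ℝ)..a, G (((-T : ℝ) : ℂ) + y * Complex.I))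
        - Complex.I * ∫ y in (0 : ℝ)..a, G ((T : ℂ) + y * Complex.I) := by
    intro T
    have h := Complex.integral_boundary_rect_eq_zero_of_differentiableOn G
      ((-T : ℝ) : ℂ) ((T : ℂ) + a * Complex.I) (hG.mono ?_)
    · simp only [Complex.ofReal_re, Complex.ofReal_im, Complex.add_re, Complex.mul_re,
        Complex.I_re, Complex.I_im, Complex.add_im, Complex.mul_im, mul_zero, mul_one, zero_add,
        add_zero, sub_zero, zero_mul, Complex.ofReal_zero, smul_eq_mul] at h
      linear_combination h
    · rintro z ⟨_, hz⟩
      simp only [Complex.ofReal_im, Complex.add_im, Complex.mul_im, Complex.ofReal_re,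
        Complex.I_im, mul_one, Complex.I_re, mul_zero, add_zero, zero_add, Set.mem_preimage] at hz
      simpa using Set.abs_sub_left_of_mem_uIcc hz
  have hside : ∀ T : ℝ, ‖∫ y in (0 : ℝ)..a, G ((T : ℂ) + y * Complex.I)‖ ≤ b T * |a| := by
    intro T
    have := intervalIntegral.norm_integral_le_of_norm_le_const (a := 0) (b := a) (C := b T)
      (f := fun y : ℝ => G ((T : ℂ) + y * Complex.I)) ?_
    · simpa using this
    · intro y hy'
      simpa using hGb ((T : ℂ) + y * Complex.I) (by simpa using hy y hy')
  have hlim0 : Tendsto (fun T : ℝ => (∫ x in (-T)..T, G x)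
      - ∫ x in (-T)..T, G (x + a * Complex.I)) atTop
      (𝓝 ((∫ x : ℝ, G x) - ∫ x : ℝ, G (x + a * Complex.I))) :=
    (intervalIntegral_tendsto_integral h0 tendsto_neg_atTop_atBot tendsto_id).sub
      (intervalIntegral_tendsto_integral h1 tendsto_neg_atTop_atBot tendsto_id)
  have hlim1 : Tendsto (fun T : ℝ => (∫ x in (-T)..T, G x)
      - ∫ x in (-T)..T, G (x + a * Complex.I)) atTop (𝓝 0) := by
    have hz : Tendsto (fun T : ℝ => b (-T) * |a| + b T * |a|) atTop (𝓝 0) := by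
      simpa using (hbB.mul_const |a|).add (hbT.mul_const |a|)
    refine squeeze_zero_norm (fun T => ?_) hz
    rw [hrect T]
    refine (norm_sub_le _ _).trans ?_
    rw [norm_mul, norm_mul, Complex.norm_I, one_mul, one_mul]
    exact add_le_add (hside (-T)) (hside T)
  exact sub_eq_zero.1 (tendsto_nhds_unique hlim0 hlim1)

/-- A Gaussian factor on a horizontal line. -/
lemma norm_gauss_line (δ x y : ℝ) :
    ‖Complex.exp (-(δ : ℂ) * ((x : ℂ) + y * Complex.I) ^ 2)‖
      = Real.exp (-δ * x ^ 2) * Real.exp (δ * y ^ 2) := by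
  rw [Complex.norm_exp, ← Real.exp_add]
  congr 1
  have : (-(δ : ℂ) * ((x : ℂ) + y * Complex.I) ^ 2)
      = ((-δ * x ^ 2 + δ * y ^ 2 : ℝ) : ℂ) + ((-2 * δ * x * y : ℝ) : ℂ) * Complex.I := by
    push_cast
    linear_combination (-(δ : ℂ) * y ^ 2) * Complex.I_sq
  rw [this, Complex.add_re, Complex.ofReal_re, Complex.re_ofReal_mul, Complex.I_re, mul_zero,
    add_zero]

/-- A horizontal shift of the Fourier transform inside a strip of holomorphy is multiplication by
an exponential. The integrals need not converge absolutely, so a Gaussian factor `e^{-δ w²}` is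
inserted and removed again by letting `δ → 0` in `L²`. -/
lemma expW_of_holomorphic {h : ℂ → ℂ} {a : ℝ} (hd : DifferentiableOn ℂ h {z | |z.im| ≤ |a|})
    {M : ℝ} (hM : ∀ z : ℂ, |z.im| ≤ |a| → ‖h z‖ ≤ M) {g₀ g₁ : ℝ → ℂ}
    (hg₀ : MemLp g₀ 2 volume) (hg₁ : MemLp g₁ 2 volume)
    (h₀ : fourierL2 g₀ =ᵐ[volume] fun ξ : ℝ => h ξ)
    (h₁ : fourierL2 g₁ =ᵐ[volume] fun ξ : ℝ => h (ξ + a * Complex.I)) :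
    g₁ =ᵐ[volume] expW (2 * Real.pi * a) g₀ := by
  have hM0 : 0 ≤ M := (norm_nonneg _).trans (hM 0 (by simp))
  set γ : ℝ → ℂ → ℂ := fun δ z => Complex.exp (-(δ : ℂ) * z ^ 2) with hγ
  have hγd : ∀ δ, Differentiable ℂ (γ δ) := fun δ => by fun_prop
  set δs : ℕ → ℝ := fun j => 1 / ((j : ℝ) + 1) with hδs
  have hδpos : ∀ j, 0 < δs j := fun j => by positivity
  have hδ1 : ∀ j, δs j ≤ 1 := fun j => by
    rw [hδs]; exact (div_le_one (by positivity)).2 (by linarith [(Nat.cast_nonneg j : (0 : ℝ) ≤ j)])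
  have hδlim : Tendsto δs atTop (𝓝 0) := tendsto_one_div_add_atTop_nhds_zero_nat
  -- the regularised functions, on the line at height `y`
  have reg : ∀ (y : ℝ), |y| ≤ |a| → ∀ g : ℝ → ℂ, MemLp g 2 volume →
      fourierL2 g =ᵐ[volume] (fun ξ : ℝ => h (ξ + y * Complex.I)) →
      ∀ j, ∃ u : ℝ → ℂ, MemLp u 2 volume ∧
        (u =ᵐ[volume] 𝓕⁻ fun ξ : ℝ => γ (δs j) (ξ + y * Complex.I) * h (ξ + y * Complex.I)) ∧
        eLpNorm (u - g) 2 volume = eLpNorm (fun ξ : ℝ => (γ (δs j) (ξ + y * Complex.I) - 1)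
          * fourierL2 g ξ) 2 volume ∧
        Integrable (fun ξ : ℝ => γ (δs j) (ξ + y * Complex.I) * h (ξ + y * Complex.I)) := by
    intro y hy g hg hgh j
    have hcont : Continuous fun ξ : ℝ => γ (δs j) (ξ + y * Complex.I) := by
      have := (hγd (δs j)).continuous
      fun_prop
    have hm : AEStronglyMeasurable (fun ξ : ℝ => γ (δs j) (ξ + y * Complex.I)
        * h (ξ + y * Complex.I)) volume :=
      hcont.aestronglyMeasurable.mul ((Lp.aestronglyMeasurable _).congr hgh)
    have hint : Integrable (fun ξ : ℝ => γ (δs j) (ξ + y * Complex.I) * h (ξ + y * Complex.I)) := by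
      refine Integrable.mono' (((integrable_exp_neg_mul_sq (hδpos j)).mul_const
        (Real.exp (δs j * y ^ 2))).mul_const M) hm (Eventually.of_forall fun ξ => ?_)
      rw [norm_mul, hγ]
      simp only [norm_gauss_line]
      gcongr
      exact hM _ (by simpa using hy)
    have hmem : MemLp (fun ξ : ℝ => γ (δs j) (ξ + y * Complex.I) * h (ξ + y * Complex.I))
        2 volume := by
      have h2 : MemLp (fun ξ : ℝ => h (ξ + y * Complex.I)) 2 volume :=
        (memLp_congr_ae hgh).1 (Lp.memLp _)
      refine MemLp.of_le_mul (c := Real.exp (δs j * y ^ 2)) h2 hm (Eventually.of_forall fun ξ => ?_)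
      rw [norm_mul, hγ]
      simp only [norm_gauss_line]
      gcongr
      have : Real.exp (-δs j * ξ ^ 2) ≤ 1 := Real.exp_le_one_iff.2 (by
        have := mul_nonneg (hδpos j).le (sq_nonneg ξ); linarith)
      exact mul_le_of_le_one_left (Real.exp_pos _).le this
    obtain ⟨u, hu, -⟩ := exists_fourierL2_eq hmem
    refine ⟨u, Lp.memLp u, ae_eq_fourierInv (Lp.memLp u) hu hint, ?_, hint⟩
    rw [← eLpNorm_fourierL2 ((Lp.memLp u).sub hg), fourierL2_sub (Lp.memLp u) hg]
    refine eLpNorm_congr_ae ?_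
    filter_upwards [Lp.coeFn_sub (fourierL2 u) (fourierL2 g), hu, hgh] with ξ h1 h2 h3
    rw [h1, Pi.sub_apply, h2, h3]
    ring
  have conv : ∀ (y : ℝ) (g : ℝ → ℂ), MemLp g 2 volume →
      Tendsto (fun j => eLpNorm (fun ξ : ℝ => (γ (δs j) (ξ + y * Complex.I) - 1)
          * fourierL2 g ξ) 2 volume) atTop (𝓝 0) := by
    intro y g hg
    refine tendsto_eLpNorm_mul_zero (Lp.memLp _) (C := Real.exp (y ^ 2) + 1) (fun j => ?_)
      (fun j => Eventually.of_forall fun ξ => ?_) (Eventually.of_forall fun ξ => ?_)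
    · have := (hγd (δs j)).continuous
      exact Continuous.aestronglyMeasurable (by fun_prop)
    · refine (norm_sub_le _ _).trans ?_
      rw [norm_one, hγ]
      simp only [norm_gauss_line]
      gcongr
      have h1 : Real.exp (-δs j * ξ ^ 2) ≤ 1 := Real.exp_le_one_iff.2 (by
        have := mul_nonneg (hδpos j).le (sq_nonneg ξ); linarith)
      have h2 : Real.exp (δs j * y ^ 2) ≤ Real.exp (y ^ 2) := Real.exp_le_exp.2 (by
        nlinarith [hδ1 j, sq_nonneg y])
      nlinarith [Real.exp_pos (δs j * y ^ 2)]
    · have hc : Continuous fun δ : ℝ => γ δ ((ξ : ℂ) + y * Complex.I) - 1 := by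
        rw [hγ]; fun_prop
      have := (hc.tendsto 0).comp hδlim
      simpa [hγ, Function.comp_def] using this
  choose u hu1 hu2 hu3 hu4 using reg 0 (by simp) g₀ hg₀ (by simpa using h₀)
  choose v hv1 hv2 hv3 hv4 using reg a le_rfl g₁ hg₁ h₁
  have huv : ∀ j, v j =ᵐ[volume] fun x => (Real.exp (2 * Real.pi * a * x) : ℂ) * u j x := by
    intro j
    filter_upwards [hu2 j, hv2 j] with x hx1 hx2
    rw [hx1, hx2, Real.fourierInv_eq', Real.fourierInv_eq', ← integral_const_mul]
    set e : ℂ → ℂ := fun z => Complex.exp (2 * Real.pi * z * x * Complex.I) with he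
    have hed : Differentiable ℂ e := by fun_prop
    have hen : ∀ z : ℂ, ‖e z‖ = Real.exp (-(2 * Real.pi * z.im * x)) := by
      intro z
      rw [he, Complex.norm_exp]
      congr 1
      simp [Complex.mul_re, Complex.mul_im]
    have hshift := integral_line_shift (G := fun z => e z * (γ (δs j) z * h z)) (a := a)
      (b := fun t => Real.exp (2 * Real.pi * |a| * |x|) * (Real.exp (-δs j * t ^ 2)
        * Real.exp (δs j * a ^ 2) * M)) ?_ ?_ ?_ ?_ ?_
    · have e1 : ∀ ξ : ℝ, Complex.exp (((2 * Real.pi * inner ℝ ξ x : ℝ) : ℂ) * Complex.I)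
          = e ξ := by
        intro ξ
        rw [he]
        congr 1
        simp only [RCLike.inner_apply, conj_trivial]
        push_cast
        ring
      have e2 : ∀ ξ : ℝ, e (ξ + a * Complex.I) = (Real.exp (-(2 * Real.pi * a * x)) : ℂ) * e ξ := by
        intro ξ
        simp only [he]
        rw [Complex.ofReal_exp, ← Complex.exp_add]
        congr 1
        push_cast
        linear_combination (2 * (Real.pi : ℂ) * a * x) * Complex.I_sq
      have e3 : (Real.exp (2 * Real.pi * a * x) : ℂ) * (Real.exp (-(2 * Real.pi * a * x)) : ℂ)
          = 1 := by
        rw [← Complex.ofReal_mul, ← Real.exp_add]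
        simp
      have hshift' : ∫ ξ : ℝ, e ξ * (γ (δs j) ξ * h ξ)
          = ∫ ξ : ℝ, (Real.exp (-(2 * Real.pi * a * x)) : ℂ) * (e ξ
            * (γ (δs j) (ξ + a * Complex.I) * h (ξ + a * Complex.I))) := by
        refine hshift.trans (integral_congr_ae (Eventually.of_forall fun ξ => ?_))
        simp only [e2]
        ring
      have lhs : ∫ (ξ : ℝ), Complex.exp (((2 * Real.pi * inner ℝ ξ x : ℝ) : ℂ) * Complex.I) •
          (γ (δs j) (ξ + a * Complex.I) * h (ξ + a * Complex.I))
          = ∫ ξ : ℝ, e ξ * (γ (δs j) (ξ + a * Complex.I) * h (ξ + a * Complex.I)) := by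
        refine integral_congr_ae (Eventually.of_forall fun ξ => ?_)
        simp only [smul_eq_mul, e1]
      have rhs : ∫ (ξ : ℝ), (Real.exp (2 * Real.pi * a * x) : ℂ) *
          (Complex.exp (((2 * Real.pi * inner ℝ ξ x : ℝ) : ℂ) * Complex.I) •
          (γ (δs j) (ξ + (0 : ℝ) * Complex.I) * h (ξ + (0 : ℝ) * Complex.I)))
          = (Real.exp (2 * Real.pi * a * x) : ℂ) * ∫ ξ : ℝ, e ξ * (γ (δs j) ξ * h ξ) := by
        rw [← integral_const_mul]
        refine integral_congr_ae (Eventually.of_forall fun ξ => ?_)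
        simp only [smul_eq_mul, e1, Complex.ofReal_zero, zero_mul, add_zero]
      rw [lhs, rhs, hshift', integral_const_mul, ← mul_assoc, e3, one_mul]
    · exact hed.differentiableOn.mul ((hγd _).differentiableOn.mul hd)
    · have h5 := hu4 j
      simp only [Complex.ofReal_zero, zero_mul, add_zero] at h5
      refine Integrable.mono h5 ?_ (Eventually.of_forall fun ξ => ?_)
      · exact (Continuous.aestronglyMeasurable (by fun_prop)).mul h5.1
      · rw [norm_mul, hen]; simp
    · refine Integrable.mono' ((hv4 j).norm.const_mul (Real.exp (-(2 * Real.pi * a * x)))) ?_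
        (Eventually.of_forall fun ξ => ?_)
      · exact (Continuous.aestronglyMeasurable (by fun_prop)).mul (hv4 j).1
      · rw [norm_mul, hen]; simp
    · have h6 : Tendsto (fun t : ℝ => Real.exp (-δs j * t ^ 2)) (cocompact ℝ) (𝓝 0) := by
        refine Real.tendsto_exp_atBot.comp ?_
        have h7 : Tendsto (fun t : ℝ => t ^ 2) (cocompact ℝ) atTop := by
          have := (tendsto_pow_atTop (α := ℝ) (n := 2) (by norm_num)).comp
            (tendsto_norm_cocompact_atTop (E := ℝ))
          refine this.congr fun t => ?_
          simp [Function.comp]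
        exact h7.const_mul_atTop_of_neg (neg_neg_of_pos (hδpos j))
      simpa using ((h6.mul_const (Real.exp (δs j * a ^ 2))).mul_const M).const_mul
        (Real.exp (2 * Real.pi * |a| * |x|))
    · intro z hz
      have hzz : z = (z.re : ℂ) + z.im * Complex.I := (Complex.re_add_im z).symm
      rw [norm_mul, norm_mul, hen]
      have h8 : ‖γ (δs j) z‖ ≤ Real.exp (-δs j * z.re ^ 2) * Real.exp (δs j * a ^ 2) := by
        conv_lhs => rw [hzz, hγ]
        simp only [norm_gauss_line]
        have h9 : z.im ^ 2 ≤ a ^ 2 := sq_le_sq.2 hz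
        gcongr
      have h10 : Real.exp (-(2 * Real.pi * z.im * x)) ≤ Real.exp (2 * Real.pi * |a| * |x|) := by
        refine Real.exp_le_exp.2 ((neg_le_abs _).trans ?_)
        rw [abs_mul, abs_mul, abs_of_pos Real.two_pi_pos]
        gcongr
      exact mul_le_mul h10 (mul_le_mul h8 (hM z hz) (norm_nonneg _) (by positivity))
        (by positivity) (Real.exp_pos _).le
  refine ae_eq_mul_of_tendsto (ws := fun _ x => (Real.exp (2 * Real.pi * a * x) : ℂ))
    (fun j => (hu1 j).1) hg₀.1 (fun j => (hv1 j).1) hg₁.1 ?_ ?_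
    (Eventually.of_forall fun x => tendsto_const_nhds) huv
  · exact (conv 0 g₀ hg₀).congr fun j => (hu3 j).symm
  · exact (conv a g₁ hg₁).congr fun j => (hv3 j).symm

/-! ### The Paley–Wiener theorem for a multiplier -/

/-- Let `F` decay exponentially with rate `q`, and let `n F̂` have a holomorphic extension `h` to the
strip `|Im z| < q` (so that possible poles of `n` on the real line are cancelled by zeros of `F̂`).
Then the function `R` with `R̂ = h` on the real line decays with rate `q` as well, and the Fourier
transform of `e^{p x} R`, `p = ± q`, is that of `e^{p x} F` times the symbol on the shifted line. -/
theorem multiplier_expW {q p : ℝ} (hq : 0 < q) (hp : |p| = q) {F R : ℝ → ℂ} (hF : ExpL2 q F)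
    (hR : MemLp R 2 volume) {n h : ℂ → ℂ} (hd : DifferentiableOn ℂ h {z | |z.im| < q})
    (hb : ∀ η < q, ∃ M, ∀ z : ℂ, |z.im| ≤ η → ‖h z‖ ≤ M)
    (hnc : ContinuousOn n {z | q / 2 ≤ |z.im| ∧ |z.im| ≤ q}) {M : ℝ}
    (hnM : ∀ z : ℂ, q / 2 ≤ |z.im| → |z.im| ≤ q → ‖n z‖ ≤ M)
    (hh : ∀ z : ℂ, q / 2 ≤ |z.im| → |z.im| < q → h z = n z * cft F z)
    (hRh : fourierL2 R =ᵐ[volume] fun ξ : ℝ => h ((2 * Real.pi * ξ : ℝ))) :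
    MemLp (expW p R) 2 volume ∧ fourierL2 (expW p R) =ᵐ[volume]
      fun ξ : ℝ => n ((2 * Real.pi * ξ : ℝ) + p * Complex.I) * fourierL2 (expW p F) ξ := by
  have hFp : MemLp (expW p F) 2 volume := hF.memLp hp.le
  -- a sequence of heights strictly inside the strip
  set ηs : ℕ → ℝ := fun j => p * (1 - 1 / ((j : ℝ) + 2)) with hηs
  have hj : ∀ j : ℕ, 1 / ((j : ℝ) + 2) ≤ 1 / 2 ∧ 0 < 1 / ((j : ℝ) + 2) := fun j =>
    ⟨one_div_le_one_div_of_le (by norm_num) (by linarith [(Nat.cast_nonneg j : (0 : ℝ) ≤ j)]),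
      by positivity⟩
  have hη : ∀ j, |ηs j| = q * (1 - 1 / ((j : ℝ) + 2)) := fun j => by
    rw [hηs]
    simp only [abs_mul, hp]
    rw [abs_of_nonneg (a := 1 - 1 / ((j : ℝ) + 2)) (by linarith [(hj j).1])]
  have hη1 : ∀ j, q / 2 ≤ |ηs j| := fun j => by rw [hη]; nlinarith [(hj j).1]
  have hη2 : ∀ j, |ηs j| < q := fun j => by rw [hη]; nlinarith [(hj j).2]
  have hηlim : Tendsto ηs atTop (𝓝 p) := by
    have h1 : Tendsto (fun j : ℕ => 1 / ((j : ℝ) + 2)) atTop (𝓝 0) := by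
      have := (tendsto_one_div_add_atTop_nhds_zero_nat (𝕜 := ℝ)).comp (tendsto_add_atTop_nat 1)
      refine this.congr fun j => ?_
      simp only [Function.comp]
      push_cast
      ring
    simpa [hηs] using (h1.const_sub 1).const_mul p
  have hline : ∀ (η ξ : ℝ), (((2 * Real.pi * ξ : ℝ) : ℂ) + η * Complex.I).im = η := by
    intro η ξ; simp
  have hncont : ∀ η, q / 2 ≤ |η| → |η| ≤ q →
      Continuous fun ξ : ℝ => n ((2 * Real.pi * ξ : ℝ) + η * Complex.I) := by
    intro η h1 h2
    refine hnc.comp_continuous (by fun_prop) fun ξ => ?_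
    simp only [Set.mem_ofPred_eq, hline]
    exact ⟨h1, h2⟩
  have prodmem : ∀ η, q / 2 ≤ |η| → |η| ≤ q → MemLp (fun ξ : ℝ =>
      n ((2 * Real.pi * ξ : ℝ) + η * Complex.I) * fourierL2 (expW η F) ξ) 2 volume := by
    intro η h1 h2
    refine MemLp.of_le_mul (c := M) (Lp.memLp (fourierL2 (expW η F)))
      ((hncont η h1 h2).aestronglyMeasurable.mul (Lp.aestronglyMeasurable _))
      (Eventually.of_forall fun ξ => ?_)
    rw [norm_mul]
    gcongr
    exact hnM _ (by rwa [hline]) (by rwa [hline])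
  have hppos : q / 2 ≤ |p| := by rw [hp]; linarith
  obtain ⟨v, hv, -⟩ := exists_fourierL2_eq (prodmem p hppos hp.le)
  have ex : ∀ j, ∃ u : Lp ℂ 2 (volume : Measure ℝ), fourierL2 u =ᵐ[volume] fun ξ : ℝ =>
      n ((2 * Real.pi * ξ : ℝ) + ηs j * Complex.I) * fourierL2 (expW (ηs j) F) ξ := fun j => by
    obtain ⟨u, hu, -⟩ := exists_fourierL2_eq (prodmem (ηs j) (hη1 j) (hη2 j).le)
    exact ⟨u, hu⟩
  choose u hu using ex
  have hFj : ∀ j, MemLp (expW (ηs j) F) 2 volume := fun j => hF.memLp (hη2 j).le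
  -- on interior lines the weighted function is known from the contour shift
  have hshift : ∀ j, (u j : ℝ → ℂ) =ᵐ[volume] expW (ηs j) R := by
    intro j
    obtain ⟨Mj, hMj⟩ := hb _ (hη2 j)
    have ha : |ηs j / (2 * Real.pi)| = |ηs j| / (2 * Real.pi) := by
      rw [abs_div, abs_of_pos Real.two_pi_pos]
    have him : ∀ z : ℂ, |z.im| ≤ |ηs j / (2 * Real.pi)| → |((2 * Real.pi : ℝ) * z).im| ≤ |ηs j| := by
      intro z hz
      rw [ha, le_div_iff₀ Real.two_pi_pos] at hz
      rw [Complex.im_ofReal_mul, abs_mul, abs_of_pos Real.two_pi_pos]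
      linarith
    have key := expW_of_holomorphic (h := fun w => h ((2 * Real.pi : ℝ) * w))
      (a := ηs j / (2 * Real.pi)) (M := Mj) ?_ (fun z hz => hMj _ (him z hz)) hR (Lp.memLp (u j))
      ?_ ?_
    · have e : 2 * Real.pi * (ηs j / (2 * Real.pi)) = ηs j := by
        field_simp
      rwa [e] at key
    · refine hd.comp (by fun_prop) fun z hz => ?_
      exact (him z hz).trans_lt (hη2 j)
    · filter_upwards [hRh] with ξ hξ
      rw [hξ]
      push_cast
      rfl
    · filter_upwards [hu j, fourierL2_ae_eq_fourier (hFj j) (hF.integrable (hη2 j))] with ξ h1 h2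
      rw [h1, h2, ← cft_line, ← hh _ (by rw [hline]; exact hη1 j) (by rw [hline]; exact hη2 j)]
      congr 1
      have : (Real.pi : ℂ) ≠ 0 := Complex.ofReal_ne_zero.2 Real.pi_ne_zero
      push_cast
      field_simp
  -- as the interior lines approach the boundary, the weighted functions converge, and with them both
  -- sides of the identity
  have hconvF : Tendsto (fun j => eLpNorm (expW (ηs j) F - expW p F) 2 volume) atTop (𝓝 0) := by
    have hg : MemLp (fun x => ‖expW q F x‖ + ‖expW (-q) F x‖) 2 volume :=
      hF.1.norm.add hF.2.norm
    have hg' : MemLp (fun x => ((‖expW q F x‖ + ‖expW (-q) F x‖ : ℝ) : ℂ)) 2 volume := hg.ofReal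
    set w : ℝ → ℝ := fun x => Real.exp (q * x) + Real.exp (-q * x) with hw
    have hwpos : ∀ x, 0 < w x := fun x => add_pos (Real.exp_pos _) (Real.exp_pos _)
    have hwc : Continuous w := by fun_prop
    have := tendsto_eLpNorm_mul_zero (g := fun x => (w x : ℂ) * F x) (C := 2)
      (φ := fun j x => (((Real.exp (ηs j * x) - Real.exp (p * x)) / w x : ℝ) : ℂ)) ?_ ?_ ?_ ?_
    · refine this.congr fun j => ?_
      refine eLpNorm_congr_ae (Eventually.of_forall fun x => ?_)
      have hne : (w x : ℂ) ≠ 0 := Complex.ofReal_ne_zero.2 (hwpos x).ne'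
      simp only [expW, Pi.sub_apply]
      push_cast
      field_simp
    · refine hg'.mono ((Continuous.aestronglyMeasurable (by fun_prop)).mul hF.aesm)
        (Eventually.of_forall fun x => ?_)
      rw [norm_mul, Complex.norm_real, Complex.norm_real, Real.norm_of_nonneg (hwpos x).le,
        Real.norm_of_nonneg (by positivity)]
      simp only [norm_expW, hw, add_mul, le_refl]
    · intro j
      refine (Complex.continuous_ofReal.comp ?_).aestronglyMeasurable
      exact Continuous.div (by fun_prop) hwc fun x => (hwpos x).ne'
    · intro j
      refine Eventually.of_forall fun x => ?_
      rw [Complex.norm_real, Real.norm_eq_abs, abs_div, abs_of_pos (hwpos x),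
        div_le_iff₀ (hwpos x)]
      have h1 := exp_le_exp_add_exp (hη2 j).le x
      have h2 := exp_le_exp_add_exp hp.le x
      rw [abs_le]
      constructor <;> simp only [hw] <;>
        linarith [Real.exp_pos (ηs j * x), Real.exp_pos (p * x), Real.exp_pos (q * x),
          Real.exp_pos (-q * x)]
    · refine Eventually.of_forall fun x => ?_
      have hc : Continuous fun η : ℝ => (((Real.exp (η * x) - Real.exp (p * x)) / w x : ℝ) : ℂ) := by
        fun_prop
      have := (hc.tendsto p).comp hηlim
      simpa [Function.comp_def] using this
  have hM0 : 0 ≤ M := (norm_nonneg _).trans (hnM (p * Complex.I) (by simpa using hppos)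
    (by simpa using hp.le))
  have hconv : Tendsto (fun j => eLpNorm ((u j : ℝ → ℂ) - (v : ℝ → ℂ)) 2 volume) atTop (𝓝 0) := by
    have h1 : Tendsto (fun j => ENNReal.ofReal M * eLpNorm (expW (ηs j) F - expW p F) 2 volume
        + eLpNorm (fun ξ : ℝ => (n ((2 * Real.pi * ξ : ℝ) + ηs j * Complex.I)
          - n ((2 * Real.pi * ξ : ℝ) + p * Complex.I)) * fourierL2 (expW p F) ξ) 2 volume)
        atTop (𝓝 0) := by
      have hA : Tendsto (fun j => ENNReal.ofReal M * eLpNorm (expW (ηs j) F - expW p F) 2 volume)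
          atTop (𝓝 0) := by
        simpa using ENNReal.Tendsto.const_mul hconvF (Or.inr ENNReal.ofReal_ne_top)
      have hB := tendsto_eLpNorm_mul_zero (g := fourierL2 (expW p F)) (Lp.memLp _) (C := M + M)
        (φ := fun j ξ => n ((2 * Real.pi * ξ : ℝ) + ηs j * Complex.I)
          - n ((2 * Real.pi * ξ : ℝ) + p * Complex.I)) ?_ ?_ ?_
      · simpa using hA.add hB
      · exact fun j => ((hncont _ (hη1 j) (hη2 j).le).sub (hncont _ hppos hp.le)).aestronglyMeasurable
      · refine fun j => Eventually.of_forall fun ξ => (norm_sub_le _ _).trans (add_le_add ?_ ?_)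
        · exact hnM _ (by rw [hline]; exact hη1 j) (by rw [hline]; exact (hη2 j).le)
        · exact hnM _ (by rw [hline]; exact hppos) (by rw [hline]; exact hp.le)
      · refine Eventually.of_forall fun ξ => ?_
        rw [tendsto_sub_nhds_zero_iff]
        have hmem : ((2 * Real.pi * ξ : ℝ) : ℂ) + p * Complex.I
            ∈ {z : ℂ | q / 2 ≤ |z.im| ∧ |z.im| ≤ q} := by
          simp only [Set.mem_ofPred_eq, hline]
          exact ⟨hppos, hp.le⟩
        refine (hnc _ hmem).tendsto.comp (tendsto_nhdsWithin_iff.2 ⟨?_, ?_⟩)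
        · have hc : Continuous fun η : ℝ => ((2 * Real.pi * ξ : ℝ) : ℂ) + η * Complex.I := by
            fun_prop
          exact (hc.tendsto p).comp hηlim
        · refine Eventually.of_forall fun j => ?_
          simp only [Set.mem_ofPred_eq, hline]
          exact ⟨hη1 j, (hη2 j).le⟩
    refine tendsto_of_tendsto_of_tendsto_of_le_of_le tendsto_const_nhds h1 (fun _ => zero_le)
      fun j => ?_
    rw [← eLpNorm_fourierL2 ((Lp.memLp (u j)).sub (Lp.memLp v)),
      fourierL2_sub (Lp.memLp (u j)) (Lp.memLp v),
      ← eLpNorm_fourierL2 ((hFj j).sub hFp), fourierL2_sub (hFj j) hFp]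
    have e1 : ((fourierL2 (u j) - fourierL2 v : Lp ℂ 2 (volume : Measure ℝ)) : ℝ → ℂ)
        =ᵐ[volume] (fun ξ : ℝ => n ((2 * Real.pi * ξ : ℝ) + ηs j * Complex.I)
          * (fourierL2 (expW (ηs j) F) - fourierL2 (expW p F) : Lp ℂ 2 (volume : Measure ℝ)) ξ)
        + fun ξ : ℝ => (n ((2 * Real.pi * ξ : ℝ) + ηs j * Complex.I)
          - n ((2 * Real.pi * ξ : ℝ) + p * Complex.I)) * fourierL2 (expW p F) ξ := by
      filter_upwards [Lp.coeFn_sub (fourierL2 (u j)) (fourierL2 v), hu j, hv,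
        Lp.coeFn_sub (fourierL2 (expW (ηs j) F)) (fourierL2 (expW p F))] with ξ h1 h2 h3 h4
      rw [h1, Pi.add_apply, h4, Pi.sub_apply, Pi.sub_apply, h2, h3]
      ring
    rw [eLpNorm_congr_ae e1]
    refine (eLpNorm_add_le ?_ ?_ (by norm_num)).trans (add_le_add ?_ le_rfl)
    · exact (hncont _ (hη1 j) (hη2 j).le).aestronglyMeasurable.mul (Lp.aestronglyMeasurable _)
    · exact ((hncont _ (hη1 j) (hη2 j).le).sub (hncont _ hppos hp.le)).aestronglyMeasurable.mul
        (Lp.aestronglyMeasurable _)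
    · refine eLpNorm_le_mul_eLpNorm_of_ae_le_mul (Eventually.of_forall fun ξ => ?_) 2
      rw [norm_mul]
      gcongr
      exact hnM _ (by rw [hline]; exact hη1 j) (by rw [hline]; exact (hη2 j).le)
  have hvR : (v : ℝ → ℂ) =ᵐ[volume] expW p R := by
    refine ae_eq_mul_of_tendsto (us := fun _ => R) (u := R) (vs := fun j => u j)
      (ws := fun j x => (Real.exp (ηs j * x) : ℂ)) (w := fun x => (Real.exp (p * x) : ℂ))
      (fun _ => hR.1) hR.1 (fun j => Lp.aestronglyMeasurable _) (Lp.aestronglyMeasurable _)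
      (by simp) hconv (Eventually.of_forall fun x => ?_) hshift
    have hc : Continuous fun η : ℝ => (Real.exp (η * x) : ℂ) := by fun_prop
    exact (hc.tendsto p).comp hηlim
  refine ⟨(memLp_congr_ae hvR).1 (Lp.memLp v), ?_⟩
  rw [← fourierL2_congr hvR]
  exact hv

/-! ### Hyperbolic functions in a strip -/

lemma norm_cosh_sq (z : ℂ) : ‖Complex.cosh z‖ ^ 2 = Real.cosh z.re ^ 2 - Real.sin z.im ^ 2 := by
  conv_lhs => rw [← Complex.re_add_im z, Complex.cosh_add, Complex.cosh_mul_I,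
    Complex.sinh_mul_I, ← mul_assoc]
  rw [← Complex.ofReal_cosh, ← Complex.ofReal_cos, ← Complex.ofReal_sinh, ← Complex.ofReal_sin,
    ← Complex.ofReal_mul, ← Complex.ofReal_mul, ← Complex.normSq_eq_norm_sq,
    Complex.normSq_add_mul_I]
  nlinarith [Real.cosh_sq z.re, Real.sin_sq_add_cos_sq z.im, sq_nonneg (Real.sinh z.re)]

lemma norm_sinh_sq (z : ℂ) : ‖Complex.sinh z‖ ^ 2 = Real.cosh z.re ^ 2 - Real.cos z.im ^ 2 := by
  conv_lhs => rw [← Complex.re_add_im z, Complex.sinh_add, Complex.cosh_mul_I,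
    Complex.sinh_mul_I, ← mul_assoc]
  rw [← Complex.ofReal_cosh, ← Complex.ofReal_cos, ← Complex.ofReal_sinh, ← Complex.ofReal_sin,
    ← Complex.ofReal_mul, ← Complex.ofReal_mul, ← Complex.normSq_eq_norm_sq,
    Complex.normSq_add_mul_I]
  nlinarith [Real.cosh_sq z.re, Real.sin_sq_add_cos_sq z.im, sq_nonneg (Real.sinh z.re)]

lemma sin_sq_le_sq (y : ℝ) : Real.sin y ^ 2 ≤ y ^ 2 := sq_le_sq.2 Real.abs_sin_le_abs

lemma cosh_ne_zero_of_im {z : ℂ} (hz : |z.im| < 1) : Complex.cosh z ≠ 0 := by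
  intro h
  have h1 := norm_cosh_sq z
  rw [h, norm_zero] at h1
  have h2 : z.im ^ 2 < 1 := by
    rw [← sq_abs]; nlinarith [abs_nonneg z.im]
  nlinarith [sin_sq_le_sq z.im, Real.one_le_cosh z.re]

lemma im_sq_le {z : ℂ} (hz : |z.im| ≤ 1 / 2) : z.im ^ 2 ≤ 1 / 4 := by
  rw [← sq_abs]; nlinarith [abs_nonneg z.im]

lemma norm_cosh_sq_ge {z : ℂ} (hz : |z.im| ≤ 1 / 2) :
    3 / 4 * Real.cosh z.re ^ 2 ≤ ‖Complex.cosh z‖ ^ 2 := by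
  rw [norm_cosh_sq]
  nlinarith [sin_sq_le_sq z.im, im_sq_le hz, Real.one_le_cosh z.re]

lemma norm_tanh_le {z : ℂ} (hz : |z.im| ≤ 1 / 2) : ‖Complex.tanh z‖ ≤ 1 := by
  have h0 : 0 < ‖Complex.cosh z‖ := norm_pos_iff.2 (cosh_ne_zero_of_im (by linarith))
  rw [Complex.tanh_eq_sinh_div_cosh, norm_div, div_le_one h0]
  refine le_of_sq_le_sq ?_ h0.le
  rw [norm_cosh_sq, norm_sinh_sq]
  nlinarith [sin_sq_le_sq z.im, im_sq_le hz, Real.sin_sq_add_cos_sq z.im]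

lemma hasDerivAt_ctanh {z : ℂ} (hz : |z.im| < 1) :
    HasDerivAt Complex.tanh (1 / Complex.cosh z ^ 2) z := by
  have hc := cosh_ne_zero_of_im hz
  have h := (Complex.hasDerivAt_sinh z).div (Complex.hasDerivAt_cosh z) hc
  have e : (Complex.cosh z * Complex.cosh z - Complex.sinh z * Complex.sinh z) = 1 := by
    have := Complex.cosh_sq_sub_sinh_sq z
    linear_combination this
  rw [e] at h
  refine h.congr_of_eventuallyEq (Eventually.of_forall fun w => ?_)
  simp [Complex.tanh_eq_sinh_div_cosh]

lemma norm_sech_sq_le {z : ℂ} (hz : |z.im| ≤ 1 / 2) :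
    ‖1 / Complex.cosh z ^ 2‖ ≤ 4 / 3 / Real.cosh z.re ^ 2 := by
  have h1 := norm_cosh_sq_ge hz
  have h2 := Real.cosh_pos z.re
  rw [norm_div, norm_one, norm_pow, div_div, div_le_div_iff₀ (by nlinarith) (by positivity)]
  nlinarith

lemma isOpen_strip (a : ℝ) : IsOpen {z : ℂ | |z.im| < a} := isOpen_lt (by fun_prop) (by fun_prop)

/-! ### The symbol on a strip -/

/-- The entire-looking quotient `tanh z / z`, with the value `1` at `0`. -/
def tanhc : ℂ → ℂ := dslope Complex.tanh 0

lemma mul_tanhc (z : ℂ) : z * tanhc z = Complex.tanh z := by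
  have h := sub_smul_dslope Complex.tanh 0 z
  simpa [tanhc] using h

lemma tanhc_of_ne {z : ℂ} (hz : z ≠ 0) : tanhc z = Complex.tanh z / z := by
  rw [← mul_tanhc, mul_div_cancel_left₀ _ hz]

lemma tanhc_zero : tanhc 0 = 1 := by
  rw [tanhc, dslope_same, (hasDerivAt_ctanh (z := 0) (by simp)).deriv]
  simp

lemma differentiableOn_tanhc : DifferentiableOn ℂ tanhc {z | |z.im| < 1} := by
  refine (Complex.differentiableOn_dslope ((isOpen_strip 1).mem_nhds (by simp))).2 fun z hz => ?_
  exact (hasDerivAt_ctanh hz).differentiableAt.differentiableWithinAt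

lemma tanhc_neg (z : ℂ) : tanhc (-z) = tanhc z := by
  by_cases hz : z = 0
  · simp [hz]
  · rw [tanhc_of_ne hz, tanhc_of_ne (neg_ne_zero.2 hz), Complex.tanh_neg, neg_div_neg_eq]

/-- The square `(1 + β z²) tanh z / z` of the phase speed, for complex wave numbers. -/
def speedSq (β : ℝ) (z : ℂ) : ℂ := (1 + β * z ^ 2) * tanhc z

lemma speedSq_neg (β : ℝ) (z : ℂ) : speedSq β (-z) = speedSq β z := by
  rw [speedSq, speedSq, tanhc_neg, neg_sq]

lemma speedSq_zero (β : ℝ) : speedSq β 0 = 1 := by simp [speedSq, tanhc_zero]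

lemma speedSq_eq (β : ℝ) (z : ℂ) : speedSq β z = tanhc z + β * (z * Complex.tanh z) := by
  rw [speedSq, ← mul_tanhc]; ring

lemma differentiableOn_speedSq (β : ℝ) : DifferentiableOn ℂ (speedSq β) {z | |z.im| < 1} :=
  DifferentiableOn.mul (by fun_prop) differentiableOn_tanhc

/-- The square of the phase speed on the real line. -/
def speedSqR (β k : ℝ) : ℝ := if k = 0 then 1 else (1 + β * k ^ 2) * (Real.tanh k / k)

lemma speedSq_ofReal (β k : ℝ) : speedSq β k = (speedSqR β k : ℂ) := by
  unfold speedSqR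
  split_ifs with h
  · rw [h, Complex.ofReal_zero, speedSq_zero, Complex.ofReal_one]
  · rw [speedSq, tanhc_of_ne (Complex.ofReal_ne_zero.2 h)]
    push_cast
    rfl

lemma phaseSpeed_eq (β k : ℝ) : phaseSpeed β k = √(speedSqR β k) := by
  unfold phaseSpeed speedSqR
  split_ifs <;> simp

lemma speedSqR_neg (β k : ℝ) : speedSqR β (-k) = speedSqR β k := by
  unfold speedSqR
  simp [Real.tanh_neg, neg_div_neg_eq]

lemma continuous_speedSqR (β : ℝ) : Continuous (speedSqR β) := by
  have h : Continuous fun k : ℝ => speedSq β k := by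
    refine (differentiableOn_speedSq β).continuousOn.comp_continuous (by fun_prop) fun k => ?_
    simp
  have h2 : speedSqR β = fun k : ℝ => (speedSq β k).re := by
    funext k; rw [speedSq_ofReal, Complex.ofReal_re]
  rw [h2]
  exact Complex.continuous_re.comp h

lemma div_one_add_le_tanh {k : ℝ} (hk : 0 ≤ k) : k / (1 + k) ≤ Real.tanh k := by
  rw [Real.tanh_eq, div_le_div_iff₀ (by linarith) (by positivity)]
  have h1 : 1 + 2 * k ≤ Real.exp k * Real.exp k := by
    rw [← Real.exp_add]
    linarith [Real.add_one_le_exp (k + k)]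
  have h2 : Real.exp k * Real.exp (-k) = 1 := by rw [← Real.exp_add]; simp
  have h3 := Real.exp_pos (-k)
  have : (1 + 2 * k) * Real.exp (-k) ≤ Real.exp k := by
    calc (1 + 2 * k) * Real.exp (-k) ≤ Real.exp k * Real.exp k * Real.exp (-k) := by gcongr
      _ = Real.exp k := by rw [mul_assoc, h2, mul_one]
  nlinarith

lemma le_speedSqR {β : ℝ} (hβ : 0 < β) (k : ℝ) : (1 + β * k ^ 2) / (1 + |k|) ≤ speedSqR β k := by
  wlog hk : 0 ≤ k generalizing k
  · have := this (-k) (by linarith)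
    rwa [speedSqR_neg, abs_neg, neg_sq] at this
  rw [abs_of_nonneg hk]
  rcases hk.eq_or_lt with h | h
  · subst h; simp [speedSqR]
  · rw [speedSqR, if_neg h.ne', div_eq_mul_one_div]
    refine mul_le_mul_of_nonneg_left ?_ (by positivity)
    rw [le_div_iff₀ h]
    have := div_one_add_le_tanh hk
    calc 1 / (1 + k) * k = k / (1 + k) := by ring
      _ ≤ _ := this

lemma half_le_speedSqR {β : ℝ} (hβ : 0 < β) (hβ' : β < 1) (k : ℝ) : β / 2 ≤ speedSqR β k := by
  refine le_trans ?_ (le_speedSqR hβ k)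
  rw [le_div_iff₀ (by positivity)]
  nlinarith [sq_abs k, sq_nonneg (|k| - 1), abs_nonneg k,
    mul_nonneg hβ.le (sq_nonneg (|k| - 1)), mul_nonneg hβ.le (sq_nonneg k)]

lemma norm_le_of_strip {z : ℂ} (hz : |z.im| ≤ 1 / 2) : ‖z‖ ≤ |z.re| + 1 / 2 :=
  (Complex.norm_le_abs_re_add_abs_im z).trans (by linarith)

lemma abs_le_cosh (x : ℝ) : |x| ≤ Real.cosh x := by
  rw [← Real.cosh_abs]
  exact (Real.self_le_sinh_iff.2 (abs_nonneg x)).trans (Real.sinh_lt_cosh _).le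

/-- The square of the phase speed is Lipschitz on a strip. -/
lemma exists_lipschitz_speedSq (β : ℝ) : ∃ L, 0 < L ∧ ∀ z w : ℂ, |z.im| ≤ 1 / 2 → |w.im| ≤ 1 / 2 →
    ‖speedSq β z - speedSq β w‖ ≤ L * ‖z - w‖ := by
  have hdiff : ∀ z : ℂ, |z.im| ≤ 1 / 2 → DifferentiableAt ℂ tanhc z := fun z hz =>
    differentiableOn_tanhc.differentiableAt ((isOpen_strip 1).mem_nhds (by
      simp only [Set.mem_ofPred_eq]; linarith))
  have hsech : ∀ z : ℂ, |z.im| ≤ 1 / 2 → ‖1 / Complex.cosh z ^ 2‖ ≤ 4 / 3 := fun z hz => by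
    refine (norm_sech_sq_le hz).trans (div_le_self (by norm_num) ?_)
    nlinarith [Real.one_le_cosh z.re]
  -- `(tanh z / z)'` is bounded by compactness for `|z| ≤ 1`, and explicitly for `|z| ≥ 1`
  obtain ⟨C, hC⟩ : ∃ C, ∀ z : ℂ, |z.im| ≤ 1 / 2 → ‖deriv tanhc z‖ ≤ C := by
    have hK : IsCompact (Metric.closedBall (0 : ℂ) 1 ∩ {z | |z.im| ≤ 1 / 2}) :=
      (isCompact_closedBall _ _).inter_right (isClosed_le (by fun_prop) (by fun_prop))
    have hcont : ContinuousOn (deriv tanhc)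
        (Metric.closedBall (0 : ℂ) 1 ∩ {z | |z.im| ≤ 1 / 2}) := by
      refine (differentiableOn_tanhc.deriv (isOpen_strip 1)).continuousOn.mono ?_
      rintro z ⟨-, hz⟩
      simp only [Set.mem_ofPred_eq] at hz ⊢
      linarith
    obtain ⟨C, hC⟩ := hK.exists_bound_of_continuousOn hcont
    refine ⟨max C (7 / 3), fun z hz => ?_⟩
    rcases le_total ‖z‖ 1 with h | h
    · exact (hC z ⟨by simpa using h, hz⟩).trans (le_max_left _ _)
    · refine le_trans ?_ (le_max_right _ _)
      have hz0 : z ≠ 0 := by rw [← norm_pos_iff]; linarith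
      have h1 : HasDerivAt (fun w => w * tanhc w) (1 * tanhc z + z * deriv tanhc z) z :=
        (hasDerivAt_id z).mul (hdiff z hz).hasDerivAt
      have h2 : (fun w => w * tanhc w) = Complex.tanh := funext mul_tanhc
      rw [h2] at h1
      have h3 := h1.unique (hasDerivAt_ctanh (by linarith))
      have h4 : deriv tanhc z = (1 / Complex.cosh z ^ 2 - tanhc z) / z := by
        rw [eq_div_iff hz0]; linear_combination h3
      have h5 : ‖tanhc z‖ ≤ 1 := by
        rw [tanhc_of_ne hz0, norm_div]
        exact div_le_one_of_le₀ ((norm_tanh_le hz).trans h) (norm_nonneg _)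
      rw [h4, norm_div]
      refine (div_le_self (norm_nonneg _) h).trans ((norm_sub_le _ _).trans ?_)
      linarith [hsech z hz]
  have hC0 : 0 ≤ C := (norm_nonneg _).trans (hC 0 (by simp))
  have hderiv : ∀ z : ℂ, |z.im| ≤ 1 / 2 → HasDerivAt (speedSq β)
      (deriv tanhc z + β * (1 * Complex.tanh z + z * (1 / Complex.cosh z ^ 2))) z := by
    intro z hz
    have h1 := (hdiff z hz).hasDerivAt.add
      (((hasDerivAt_id z).mul (hasDerivAt_ctanh (z := z) (by linarith))).const_mul (β : ℂ))
    refine h1.congr_of_eventuallyEq (Eventually.of_forall fun w => ?_)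
    rw [speedSq_eq]
    rfl
  refine ⟨C + |β| * 3 + 1, by positivity, fun z w hz hw => ?_⟩
  have hconv : Convex ℝ {z : ℂ | |z.im| ≤ 1 / 2} := by
    have : {z : ℂ | |z.im| ≤ 1 / 2} = Complex.imLm ⁻¹' Set.Icc (-(1 / 2)) (1 / 2) := by
      ext z; simp [abs_le]
    rw [this]
    exact (convex_Icc _ _).linear_preimage _
  refine hconv.norm_image_sub_le_of_norm_hasDerivWithin_le
    (fun z hz => (hderiv z hz).hasDerivWithinAt) (fun z hz => ?_) hw hz
  have hz : |z.im| ≤ 1 / 2 := hz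
  have h2 : ‖z * (1 / Complex.cosh z ^ 2)‖ ≤ 2 := by
    rw [norm_mul]
    calc ‖z‖ * ‖1 / Complex.cosh z ^ 2‖
        ≤ (Real.cosh z.re + 1 / 2 * Real.cosh z.re) * (4 / 3 / Real.cosh z.re ^ 2) := by
          gcongr
          · exact (norm_le_of_strip hz).trans (by
              linarith [abs_le_cosh z.re, Real.one_le_cosh z.re])
          · exact norm_sech_sq_le hz
      _ = 2 / Real.cosh z.re := by
          have := (Real.cosh_pos z.re).ne'
          field_simp; norm_num
      _ ≤ 2 := div_le_self (by norm_num) (Real.one_le_cosh _)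
  calc ‖deriv tanhc z + β * (1 * Complex.tanh z + z * (1 / Complex.cosh z ^ 2))‖
      ≤ ‖deriv tanhc z‖ + ‖(β : ℂ)‖ * (‖Complex.tanh z‖ + ‖z * (1 / Complex.cosh z ^ 2)‖) := by
        refine (norm_add_le _ _).trans ?_
        rw [norm_mul, one_mul]
        gcongr
        exact norm_add_le _ _
    _ ≤ C + |β| * (1 + 2) := by
        rw [Complex.norm_real, Real.norm_eq_abs]
        gcongr
        exacts [hC z hz, norm_tanh_le hz]
    _ ≤ _ := by linarith

/-! ### The phase speed at complex wave numbers -/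

/-- The phase speed at complex wave numbers. -/
def speedC (β : ℝ) (z : ℂ) : ℂ := speedSq β z ^ (1 / 2 : ℂ)

lemma speedC_sq (β : ℝ) (z : ℂ) : speedC β z ^ 2 = speedSq β z := by
  simp [speedC]

lemma norm_speedC_sq (β : ℝ) (z : ℂ) : ‖speedC β z‖ ^ 2 = ‖speedSq β z‖ := by
  rw [← norm_pow, speedC_sq]

lemma speedC_re_pos {β : ℝ} {z : ℂ} (h : 0 < (speedSq β z).re) : 0 < (speedC β z).re := by
  have h0 : speedSq β z ≠ 0 := fun h' => by rw [h'] at h; simp at h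
  rw [speedC, Complex.cpow_def_of_ne_zero h0, Complex.exp_re]
  refine mul_pos (Real.exp_pos _) (Real.cos_pos_of_mem_Ioo ?_)
  have h1 : (Complex.log (speedSq β z) * (1 / 2)).im = (speedSq β z).arg / 2 := by
    rw [show (1 / 2 : ℂ) = ((1 / 2 : ℝ) : ℂ) by push_cast; rfl, Complex.im_mul_ofReal,
      Complex.log_im]
    ring
  rw [h1]
  have h2 := Complex.abs_arg_lt_pi_div_two_iff.2 (Or.inl h)
  rw [abs_lt] at h2
  constructor <;> linarith [Real.pi_pos]

lemma speedC_ofReal {β : ℝ} (hβ : 0 < β) (hβ' : β < 1) (k : ℝ) :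
    speedC β k = (phaseSpeed β k : ℂ) := by
  have h : 0 ≤ speedSqR β k := (by linarith : 0 ≤ β / 2).trans (half_le_speedSqR hβ hβ' k)
  rw [speedC, speedSq_ofReal, phaseSpeed_eq, Real.sqrt_eq_rpow, Complex.ofReal_cpow h]
  norm_num

/-- On a thin strip the square of the phase speed stays in the right half-plane. -/
lemma exists_strip_re_pos {β : ℝ} (hβ : 0 < β) (hβ' : β < 1) :
    ∃ η₀, 0 < η₀ ∧ η₀ ≤ 1 / 2 ∧ ∀ z : ℂ, |z.im| ≤ η₀ → 0 < (speedSq β z).re := by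
  obtain ⟨L, hL, hLip⟩ := exists_lipschitz_speedSq β
  refine ⟨min (1 / 2) (β / (4 * L)), by positivity, min_le_left _ _, fun z hz => ?_⟩
  have h1 : |z.im| ≤ 1 / 2 := hz.trans (min_le_left _ _)
  have h2 := hLip z z.re h1 (by simp)
  have h3 : ‖z - z.re‖ = |z.im| := by
    have : z - z.re = z.im * Complex.I := by
      linear_combination -Complex.re_add_im z
    rw [this, norm_mul, Complex.norm_I, mul_one, Complex.norm_real, Real.norm_eq_abs]
  rw [h3] at h2
  have h4 : L * |z.im| ≤ β / 4 := by
    calc L * |z.im| ≤ L * (β / (4 * L)) := by gcongr; exact hz.trans (min_le_right _ _)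
      _ = β / 4 := by field_simp
  have h5 := (Complex.abs_re_le_norm (speedSq β z - speedSq β z.re)).trans (h2.trans h4)
  rw [speedSq_ofReal, Complex.sub_re, Complex.ofReal_re] at h5
  have h6 := half_le_speedSqR hβ hβ' z.re
  have h7 := (abs_le.1 h5).1
  linarith

lemma differentiableAt_speedC {β : ℝ} {z : ℂ} (hz : |z.im| < 1) (h : 0 < (speedSq β z).re) :
    DifferentiableAt ℂ (speedC β) z :=
  ((differentiableOn_speedSq β).differentiableAt ((isOpen_strip 1).mem_nhds hz)).cpow
    (differentiableAt_const _) (Or.inl h)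

/-! ### The long-wave expansion -/

/-- `sinh z = (z - z³/3) cosh z + O(z⁵)`: the expansion of `tanh` without a division. -/
lemma norm_sinh_sub_le {z : ℂ} (hz : ‖z‖ ≤ 1) :
    ‖Complex.sinh z - (z - z ^ 3 / 3) * Complex.cosh z‖ ≤ ‖z‖ ^ 5 := by
  have e1 := Complex.exp_bound hz (n := 5) (by norm_num)
  have e2 := Complex.exp_bound (x := -z) (by rwa [norm_neg]) (n := 5) (by norm_num)
  have e3 := Complex.exp_bound hz (n := 4) (by norm_num)
  have e4 := Complex.exp_bound (x := -z) (by rwa [norm_neg]) (n := 4) (by norm_num)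
  rw [norm_neg] at e2 e4
  simp only [Finset.sum_range_succ, Finset.sum_range_zero, Nat.factorial] at e1 e2 e3 e4
  norm_num at e1 e2 e3 e4
  set a := Complex.exp z - (1 + z + z ^ 2 / 2 + z ^ 3 / 6 + z ^ 4 / 24) with ha
  set b := Complex.exp (-z) - (1 + -z + z ^ 2 / 2 + (-z) ^ 3 / 6 + z ^ 4 / 24) with hb
  set c := Complex.exp z - (1 + z + z ^ 2 / 2 + z ^ 3 / 6) with hc
  set d := Complex.exp (-z) - (1 + -z + z ^ 2 / 2 + (-z) ^ 3 / 6) with hd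
  have key : Complex.sinh z - (z - z ^ 3 / 3) * Complex.cosh z
      = (a - b) / 2 - (z - z ^ 3 / 3) * ((c + d) / 2) + z ^ 5 / 6 := by
    rw [Complex.sinh, Complex.cosh, ha, hb, hc, hd]
    ring
  have n0 := norm_nonneg z
  have hab : ‖(a - b) / 2‖ ≤ ‖z‖ ^ 5 * (1 / 100) := by
    rw [norm_div, Complex.norm_ofNat]
    have := norm_sub_le a b
    linarith
  have hcd : ‖(c + d) / 2‖ ≤ ‖z‖ ^ 4 * (5 / 96) := by
    rw [norm_div, Complex.norm_ofNat]
    have := norm_add_le c d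
    linarith
  have hz3 : ‖z - z ^ 3 / 3‖ ≤ 2 * ‖z‖ := by
    refine (norm_sub_le _ _).trans ?_
    rw [norm_div, norm_pow, Complex.norm_ofNat]
    have : ‖z‖ ^ 3 ≤ ‖z‖ := by
      calc ‖z‖ ^ 3 ≤ ‖z‖ ^ 1 := pow_le_pow_of_le_one n0 hz (by norm_num)
        _ = _ := pow_one _
    linarith
  rw [key]
  calc _ ≤ ‖(a - b) / 2‖ + ‖z - z ^ 3 / 3‖ * ‖(c + d) / 2‖ + ‖z ^ 5 / 6‖ := by
        refine (norm_add_le _ _).trans ?_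
        gcongr
        refine (norm_sub_le _ _).trans ?_
        rw [norm_mul]
    _ ≤ ‖z‖ ^ 5 * (1 / 100) + 2 * ‖z‖ * (‖z‖ ^ 4 * (5 / 96)) + ‖z‖ ^ 5 / 6 := by
        rw [norm_div (z ^ 5), norm_pow, Complex.norm_ofNat]
        gcongr
    _ ≤ ‖z‖ ^ 5 := by
        have : 0 ≤ ‖z‖ ^ 5 := by positivity
        nlinarith

/-- `tanh z / z = 1 - z²/3 + O(z⁴)`. -/
lemma norm_tanhc_sub_le {z : ℂ} (hz : ‖z‖ ≤ 1) (hi : |z.im| ≤ 1 / 2) :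
    ‖tanhc z - (1 - z ^ 2 / 3)‖ ≤ 2 * ‖z‖ ^ 4 := by
  by_cases h0 : z = 0
  · simp [h0, tanhc_zero]
  have hc : Complex.cosh z ≠ 0 := cosh_ne_zero_of_im (by linarith)
  have hcn : 1 / 2 ≤ ‖Complex.cosh z‖ := by
    have := norm_cosh_sq_ge hi
    nlinarith [Real.one_le_cosh z.re, norm_nonneg (Complex.cosh z)]
  have e : tanhc z - (1 - z ^ 2 / 3)
      = (Complex.sinh z - (z - z ^ 3 / 3) * Complex.cosh z) / (z * Complex.cosh z) := by
    rw [tanhc_of_ne h0, Complex.tanh_eq_sinh_div_cosh]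
    field_simp
  have hzp : 0 < ‖z‖ := norm_pos_iff.2 h0
  rw [e, norm_div, norm_mul, div_le_iff₀ (by positivity)]
  refine (norm_sinh_sub_le hz).trans ?_
  calc ‖z‖ ^ 5 = 2 * ‖z‖ ^ 4 * (‖z‖ * (1 / 2)) := by ring
    _ ≤ _ := by gcongr

/-- `m_β(z) = 1 - γ_β z² + O(z⁴)`. -/
lemma norm_speedC_sub_le {β : ℝ} (hβ : 0 < β) (hβ' : β < 1 / 3) {z : ℂ} (hz : ‖z‖ ≤ 1)
    (hi : |z.im| ≤ 1 / 2) (hp : 0 < (speedSq β z).re) :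
    ‖speedC β z - 1 + gammaCoeff β * z ^ 2‖ ≤ 12 * ‖z‖ ^ 4 := by
  have hγ0 : 0 < gammaCoeff β := by unfold gammaCoeff; linarith
  have hγ1 : gammaCoeff β ≤ 1 / 6 := by unfold gammaCoeff; linarith
  have n0 := norm_nonneg z
  have hz2 : ‖z‖ ^ 2 ≤ 1 := pow_le_one₀ n0 hz
  have hβz : ‖1 + (β : ℂ) * z ^ 2‖ ≤ 2 := by
    refine (norm_add_le _ _).trans ?_
    rw [norm_one, norm_mul, norm_pow, Complex.norm_real, Real.norm_of_nonneg hβ.le]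
    nlinarith
  have h1 : ‖speedSq β z - 1 + 2 * gammaCoeff β * z ^ 2‖ ≤ 5 * ‖z‖ ^ 4 := by
    have e : speedSq β z - 1 + 2 * gammaCoeff β * z ^ 2
        = (1 + β * z ^ 2) * (tanhc z - (1 - z ^ 2 / 3)) - (β / 3 : ℝ) * z ^ 4 := by
      unfold gammaCoeff speedSq
      push_cast
      ring
    rw [e]
    refine (norm_sub_le _ _).trans ?_
    rw [norm_mul, norm_mul, norm_pow, Complex.norm_real, Real.norm_of_nonneg (by positivity)]
    have := norm_tanhc_sub_le hz hi
    calc ‖1 + (β : ℂ) * z ^ 2‖ * ‖tanhc z - (1 - z ^ 2 / 3)‖ + β / 3 * ‖z‖ ^ 4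
        ≤ 2 * (2 * ‖z‖ ^ 4) + 1 * ‖z‖ ^ 4 := by gcongr; linarith
      _ = _ := by ring
  -- `m - (1 - γ z²)` from `m² - (1 - γ z²)²`, as the conjugate factor is bounded below
  have h2 : (speedC β z - 1 + gammaCoeff β * z ^ 2) * (speedC β z + 1 - gammaCoeff β * z ^ 2)
      = (speedSq β z - 1 + 2 * gammaCoeff β * z ^ 2) - (gammaCoeff β ^ 2 : ℝ) * z ^ 4 := by
    rw [← speedC_sq]
    push_cast
    ring
  have h3 : 1 / 2 ≤ ‖speedC β z + 1 - gammaCoeff β * z ^ 2‖ := by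
    refine le_trans ?_ (Complex.re_le_norm _)
    have h4 := speedC_re_pos hp
    have h5 : (gammaCoeff β * z ^ 2 : ℂ).re ≤ 1 / 6 := by
      refine (Complex.re_le_norm _).trans ?_
      rw [norm_mul, norm_pow, Complex.norm_real, Real.norm_of_nonneg hγ0.le]
      nlinarith
    rw [Complex.sub_re, Complex.add_re, Complex.one_re]
    linarith
  have h4 : ‖speedC β z - 1 + gammaCoeff β * z ^ 2‖
      * ‖speedC β z + 1 - gammaCoeff β * z ^ 2‖ ≤ 6 * ‖z‖ ^ 4 := by
    rw [← norm_mul, h2]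
    refine (norm_sub_le _ _).trans ?_
    rw [norm_mul, norm_pow, Complex.norm_real, Real.norm_of_nonneg (by positivity)]
    have : gammaCoeff β ^ 2 ≤ 1 := by nlinarith
    calc _ ≤ 5 * ‖z‖ ^ 4 + 1 * ‖z‖ ^ 4 := by gcongr
      _ = _ := by ring
  nlinarith [norm_nonneg (speedC β z - 1 + gammaCoeff β * z ^ 2)]

/-- Near zero wave number the symbol is comparable to that of the KdV operator. -/
lemma speedC_sub_ge {β : ℝ} (hβ : 0 < β) (hβ' : β < 1 / 3) {ε : ℝ} (hε : 0 < ε) {z : ℂ}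
    (hz : ‖z‖ ≤ 1) (hzγ : 48 * ‖z‖ ^ 2 ≤ gammaCoeff β) (hi : |z.im| ≤ 1 / 2) (hiε : |z.im| ≤ ε / 2)
    (hp : 0 < (speedSq β z).re) :
    gammaCoeff β / 4 * (‖z‖ ^ 2 + ε ^ 2) ≤ ‖speedC β z - (1 + gammaCoeff β * ε ^ 2)‖ := by
  have hγ0 : 0 < gammaCoeff β := by unfold gammaCoeff; linarith
  have h1 := norm_speedC_sub_le hβ hβ' hz hi hp
  have h2 : gammaCoeff β / 2 * (‖z‖ ^ 2 + ε ^ 2) ≤ ‖(gammaCoeff β : ℂ) * (z ^ 2 + ε ^ 2)‖ := by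
    rw [norm_mul, Complex.norm_real, Real.norm_of_nonneg hγ0.le]
    have h3 : z.re ^ 2 - z.im ^ 2 + ε ^ 2 ≤ ‖z ^ 2 + (ε : ℂ) ^ 2‖ := by
      refine le_trans (le_of_eq ?_) (Complex.re_le_norm _)
      rw [← Complex.ofReal_pow, Complex.add_re, Complex.ofReal_re, sq z, Complex.mul_re]
      ring
    have h4 : ‖z‖ ^ 2 = z.re ^ 2 + z.im ^ 2 := by
      rw [← Complex.normSq_eq_norm_sq, Complex.normSq_apply]; ring
    have h5 : z.im ^ 2 ≤ ε ^ 2 / 4 := by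
      rw [← sq_abs]; nlinarith [abs_nonneg z.im]
    have : (‖z‖ ^ 2 + ε ^ 2) / 2 ≤ ‖z ^ 2 + (ε : ℂ) ^ 2‖ := by nlinarith [sq_nonneg z.re]
    nlinarith
  have h3 : ‖z‖ ^ 4 = ‖z‖ ^ 2 * ‖z‖ ^ 2 := by ring
  have h4 : speedC β z - (1 + gammaCoeff β * ε ^ 2)
      = (speedC β z - 1 + gammaCoeff β * z ^ 2) - gammaCoeff β * (z ^ 2 + ε ^ 2) := by ring
  rw [h4, norm_sub_rev]
  have h5 := norm_sub_norm_le ((gammaCoeff β : ℂ) * (z ^ 2 + ε ^ 2))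
    (speedC β z - 1 + gammaCoeff β * z ^ 2)
  nlinarith [sq_nonneg ‖z‖, sq_nonneg ε, mul_nonneg (sub_nonneg.2 hzγ) (sq_nonneg ‖z‖),
    mul_nonneg hγ0.le (sq_nonneg ε)]

/-! ### The positive zero of the symbol -/

lemma pos_of_hasDerivAt_pos {f f' : ℝ → ℝ} (hf : ∀ x, HasDerivAt f (f' x) x) (h0 : f 0 = 0)
    (hpos : ∀ x, 0 < x → 0 < f' x) {x : ℝ} (hx : 0 < x) : 0 < f x := by
  have hc : ContinuousOn f (Set.Ici 0) := fun y _ => (hf y).continuousAt.continuousWithinAt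
  have h := strictMonoOn_of_deriv_pos (convex_Ici 0) hc (fun y hy => by
    rw [interior_Ici] at hy
    rw [(hf y).deriv]
    exact hpos y hy)
  have := h (Set.mem_Ici.2 le_rfl) (Set.mem_Ici.2 hx.le) hx
  rwa [h0] at this

/-- The inequality that makes `criticalBeta b` decreasing. At `2k` it is the positivity of
`x sinh x + x² - 4 cosh x + 4`, which follows by integrating four times from `0`. -/
lemma two_sinh_sq_lt {k : ℝ} (hk : 0 < k) :
    2 * Real.sinh k ^ 2 < k ^ 2 + k * (Real.sinh k * Real.cosh k) := by
  have h1 : ∀ x, 0 < x → 0 < x * Real.cosh x - Real.sinh x := fun x hx =>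
    pos_of_hasDerivAt_pos (f := fun x => x * Real.cosh x - Real.sinh x)
      (f' := fun x => 1 * Real.cosh x + x * Real.sinh x - Real.cosh x)
      (fun x => ((hasDerivAt_id x).mul (Real.hasDerivAt_cosh x)).sub (Real.hasDerivAt_sinh x))
      (by simp) (fun x hx => by nlinarith [mul_pos hx (Real.sinh_pos_iff.2 hx)]) hx
  have h2 : ∀ x, 0 < x → 0 < x * Real.sinh x - 2 * Real.cosh x + 2 := fun x hx =>
    pos_of_hasDerivAt_pos (f := fun x => x * Real.sinh x - 2 * Real.cosh x + 2)
      (f' := fun x => 1 * Real.sinh x + x * Real.cosh x - 2 * Real.sinh x)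
      (fun x => (((hasDerivAt_id x).mul (Real.hasDerivAt_sinh x)).sub
        ((Real.hasDerivAt_cosh x).const_mul 2)).add_const 2)
      (by simp) (fun x hx => by linarith [h1 x hx]) hx
  have h3 : ∀ x, 0 < x → 0 < x * Real.cosh x + 2 * x - 3 * Real.sinh x := fun x hx =>
    pos_of_hasDerivAt_pos (f := fun x => x * Real.cosh x + 2 * x - 3 * Real.sinh x)
      (f' := fun x => 1 * Real.cosh x + x * Real.sinh x + 2 * 1 - 3 * Real.cosh x)
      (fun x => ((((hasDerivAt_id x).mul (Real.hasDerivAt_cosh x)).add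
        ((hasDerivAt_id x).const_mul 2)).sub ((Real.hasDerivAt_sinh x).const_mul 3)))
      (by simp) (fun x hx => by linarith [h2 x hx]) hx
  have h4 : ∀ x, 0 < x → 0 < x * Real.sinh x + x ^ 2 - 4 * Real.cosh x + 4 := fun x hx =>
    pos_of_hasDerivAt_pos (f := fun x => x * Real.sinh x + x ^ 2 - 4 * Real.cosh x + 4)
      (f' := fun x => 1 * Real.sinh x + x * Real.cosh x + 2 * x - 4 * Real.sinh x)
      (fun x => by
        have := ((((hasDerivAt_id x).mul (Real.hasDerivAt_sinh x)).add
          (hasDerivAt_pow 2 x)).sub ((Real.hasDerivAt_cosh x).const_mul 4)).add_const 4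
        simpa using this)
      (by simp) (fun x hx => by linarith [h3 x hx]) hx
  have h5 := h4 (2 * k) (by linarith)
  rw [Real.sinh_two_mul, Real.cosh_two_mul, Real.cosh_sq] at h5
  nlinarith

/-- The function whose value at `k` is the `β` for which the squared phase speed at `k` is `b`. -/
def criticalBeta (b k : ℝ) : ℝ := b * (Real.cosh k / (k * Real.sinh k)) - 1 / k ^ 2

lemma speedSqR_eq {β k : ℝ} (b : ℝ) (hk : 0 < k) :
    speedSqR β k = b + k * Real.tanh k * (β - criticalBeta b k) := by
  have hs : Real.sinh k ≠ 0 := (Real.sinh_pos_iff.2 hk).ne'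
  have hc : Real.cosh k ≠ 0 := (Real.cosh_pos k).ne'
  rw [speedSqR, if_neg hk.ne', criticalBeta, Real.tanh_eq_sinh_div_cosh]
  field_simp
  ring

lemma exists_hasDerivAt_criticalBeta {b k : ℝ} (hb : 1 ≤ b) (hk : 0 < k) :
    ∃ d < 0, HasDerivAt (criticalBeta b) d k := by
  have hs : 0 < Real.sinh k := Real.sinh_pos_iff.2 hk
  have hmul : HasDerivAt (fun k => k * Real.sinh k) (1 * Real.sinh k + k * Real.cosh k) k :=
    (hasDerivAt_id k).mul (Real.hasDerivAt_sinh k)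
  have h1 := ((((Real.hasDerivAt_cosh k).div hmul (mul_pos hk hs).ne').const_mul b).sub
    ((hasDerivAt_const k (1 : ℝ)).div (hasDerivAt_pow 2 k) (by positivity)))
  refine ⟨_, ?_, h1⟩
  have hne := hs.ne'
  have e : b * ((Real.sinh k * (k * Real.sinh k)
      - Real.cosh k * (1 * Real.sinh k + k * Real.cosh k)) / (k * Real.sinh k) ^ 2) - (0 * k ^ 2 - 1 * (((2 : ℕ) : ℝ) * k ^ (2 - 1))) / (k ^ 2) ^ 2
      = -((b * (k ^ 2 + k * (Real.sinh k * Real.cosh k)) - 2 * Real.sinh k ^ 2)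
        / (k ^ 3 * Real.sinh k ^ 2)) := by
    field_simp
    push_cast
    linear_combination (-(b * k ^ 3)) * Real.cosh_sq k
  rw [e]
  have h2 := two_sinh_sq_lt hk
  have h3 : 0 < k ^ 2 + k * (Real.sinh k * Real.cosh k) := by
    have := Real.cosh_pos k; positivity
  exact neg_neg_of_pos (div_pos (by nlinarith) (by positivity))

lemma strictAntiOn_criticalBeta {b : ℝ} (hb : 1 ≤ b) :
    StrictAntiOn (criticalBeta b) (Set.Ioi 0) := by
  refine strictAntiOn_of_deriv_neg (convex_Ioi 0) (fun k hk => ?_) (fun k hk => ?_)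
  · obtain ⟨d, -, h⟩ := exists_hasDerivAt_criticalBeta hb hk
    exact h.continuousAt.continuousWithinAt
  · rw [interior_Ioi] at hk
    obtain ⟨d, hd, h⟩ := exists_hasDerivAt_criticalBeta hb hk
    rwa [h.deriv]

lemma speedSqR_eq_iff {β b k : ℝ} (hk : 0 < k) : speedSqR β k = b ↔ criticalBeta b k = β := by
  have ht : 0 < Real.tanh k := by
    rw [Real.tanh_eq_sinh_div_cosh]; exact div_pos (Real.sinh_pos_iff.2 hk) (Real.cosh_pos k)
  rw [speedSqR_eq b hk]
  constructor
  · intro h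
    have : k * Real.tanh k * (β - criticalBeta b k) = 0 := by linarith
    have := (mul_eq_zero.1 this).resolve_left (mul_pos hk ht).ne'
    linarith
  · intro h; rw [h]; ring

lemma speedSqR_unique {β b k k' : ℝ} (hb : 1 ≤ b) (hk : 0 < k) (hk' : 0 < k')
    (h : speedSqR β k = b) (h' : speedSqR β k' = b) : k = k' := by
  rw [speedSqR_eq_iff hk] at h
  rw [speedSqR_eq_iff hk'] at h'
  exact (strictAntiOn_criticalBeta hb).injOn hk hk' (h.trans h'.symm)

lemma two_le_speedSqR {β : ℝ} (hβ : 0 < β) (hβ' : β < 1 / 3) {k : ℝ} (hk : 4 / β ≤ k) :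
    1 + β / 4 * (1 + k) ≤ speedSqR β k := by
  have h1 : 4 ≤ β * k := by
    rwa [div_le_iff₀ hβ, mul_comm] at hk
  have hk0 : 12 ≤ k := by nlinarith
  refine le_trans ?_ (le_speedSqR hβ k)
  rw [abs_of_nonneg (by linarith), le_div_iff₀ (by linarith)]
  nlinarith [mul_nonneg hβ.le (sq_nonneg (k - 1))]

/-- There is a wave number `k > 0` at which the phase speed is again `1`. -/
lemma exists_speedSqR_eq_one {β : ℝ} (hβ : 0 < β) (hβ' : β < 1 / 3) :
    ∃ k, 0 < k ∧ k ≤ 4 / β ∧ speedSqR β k = 1 := by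
  have hγ0 : 0 < gammaCoeff β := by unfold gammaCoeff; linarith
  have hγ1 : gammaCoeff β ≤ 1 / 6 := by unfold gammaCoeff; linarith
  obtain ⟨s, hs0, hs1, hs2⟩ : ∃ s : ℝ, 0 < s ∧ s ≤ 1 / 2 ∧ 24 * s ^ 2 ≤ gammaCoeff β :=
    ⟨gammaCoeff β / 5, by positivity, by linarith, by nlinarith⟩
  have hsmall : speedSqR β s ≤ 1 := by
    have hpos : 0 < speedSqR β s := by
      have := half_le_speedSqR hβ (by linarith) s; linarith
    have h1 := norm_speedC_sub_le hβ hβ' (z := s)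
      (by rw [Complex.norm_real, Real.norm_of_nonneg hs0.le]; linarith) (by simp)
      (by rw [speedSq_ofReal, Complex.ofReal_re]; exact hpos)
    rw [speedC_ofReal hβ (by linarith), Complex.norm_real, Real.norm_of_nonneg hs0.le,
      ← Complex.ofReal_one, ← Complex.ofReal_pow, ← Complex.ofReal_mul, ← Complex.ofReal_sub,
      ← Complex.ofReal_add, Complex.norm_real, Real.norm_eq_abs] at h1
    have h2 := (abs_le.1 h1).2
    have h3 : phaseSpeed β s ≤ 1 := by nlinarith [sq_nonneg s]
    rw [phaseSpeed_eq] at h3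
    simpa using (Real.sqrt_le_left zero_le_one).1 h3
  have hβ4 : s ≤ 4 / β := by
    rw [le_div_iff₀ hβ]; nlinarith
  have hlarge : 1 ≤ speedSqR β (4 / β) := by
    have := two_le_speedSqR hβ hβ' (le_refl (4 / β))
    have : 0 < β / 4 * (1 + 4 / β) := by positivity
    linarith
  obtain ⟨k, ⟨hk1, hk2⟩, hk3⟩ := intermediate_value_Icc hβ4 (continuous_speedSqR β).continuousOn
    ⟨hsmall, hlarge⟩
  exact ⟨k, hs0.trans_le hk1, hk2, hk3⟩

lemma one_lt_speedSqR {β k l : ℝ} (hk : 0 < k) (h : speedSqR β k = 1) (hl : k < l) :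
    1 < speedSqR β l := by
  have hl0 : 0 < l := hk.trans hl
  rw [speedSqR_eq_iff hk] at h
  have ht : 0 < Real.tanh l := by
    rw [Real.tanh_eq_sinh_div_cosh]; exact div_pos (Real.sinh_pos_iff.2 hl0) (Real.cosh_pos l)
  have h1 := strictAntiOn_criticalBeta le_rfl hk hl0 hl
  rw [speedSqR_eq 1 hl0]
  have : 0 < l * Real.tanh l * (β - criticalBeta 1 l) := mul_pos (mul_pos hl0 ht) (by linarith)
  linarith

/-- The squared phase speed is expanding near the wave number where it returns to `1`. -/
lemma exists_expanding {β k : ℝ} (hk : 0 < k) (h : speedSqR β k = 1) :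
    ∃ ρ c, 0 < ρ ∧ 0 < c ∧ ∀ z w : ℂ, ‖z - k‖ < ρ → ‖w - k‖ < ρ →
      c * ‖z - w‖ ≤ ‖speedSq β z - speedSq β w‖ := by
  have han : AnalyticAt ℂ (speedSq β) k :=
    (differentiableOn_speedSq β).analyticAt ((isOpen_strip 1).mem_nhds (by simp))
  have hst := han.hasStrictDerivAt
  set d := deriv (speedSq β) (k : ℂ) with hd
  -- the derivative on the real axis is `-k tanh k · (criticalBeta 1)' k`, which is nonzero
  have hd0 : d ≠ 0 := by
    obtain ⟨e, he, hde⟩ := exists_hasDerivAt_criticalBeta (b := 1) le_rfl hk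
    have ht : 0 < Real.tanh k := by
      rw [Real.tanh_eq_sinh_div_cosh]; exact div_pos (Real.sinh_pos_iff.2 hk) (Real.cosh_pos k)
    have htd : HasDerivAt (fun k => k * Real.tanh k) (deriv (fun k => k * Real.tanh k) k) k := by
      refine DifferentiableAt.hasDerivAt ?_
      have : Real.tanh = fun x => Real.sinh x / Real.cosh x :=
        funext Real.tanh_eq_sinh_div_cosh
      rw [this]
      exact differentiableAt_id.mul (Real.differentiable_sinh.differentiableAt.div
        Real.differentiable_cosh.differentiableAt (Real.cosh_pos k).ne')
    have h1 := (htd.mul (hde.const_sub β)).const_add (1 : ℝ)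
    have h2 : HasDerivAt (speedSqR β) (k * Real.tanh k * -e) k := by
      rw [speedSqR_eq_iff hk] at h
      rw [h, sub_self, mul_zero, zero_add] at h1
      refine h1.congr_of_eventuallyEq ?_
      filter_upwards [lt_mem_nhds hk] with x hx
      exact speedSqR_eq 1 hx
    have h3 := h2.ofReal_comp
    have h4 := han.differentiableAt.hasDerivAt.comp_ofReal
    have h5 : (fun y : ℝ => speedSq β y) = fun y : ℝ => (speedSqR β y : ℂ) :=
      funext fun y => speedSq_ofReal β y
    rw [h5] at h4
    have h6 := h4.unique h3
    rw [hd, h6, Complex.ofReal_ne_zero]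
    exact (mul_pos (mul_pos hk ht) (by linarith)).ne'
  have hdpos : 0 < ‖d‖ := norm_pos_iff.2 hd0
  have hlo := hst.hasStrictFDerivAt.isLittleO.def (half_pos hdpos)
  rw [Metric.eventually_nhds_iff] at hlo
  obtain ⟨ρ, hρ, hball⟩ := hlo
  refine ⟨ρ, ‖d‖ / 2, hρ, by positivity, fun z w hz hw => ?_⟩
  have h1 := hball (y := (z, w)) (by
    rw [Prod.dist_eq, max_lt_iff]; exact ⟨by simpa [dist_eq_norm] using hz, by
      simpa [dist_eq_norm] using hw⟩)
  simp only [ContinuousLinearMap.toSpanSingleton_apply, smul_eq_mul] at h1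
  have h2 : ‖(z - w) * d‖ = ‖z - w‖ * ‖d‖ := norm_mul _ _
  have h3 := norm_sub_norm_le ((z - w) * d) (speedSq β z - speedSq β w)
  rw [norm_sub_rev] at h1
  rw [h2] at h3
  linarith

/-! ### Lower bounds for the symbol -/

/-- Away from `0` and from the wave numbers of phase speed `1`, the squared phase speed minus `1`
is bounded below. -/
lemma exists_far_bound {β : ℝ} (hβ : 0 < β) (hβ' : β < 1 / 3) {k₀ : ℝ} (hk₀ : 0 < k₀)
    (h : speedSqR β k₀ = 1) {δ ρ : ℝ} (hδ : 0 < δ) (hρ : 0 < ρ) :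
    ∃ c, 0 < c ∧ ∀ k, δ ≤ |k| → ρ ≤ |(|k| - k₀)| → c * (1 + |k|) ≤ |speedSqR β k - 1| := by
  -- beyond `4 / β` the squared phase speed is at least `2` and grows linearly; below, compactness
  have hK : IsCompact (Set.Icc δ (4 / β) ∩ {k | ρ ≤ |k - k₀|}) :=
    isCompact_Icc.inter_right (isClosed_le (by fun_prop) (by fun_prop))
  obtain ⟨c, hc, hcK⟩ := hK.exists_forall_le' (f := fun k => |speedSqR β k - 1| / (1 + |k|)) (a := 0)
    (by
      have := continuous_speedSqR β
      refine (Continuous.div (by fun_prop) (by fun_prop) fun k => ?_).continuousOn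
      positivity)
    (by
      rintro k ⟨⟨hk1, _⟩, hk2⟩
      refine div_pos (abs_pos.2 (sub_ne_zero.2 fun hk => ?_)) (by positivity)
      have := speedSqR_unique le_rfl (hδ.trans_le hk1) hk₀ hk h
      rw [Set.mem_ofPred_eq, this, sub_self, abs_zero] at hk2
      linarith)
  refine ⟨min c (β / 4), lt_min hc (by linarith), fun k h1 h2 => ?_⟩
  wlog hk : 0 ≤ k generalizing k
  · have := this (-k) (by rwa [abs_neg]) (by rwa [abs_neg]) (by linarith)
    rwa [abs_neg, speedSqR_neg] at this
  rw [abs_of_nonneg hk] at h1 h2 ⊢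
  rcases le_total k (4 / β) with hk4 | hk4
  · have := hcK k ⟨⟨h1, hk4⟩, h2⟩
    rw [abs_of_nonneg hk, le_div_iff₀ (by linarith)] at this
    refine le_trans ?_ this
    gcongr
    exact min_le_left _ _
  · have := two_le_speedSqR hβ hβ' hk4
    calc min c (β / 4) * (1 + k) ≤ β / 4 * (1 + k) := by gcongr; exact min_le_right _ _
      _ ≤ speedSqR β k - 1 := by linarith
      _ ≤ _ := le_abs_self _

/-- Lower bounds for the symbol on the strip `|Im z| ≤ ε / 2`, uniform in `ε`: near `0` it behaves
as that of the KdV operator, elsewhere it only vanishes at the two wave numbers `± κ` of phase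
speed `1 + γ_β ε²`, and there with nonzero derivative. -/
theorem exists_symbol_bounds {β : ℝ} (hβ : 0 < β) (hβ' : β < 1 / 3) :
    ∃ δ c A ε₁ : ℝ, 0 < δ ∧ 0 < c ∧ 1 ≤ A ∧ 0 < ε₁ ∧ ε₁ ≤ 1 ∧
      (∀ z : ℂ, |z.im| ≤ ε₁ → 0 < (speedSq β z).re) ∧
      (∀ z : ℂ, |z.im| ≤ ε₁ → |z.re| ≤ δ →
        ‖speedC β z - 1 + gammaCoeff β * z ^ 2‖ ≤ 12 * ‖z‖ ^ 4) ∧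
      ∀ ε, 0 < ε → ε ≤ ε₁ → ∃ κ, δ ≤ κ ∧ κ ≤ A ∧
        speedSqR β κ = (1 + gammaCoeff β * ε ^ 2) ^ 2 ∧
        (∀ κ', 0 < κ' → speedSqR β κ' = (1 + gammaCoeff β * ε ^ 2) ^ 2 → κ' = κ) ∧
        ∀ z : ℂ, |z.im| ≤ ε / 2 →
          (|z.re| ≤ δ → c * (‖z‖ ^ 2 + ε ^ 2) ≤ ‖speedC β z - (1 + gammaCoeff β * ε ^ 2)‖) ∧
          (δ ≤ |z.re| →
            c * (1 + |z.re|) ≤ ‖speedSq β z - (1 + gammaCoeff β * ε ^ 2) ^ 2‖ ∨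
            (|z.re| ≤ A ∧
              (c * ‖z - κ‖ ≤ ‖speedSq β z - (1 + gammaCoeff β * ε ^ 2) ^ 2‖ ∨
                c * ‖z + κ‖ ≤ ‖speedSq β z - (1 + gammaCoeff β * ε ^ 2) ^ 2‖))) := by
  have hγ0 : 0 < gammaCoeff β := by unfold gammaCoeff; linarith
  have hγ1 : gammaCoeff β ≤ 1 / 6 := by unfold gammaCoeff; linarith
  obtain ⟨k₀, hk₀, hk₀', hk1⟩ := exists_speedSqR_eq_one hβ hβ'
  obtain ⟨ρ, c₁, hρ, hc₁, hexp⟩ := exists_expanding hk₀ hk1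
  obtain ⟨η₀, hη0, hη1, hre⟩ := exists_strip_re_pos hβ (by linarith)
  obtain ⟨L, hL, hLip⟩ := exists_lipschitz_speedSq β
  set δ := min k₀ (gammaCoeff β / 16) with hδdef
  have hδ : 0 < δ := by positivity
  have hδγ : δ ≤ gammaCoeff β / 16 := min_le_right _ _
  obtain ⟨c₂, hc₂, hfar⟩ := exists_far_bound hβ hβ' hk₀ hk1 hδ (half_pos hρ)
  have hbig := one_lt_speedSqR hk₀ hk1 (show k₀ < k₀ + ρ / 2 by linarith)
  set b₁ := speedSqR β (k₀ + ρ / 2) - 1 with hb₁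
  have hb₁pos : 0 < b₁ := by linarith
  -- small enough for the strip, for the long-wave expansion, for the root `κ` to lie within `ρ / 2`
  -- of `k₀`, and for the far bound to survive the shift off the real axis and from `1` to `1 + γ ε²`
  set ε₁ := min (min η₀ (gammaCoeff β / 16)) (min (min (ρ / 2) b₁) (min 1 (c₂ / (L + 2)))) with hε₁
  have e1 : ε₁ ≤ η₀ := (min_le_left _ _).trans (min_le_left _ _)
  have e2 : ε₁ ≤ gammaCoeff β / 16 := (min_le_left _ _).trans (min_le_right _ _)
  have e3 : ε₁ ≤ ρ / 2 := (min_le_right _ _).trans ((min_le_left _ _).trans (min_le_left _ _))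
  have e4 : ε₁ ≤ b₁ := (min_le_right _ _).trans ((min_le_left _ _).trans (min_le_right _ _))
  have e5 : ε₁ ≤ 1 := (min_le_right _ _).trans ((min_le_right _ _).trans (min_le_left _ _))
  have e6 : ε₁ ≤ c₂ / (L + 2) :=
    (min_le_right _ _).trans ((min_le_right _ _).trans (min_le_right _ _))
  have hε₁pos : 0 < ε₁ := by positivity
  have hnear : ∀ z : ℂ, |z.im| ≤ ε₁ → |z.re| ≤ δ → ‖z‖ ≤ gammaCoeff β / 8 := fun z h1 h2 =>
    (Complex.norm_le_abs_re_add_abs_im z).trans (by linarith)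
  refine ⟨δ, min (min (gammaCoeff β / 4) c₁) (c₂ / 2), 4 / β + ρ + 1, ε₁, hδ, by positivity,
    ?_, hε₁pos, e5, fun z hz => hre z (hz.trans e1), fun z h1 h2 => ?_, ?_⟩
  · have : 0 < 4 / β := by positivity
    linarith
  · exact norm_speedC_sub_le hβ hβ' ((hnear z h1 h2).trans (by linarith))
      (h1.trans (e1.trans hη1)) (hre z (h1.trans e1))
  intro ε hε hεle
  set b := (1 + gammaCoeff β * ε ^ 2) ^ 2 with hb
  have hε1 : ε ≤ 1 := hεle.trans e5
  have hbge : 1 ≤ b := by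
    rw [hb]; nlinarith only [mul_nonneg hγ0.le (sq_nonneg ε)]
  have hble : b - 1 ≤ ε := by
    have h1 : ε ^ 2 ≤ ε := by nlinarith only [hε, hε1]
    have h2 : gammaCoeff β * ε ^ 2 ≤ ε / 6 := by nlinarith only [h1, hγ1, sq_nonneg ε]
    have h3 : 0 ≤ gammaCoeff β * ε ^ 2 := by positivity
    rw [hb]; nlinarith only [h2, h3, hε1]
  -- the root, by the intermediate value theorem: the squared phase speed is at least `1 + ε` at
  -- `k₀ + ρ / 2`
  obtain ⟨κ, ⟨hκ1, hκ2⟩, hκ⟩ : ∃ κ ∈ Set.Icc k₀ (k₀ + ρ / 2), speedSqR β κ = b := by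
    refine intermediate_value_Icc (by linarith) (continuous_speedSqR β).continuousOn ⟨?_, ?_⟩
    · rw [hk1]; exact hbge
    · linarith
  have hκ0 : 0 < κ := hk₀.trans_le hκ1
  have hκC : speedSq β κ = (1 + gammaCoeff β * ε ^ 2) ^ 2 := by
    rw [speedSq_ofReal, hκ, hb]; push_cast; rfl
  refine ⟨κ, (min_le_left _ _).trans hκ1, by linarith, hκ, fun κ' h0 h1 =>
    speedSqR_unique hbge h0 hκ0 h1 hκ, fun z hz => ⟨fun hzδ => ?_, fun hzδ => ?_⟩⟩
  · have hzε : |z.im| ≤ ε₁ := by linarith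
    have hn := hnear z hzε hzδ
    refine le_trans ?_ (speedC_sub_ge hβ hβ' hε (hn.trans (by linarith)) ?_
      (hzε.trans (e1.trans hη1)) hz (hre z (hzε.trans e1)))
    · gcongr
      exact (min_le_left _ _).trans (min_le_left _ _)
    · nlinarith only [norm_nonneg z, hn, hγ0, hγ1]
  · have hzε : |z.im| ≤ ε₁ := by linarith
    -- away from `±k₀` use the bound on the real axis, near them that the symbol is expanding
    by_cases hzfar : ρ / 2 ≤ |(|z.re| - k₀)|
    · left
      have h1 := hfar z.re hzδ hzfar
      have h2 := hLip z z.re (hzε.trans (e1.trans hη1)) (by simp)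
      have h3 : ‖z - z.re‖ = |z.im| := by
        have : z - z.re = z.im * Complex.I := by linear_combination -Complex.re_add_im z
        rw [this, norm_mul, Complex.norm_I, mul_one, Complex.norm_real, Real.norm_eq_abs]
      rw [h3, speedSq_ofReal] at h2
      have h4 : ‖((speedSqR β z.re : ℝ) : ℂ) - 1‖ = |speedSqR β z.re - 1| := by
        rw [← Complex.ofReal_one, ← Complex.ofReal_sub, Complex.norm_real, Real.norm_eq_abs]
      have h5 : ‖((1 + gammaCoeff β * ε ^ 2) ^ 2 : ℂ) - 1‖ = b - 1 := by
        have : ((1 + gammaCoeff β * ε ^ 2) ^ 2 : ℂ) - 1 = ((b - 1 : ℝ) : ℂ) := by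
          rw [hb]; push_cast; rfl
        rw [this, Complex.norm_real, Real.norm_of_nonneg (by linarith)]
      have h6 : ‖((speedSqR β z.re : ℝ) : ℂ) - 1‖
          ≤ ‖speedSq β z - (1 + gammaCoeff β * ε ^ 2) ^ 2‖
            + ‖speedSq β z - ((speedSqR β z.re : ℝ) : ℂ)‖
            + ‖((1 + gammaCoeff β * ε ^ 2) ^ 2 : ℂ) - 1‖ := by
        have : ((speedSqR β z.re : ℝ) : ℂ) - 1 = (speedSq β z - (1 + gammaCoeff β * ε ^ 2) ^ 2)
          - (speedSq β z - ((speedSqR β z.re : ℝ) : ℂ)) + ((1 + gammaCoeff β * ε ^ 2) ^ 2 - 1) := by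
          ring
        rw [this]
        exact (norm_add_le _ _).trans (by gcongr; exact norm_sub_le _ _)
      have h7 : (L + 2) * ε ≤ c₂ := by
        have := hεle.trans e6
        rwa [le_div_iff₀ (by linarith), mul_comm] at this
      have h8 : L * |z.im| ≤ L * (ε / 2) := by gcongr
      have h9 : min (min (gammaCoeff β / 4) c₁) (c₂ / 2) * (1 + |z.re|)
          ≤ c₂ / 2 * (1 + |z.re|) := by
        gcongr; exact min_le_right _ _
      rw [h4, h5] at h6
      have h10 : 0 ≤ c₂ * |z.re| := mul_nonneg hc₂.le (abs_nonneg _)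
      have h11 : L * ε + 2 * ε ≤ c₂ := by rw [← add_mul]; exact h7
      refine h9.trans ?_
      linarith
    · right
      rw [not_le] at hzfar
      have hz2 := abs_lt.1 hzfar
      refine ⟨by linarith, ?_⟩
      have hcle : min (min (gammaCoeff β / 4) c₁) (c₂ / 2) ≤ c₁ :=
        (min_le_left _ _).trans (min_le_right _ _)
      have hκρ : ‖(κ : ℂ) - k₀‖ < ρ := by
        rw [← Complex.ofReal_sub, Complex.norm_real, Real.norm_of_nonneg (by linarith)]
        linarith
      rcases le_total 0 z.re with h0 | h0
      · left
        rw [abs_of_nonneg h0] at hzfar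
        have h1 : ‖z - k₀‖ < ρ := by
          refine (Complex.norm_le_abs_re_add_abs_im _).trans_lt ?_
          simp only [Complex.sub_re, Complex.ofReal_re, Complex.sub_im, Complex.ofReal_im, sub_zero]
          linarith
        have h2 := hexp z κ h1 hκρ
        rw [hκC] at h2
        refine le_trans ?_ h2
        gcongr
      · right
        rw [abs_of_nonpos h0] at hzfar
        have h1 : ‖-z - k₀‖ < ρ := by
          refine (Complex.norm_le_abs_re_add_abs_im _).trans_lt ?_
          simp only [Complex.sub_re, Complex.ofReal_re, Complex.sub_im, Complex.ofReal_im, sub_zero,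
            Complex.neg_re, Complex.neg_im, abs_neg]
          linarith
        have h2 := hexp (-z) κ h1 hκρ
        rw [hκC, speedSq_neg] at h2
        refine le_trans ?_ h2
        have : ‖-z - κ‖ = ‖z + κ‖ := by rw [← norm_neg]; congr 1; ring
        rw [this]
        gcongr

/-! ### Division by a symbol with two simple zeros -/

lemma norm_ge_of_trichotomy {l : ℂ → ℂ} {K c : ℝ} (hK : 0 < K) (hc : 0 < c) {z : ℂ}
    (hl : c ≤ ‖l z‖ ∨ c * ‖z - K‖ ≤ ‖l z‖ ∨ c * ‖z + K‖ ≤ ‖l z‖) (h1 : ‖z - K‖ ≤ 1)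
    (h2 : ‖z - K‖ ≤ K) : c * ‖z - K‖ ≤ ‖l z‖ := by
  rcases hl with h | h | h
  · nlinarith
  · exact h
  · have h3 : 2 * K ≤ ‖z + K‖ + ‖z - K‖ := by
      have := norm_sub_le (z + K) (z - K)
      rw [show z + K - (z - K) = ((2 * K : ℝ) : ℂ) by push_cast; ring, Complex.norm_real,
        Real.norm_of_nonneg (by positivity)] at this
      exact this
    nlinarith

lemma eq_mul_dslope_dslope {f : ℂ → ℂ} {K : ℂ} (hK : K ≠ 0) (h1 : f K = 0) (h2 : f (-K) = 0)
    (z : ℂ) : f z = (z - K) * (z + K) * dslope (dslope f K) (-K) z := by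
  have e1 := sub_smul_dslope f K z
  have e2 := sub_smul_dslope (dslope f K) (-K) z
  have e3 : dslope f K (-K) = 0 := by
    rw [dslope_of_ne _ (by
      intro h
      exact hK (by linear_combination (-1 / 2 : ℂ) * h)), slope_def_field, h1, h2]
    simp
  rw [e3, smul_eq_mul, sub_zero, sub_neg_eq_add] at e2
  rw [h1, smul_eq_mul, sub_zero] at e1
  rw [mul_assoc, e2, e1]

/-- A function that vanishes at the two simple zeros `±K` of `l` is divisible by `l` in the
strip. The lower bound on `l` says that these zeros are simple, and that `l` has no other zero,
not even at infinity. -/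
lemma exists_strip_quotient {q K c : ℝ} (hq : 0 < q) (hK : 0 < K) (hc : 0 < c) {F l : ℂ → ℂ}
    (hF : DifferentiableOn ℂ F {z | |z.im| < q})
    (hFb : ∀ η, η < q → ∃ M, ∀ z : ℂ, |z.im| ≤ η → ‖F z‖ ≤ M)
    (hFK : F K = 0) (hFK' : F (-K) = 0)
    (hl : DifferentiableOn ℂ l {z | |z.im| < q}) (hlK : l K = 0) (hlK' : l (-K) = 0)
    (hlb : ∀ z : ℂ, |z.im| < q →
      c ≤ ‖l z‖ ∨ c * ‖z - K‖ ≤ ‖l z‖ ∨ c * ‖z + K‖ ≤ ‖l z‖) :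
    ∃ h : ℂ → ℂ, DifferentiableOn ℂ h {z | |z.im| < q} ∧
      (∀ η, η < q → ∃ M, ∀ z : ℂ, |z.im| ≤ η → ‖h z‖ ≤ M) ∧
      ∀ z : ℂ, |z.im| < q → l z * h z = F z := by
  have hKc : (K : ℂ) ≠ 0 := by exact_mod_cast hK.ne'
  have hop := isOpen_strip q
  have hdd : ∀ f : ℂ → ℂ, DifferentiableOn ℂ f {z | |z.im| < q} →
      DifferentiableOn ℂ (dslope (dslope f K) (-K)) {z | |z.im| < q} := by
    intro f hf
    refine (Complex.differentiableOn_dslope (hop.mem_nhds (by simpa using hq))).2 ?_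
    exact (Complex.differentiableOn_dslope (hop.mem_nhds (by simpa using hq))).2 hf
  have hFd := hdd F hF
  have hld := hdd l hl
  have eF := eq_mul_dslope_dslope hKc hFK hFK'
  have el := eq_mul_dslope_dslope hKc hlK hlK'
  set F₁ := dslope (dslope F K) (-K) with hF₁
  set l₁ := dslope (dslope l K) (-K) with hl₁
  have hlne : ∀ z : ℂ, |z.im| < q → z ≠ K → z ≠ -K → l z ≠ 0 := by
    intro z hz h1 h2 h0
    have h1' : 0 < ‖z - K‖ := norm_pos_iff.2 (sub_ne_zero.2 h1)
    have h2' : 0 < ‖z + K‖ := norm_pos_iff.2 (by rwa [← sub_neg_eq_add, sub_ne_zero])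
    have := hlb z hz
    rw [h0, norm_zero] at this
    rcases this with h | h | h
    · linarith
    · nlinarith
    · nlinarith
  -- near a zero, the lower bound passes to the limit in the quotient
  have hkey : ∀ w w' : ℂ, w ≠ w' → |w.im| < q → (∀ z, l z = (z - w) * (z - w') * l₁ z) →
      (∀ᶠ z in 𝓝 w, c * ‖z - w‖ ≤ ‖l z‖) → l₁ w ≠ 0 := by
    intro w w' hne hw hfac hlow h0
    have hcont : ContinuousAt (fun z => ‖(z - w') * l₁ z‖) w := by
      have := (hld.differentiableAt (hop.mem_nhds hw)).continuousAt
      fun_prop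
    have hlim : Tendsto (fun z => ‖(z - w') * l₁ z‖) (𝓝[≠] w) (𝓝 0) := by
      have := hcont.tendsto.mono_left (nhdsWithin_le_nhds (s := {w}ᶜ))
      simpa [h0] using this
    have : c ≤ 0 := by
      refine ge_of_tendsto hlim ?_
      filter_upwards [hlow.filter_mono nhdsWithin_le_nhds, self_mem_nhdsWithin] with z hz hzw
      have hp : 0 < ‖z - w‖ := norm_pos_iff.2 (sub_ne_zero.2 hzw)
      rw [hfac, mul_assoc, norm_mul, mul_comm] at hz
      exact le_of_mul_le_mul_left hz hp
    linarith
  have hKK : (K : ℂ) ≠ -K := fun h => hKc (by linear_combination (1 / 2 : ℂ) * h)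
  have hl₁ne : ∀ z : ℂ, |z.im| < q → l₁ z ≠ 0 := by
    intro z hz
    have hball : ∀ w : ℂ, ∀ᶠ z in 𝓝 w, ‖z - w‖ ≤ 1 ∧ ‖z - w‖ ≤ K := by
      intro w
      filter_upwards [Metric.ball_mem_nhds w one_pos, Metric.ball_mem_nhds w hK] with z h1 h2
      rw [mem_ball_iff_norm] at h1 h2
      exact ⟨h1.le, h2.le⟩
    have hstrip : ∀ w : ℂ, w.im = 0 → ∀ᶠ z : ℂ in 𝓝 w, |z.im| < q := fun w hw =>
      hop.mem_nhds (by simpa [hw] using hq)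
    by_cases h1 : z = K
    · rw [h1]
      refine hkey K (-K) hKK (by simpa using hq) (fun z => by rw [sub_neg_eq_add]; exact el z) ?_
      filter_upwards [hball K, hstrip K (by simp)] with w hw hw'
      exact norm_ge_of_trichotomy hK hc (hlb w hw') hw.1 hw.2
    by_cases h2 : z = -K
    · rw [h2]
      refine hkey (-K) K hKK.symm (by simpa using hq)
        (fun z => by rw [sub_neg_eq_add, mul_comm (z + K)]; exact el z) ?_
      filter_upwards [hball (-K), hstrip (-K) (by simp)] with w hw hw'
      have e1 : ‖-w - K‖ = ‖w - -K‖ := by rw [← norm_neg]; congr 1; ring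
      have e2 : ‖-w + K‖ = ‖w - K‖ := by rw [← norm_neg]; congr 1; ring
      have e3 : ‖w + K‖ = ‖w - -K‖ := by rw [sub_neg_eq_add]
      have := norm_ge_of_trichotomy (l := fun z => l (-z)) (z := -w) hK hc (by
        rw [neg_neg, e1, e2, ← e3]
        rcases hlb w hw' with h | h | h
        · exact Or.inl h
        · exact Or.inr (Or.inr h)
        · exact Or.inr (Or.inl h)) (by rw [e1]; exact hw.1) (by rw [e1]; exact hw.2)
      rwa [neg_neg, e1] at this
    · intro h0
      exact hlne z hz h1 h2 (by rw [el z, h0, mul_zero])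
  have hmul : ∀ z : ℂ, |z.im| < q → l z * (F₁ z / l₁ z) = F z := by
    intro z hz
    rw [el z, eF z]
    field_simp [hl₁ne z hz]
  have hdiff : DifferentiableOn ℂ (fun z => F₁ z / l₁ z) {z | |z.im| < q} := hFd.div hld hl₁ne
  refine ⟨fun z => F₁ z / l₁ z, hdiff, fun η hη => ?_, hmul⟩
  obtain ⟨M, hM⟩ := hFb η hη
  have hcomp : IsCompact ({z : ℂ | |z.re| ≤ K + 1 ∧ |z.im| ≤ η}) := by
    have : {z : ℂ | |z.re| ≤ K + 1 ∧ |z.im| ≤ η}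
        = Set.Icc (-(K + 1)) (K + 1) ×ℂ Set.Icc (-η) η := by
      ext z
      simp [Complex.mem_reProdIm, abs_le]
    rw [this]
    exact isCompact_Icc.reProdIm isCompact_Icc
  obtain ⟨M', hM'⟩ := hcomp.exists_bound_of_continuousOn
    (hdiff.continuousOn.mono fun z hz => (hz.2.trans_lt hη : |z.im| < q))
  refine ⟨max M' (M / c), fun z hz => ?_⟩
  by_cases hr : |z.re| ≤ K + 1
  · exact (hM' z ⟨hr, hz⟩).trans (le_max_left _ _)
  · refine le_trans ?_ (le_max_right _ _)
    push Not at hr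
    have hb1 : 1 ≤ ‖z - K‖ := by
      refine le_trans ?_ (Complex.abs_re_le_norm _)
      have := abs_sub_abs_le_abs_sub z.re K
      rw [abs_of_pos hK] at this
      simp only [Complex.sub_re, Complex.ofReal_re]
      linarith
    have hb2 : 1 ≤ ‖z + K‖ := by
      refine le_trans ?_ (Complex.abs_re_le_norm _)
      have := abs_sub_abs_le_abs_sub z.re (-K)
      rw [abs_neg, abs_of_pos hK] at this
      simp only [Complex.add_re, Complex.ofReal_re]
      rw [sub_neg_eq_add] at this
      linarith
    have hcl : c ≤ ‖l z‖ := by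
      rcases hlb z (hz.trans_lt hη) with h | h | h <;> nlinarith
    have h2 := hmul z (hz.trans_lt hη)
    have h3 := congrArg norm h2
    rw [norm_mul] at h3
    rw [le_div_iff₀ hc]
    have h4 := hM z hz
    have h5 := norm_nonneg (F₁ z / l₁ z)
    nlinarith

/-! ### The rescaled symbol -/

/-- The symbol `l_ε` at a complex wave number. -/
def linSymbolC (β ε : ℝ) (Z : ℂ) : ℂ := (speedC β (ε * Z) - (1 + gammaCoeff β * ε ^ 2)) / ε ^ 2

/-- The limit `-1 / (γ (1 + Z²))` of `1 / l_ε`. -/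
def limitSymbol (β : ℝ) (Z : ℂ) : ℂ := -(gammaCoeff β * (1 + Z ^ 2))⁻¹

lemma linSymbolC_ofReal {β : ℝ} (hβ : 0 < β) (hβ' : β < 1) (ε k : ℝ) :
    linSymbolC β ε k = (linSymbol β ε k : ℂ) := by
  rw [linSymbolC, linSymbol, ← Complex.ofReal_mul, speedC_ofReal hβ hβ']
  push_cast
  ring

lemma linSymbol_neg (β ε k : ℝ) : linSymbol β ε (-k) = linSymbol β ε k := by
  rw [linSymbol, linSymbol, mul_neg, phaseSpeed_eq, phaseSpeed_eq, speedSqR_neg]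

lemma linSymbol_eq_zero_iff {β ε : ℝ} (hβ : 0 < β) (hβ' : β < 1 / 3) (hε : 0 < ε) (k : ℝ) :
    linSymbol β ε k = 0 ↔ speedSqR β (ε * k) = (1 + gammaCoeff β * ε ^ 2) ^ 2 := by
  have hγ : 0 < gammaCoeff β := by unfold gammaCoeff; linarith
  have h : 0 ≤ speedSqR β (ε * k) :=
    (by linarith : 0 ≤ β / 2).trans (half_le_speedSqR hβ (by linarith) _)
  rw [linSymbol, div_eq_zero_iff, phaseSpeed_eq, sub_sub, sub_eq_zero]
  constructor
  · rintro (h1 | h1)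
    · rw [← h1, Real.sq_sqrt h]
    · exact absurd h1 (by positivity)
  · intro h1
    left
    rw [h1, Real.sqrt_sq (by positivity)]

lemma inv_linSymbolC {β ε : ℝ} (Z : ℂ) :
    (linSymbolC β ε Z)⁻¹ = ε ^ 2 / (speedC β (ε * Z) - (1 + gammaCoeff β * ε ^ 2)) := by
  rw [linSymbolC, inv_div]

lemma three_quarters_le_norm {Z : ℂ} (hZ : |Z.im| ≤ 1 / 2) :
    3 / 4 + Z.re ^ 2 ≤ ‖1 + Z ^ 2‖ := by
  refine le_trans ?_ (Complex.re_le_norm _)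
  have : Z.im ^ 2 ≤ (1 / 2) ^ 2 := sq_le_sq' (by linarith [(abs_le.1 hZ).1]) (abs_le.1 hZ).2
  simp only [Complex.add_re, Complex.one_re, pow_two, Complex.mul_re]
  nlinarith

/-! ### Uniform bounds for the inverse symbol -/

/-- Where `m² - c²` is known to be large, so is `m - c`, because `|m + c| ≲ (1 + |k|)^{1/2}`. -/
lemma exists_speedC_add_le (β : ℝ) : ∃ B, 1 ≤ B ∧ ∀ z : ℂ, |z.im| ≤ 1 / 2 → ∀ b : ℂ, ‖b‖ ≤ 2 →
    ‖speedC β z + b‖ ≤ B * √(1 + |z.re|) ∧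
    ‖speedSq β z - b ^ 2‖ ≤ B * √(1 + |z.re|) * ‖speedC β z - b‖ := by
  obtain ⟨L, hL, hLip⟩ := exists_lipschitz_speedSq β
  refine ⟨√(1 + L) + 2, by linarith [Real.sqrt_nonneg (1 + L)], fun z hz b hb => ?_⟩
  have h1 : ‖speedSq β z‖ ≤ (1 + L) * (1 + |z.re|) := by
    have h2 := hLip z 0 hz (by simp)
    rw [speedSq_zero, sub_zero] at h2
    have h3 := norm_sub_norm_le (speedSq β z) 1
    rw [norm_one] at h3
    have h4 := Complex.norm_le_abs_re_add_abs_im z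
    nlinarith [abs_nonneg z.re, abs_nonneg z.im]
  have h2 : ‖speedC β z‖ ≤ √(1 + L) * √(1 + |z.re|) := by
    rw [← Real.sqrt_mul (by linarith)]
    refine Real.le_sqrt_of_sq_le ?_
    rw [norm_speedC_sq]
    exact h1
  have h3 : 1 ≤ √(1 + |z.re|) := Real.one_le_sqrt.2 (by linarith [abs_nonneg z.re])
  have h4 : ‖speedC β z + b‖ ≤ (√(1 + L) + 2) * √(1 + |z.re|) := by
    refine (norm_add_le _ _).trans ?_
    nlinarith
  refine ⟨h4, ?_⟩
  rw [← speedC_sq, sq_sub_sq, norm_mul]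
  gcongr

lemma gammaCoeff_pos {β : ℝ} (hβ' : β < 1 / 3) : 0 < gammaCoeff β := by unfold gammaCoeff; linarith

lemma rpow_quarter_le (x : ℝ) : (1 + x ^ 2) ^ (1 / 4 : ℝ) ≤ √(1 + |x|) := by
  have h : (1 + x ^ 2) ≤ (1 + |x|) ^ 2 := by nlinarith [abs_nonneg x, sq_abs x]
  calc (1 + x ^ 2) ^ (1 / 4 : ℝ) ≤ ((1 + |x|) ^ 2) ^ (1 / 4 : ℝ) := by gcongr
    _ = _ := by
      rw [Real.sqrt_eq_rpow, ← Real.rpow_natCast, ← Real.rpow_mul (by positivity)]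
      norm_num

lemma mul_sqrt_le {ε x : ℝ} (hε : 0 < ε) (hε1 : ε ≤ 1) (hx : 0 ≤ x) :
    ε * √(1 + x) ≤ √(1 + ε * x) := by
  refine Real.le_sqrt_of_sq_le ?_
  rw [mul_pow, Real.sq_sqrt (by positivity)]
  nlinarith [mul_nonneg hε.le hx]

set_option maxHeartbeats 1000000 in
/-- The properties of the symbol `l_ε` on which the solution theory rests: it has exactly two
zeros `±K_ε` in the strip `|Im Z| ≤ 1/2`, both simple, with `K_ε ≳ 1/ε`; off the real axis `1 / l_ε`
decays like `|Z|^{-1/2}`, uniformly in `ε`; and `1 / l_ε` is close to `limitSymbol` on the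
boundary of the strip. -/
lemma exists_linSymbol_bounds {β : ℝ} (hβ : 0 < β) (hβ' : β < 1 / 3) :
    ∃ ε₁ D : ℝ, 0 < ε₁ ∧ ε₁ ≤ 1 ∧ 0 < D ∧
      (∀ q, 0 < q → ∃ C, 0 < C ∧ ∀ ε, 0 < ε → ε ≤ ε₁ → ∀ Z : ℂ, q ≤ |Z.im| → |Z.im| ≤ 1 / 2 →
        (1 + Z.re ^ 2) ^ (1 / 4 : ℝ) * ‖(linSymbolC β ε Z)⁻¹‖ ≤ C) ∧
      (∃ C, 0 < C ∧ ∀ ε, 0 < ε → ε ≤ ε₁ → ∀ Z : ℂ, |Z.im| = 1 / 2 →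
        ‖(linSymbolC β ε Z)⁻¹ - limitSymbol β Z‖ ≤ C * ε) ∧
      ∀ ε, 0 < ε → ε ≤ ε₁ → DifferentiableOn ℂ (linSymbolC β ε) {Z | |Z.im| < 1} ∧
        ∃ K, 0 < K ∧ D / ε ≤ K ∧ linSymbol β ε K = 0 ∧
          (∀ K', 0 < K' → linSymbol β ε K' = 0 → K' = K) ∧
          ∃ c, 0 < c ∧ ∀ Z : ℂ, |Z.im| ≤ 1 / 2 → c ≤ ‖linSymbolC β ε Z‖ ∨
            c * ‖Z - K‖ ≤ ‖linSymbolC β ε Z‖ ∨ c * ‖Z + K‖ ≤ ‖linSymbolC β ε Z‖ := by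
  obtain ⟨δ, c, A, ε₁, hδ, hc, hA, hε₁, hε₁1, hpos, hlw, hmain⟩ := exists_symbol_bounds hβ hβ'
  obtain ⟨B, hB, hBm⟩ := exists_speedC_add_le β
  have hγ := gammaCoeff_pos hβ'
  have hγ1 : gammaCoeff β ≤ 1 / 6 := by unfold gammaCoeff; linarith
  -- the scaled variable
  have hz : ∀ ε, 0 < ε → ε ≤ ε₁ → ∀ Z : ℂ, |Z.im| ≤ 1 / 2 →
      ((ε : ℂ) * Z).re = ε * Z.re ∧ |((ε : ℂ) * Z).re| = ε * |Z.re| ∧ |((ε : ℂ) * Z).im| = ε * |Z.im| ∧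
      |((ε : ℂ) * Z).im| ≤ ε / 2 ∧ |((ε : ℂ) * Z).im| ≤ 1 / 2 ∧ |((ε : ℂ) * Z).im| ≤ ε₁ ∧
      ‖(ε : ℂ) * Z‖ = ε * ‖Z‖ := by
    intro ε hε hε' Z hZ
    have e1 : |((ε : ℂ) * Z).im| = ε * |Z.im| := by
      rw [Complex.im_ofReal_mul ε Z, abs_mul, abs_of_pos hε]
    have e2 : ε * |Z.im| ≤ ε / 2 := by nlinarith
    refine ⟨by simp, ?_, e1, by rw [e1]; exact e2, by rw [e1]; linarith, by rw [e1]; linarith, ?_⟩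
    · rw [Complex.re_ofReal_mul, abs_mul, abs_of_pos hε]
    · rw [norm_mul, Complex.norm_real, Real.norm_of_nonneg hε.le]
  have hcb : ∀ ε, 0 < ε → ε ≤ ε₁ → ‖((1 + gammaCoeff β * ε ^ 2 : ℝ) : ℂ)‖ ≤ 2 := by
    intro ε hε hε'
    rw [Complex.norm_real, Real.norm_of_nonneg (by positivity)]
    have : ε ^ 2 ≤ 1 := by nlinarith
    nlinarith
  have hinv : ∀ ε, 0 < ε → ∀ Z : ℂ, ‖(linSymbolC β ε Z)⁻¹‖
      = ε ^ 2 / ‖speedC β (ε * Z) - ((1 + gammaCoeff β * ε ^ 2 : ℝ) : ℂ)‖ := by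
    intro ε hε Z
    rw [inv_linSymbolC, norm_div, norm_pow, Complex.norm_real, Real.norm_of_nonneg hε.le]
    push_cast
    rfl
  -- the zone of large wave numbers
  have zone2 : ∀ q, 0 < q → ∃ C, 0 < C ∧ ∀ ε, 0 < ε → ε ≤ ε₁ → ∀ Z : ℂ, q ≤ |Z.im| →
      |Z.im| ≤ 1 / 2 → δ ≤ ε * |Z.re| →
      √(1 + ε * |Z.re|) * ‖(linSymbolC β ε Z)⁻¹‖ ≤ C * ε := by
    intro q hq
    refine ⟨B / c + (1 + A) * B / (c * q), by positivity, fun ε hε hε' Z hqZ hZ hδZ => ?_⟩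
    obtain ⟨-, hre, him, him1, him2, him3, -⟩ := hz ε hε hε' Z hZ
    obtain ⟨κ, -, -, -, -, hκ⟩ := hmain ε hε hε'
    have h2 := (hκ (ε * Z) him1).2 (by rw [hre]; exact hδZ)
    have h3 := (hBm (ε * Z) him2 _ (hcb ε hε hε')).2
    rw [hre] at h2 h3
    set s := √(1 + ε * |Z.re|) with hs
    set w := ‖speedC β (ε * Z) - ((1 + gammaCoeff β * ε ^ 2 : ℝ) : ℂ)‖ with hw
    set v := ‖speedSq β (ε * Z) - ((1 + gammaCoeff β * ε ^ 2 : ℝ) : ℂ) ^ 2‖ with hv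
    have hx : 0 ≤ ε * |Z.re| := by positivity
    have hs2 : s ^ 2 = 1 + ε * |Z.re| := Real.sq_sqrt (by positivity)
    have hs1 : 1 ≤ s := Real.one_le_sqrt.2 (by linarith)
    have hv' : v = ‖speedSq β (ε * Z) - (1 + gammaCoeff β * ε ^ 2) ^ 2‖ := by
      rw [hv]; push_cast; rfl
    rw [← hv'] at h2
    rw [hinv ε hε Z, ← hw]
    have hε1 : ε ≤ 1 := hε'.trans hε₁1
    -- `m² - c²` bounds `m - c` through the factor `m + c`, which is at most of order `s`; near a zero
    -- the distance to it is at least the imaginary part `ε |Im Z| ≥ ε q`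
    rcases h2 with h2 | ⟨hA2, h2⟩
    · have h4 : c * s ≤ B * w := by
        have : s * (c * s) ≤ s * (B * w) := by
          calc s * (c * s) = c * s ^ 2 := by ring
            _ ≤ v := by rw [hs2]; exact h2
            _ ≤ B * s * w := h3
            _ = s * (B * w) := by ring
        exact le_of_mul_le_mul_left this (by linarith)
      have hw0 : 0 < w := by
        by_contra hcon
        have : B * w ≤ 0 := mul_nonpos_of_nonneg_of_nonpos (by linarith) (by linarith)
        have : 0 < c * s := by positivity
        linarith
      have h5 : s / w ≤ B / c := by
        rw [div_le_div_iff₀ hw0 hc]; linarith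
      calc s * (ε ^ 2 / w) = (s / w) * (ε * ε) := by ring
        _ ≤ (B / c) * (1 * ε) := by gcongr
        _ ≤ _ := by
          rw [one_mul]
          gcongr
          exact le_add_of_nonneg_right (by positivity)
    · have h4 : c * (ε * q) ≤ v := by
        have key : ∀ t : ℝ, ε * q ≤ ‖(ε : ℂ) * Z + t‖ := fun t => by
          refine le_trans ?_ (Complex.abs_im_le_norm _)
          rw [Complex.add_im, Complex.ofReal_im, add_zero, him]
          gcongr
        rcases h2 with h2 | h2
        · refine le_trans ?_ h2
          have := key (-κ)
          rw [Complex.ofReal_neg, ← sub_eq_add_neg] at this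
          gcongr
        · refine le_trans ?_ h2
          gcongr
          exact key κ
      have h5 : c * (ε * q) ≤ B * s * w := h4.trans h3
      have hw0 : 0 < w := by
        by_contra hcon
        have : B * s * w ≤ 0 := mul_nonpos_of_nonneg_of_nonpos (by positivity) (by linarith)
        have : 0 < c * (ε * q) := by positivity
        linarith
      have h6 : s * ε / w ≤ (1 + A) * B / (c * q) := by
        rw [div_le_div_iff₀ hw0 (by positivity)]
        calc s * ε * (c * q) = s * (c * (ε * q)) := by ring
          _ ≤ s * (B * s * w) := by gcongr
          _ = s ^ 2 * B * w := by ring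
          _ ≤ (1 + A) * B * w := by
            gcongr
            rw [hs2]; linarith
      calc s * (ε ^ 2 / w) = (s * ε / w) * ε := by ring
        _ ≤ ((1 + A) * B / (c * q)) * ε := by gcongr
        _ ≤ _ := by
          gcongr
          exact le_add_of_nonneg_left (by positivity)
  refine ⟨ε₁, δ, hε₁, hε₁1, hδ, fun q hq => ?_, ?_, fun ε hε hε' => ⟨?_, ?_⟩⟩
  · obtain ⟨C, hC, hC2⟩ := zone2 q hq
    refine ⟨2 / c + C, by positivity, fun ε hε hε' Z hqZ hZ => ?_⟩
    obtain ⟨-, hre, him, him1, him2, him3, hn⟩ := hz ε hε hε' Z hZ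
    refine (mul_le_mul_of_nonneg_right (rpow_quarter_le Z.re) (norm_nonneg _)).trans ?_
    rcases le_total δ (ε * |Z.re|) with h | h
    · have h1 := hC2 ε hε hε' Z hqZ hZ h
      have h2 := mul_sqrt_le hε (hε'.trans hε₁1) (abs_nonneg Z.re)
      have h3 : ε * (√(1 + |Z.re|) * ‖(linSymbolC β ε Z)⁻¹‖) ≤ ε * C := by
        rw [← mul_assoc, mul_comm ε C]
        exact (mul_le_mul_of_nonneg_right h2 (norm_nonneg _)).trans h1
      have h4 := le_of_mul_le_mul_left h3 hε
      have : 0 < 2 / c := by positivity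
      linarith
    · obtain ⟨κ, -, -, -, -, hκ⟩ := hmain ε hε hε'
      have h1 := (hκ (ε * Z) him1).1 (by rw [hre]; exact h)
      rw [hn] at h1
      rw [hinv ε hε Z]
      push_cast
      set w := ‖speedC β (ε * Z) - (1 + gammaCoeff β * ε ^ 2)‖
      have hw0 : 0 < w := lt_of_lt_of_le (by positivity) h1
      have h2 : √(1 + |Z.re|) ≤ 2 * (1 + ‖Z‖ ^ 2) := by
        refine Real.sqrt_le_iff.2 ⟨by positivity, ?_⟩
        have := Complex.abs_re_le_norm Z
        nlinarith only [this, sq_nonneg (‖Z‖ - 1), sq_nonneg (‖Z‖ ^ 2), norm_nonneg Z]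
      have h3 : √(1 + |Z.re|) * (ε ^ 2 / w) ≤ 2 / c := by
        rw [← mul_div_assoc, div_le_div_iff₀ hw0 hc]
        have : √(1 + |Z.re|) * ε ^ 2 * c ≤ 2 * (1 + ‖Z‖ ^ 2) * ε ^ 2 * c := by gcongr
        nlinarith only [this, h1]
      linarith
  · obtain ⟨C, hC, hC2⟩ := zone2 (1 / 2) (by norm_num)
    refine ⟨12 / (c * gammaCoeff β) + (C + 1 / (gammaCoeff β * δ ^ 2)), by positivity,
      fun ε hε hε' Z hZ => ?_⟩
    obtain ⟨-, hre, him, him1, him2, him3, hn⟩ := hz ε hε hε' Z hZ.le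
    have hε1 : ε ≤ 1 := hε'.trans hε₁1
    have hZ2 := three_quarters_le_norm hZ.le
    rcases le_total δ (ε * |Z.re|) with h | h
    · have h1 := hC2 ε hε hε' Z hZ.ge hZ.le h
      have h2 : 1 ≤ √(1 + ε * |Z.re|) := Real.one_le_sqrt.2 (by linarith)
      have h3 : ‖(linSymbolC β ε Z)⁻¹‖ ≤ C * ε := by
        nlinarith only [h1, h2, norm_nonneg (linSymbolC β ε Z)⁻¹]
      have h4 : ‖limitSymbol β Z‖ ≤ 1 / (gammaCoeff β * δ ^ 2) * ε := by
        rw [limitSymbol, norm_neg, norm_inv, norm_mul, Complex.norm_real,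
          Real.norm_of_nonneg hγ.le, div_mul_eq_mul_div, one_mul, inv_eq_one_div]
        rw [div_le_div_iff₀ (by nlinarith [sq_nonneg Z.re]) (by positivity)]
        have h5 : δ ^ 2 ≤ ε ^ 2 * Z.re ^ 2 := by
          rw [← sq_abs Z.re, ← mul_pow]; gcongr
        calc 1 * (gammaCoeff β * δ ^ 2) ≤ gammaCoeff β * (ε ^ 2 * Z.re ^ 2) := by
              rw [one_mul]; gcongr
          _ ≤ gammaCoeff β * (ε * ‖1 + Z ^ 2‖) := by
              gcongr
              · nlinarith
              · linarith
          _ = _ := by ring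
      refine (norm_sub_le _ _).trans ?_
      rw [add_mul, add_mul]
      have : 0 < 12 / (c * gammaCoeff β) * ε := by positivity
      linarith
    · obtain ⟨κ, -, -, -, -, hκ⟩ := hmain ε hε hε'
      have h1 := (hκ (ε * Z) him1).1 (by rw [hre]; exact h)
      have h2 := hlw (ε * Z) him3 (by rw [hre]; exact h)
      rw [hn] at h1 h2
      set m := speedC β (ε * Z) - (1 + gammaCoeff β * ε ^ 2) with hm
      have hZn : ‖Z‖ ^ 2 ≤ ‖1 + Z ^ 2‖ := by
        refine le_trans ?_ hZ2
        rw [Complex.sq_norm, Complex.normSq_apply, ← abs_mul_abs_self Z.im, hZ]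
        nlinarith
      have hm0 : 0 < ‖m‖ := lt_of_lt_of_le (by positivity) h1
      have hd0 : 0 < ‖1 + Z ^ 2‖ := by nlinarith [sq_nonneg Z.re]
      have hγc : (gammaCoeff β : ℂ) ≠ 0 := by exact_mod_cast hγ.ne'
      -- the difference of the inverses is the error of the long-wave expansion over two quadratic
      -- factors
      have e1 : (linSymbolC β ε Z)⁻¹ - limitSymbol β Z
          = (speedC β (ε * Z) - 1 + gammaCoeff β * (ε * Z) ^ 2) / (m * (gammaCoeff β * (1 + Z ^ 2))) := by
        rw [inv_linSymbolC, limitSymbol, ← hm, sub_neg_eq_add]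
        have hm0' : m ≠ 0 := norm_pos_iff.1 hm0
        have hd0' : 1 + Z ^ 2 ≠ 0 := norm_pos_iff.1 hd0
        field_simp
        rw [hm]
        ring
      rw [e1, norm_div, norm_mul, norm_mul, Complex.norm_real, Real.norm_of_nonneg hγ.le]
      have h3 : 12 * (ε * ‖Z‖) ^ 4 ≤
          12 / (c * gammaCoeff β) * ε * (‖m‖ * (gammaCoeff β * ‖1 + Z ^ 2‖)) := by
        have h4 : c * (ε ^ 2 * ‖Z‖ ^ 2) * ‖Z‖ ^ 2 ≤ ‖m‖ * ‖1 + Z ^ 2‖ := by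
          gcongr
          refine le_trans ?_ h1
          rw [← mul_pow]
          gcongr
          exact le_add_of_nonneg_right (by positivity)
        calc 12 * (ε * ‖Z‖) ^ 4 = 12 / c * ε ^ 2 * (c * (ε ^ 2 * ‖Z‖ ^ 2) * ‖Z‖ ^ 2) := by
              field_simp
          _ ≤ 12 / c * ε * (‖m‖ * ‖1 + Z ^ 2‖) := by
              gcongr
              exact pow_le_of_le_one hε.le hε1 two_ne_zero
          _ = _ := by field_simp
      rw [div_le_iff₀ (by positivity)]
      refine (h2.trans h3).trans ?_
      gcongr
      exact le_add_of_nonneg_right (by positivity)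
  · intro Z hZ
    have hZ' : |((ε : ℂ) * Z).im| < ε := by
      rw [Complex.im_ofReal_mul, abs_mul, abs_of_pos hε]
      exact mul_lt_of_lt_one_right hε hZ
    have h1 : DifferentiableAt ℂ (speedC β) (ε * Z) :=
      differentiableAt_speedC (hZ'.trans_le (hε'.trans hε₁1)) (hpos _ (hZ'.le.trans hε'))
    have h2 : DifferentiableAt ℂ (fun Z : ℂ => speedC β (ε * Z)) Z :=
      h1.comp Z (f := fun Z : ℂ => (ε : ℂ) * Z) (by fun_prop)
    exact ((h2.sub_const _).div_const _).differentiableWithinAt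
  · obtain ⟨κ, hκ1, -, hκ2, hκ3, hκ⟩ := hmain ε hε hε'
    have hκ0 : 0 < κ := hδ.trans_le hκ1
    have hε1 : ε ≤ 1 := hε'.trans hε₁1
    refine ⟨κ / ε, by positivity, by gcongr, ?_, fun K' hK' h => ?_,
      c / (B * √(1 + A)), by positivity, fun Z hZ => ?_⟩
    · rw [linSymbol_eq_zero_iff hβ hβ' hε, mul_div_cancel₀ _ hε.ne', hκ2]
    · rw [linSymbol_eq_zero_iff hβ hβ' hε] at h
      rw [eq_div_iff hε.ne', mul_comm]
      exact hκ3 _ (by positivity) h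
    obtain ⟨-, hre, him, him1, him2, him3, hn⟩ := hz ε hε hε' Z hZ
    have hl : ‖linSymbolC β ε Z‖
        = ‖speedC β (ε * Z) - ((1 + gammaCoeff β * ε ^ 2 : ℝ) : ℂ)‖ / ε ^ 2 := by
      rw [linSymbolC, norm_div, norm_pow, Complex.norm_real, Real.norm_of_nonneg hε.le]
      push_cast
      rfl
    have hB' : 1 ≤ B * √(1 + A) := by
      have : 1 ≤ √(1 + A) := Real.one_le_sqrt.2 (by linarith)
      nlinarith only [this, hB]
    have hε2 : ε ^ 2 ≤ ε := pow_le_of_le_one hε.le hε1 two_ne_zero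
    rcases le_total (ε * |Z.re|) δ with h | h
    · left
      have h1 := (hκ (ε * Z) him1).1 (by rw [hre]; exact h)
      rw [hl, le_div_iff₀ (by positivity)]
      push_cast
      refine le_trans ?_ h1
      have h2 : c / (B * √(1 + A)) ≤ c := div_le_self hc.le hB'
      have h3 : 0 ≤ (‖(ε : ℂ) * Z‖) ^ 2 := by positivity
      gcongr
      linarith
    have h2 := (hκ (ε * Z) him1).2 (by rw [hre]; exact h)
    have h3 := (hBm (ε * Z) him2 _ (hcb ε hε hε')).2
    push_cast at h3 hl
    set w := ‖speedC β (ε * Z) - (1 + gammaCoeff β * ε ^ 2)‖ with hw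
    rw [hre] at h2 h3
    have hx : 0 ≤ ε * |Z.re| := by positivity
    set s := √(1 + ε * |Z.re|) with hs
    have hs1 : 1 ≤ s := Real.one_le_sqrt.2 (by linarith)
    have hs2 : s ^ 2 = 1 + ε * |Z.re| := Real.sq_sqrt (by positivity)
    have hw0 : 0 ≤ w := norm_nonneg _
    have hlw : w ≤ ‖linSymbolC β ε Z‖ * ε := by
      rw [hl, div_mul_eq_mul_div, le_div_iff₀ (by positivity)]
      gcongr
    rcases h2 with h2 | ⟨hA2, h2⟩
    · left
      have h4 : c * s ≤ B * w := by
        have : s * (c * s) ≤ s * (B * w) := by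
          calc s * (c * s) = c * s ^ 2 := by ring
            _ ≤ B * s * w := by rw [hs2]; exact h2.trans h3
            _ = s * (B * w) := by ring
        exact le_of_mul_le_mul_left this (by linarith)
      have h5 : c / (B * √(1 + A)) ≤ c / B := by
        gcongr
        exact le_mul_of_one_le_right (by linarith) (Real.one_le_sqrt.2 (by linarith))
      have h6 : c / B ≤ w := by
        rw [div_le_iff₀ (by linarith)]
        nlinarith only [h4, hs1, hc]
      refine h5.trans (h6.trans (hlw.trans ?_))
      exact mul_le_of_le_one_right (norm_nonneg _) hε1
    · right
      have hsA : s ≤ √(1 + A) := Real.sqrt_le_sqrt (by linarith)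
      have h4 : B * s * w ≤ B * √(1 + A) * (‖linSymbolC β ε Z‖ * ε) := by gcongr
      have key : ∀ t : ℝ, c * ‖(ε : ℂ) * Z + t‖ ≤ B * √(1 + A) * (‖linSymbolC β ε Z‖ * ε) →
          c / (B * √(1 + A)) * ‖Z + (t / ε : ℝ)‖ ≤ ‖linSymbolC β ε Z‖ := by
        intro t ht
        have e1 : (ε : ℂ) * Z + t = ε * (Z + (t / ε : ℝ)) := by
          push_cast
          have : (ε : ℂ) ≠ 0 := by exact_mod_cast hε.ne'
          field_simp
        rw [e1, norm_mul, Complex.norm_real, Real.norm_of_nonneg hε.le] at ht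
        rw [div_mul_eq_mul_div, div_le_iff₀ (by positivity)]
        refine le_of_mul_le_mul_right (a := ε) ?_ hε
        linarith only [ht]
      refine h2.imp (fun h2 => ?_) (fun h2 => ?_)
      · have := key (-κ) (by
          rw [Complex.ofReal_neg, ← sub_eq_add_neg]
          exact h2.trans (h3.trans h4))
        rwa [neg_div, Complex.ofReal_neg, ← sub_eq_add_neg] at this
      · exact key κ (h2.trans (h3.trans h4))

/-! ### Inverting a Fourier multiplier on exponentially decaying functions -/

lemma fourierL2_ae_eq_cft {q : ℝ} (hq : 0 < q) {F : ℝ → ℂ} (hF : ExpL2 q F) :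
    fourierL2 F =ᵐ[volume] fun ξ => cft F ((2 * Real.pi * ξ : ℝ) : ℂ) := by
  have h0 : MemLp F 2 volume := by simpa [expW_zero] using hF.memLp (η := 0) (by simpa using hq.le)
  have h1 : Integrable F := by simpa [expW_zero] using hF.integrable (η := 0) (by simpa using hq)
  filter_upwards [fourierL2_ae_eq_fourier h0 h1] with ξ hξ
  have := cft_line F 0 ξ
  rw [expW_zero] at this
  rw [hξ, ← this]
  simp

/-- If `h` divides the Fourier transform of `F` by the symbol `l` in the strip, then `h` is the
Fourier transform of a function with the same exponential decay as `F`. -/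
lemma exists_multiplier_image {q c N : ℝ} (hq : 0 < q) (hc : 0 < c) {F : ℝ → ℂ} (hF : ExpL2 q F)
    {l h : ℂ → ℂ} (hl : ContinuousOn l {z | |z.im| ≤ q})
    (hlc : ∀ z : ℂ, q / 2 ≤ |z.im| → |z.im| ≤ q → c ≤ ‖l z‖)
    (hlr : ∀ k : ℝ, N ≤ |k| → c ≤ ‖l k‖)
    (hd : DifferentiableOn ℂ h {z | |z.im| < q})
    (hb : ∀ η, η < q → ∃ M, ∀ z : ℂ, |z.im| ≤ η → ‖h z‖ ≤ M)
    (hlh : ∀ z : ℂ, |z.im| < q → l z * h z = cft F z) :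
    ∃ R : ℝ → ℂ, MemLp R 2 volume ∧ ExpL2 q R ∧
      (∀ p : ℝ, |p| = q → fourierL2 (expW p R) =ᵐ[volume]
        fun ξ => (l ((2 * Real.pi * ξ : ℝ) + p * Complex.I))⁻¹ * fourierL2 (expW p F) ξ) ∧
      ∀ᵐ ξ : ℝ, l ((2 * Real.pi * ξ : ℝ) : ℂ) * fourierL2 R ξ = fourierL2 F ξ := by
  have hFhat := fourierL2_ae_eq_cft hq hF
  have hreal : ∀ ξ : ℝ, |((2 * Real.pi * ξ : ℝ) : ℂ).im| < q := fun ξ => by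
    rw [Complex.ofReal_im, abs_zero]; exact hq
  have hcont : Continuous fun ξ : ℝ => h ((2 * Real.pi * ξ : ℝ) : ℂ) := by
    rw [continuous_iff_continuousAt]
    intro ξ
    have h1 := (hd.differentiableAt ((isOpen_strip q).mem_nhds (hreal ξ))).continuousAt
    exact h1.comp (f := fun ξ : ℝ => ((2 * Real.pi * ξ : ℝ) : ℂ)) (by fun_prop)
  obtain ⟨M, hM⟩ := hb 0 hq
  have hM0 : 0 ≤ M := (norm_nonneg _).trans (hM 0 (by simp))
  -- `h` is bounded on a compact interval, and bounded by a multiple of `F̂` outside it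
  have hmem : MemLp (fun ξ : ℝ => h ((2 * Real.pi * ξ : ℝ) : ℂ)) 2 volume := by
    have h1 : MemLp ((Set.Icc (-N) N).indicator fun _ : ℝ => M) 2 volume :=
      memLp_indicator_const 2 measurableSet_Icc M (Or.inr (by simp))
    have h2 : MemLp (fun ξ => c⁻¹ * ‖fourierL2 F ξ‖) 2 volume :=
      (Lp.memLp (fourierL2 F)).norm.const_mul _
    refine MemLp.mono' (h1.add h2) hcont.aestronglyMeasurable ?_
    filter_upwards [hFhat] with ξ hξ
    simp only [Pi.add_apply]
    by_cases hN : ξ ∈ Set.Icc (-N) N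
    · rw [Set.indicator_of_mem hN]
      have := hM ((2 * Real.pi * ξ : ℝ) : ℂ) (by simp)
      have h3 : 0 ≤ c⁻¹ * ‖fourierL2 F ξ‖ := by positivity
      linarith
    · rw [Set.indicator_of_notMem hN, zero_add, hξ, ← hlh _ (hreal ξ), norm_mul,
        inv_mul_eq_div, le_div_iff₀ hc, mul_comm]
      gcongr
      refine hlr _ ?_
      have h4 : N < |ξ| := by
        by_contra hcon
        exact hN (abs_le.1 (not_lt.1 hcon))
      rw [abs_mul, abs_of_pos (by positivity)]
      have h5 : 1 ≤ 2 * Real.pi := by linarith [Real.pi_gt_three]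
      nlinarith [abs_nonneg ξ]
  obtain ⟨R, hR, -⟩ := exists_fourierL2_eq hmem
  have key : ∀ p : ℝ, |p| = q → MemLp (expW p R) 2 volume ∧ fourierL2 (expW p R) =ᵐ[volume]
      fun ξ => (l ((2 * Real.pi * ξ : ℝ) + p * Complex.I))⁻¹ * fourierL2 (expW p F) ξ := by
    intro p hp
    refine multiplier_expW (n := fun z => (l z)⁻¹) (M := c⁻¹) hq hp hF (Lp.memLp R) hd hb ?_ ?_ ?_ hR
    · refine (hl.mono fun z hz => hz.2).inv₀ fun z hz h0 => ?_
      have := hlc z hz.1 hz.2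
      rw [h0, norm_zero] at this
      linarith
    · intro z h1 h2
      rw [norm_inv]
      exact inv_anti₀ hc (hlc z h1 h2)
    · intro z h1 h2
      have h3 := hlc z h1 h2.le
      have h4 : l z ≠ 0 := norm_pos_iff.1 (hc.trans_le h3)
      rw [← hlh z h2]
      field_simp
  refine ⟨R, Lp.memLp R, ⟨(key q (abs_of_pos hq)).1, (key (-q) (by rw [abs_neg, abs_of_pos hq])).1⟩,
    fun p hp => (key p hp).2, ?_⟩
  filter_upwards [hR, hFhat] with ξ h1 h2
  rw [h1, h2]
  exact hlh _ (hreal ξ)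

/-- The version for a symbol with two simple real zeros `±K`: the function has to have vanishing
Fourier transform there. -/
lemma exists_multiplier_image_of_zeros {q K c : ℝ} (hq : 0 < q) (hq' : q ≤ 1 / 2) (hK : 0 < K)
    (hc : 0 < c) {F : ℝ → ℂ} (hF : ExpL2 q F) (hFK : cft F K = 0) (hFK' : cft F (-K) = 0)
    {l : ℂ → ℂ} (hl : DifferentiableOn ℂ l {z | |z.im| < 1}) (hlK : l K = 0) (hlK' : l (-K) = 0)
    (hlb : ∀ z : ℂ, |z.im| ≤ 1 / 2 →
      c ≤ ‖l z‖ ∨ c * ‖z - K‖ ≤ ‖l z‖ ∨ c * ‖z + K‖ ≤ ‖l z‖) :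
    ∃ R : ℝ → ℂ, MemLp R 2 volume ∧ ExpL2 q R ∧
      (∀ p : ℝ, |p| = q → fourierL2 (expW p R) =ᵐ[volume]
        fun ξ => (l ((2 * Real.pi * ξ : ℝ) + p * Complex.I))⁻¹ * fourierL2 (expW p F) ξ) ∧
      ∀ᵐ ξ : ℝ, l ((2 * Real.pi * ξ : ℝ) : ℂ) * fourierL2 R ξ = fourierL2 F ξ := by
  obtain ⟨h, hd, hb, hlh⟩ := exists_strip_quotient hq hK hc (differentiableOn_cft hF)
    (fun η hη => norm_cft_le hF hη) hFK hFK'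
    (hl.mono fun z (hz : |z.im| < q) => (hz.trans_le (by linarith) : |z.im| < 1)) hlK hlK'
    (fun z hz => hlb z (hz.le.trans hq'))
  have hlow : ∀ z : ℂ, |z.im| ≤ 1 / 2 → ∀ t, t ≤ 1 → 0 ≤ t → t ≤ ‖z - K‖ → t ≤ ‖z + K‖ →
      c * t ≤ ‖l z‖ := by
    intro z hz t ht1 ht0 h1 h2
    rcases hlb z hz with h3 | h3 | h3 <;> nlinarith
  refine exists_multiplier_image (c := c * (q / 2)) (N := K + 1) hq (by positivity) hF
    (hl.continuousOn.mono fun z (hz : |z.im| ≤ q) => (hz.trans_lt (by linarith) : |z.im| < 1)) ?_ ?_ hd hb hlh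
  · intro z h1 h2
    refine hlow z (h2.trans hq') _ (by linarith) (by linarith) ?_ ?_
    · refine h1.trans ((le_of_eq ?_).trans (Complex.abs_im_le_norm _))
      simp
    · refine h1.trans ((le_of_eq ?_).trans (Complex.abs_im_le_norm _))
      simp
  · intro k hk
    have hb1 : 1 ≤ |k - K| := by
      have := abs_sub_abs_le_abs_sub k K
      rw [abs_of_pos hK] at this
      linarith
    have hb2 : 1 ≤ |k + K| := by
      have := abs_sub_abs_le_abs_sub k (-K)
      rw [abs_neg, abs_of_pos hK, sub_neg_eq_add] at this
      linarith
    refine hlow k (by simp) _ (by linarith) (by linarith) ?_ ?_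
    · rw [← Complex.ofReal_sub, Complex.norm_real, Real.norm_eq_abs]; linarith
    · rw [← Complex.ofReal_add, Complex.norm_real, Real.norm_eq_abs]; linarith

/-- `exists_multiplier_image` for the symbol `-γ (1 + z²)`, which has no zeros in the strip. -/
lemma limitSymbol_image {β q : ℝ} (hβ' : β < 1 / 3) (hq : 0 < q) (hq' : q ≤ 1 / 2) {F : ℝ → ℂ}
    (hF : ExpL2 q F) :
    ∃ R : ℝ → ℂ, MemLp R 2 volume ∧ ExpL2 q R ∧
      (∀ p : ℝ, |p| = q → fourierL2 (expW p R) =ᵐ[volume]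
        fun ξ => limitSymbol β ((2 * Real.pi * ξ : ℝ) + p * Complex.I) * fourierL2 (expW p F) ξ) ∧
      fourierL2 R =ᵐ[volume] fun ξ => limitSymbol β ((2 * Real.pi * ξ : ℝ) : ℂ) * fourierL2 F ξ := by
  have hγ := gammaCoeff_pos hβ'
  have hlow : ∀ z : ℂ, |z.im| ≤ 1 / 2 →
      gammaCoeff β * (3 / 4) ≤ ‖-(gammaCoeff β * (1 + z ^ 2) : ℂ)‖ := by
    intro z hz
    rw [norm_neg, norm_mul, Complex.norm_real, Real.norm_of_nonneg hγ.le]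
    gcongr
    exact le_trans (by nlinarith [sq_nonneg z.re]) (three_quarters_le_norm hz)
  have hne : ∀ z : ℂ, |z.im| ≤ 1 / 2 → -(gammaCoeff β * (1 + z ^ 2) : ℂ) ≠ 0 := fun z hz =>
    norm_pos_iff.1 (lt_of_lt_of_le (by positivity) (hlow z hz))
  have hcd := differentiableOn_cft hF
  obtain ⟨R, h1, h2, h3, h4⟩ := exists_multiplier_image (c := gammaCoeff β * (3 / 4)) (N := 0) hq
    (by positivity) hF (l := fun z => -(gammaCoeff β * (1 + z ^ 2)))
    (h := fun z => cft F z / -(gammaCoeff β * (1 + z ^ 2))) (by fun_prop)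
    (fun z _ hz => hlow z (hz.trans hq')) (fun k _ => hlow k (by simp))
    (hcd.div (by fun_prop) fun z hz => hne z (hz.le.trans hq'))
    (fun η hη => by
      obtain ⟨M, hM⟩ := norm_cft_le hF hη
      refine ⟨M / (gammaCoeff β * (3 / 4)), fun z hz => ?_⟩
      rw [norm_div]
      have := hM z hz
      have hM0 : 0 ≤ M := (norm_nonneg _).trans this
      gcongr
      exact hlow z (by linarith))
    (fun z hz => mul_div_cancel₀ _ (hne z (hz.le.trans hq')))
  refine ⟨R, h1, h2, fun p hp => ?_, ?_⟩
  · filter_upwards [h3 p hp] with ξ hξ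
    rw [hξ, limitSymbol, ← inv_neg]
  · filter_upwards [h4] with ξ hξ
    rw [← hξ, limitSymbol, ← inv_neg, inv_mul_cancel_left₀ (hne _ (by simp))]

/-! ### Reflection and complex conjugation -/

lemma ae_comp_neg {p : ℝ → Prop} (h : ∀ᵐ x, p x) : ∀ᵐ x, p (-x) :=
  (Measure.measurePreserving_neg (volume : Measure ℝ)).quasiMeasurePreserving.ae h

lemma MemLp.comp_neg_real {g : ℝ → ℂ} (hg : MemLp g 2 volume) :
    MemLp (fun x => g (-x)) 2 volume :=
  hg.comp_measurePreserving (Measure.measurePreserving_neg (volume : Measure ℝ))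

lemma MemLp.conj {g : ℝ → ℂ} (hg : MemLp g 2 volume) :
    MemLp (fun x => starRingEnd ℂ (g x)) 2 volume :=
  hg.of_le (Complex.continuous_conj.comp_aestronglyMeasurable hg.1)
    (Eventually.of_forall fun x => by simp)

/-- Reflection on `L²`. -/
def reflL2 : Lp ℂ 2 (volume : Measure ℝ) →ₗᵢ[ℂ] Lp ℂ 2 (volume : Measure ℝ) :=
  Lp.compMeasurePreservingₗᵢ ℂ (fun x : ℝ => -x) (Measure.measurePreserving_neg volume)

lemma coeFn_reflL2 (f : Lp ℂ 2 (volume : Measure ℝ)) : reflL2 f =ᵐ[volume] fun x => f (-x) :=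
  Lp.coeFn_compMeasurePreserving f (Measure.measurePreserving_neg volume)

lemma reflL2_toLp {g : ℝ → ℂ} (hg : MemLp g 2 volume) :
    reflL2 (hg.toLp g) = (MemLp.comp_neg_real hg).toLp (fun x => g (-x)) := by
  refine Lp.ext ?_
  filter_upwards [coeFn_reflL2 (hg.toLp g), ae_comp_neg hg.coeFn_toLp,
    (MemLp.comp_neg_real hg).coeFn_toLp] with x h1 h2 h3
  rw [h1, h2, h3]

lemma star_toLp {g : ℝ → ℂ} (hg : MemLp g 2 volume) :
    star (hg.toLp g) = (MemLp.conj hg).toLp (fun x => starRingEnd ℂ (g x)) := by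
  refine Lp.ext ?_
  filter_upwards [Lp.coeFn_star (hg.toLp g), hg.coeFn_toLp,
    (MemLp.conj hg).coeFn_toLp] with x h1 h2 h3
  rw [h1, h3, Pi.star_apply, h2]
  rfl

lemma eq_of_eq_schwartz {A B : Lp ℂ 2 (volume : Measure ℝ) → Lp ℂ 2 (volume : Measure ℝ)}
    (hA : Continuous A) (hB : Continuous B)
    (h : ∀ φ : SchwartzMap ℝ ℂ, A (φ.toLp 2) = B (φ.toLp 2)) (f : Lp ℂ 2 (volume : Measure ℝ)) :
    A f = B f := by
  have hd : DenseRange (SchwartzMap.toLpCLM ℝ ℂ 2 (volume : Measure ℝ)) :=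
    SchwartzMap.denseRange_toLpCLM (by norm_num)
  exact congrFun (hd.equalizer hA hB (funext fun φ => h φ)) f

lemma fourierL2_comp_neg {g : ℝ → ℂ} (hg : MemLp g 2 volume) :
    fourierL2 (fun x => g (-x)) =ᵐ[volume] fun ξ => fourierL2 g (-ξ) := by
  have hcF : Continuous fun f : Lp ℂ 2 (volume : Measure ℝ) => 𝓕 f :=
    (Lp.fourierTransformₗᵢ ℝ ℂ).continuous
  have key := eq_of_eq_schwartz (A := fun f => 𝓕 (reflL2 f)) (B := fun f => reflL2 (𝓕 f))
    (hcF.comp reflL2.continuous) (reflL2.continuous.comp hcF) (fun φ => by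
      have hφ : MemLp φ 2 volume := φ.memLp 2
      have hφ1 : Integrable φ := φ.integrable
      have e0 : φ.toLp 2 = hφ.toLp φ := rfl
      refine Lp.ext ?_
      simp only [e0]
      rw [reflL2_toLp hφ, ← fourierL2_eq, ← fourierL2_eq]
      filter_upwards [fourierL2_ae_eq_fourier (MemLp.comp_neg_real hφ) hφ1.comp_neg,
        ae_comp_neg (fourierL2_ae_eq_fourier hφ hφ1), coeFn_reflL2 (fourierL2 φ)] with ξ h1 h2 h3
      rw [h1, h3, h2, Real.fourier_real_eq, Real.fourier_real_eq,
        ← integral_neg_eq_self]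
      simp) (hg.toLp g)
  rw [fourierL2_eq (MemLp.comp_neg_real hg), ← reflL2_toLp hg, fourierL2_eq hg]
  rw [key]
  exact coeFn_reflL2 _

lemma fourierL2_conj {g : ℝ → ℂ} (hg : MemLp g 2 volume) :
    fourierL2 (fun x => starRingEnd ℂ (g x)) =ᵐ[volume]
      fun ξ => starRingEnd ℂ (fourierL2 g (-ξ)) := by
  have hcF : Continuous fun f : Lp ℂ 2 (volume : Measure ℝ) => 𝓕 f :=
    (Lp.fourierTransformₗᵢ ℝ ℂ).continuous
  have hcS : Continuous fun f : Lp ℂ 2 (volume : Measure ℝ) => star f := by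
    refine Isometry.continuous fun f g => ?_
    have e : star f - star g = star (f - g) := by
      refine Lp.ext ?_
      filter_upwards [Lp.coeFn_sub (star f) (star g), Lp.coeFn_sub f g, Lp.coeFn_star f,
        Lp.coeFn_star g, Lp.coeFn_star (f - g)] with x h1 h2 h3 h4 h5
      rw [h1, h5, Pi.star_apply, h2, Pi.sub_apply, Pi.sub_apply, h3, h4, star_sub]
      rfl
    rw [edist_dist, edist_dist, dist_eq_norm, dist_eq_norm, e]
    congr 1
    rw [Lp.norm_def, Lp.norm_def]
    congr 1
    refine eLpNorm_congr_norm_ae ?_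
    filter_upwards [Lp.coeFn_star (f - g)] with x hx
    rw [hx, Pi.star_apply, norm_star]
  have key := eq_of_eq_schwartz (A := fun f => 𝓕 (star f)) (B := fun f => star (reflL2 (𝓕 f)))
    (hcF.comp hcS) (hcS.comp (reflL2.continuous.comp hcF)) (fun φ => by
      have hφ : MemLp φ 2 volume := φ.memLp 2
      have hφ1 : Integrable φ := φ.integrable
      have hφ2 : Integrable fun x => starRingEnd ℂ (φ x) :=
        hφ1.congr' (Complex.continuous_conj.comp_aestronglyMeasurable hφ1.1)
          (Eventually.of_forall fun x => by simp)
      have e0 : φ.toLp 2 = hφ.toLp φ := rfl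
      refine Lp.ext ?_
      simp only [e0]
      rw [star_toLp hφ, ← fourierL2_eq, ← fourierL2_eq]
      filter_upwards [fourierL2_ae_eq_fourier (MemLp.conj hφ) hφ2,
        ae_comp_neg (fourierL2_ae_eq_fourier hφ hφ1), coeFn_reflL2 (fourierL2 φ),
        Lp.coeFn_star (reflL2 (fourierL2 φ))] with ξ h1 h2 h3 h4
      rw [h1, h4, Pi.star_apply, h3, h2, Real.fourier_real_eq_integral_exp_smul,
        Real.fourier_real_eq_integral_exp_smul]
      change _ = starRingEnd ℂ _
      rw [← integral_conj]
      congr 1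
      funext x
      simp only [smul_eq_mul, map_mul, ← Complex.exp_conj, Complex.conj_I, Complex.conj_ofReal]
      congr 2
      push_cast
      ring) (hg.toLp g)
  rw [fourierL2_eq (MemLp.conj hg), ← star_toLp hg, fourierL2_eq hg]
  rw [key]
  filter_upwards [Lp.coeFn_star (reflL2 (𝓕 (hg.toLp g))), coeFn_reflL2 (𝓕 (hg.toLp g))] with ξ h1 h2
  rw [h1, Pi.star_apply, h2]
  rfl

/-! ### Multiplication operators and Fourier multipliers on `L²` -/

/-- The space `L²(ℝ; ℂ)`. -/
abbrev L2 : Type := Lp ℂ 2 (volume : Measure ℝ)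

/-- `ψ` is measurable and bounded by `M`. -/
structure IsBddMul (ψ : ℝ → ℂ) (M : ℝ) : Prop where
  aesm : AEStronglyMeasurable ψ volume
  bound : ∀ x, ‖ψ x‖ ≤ M

lemma IsBddMul.nonneg {ψ : ℝ → ℂ} {M : ℝ} (h : IsBddMul ψ M) : 0 ≤ M :=
  (norm_nonneg _).trans (h.bound 0)

lemma IsBddMul.memLp {ψ : ℝ → ℂ} {M : ℝ} (h : IsBddMul ψ M) {g : ℝ → ℂ} (hg : MemLp g 2 volume) :
    MemLp (fun x => ψ x * g x) 2 volume := by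
  refine MemLp.of_le_mul (c := M) hg (h.aesm.mul hg.1) (Eventually.of_forall fun x => ?_)
  rw [norm_mul]
  exact mul_le_mul_of_nonneg_right (h.bound x) (norm_nonneg _)

/-- Multiplication by a bounded function on `L²`. -/
def mulL2 {ψ : ℝ → ℂ} {M : ℝ} (h : IsBddMul ψ M) : L2 →L[ℂ] L2 :=
  LinearMap.mkContinuous
    { toFun := fun f => (h.memLp (Lp.memLp f)).toLp _
      map_add' := fun f g => by
        rw [← MemLp.toLp_add, MemLp.toLp_eq_toLp_iff]
        filter_upwards [Lp.coeFn_add f g] with x hx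
        simp only [hx, Pi.add_apply, mul_add]
      map_smul' := fun c f => by
        rw [RingHom.id_apply, ← MemLp.toLp_const_smul, MemLp.toLp_eq_toLp_iff]
        filter_upwards [Lp.coeFn_smul c f] with x hx
        simp only [hx, Pi.smul_apply, smul_eq_mul]
        ring } M fun f => by
      refine Lp.norm_le_mul_norm_of_ae_le_mul ?_
      filter_upwards [(h.memLp (Lp.memLp f)).coeFn_toLp] with x hx
      simp only [LinearMap.coe_mk, AddHom.coe_mk]
      rw [hx, norm_mul]
      exact mul_le_mul_of_nonneg_right (h.bound x) (norm_nonneg _)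

lemma coeFn_mulL2 {ψ : ℝ → ℂ} {M : ℝ} (h : IsBddMul ψ M) (f : L2) :
    mulL2 h f =ᵐ[volume] fun x => ψ x * f x :=
  (h.memLp (Lp.memLp f)).coeFn_toLp

lemma norm_mulL2_le {ψ : ℝ → ℂ} {M : ℝ} (h : IsBddMul ψ M) : ‖mulL2 h‖ ≤ M :=
  LinearMap.mkContinuous_norm_le _ h.nonneg _

/-- The Fourier transform on `L²` as a unitary operator. -/
def fourierIso : L2 ≃ₗᵢ[ℂ] L2 := Lp.fourierTransformₗᵢ ℝ ℂ

lemma fourierIso_apply (f : L2) : fourierIso f = fourierL2 f := (fourierL2_coe f).symm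

/-- The operator on `L²` whose action on Fourier transforms is multiplication by `ψ`. -/
def fmulL2 {ψ : ℝ → ℂ} {M : ℝ} (h : IsBddMul ψ M) : L2 →L[ℂ] L2 :=
  fourierIso.symm.toContinuousLinearEquiv.toContinuousLinearMap ∘L mulL2 h ∘L
    fourierIso.toContinuousLinearEquiv.toContinuousLinearMap

lemma fmulL2_apply {ψ : ℝ → ℂ} {M : ℝ} (h : IsBddMul ψ M) (f : L2) :
    fmulL2 h f = fourierIso.symm (mulL2 h (fourierIso f)) := rfl

lemma fourierIso_fmulL2 {ψ : ℝ → ℂ} {M : ℝ} (h : IsBddMul ψ M) (f : L2) :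
    fourierIso (fmulL2 h f) = mulL2 h (fourierIso f) := by
  rw [fmulL2_apply, LinearIsometryEquiv.apply_symm_apply]

lemma norm_fmulL2_apply {ψ : ℝ → ℂ} {M : ℝ} (h : IsBddMul ψ M) (f : L2) :
    ‖fmulL2 h f‖ = ‖mulL2 h (fourierIso f)‖ := by
  rw [fmulL2_apply, LinearIsometryEquiv.norm_map]

lemma norm_fmulL2_le {ψ : ℝ → ℂ} {M : ℝ} (h : IsBddMul ψ M) : ‖fmulL2 h‖ ≤ M := by
  refine ContinuousLinearMap.opNorm_le_bound _ h.nonneg fun f => ?_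
  rw [norm_fmulL2_apply, ← fourierIso.norm_map f]
  exact (mulL2 h).le_of_opNorm_le (norm_mulL2_le h) _

lemma eq_fmulL2_of_fourierL2 {ψ : ℝ → ℂ} {M : ℝ} (h : IsBddMul ψ M) {f g : ℝ → ℂ}
    (hf : MemLp f 2 volume) (hg : MemLp g 2 volume)
    (hfg : fourierL2 g =ᵐ[volume] fun ξ => ψ ξ * fourierL2 f ξ) :
    hg.toLp g = fmulL2 h (hf.toLp f) := by
  refine fourierIso.injective (Lp.ext ?_)
  rw [fourierIso_fmulL2, fourierIso_apply, fourierIso_apply]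
  have e1 : fourierL2 (hg.toLp g) = fourierL2 g := by rw [fourierL2_coe, fourierL2_eq hg]
  have e2 : fourierL2 (hf.toLp f) = fourierL2 f := by rw [fourierL2_coe, fourierL2_eq hf]
  rw [e1, e2]
  exact hfg.trans (coeFn_mulL2 h _).symm

lemma reflL2_mulL2 {ψ : ℝ → ℂ} {M : ℝ} (h : IsBddMul ψ M) (he : ∀ x, ψ (-x) = ψ x) (f : L2) :
    reflL2 (mulL2 h f) = mulL2 h (reflL2 f) := by
  refine Lp.ext ?_
  filter_upwards [coeFn_reflL2 (mulL2 h f), ae_comp_neg (coeFn_mulL2 h f),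
    coeFn_mulL2 h (reflL2 f), coeFn_reflL2 f] with x h1 h2 h3 h4
  rw [h1, h2, h3, h4, he]

lemma fourierIso_reflL2 (f : L2) : fourierIso (reflL2 f) = reflL2 (fourierIso f) := by
  refine Lp.ext ?_
  rw [fourierIso_apply, fourierIso_apply, fourierL2_congr (coeFn_reflL2 f)]
  exact (fourierL2_comp_neg (Lp.memLp f)).trans (coeFn_reflL2 _).symm

lemma reflL2_fmulL2 {ψ : ℝ → ℂ} {M : ℝ} (h : IsBddMul ψ M) (he : ∀ x, ψ (-x) = ψ x) (f : L2) :
    reflL2 (fmulL2 h f) = fmulL2 h (reflL2 f) := by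
  refine fourierIso.injective ?_
  rw [fourierIso_reflL2, fourierIso_fmulL2, fourierIso_fmulL2, fourierIso_reflL2,
    reflL2_mulL2 h he]

lemma reflL2_reflL2 (f : L2) : reflL2 (reflL2 f) = f := by
  refine Lp.ext ?_
  filter_upwards [coeFn_reflL2 (reflL2 f), ae_comp_neg (coeFn_reflL2 f)] with x h1 h2
  rw [h1, h2, neg_neg]

/-- The projection of `L²` onto the even functions. -/
def evenPart : L2 →L[ℂ] L2 :=
  (1 / 2 : ℂ) • (ContinuousLinearMap.id ℂ L2 + reflL2.toContinuousLinearMap)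

lemma evenPart_apply (f : L2) : evenPart f = (1 / 2 : ℂ) • (f + reflL2 f) := rfl

lemma reflL2_evenPart (f : L2) : reflL2 (evenPart f) = evenPart f := by
  rw [evenPart_apply, map_smul, map_add, reflL2_reflL2, add_comm]

lemma evenPart_of_even {f : L2} (hf : reflL2 f = f) : evenPart f = f := by
  rw [evenPart_apply, hf, ← two_smul ℂ, smul_smul]
  norm_num

lemma norm_evenPart_le : ‖evenPart‖ ≤ 1 := by
  refine ContinuousLinearMap.opNorm_le_bound _ zero_le_one fun f => ?_
  rw [evenPart_apply, norm_smul, one_mul]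
  have := norm_add_le f (reflL2 f)
  rw [reflL2.norm_map] at this
  norm_num
  linarith

lemma evenPart_comm {A : L2 →L[ℂ] L2} (hA : ∀ f, reflL2 (A f) = A (reflL2 f)) (f : L2) :
    evenPart (A f) = A (evenPart f) := by
  rw [evenPart_apply, evenPart_apply, map_smul, map_add, hA]

/-- Multiplication by a real function is self-adjoint. -/
lemma inner_mulL2 {ψ : ℝ → ℂ} {M : ℝ} (h : IsBddMul ψ M)
    (hr : ∀ x, starRingEnd ℂ (ψ x) = ψ x) (f g : L2) :
    inner ℂ (mulL2 h f) g = inner ℂ f (mulL2 h g) := by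
  rw [L2.inner_def, L2.inner_def]
  refine integral_congr_ae ?_
  filter_upwards [coeFn_mulL2 h f, coeFn_mulL2 h g] with x h1 h2
  rw [h1, h2, RCLike.inner_apply, RCLike.inner_apply, map_mul, hr]
  ring

lemma inner_fmulL2 {ψ : ℝ → ℂ} {M : ℝ} (h : IsBddMul ψ M)
    (hr : ∀ x, starRingEnd ℂ (ψ x) = ψ x) (f g : L2) :
    inner ℂ (fmulL2 h f) g = inner ℂ f (fmulL2 h g) := by
  rw [← fourierIso.inner_map_map, ← fourierIso.inner_map_map f, fourierIso_fmulL2,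
    fourierIso_fmulL2, inner_mulL2 h hr]

lemma inner_reflL2 (f g : L2) : inner ℂ (reflL2 f) g = inner ℂ f (reflL2 g) := by
  rw [← reflL2.inner_map_map, reflL2_reflL2]

/-! ### The ladder inequality for the linearized KdV operator -/

/-- The function `tanh (x / 2)`. -/
def halfTanh (x : ℝ) : ℝ := Real.tanh (x / 2)

/-- The function `sech² (x / 2)`. -/
def sechSq (x : ℝ) : ℝ := (1 / Real.cosh (x / 2)) ^ 2

lemma sechSq_eq (x : ℝ) : sechSq x = 1 - halfTanh x ^ 2 := by
  have hc := (Real.cosh_pos (x / 2)).ne'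
  have := Real.cosh_sq (x / 2)
  rw [sechSq, halfTanh, Real.tanh_eq_sinh_div_cosh]
  field_simp
  linarith

lemma hasDerivAt_halfTanh (x : ℝ) : HasDerivAt halfTanh ((1 - halfTanh x ^ 2) / 2) x := by
  have hc := (Real.cosh_pos (x / 2)).ne'
  have h0 : HasDerivAt (fun x : ℝ => x / 2) (1 / 2) x := (hasDerivAt_id x).div_const 2
  have h1 := ((Real.hasDerivAt_sinh (x / 2)).comp x h0).div ((Real.hasDerivAt_cosh (x / 2)).comp x h0)
    (show (Real.cosh ∘ fun x => x / 2) x ≠ 0 from hc)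
  have e : halfTanh = (Real.sinh ∘ fun x => x / 2) / (Real.cosh ∘ fun x => x / 2) := by
    funext y
    rw [halfTanh, Real.tanh_eq_sinh_div_cosh]
    rfl
  rw [e]
  refine h1.congr_deriv ?_
  simp only [Function.comp, Pi.div_apply]
  field_simp

lemma continuous_halfTanh : Continuous halfTanh :=
  continuous_iff_continuousAt.2 fun x => (hasDerivAt_halfTanh x).continuousAt

lemma abs_halfTanh_le (x : ℝ) : |halfTanh x| ≤ 1 := by
  rw [halfTanh, Real.tanh_eq_sinh_div_cosh, abs_div, abs_of_pos (Real.cosh_pos _),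
    div_le_one (Real.cosh_pos _)]
  refine abs_le_of_sq_le_sq ?_ (Real.cosh_pos _).le
  have := Real.cosh_sq (x / 2)
  linarith

lemma halfTanh_pos {x : ℝ} (hx : 0 < x) : 0 < halfTanh x := by
  rw [halfTanh, Real.tanh_eq_sinh_div_cosh]
  exact div_pos (Real.sinh_pos_iff.2 (by positivity)) (Real.cosh_pos _)

lemma halfTanh_zero : halfTanh 0 = 0 := by simp [halfTanh]

lemma monotone_halfTanh : Monotone halfTanh := by
  refine monotone_of_deriv_nonneg (fun x => (hasDerivAt_halfTanh x).differentiableAt) fun x => ?_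
  rw [(hasDerivAt_halfTanh x).deriv]
  have := (sq_le_one_iff_abs_le_one _).2 (abs_halfTanh_le x)
  linarith

/-- `16 (L w)² + 8 w L w - 15 w²`, where `L w = w - w'' - 3 sech²(x/2) w`. -/
def ladderDensity (w w₂ : ℝ → ℝ) (x : ℝ) : ℝ :=
  16 * (w x - w₂ x - 3 * sechSq x * w x) ^ 2 + 8 * (w x * (w x - w₂ x - 3 * sechSq x * w x))
    - 15 * w x ^ 2

/-- Up to the derivative of a function that vanishes at `0` and at `∞`, `ladderDensity` is a square.
It arises on factorizing `L` twice, with `t = tanh(x/2)`, `p = w' + (3/2) t w` and `r = p' + t p`: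
one has `∫ p² = ∫ w L w + (5/4) ∫ w²` and `∫ r² = ∫ (L w)² + (5/4) ∫ w L w`, while
`∫ r² - (3/4) ∫ p²` is the integral of the square of `p' - (1/(2t) - t) p`. -/
lemma ladder_nonneg {w w₁ w₂ : ℝ → ℝ} (h1 : ∀ x, HasDerivAt w (w₁ x) x)
    (h2 : ∀ x, HasDerivAt w₁ (w₂ x) x) (hc : Continuous w₂) (h0 : w₁ 0 = 0)
    (hw : Tendsto w atTop (𝓝 0)) (hw₁ : Tendsto w₁ atTop (𝓝 0))
    (hint : IntegrableOn (ladderDensity w w₂) (Set.Ioi 0)) :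
    0 ≤ ∫ x in Set.Ioi 0, ladderDensity w w₂ x := by
  set t := halfTanh with ht
  set p : ℝ → ℝ := fun x => w₁ x + 3 / 2 * (t x * w x) with hp
  set B : ℝ → ℝ := fun x => 8 * (p x ^ 2 / t x) + 12 * (3 / 2 * (t x * w x ^ 2) + w x * w₁ x)
    - 16 * (5 / 2 * (t x * w₁ x ^ 2) + (-5 / 4 + 15 / 2 * t x ^ 2) * (w x * w₁ x)
      + 1 / 2 * ((-15 / 4 * t x + 45 / 4 * t x ^ 3) * w x ^ 2)) with hB
  have hwc : Continuous w := continuous_iff_continuousAt.2 fun x => (h1 x).continuousAt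
  have hw₁c : Continuous w₁ := continuous_iff_continuousAt.2 fun x => (h2 x).continuousAt
  have htc : Continuous t := continuous_halfTanh
  have hsc : Continuous sechSq := by
    have : sechSq = fun x => 1 - t x ^ 2 := funext sechSq_eq
    rw [this]; fun_prop
  have hEc : Continuous (ladderDensity w w₂) := by
    unfold ladderDensity
    fun_prop
  have hp' : ∀ x, HasDerivAt p (w₂ x + 3 / 2 * ((1 - t x ^ 2) / 2 * w x + t x * w₁ x)) x := fun x =>
    (h2 x).add (((hasDerivAt_halfTanh x).mul (h1 x)).const_mul _)
  have hp0 : p 0 = 0 := by simp [hp, h0, ht, halfTanh_zero]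
  have ht0 : t 0 = 0 := halfTanh_zero
  -- `p² / t` extends continuously by `0`, as `p` and `t` both vanish at `0`
  have hquot : ContinuousWithinAt (fun x => p x ^ 2 / t x) (Set.Ici 0) 0 := by
    rw [← continuousWithinAt_Ioi_iff_Ici]
    have e1 := (hasDerivAt_iff_tendsto_slope.1 (hp' 0)).mono_left
      (nhdsWithin_mono (0 : ℝ) (fun x (hx : 0 < x) => (hx.ne' : x ≠ 0)))
    have e2 := (hasDerivAt_iff_tendsto_slope.1 (hasDerivAt_halfTanh 0)).mono_left
      (nhdsWithin_mono (0 : ℝ) (fun x (hx : 0 < x) => (hx.ne' : x ≠ 0)))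
    have e3 : Tendsto (fun x : ℝ => x) (𝓝[>] 0) (𝓝 0) := tendsto_id.mono_left nhdsWithin_le_nhds
    have e4 := e3.mul ((e1.pow 2).div e2 (by rw [← ht, ht0]; norm_num))
    rw [zero_mul] at e4
    rw [ContinuousWithinAt, hp0]
    simp only [ne_eq, OfNat.ofNat_ne_zero, not_false_eq_true, zero_pow, zero_div]
    refine e4.congr' ?_
    filter_upwards [self_mem_nhdsWithin] with x hx
    have hx0 : x ≠ 0 := (ne_of_gt hx)
    rw [Pi.div_apply, slope_def_field, slope_def_field, hp0, ← ht, ht0]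
    simp only [sub_zero]
    have := (halfTanh_pos hx).ne'
    field_simp
  -- `ladderDensity` is `B'` plus a square
  have hderiv : ∀ x, 0 < x → HasDerivAt B (ladderDensity w w₂ x
      - 16 * (w₂ x + 3 / 2 * ((1 - t x ^ 2) / 2 * w x + t x * w₁ x)
        - (1 / (2 * t x) - t x) * p x) ^ 2) x := by
    intro x hx
    have htx := (halfTanh_pos hx).ne'
    have ht' := hasDerivAt_halfTanh x
    have hq := ((((hp' x).pow 2).div ht' htx).const_mul 8)
    have hD3 := (((ht'.mul ((h1 x).pow 2)).const_mul (3 / 2)).add ((h1 x).mul (h2 x))).const_mul 12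
    have hD1 := ((((ht'.mul ((h2 x).pow 2)).const_mul (5 / 2)).add
      ((((ht'.pow 2).const_mul (15 / 2)).const_add (-5 / 4)).mul ((h1 x).mul (h2 x)))).add
      ((((ht'.const_mul (-15 / 4)).add ((ht'.pow 3).const_mul (45 / 4))).mul
        ((h1 x).pow 2)).const_mul (1 / 2))).const_mul 16
    refine ((hq.add hD3).sub hD1).congr_deriv ?_
    simp only [Pi.mul_apply, Pi.pow_apply, Pi.add_apply, ladderDensity, sechSq_eq, hp]
    change t x ≠ 0 at htx
    rw [← ht]
    field_simp
    ring
  have hBc : ContinuousOn B (Set.Ici 0) := by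
    have hpc : Continuous p := by fun_prop
    refine ContinuousOn.sub (ContinuousOn.add (continuousOn_const.mul fun x hx => ?_) ?_) ?_
    · rcases (Set.mem_Ici.1 hx).eq_or_lt with h | h
      · rw [← h]; exact hquot
      · exact ((hpc.pow 2).continuousAt.div htc.continuousAt
          (halfTanh_pos h).ne').continuousWithinAt
    · fun_prop
    · fun_prop
  have hmono : MonotoneOn (fun X => (∫ x in (0 : ℝ)..X, ladderDensity w w₂ x) - B X) (Set.Ici 0) := by
    have hI : ∀ X, HasDerivAt (fun X => ∫ x in (0 : ℝ)..X, ladderDensity w w₂ x)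
        (ladderDensity w w₂ X) X := fun X =>
      intervalIntegral.integral_hasDerivAt_right (hEc.intervalIntegrable _ _)
        (hEc.stronglyMeasurableAtFilter _ _) hEc.continuousAt
    refine monotoneOn_of_deriv_nonneg (convex_Ici 0) (ContinuousOn.sub (fun X _ =>
      (hI X).continuousAt.continuousWithinAt) hBc) (fun X hX => ?_) (fun X hX => ?_)
    · rw [interior_Ici] at hX
      exact ((hI X).sub (hderiv X hX)).differentiableAt.differentiableWithinAt
    · rw [interior_Ici] at hX
      have := ((hI X).sub (hderiv X hX)).deriv
      rw [show (fun X => (∫ x in (0 : ℝ)..X, ladderDensity w w₂ x) - B X)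
        = (fun X => ∫ x in (0 : ℝ)..X, ladderDensity w w₂ x) - B from rfl, this]
      have := sq_nonneg (w₂ X + 3 / 2 * ((1 - t X ^ 2) / 2 * w X + t X * w₁ X)
        - (1 / (2 * t X) - t X) * p X)
      linarith
  have hge : ∀ X, 0 ≤ X → B X ≤ ∫ x in (0 : ℝ)..X, ladderDensity w w₂ x := by
    intro X hX
    have h := hmono (Set.mem_Ici.2 le_rfl) (Set.mem_Ici.2 hX) hX
    have hB0 : B 0 = 0 := by simp [hB, ht0, h0]
    simp only [intervalIntegral.integral_same, hB0] at h
    linarith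
  have hlim := intervalIntegral_tendsto_integral_Ioi 0 hint tendsto_id
  -- a bounded factor times a factor tending to zero
  have hbt : ∀ {f : ℝ → ℝ} {g : ℝ → ℝ}, (∀ᶠ x in atTop, |g x| ≤ 30) → Tendsto f atTop (𝓝 0) →
      Tendsto (fun x => g x * f x) atTop (𝓝 0) := by
    intro f g hg hf
    exact bdd_le_mul_tendsto_zero' 30 hg hf
  have htb : ∀ x, |t x| ≤ 1 := abs_halfTanh_le
  have htw : Tendsto (fun x => t x * w x) atTop (𝓝 0) :=
    hbt (Eventually.of_forall fun x => (htb x).trans (by norm_num)) hw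
  have hp0' : Tendsto p atTop (𝓝 0) := by simpa using hw₁.add (htw.const_mul (3 / 2))
  have hBlim : Tendsto B atTop (𝓝 0) := by
    have a1 : Tendsto (fun x => p x ^ 2 / t x) atTop (𝓝 0) := by
      have hinv : ∀ᶠ x in atTop, |(1 / t x)| ≤ 1 / t 1 := by
        filter_upwards [eventually_ge_atTop (1 : ℝ)] with x hx
        have h3 : 0 < t 1 := halfTanh_pos one_pos
        have h4 : t 1 ≤ t x := monotone_halfTanh hx
        rw [abs_of_pos (one_div_pos.2 (h3.trans_le h4))]
        exact one_div_le_one_div_of_le h3 h4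
      have := bdd_le_mul_tendsto_zero' (1 / t 1) hinv (f := fun x => 1 / t x) (g := fun x => p x ^ 2)
        (by simpa using hp0'.pow 2)
      refine this.congr fun x => ?_
      ring
    have a2 := (htw.mul hw).const_mul (3 / 2 : ℝ)
    have a3 := hw.mul hw₁
    have a4 : Tendsto (fun x => t x * w₁ x ^ 2) atTop (𝓝 0) :=
      hbt (Eventually.of_forall fun x => (htb x).trans (by norm_num)) (by simpa using hw₁.pow 2)
    have hsq : ∀ x, t x ^ 2 ≤ 1 := fun x => (sq_le_one_iff_abs_le_one _).2 (htb x)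
    have a5 : Tendsto (fun x => (-5 / 4 + 15 / 2 * t x ^ 2) * (w x * w₁ x)) atTop (𝓝 0) :=
      hbt (Eventually.of_forall fun x => abs_le.2 ⟨by nlinarith [sq_nonneg (t x)],
        by nlinarith [hsq x]⟩) (by simpa using a3)
    have a6 : Tendsto (fun x => (-15 / 4 * t x + 45 / 4 * t x ^ 3) * w x ^ 2) atTop (𝓝 0) := by
      refine hbt (Eventually.of_forall fun x => ?_) (by simpa using hw.pow 2)
      rw [show -15 / 4 * t x + 45 / 4 * t x ^ 3 = t x * (-15 / 4 + 45 / 4 * t x ^ 2) by ring, abs_mul]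
      have h5 : |(-15 / 4 + 45 / 4 * t x ^ 2)| ≤ 30 :=
        abs_le.2 ⟨by nlinarith [sq_nonneg (t x)], by nlinarith [hsq x]⟩
      nlinarith [htb x, abs_nonneg (t x), abs_nonneg (-15 / 4 + 45 / 4 * t x ^ 2)]
    have := ((a1.const_mul 8).add ((a2.add a3).const_mul 12)).sub
      ((((a4.const_mul (5 / 2)).add a5).add (a6.const_mul (1 / 2))).const_mul 16)
    simp only [mul_zero, add_zero, sub_zero] at this
    refine this.congr fun x => ?_
    simp only [hB]
    ring
  refine le_of_tendsto_of_tendsto hBlim hlim ?_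
  filter_upwards [eventually_ge_atTop (0 : ℝ)] with X hX
  exact hge X hX

/-! ### Invertibility of the linearized KdV operator on even functions -/

lemma continuous_sechSq : Continuous sechSq := by
  have : sechSq = fun x => 1 - halfTanh x ^ 2 := funext sechSq_eq
  have h := continuous_halfTanh
  rw [this]
  fun_prop

lemma sechSq_nonneg (x : ℝ) : 0 ≤ sechSq x := sq_nonneg _

lemma sechSq_le_one (x : ℝ) : sechSq x ≤ 1 := by
  rw [sechSq_eq]; linarith [sq_nonneg (halfTanh x)]

lemma sechSq_neg (x : ℝ) : sechSq (-x) = sechSq x := by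
  rw [sechSq, sechSq, neg_div, Real.cosh_neg]

/-- The linearized KdV operator `L = 1 - ∂² - 3 sech²(x/2)` is bounded below on the even Schwartz
functions. `ladder_nonneg` applies to the real and imaginary parts on the half-line, as the derivative
of an even function vanishes at `0`. -/
lemma ladder_schwartz (φ : 𝓢(ℝ, ℂ)) (he : ∀ x, φ (-x) = φ x) :
    11 * ∫ x, ‖φ x‖ ^ 2 ≤
      20 * ∫ x, ‖φ x - derivCLM ℂ ℂ (derivCLM ℂ ℂ φ) x - 3 * sechSq x * φ x‖ ^ 2 := by
  set φ₁ := derivCLM ℂ ℂ φ with hφ₁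
  set φ₂ := derivCLM ℂ ℂ φ₁ with hφ₂
  have d1 : ∀ x, HasDerivAt φ (φ₁ x) x := fun x => φ.hasDerivAt x
  have d2 : ∀ x, HasDerivAt φ₁ (φ₂ x) x := fun x => φ₁.hasDerivAt x
  have odd1 : ∀ x, φ₁ (-x) = -φ₁ x := by
    intro x
    have h1 : HasDerivAt (fun x => φ (-x)) (-φ₁ (-x)) x := by
      have := (d1 (-x)).scomp x (hasDerivAt_neg x)
      simpa [Function.comp_def] using this
    rw [funext he] at h1
    have := h1.unique (d1 x)
    rw [← this, neg_neg]
  have even2 : ∀ x, φ₂ (-x) = φ₂ x := by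
    intro x
    have h1 : HasDerivAt (fun x => φ₁ (-x)) (-φ₂ (-x)) x := by
      have := (d2 (-x)).scomp x (hasDerivAt_neg x)
      simpa [Function.comp_def] using this
    rw [funext odd1] at h1
    exact neg_injective (h1.unique (d2 x).fun_neg)
  have h10 : φ₁ 0 = 0 := by
    have := odd1 0
    rw [neg_zero] at this
    exact self_eq_neg.1 this
  set Lφ : ℝ → ℂ := fun x => φ x - φ₂ x - 3 * sechSq x * φ x with hL
  have hsc := continuous_sechSq
  have mφ : MemLp φ 2 volume := φ.memLp 2
  have mL : MemLp Lφ 2 volume := by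
    refine (mφ.sub (φ₂.memLp 2)).sub (MemLp.of_le_mul (c := 3) mφ ?_ (Eventually.of_forall fun x => ?_))
    · exact (by have := φ.continuous; fun_prop : Continuous fun x => 3 * (sechSq x : ℂ) * φ x).aestronglyMeasurable
    · rw [norm_mul, norm_mul, Complex.norm_real, Real.norm_of_nonneg (sechSq_nonneg x)]
      have := sechSq_le_one x
      norm_num
      nlinarith [norm_nonneg (φ x)]
  have iφ : Integrable fun x => ‖φ x‖ ^ 2 := (memLp_two_iff_integrable_sq_norm mφ.1).1 mφ
  have iL : Integrable fun x => ‖Lφ x‖ ^ 2 := (memLp_two_iff_integrable_sq_norm mL.1).1 mL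
  -- a real-linear coordinate of `φ`
  have coord : ∀ T : ℂ →L[ℝ] ℝ, (∀ z, |T z| ≤ ‖z‖) → (∀ (a : ℝ) z, T (a * z) = a * T z) →
      IntegrableOn (ladderDensity (fun x => T (φ x)) (fun x => T (φ₂ x))) (Set.Ioi 0) ∧
      0 ≤ ∫ x in Set.Ioi 0, ladderDensity (fun x => T (φ x)) (fun x => T (φ₂ x)) x := by
    intro T hT hTm
    have c1 := φ.continuous
    have c2 := φ₂.continuous
    have hcE : Continuous (ladderDensity (fun x => T (φ x)) (fun x => T (φ₂ x))) := by
      unfold ladderDensity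
      fun_prop
    have hTL : ∀ x, T (φ x) - T (φ₂ x) - 3 * sechSq x * T (φ x) = T (Lφ x) := by
      intro x
      have e : (3 * (sechSq x : ℂ) * φ x) = ((3 * sechSq x : ℝ) : ℂ) * φ x := by push_cast; ring
      simp only [hL, map_sub]
      rw [e, hTm]
    have hint : Integrable (ladderDensity (fun x => T (φ x)) (fun x => T (φ₂ x))) := by
      refine Integrable.mono' ((iL.const_mul 20).add (iφ.const_mul 19)) hcE.aestronglyMeasurable
        (Eventually.of_forall fun x => ?_)
      simp only [Pi.add_apply, ladderDensity, hTL]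
      have a1 := hT (φ x)
      have a2 := hT (Lφ x)
      have b1 : T (φ x) ^ 2 ≤ ‖φ x‖ ^ 2 := sq_le_sq' (abs_le.1 a1).1 (abs_le.1 a1).2
      have b2 : T (Lφ x) ^ 2 ≤ ‖Lφ x‖ ^ 2 := sq_le_sq' (abs_le.1 a2).1 (abs_le.1 a2).2
      rw [Real.norm_eq_abs, abs_le]
      constructor <;>
        nlinarith [sq_nonneg (T (φ x) + T (Lφ x)), sq_nonneg (T (φ x) - T (Lφ x)),
          sq_nonneg (T (φ x)), sq_nonneg (T (Lφ x))]
    have hcomp : ∀ (ψ ψ' : 𝓢(ℝ, ℂ)), (∀ x, HasDerivAt ψ (ψ' x) x) →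
        ∀ x, HasDerivAt (fun x => T (ψ x)) (T (ψ' x)) x := fun ψ ψ' h x =>
      T.hasFDerivAt.comp_hasDerivAt x (h x)
    have hlim : ∀ ψ : 𝓢(ℝ, ℂ), Tendsto (fun x => T (ψ x)) atTop (𝓝 0) := by
      intro ψ
      have h1 := (ψ.tendsto_cocompact).mono_left atTop_le_cocompact
      have h2 := (T.continuous.tendsto 0).comp h1
      simpa [Function.comp_def] using h2
    refine ⟨hint.integrableOn, ladder_nonneg (hcomp _ _ d1) (hcomp _ _ d2) (by fun_prop) ?_
      (hlim φ) (hlim φ₁) hint.integrableOn⟩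
    rw [h10, map_zero]
  obtain ⟨ir, hr⟩ := coord Complex.reCLM Complex.abs_re_le_norm (fun a z => by simp)
  obtain ⟨ii, hi⟩ := coord Complex.imCLM Complex.abs_im_le_norm (fun a z => by simp)
  have hhalf : 11 * ∫ x in Set.Ioi 0, ‖φ x‖ ^ 2 ≤ 20 * ∫ x in Set.Ioi 0, ‖Lφ x‖ ^ 2 := by
    have h0 := add_nonneg hr hi
    rw [← integral_add ir ii] at h0
    have h1 : (∫ x in Set.Ioi 0, (ladderDensity (fun x => Complex.reCLM (φ x))
          (fun x => Complex.reCLM (φ₂ x)) x + ladderDensity (fun x => Complex.imCLM (φ x))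
          (fun x => Complex.imCLM (φ₂ x)) x))
        ≤ ∫ x in Set.Ioi 0, (20 * ‖Lφ x‖ ^ 2 - 11 * ‖φ x‖ ^ 2) := by
      refine integral_mono (ir.add ii)
        ((iL.integrableOn.const_mul 20).sub (iφ.integrableOn.const_mul 11)) fun x => ?_
      have e1 : (Lφ x).re = (φ x).re - (φ₂ x).re - 3 * sechSq x * (φ x).re := by
        simp [hL]
      have e2 : (Lφ x).im = (φ x).im - (φ₂ x).im - 3 * sechSq x * (φ x).im := by
        simp [hL]
      simp only [ladderDensity, Complex.reCLM_apply, Complex.imCLM_apply]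
      rw [← e1, ← e2, Complex.sq_norm, Complex.sq_norm, Complex.normSq_apply, Complex.normSq_apply]
      nlinarith [sq_nonneg ((φ x).re - (Lφ x).re), sq_nonneg ((φ x).im - (Lφ x).im)]
    rw [integral_sub (iL.integrableOn.const_mul 20) (iφ.integrableOn.const_mul 11),
      integral_const_mul, integral_const_mul] at h1
    linarith
  have hev : ∀ f : ℝ → ℝ, (∀ x, f (-x) = f x) → ∫ x, f x = 2 * ∫ x in Set.Ioi 0, f x := by
    intro f hf
    rw [← integral_comp_abs]
    congr 1
    funext x
    rcases abs_choice x with h | h <;> rw [h]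
    exact (hf x).symm
  rw [hev _ (fun x => by rw [he]), hev _ (fun x => by rw [he, even2, sechSq_neg])]
  linarith

/-- The symbol `1 / (1 + k²)` of `(1 - ∂²)⁻¹`. -/
def besselSymbol (ξ : ℝ) : ℂ := (((1 + (2 * Real.pi * ξ) ^ 2)⁻¹ : ℝ) : ℂ)

lemma isBddMul_besselSymbol : IsBddMul besselSymbol 1 := by
  refine ⟨Continuous.aestronglyMeasurable ?_, fun ξ => ?_⟩
  · unfold besselSymbol
    exact Complex.continuous_ofReal.comp ((by fun_prop : Continuous fun ξ : ℝ =>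
      1 + (2 * Real.pi * ξ) ^ 2).inv₀ fun ξ => by positivity)
  · rw [besselSymbol, Complex.norm_real, Real.norm_of_nonneg (by positivity)]
    exact inv_le_one_of_one_le₀ (by nlinarith [sq_nonneg (2 * Real.pi * ξ)])

lemma besselSymbol_neg (ξ : ℝ) : besselSymbol (-ξ) = besselSymbol ξ := by
  rw [besselSymbol, besselSymbol, mul_neg, neg_sq]

/-- The operator `(1 - ∂²)⁻¹` on `L²`. -/
def besselL2 : L2 →L[ℂ] L2 := fmulL2 isBddMul_besselSymbol

lemma hasTemperateGrowth_besselSymbol : besselSymbol.HasTemperateGrowth := by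
  have h1 := Function.hasTemperateGrowth_one_add_norm_sq_rpow ℝ (-1)
  have h2 : (fun ξ : ℝ => 2 * Real.pi * ξ).HasTemperateGrowth := by fun_prop
  have h3 := Function.HasTemperateGrowth.comp Function.Complex.hasTemperateGrowth_ofReal (h1.comp h2)
  refine Eq.mp ?_ h3
  congr 1
  funext ξ
  simp only [Function.comp, besselSymbol]
  rw [Real.rpow_neg_one, Real.norm_eq_abs, sq_abs]

/-- On Schwartz functions `besselL2` is the solution operator of `φ - φ'' = k`. -/
lemma exists_schwartz_resolvent (k : 𝓢(ℝ, ℂ)) : ∃ φ : 𝓢(ℝ, ℂ),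
    (φ.toLp 2 : L2) = besselL2 (k.toLp 2) ∧ ∀ x, φ x - derivCLM ℂ ℂ (derivCLM ℂ ℂ φ) x = k x := by
  set φ : 𝓢(ℝ, ℂ) := fourierMultiplierCLM ℂ besselSymbol k with hφ
  have hF : ∀ ξ, 𝓕 φ ξ = besselSymbol ξ * 𝓕 k ξ := by
    intro ξ
    rw [hφ, fourierMultiplierCLM_apply, FourierTransform.fourier_fourierInv_eq,
      smulLeftCLM_apply_apply hasTemperateGrowth_besselSymbol, smul_eq_mul]
  refine ⟨φ, ?_, ?_⟩
  · refine fourierIso.injective ?_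
    rw [besselL2, fourierIso_fmulL2]
    refine Lp.ext ?_
    have e : ∀ f : 𝓢(ℝ, ℂ), fourierIso (f.toLp 2 : L2) =ᵐ[volume] (𝓕 f : 𝓢(ℝ, ℂ)) := fun f => by
      change (𝓕 (f.toLp 2 : L2) : L2) =ᵐ[volume] _
      rw [SchwartzMap.toLp_fourier_eq]
      exact SchwartzMap.coeFn_toLp _ 2 volume
    filter_upwards [e φ, e k, coeFn_mulL2 isBddMul_besselSymbol (fourierIso (k.toLp 2 : L2))]
      with ξ h1 h2 h3
    rw [h1, h3, h2, hF]
  · have hd : ∀ (f : 𝓢(ℝ, ℂ)) ξ, 𝓕 (derivCLM ℂ ℂ f) ξ = (2 * Real.pi * Complex.I * ξ) * 𝓕 f ξ := by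
      intro f ξ
      have := congrFun (Real.fourier_deriv (f := f) f.integrable f.differentiable
        (derivCLM ℂ ℂ f).integrable) ξ
      exact this
    have h0 : 𝓕 (φ - derivCLM ℂ ℂ (derivCLM ℂ ℂ φ)) = 𝓕 k := by
      ext ξ
      rw [sub_eq_add_neg, FourierTransform.fourier_add, FourierTransform.fourier_neg]
      change 𝓕 φ ξ + -(𝓕 (derivCLM ℂ ℂ (derivCLM ℂ ℂ φ)) ξ) = _
      rw [hd, hd, hF, besselSymbol]
      have h5 : ((1 : ℂ) + (2 * Real.pi * ξ) ^ 2) ≠ 0 := by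
        have h : (0 : ℝ) < 1 + (2 * Real.pi * ξ) ^ 2 := by positivity
        exact_mod_cast h.ne'
      push_cast
      calc _ = (1 + (2 * Real.pi * ξ : ℂ) ^ 2) * (1 + (2 * Real.pi * ξ : ℂ) ^ 2)⁻¹ * 𝓕 k ξ := by
            linear_combination (-4 * (Real.pi : ℂ) ^ 2 * ξ ^ 2 *
              (1 + (2 * Real.pi * ξ : ℂ) ^ 2)⁻¹ * 𝓕 k ξ) * Complex.I_sq
        _ = _ := by rw [mul_inv_cancel₀ h5, one_mul]
    have h1 : φ - derivCLM ℂ ℂ (derivCLM ℂ ℂ φ) = k := by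
      have h2 := congrArg (fun f : 𝓢(ℝ, ℂ) => 𝓕⁻ f) h0
      simpa only [FourierTransform.fourierInv_fourier_eq] using h2
    intro x
    exact congrArg (fun f : 𝓢(ℝ, ℂ) => f x) h1

lemma isBddMul_ofReal {f : ℝ → ℝ} (hf : Continuous f) {M : ℝ} (hM : ∀ x, |f x| ≤ M) :
    IsBddMul (fun x => (f x : ℂ)) M :=
  ⟨(Complex.continuous_ofReal.comp hf).aestronglyMeasurable, fun x => by
    rw [Complex.norm_real]; exact hM x⟩

lemma isBddMul_sechSq : IsBddMul (fun x => (sechSq x : ℂ)) 1 :=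
  isBddMul_ofReal continuous_sechSq fun x => by
    rw [abs_of_nonneg (sechSq_nonneg x)]; exact sechSq_le_one x

lemma continuous_sech : Continuous fun x : ℝ => 1 / Real.cosh (x / 2) := by
  refine continuous_const.div (Real.continuous_cosh.comp (by fun_prop)) fun x => ?_
  exact (Real.cosh_pos _).ne'

lemma isBddMul_sech : IsBddMul (fun x => ((1 / Real.cosh (x / 2) : ℝ) : ℂ)) 1 :=
  isBddMul_ofReal continuous_sech fun x => by
    rw [abs_of_pos (one_div_pos.2 (Real.cosh_pos _)), div_le_one (Real.cosh_pos _)]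
    exact Real.one_le_cosh _

/-- Multiplication by `sech (x / 2)` on `L²`. -/
def sechL2 : L2 →L[ℂ] L2 := mulL2 isBddMul_sech

lemma sechL2_sechL2 (f : L2) : sechL2 (sechL2 f) = mulL2 isBddMul_sechSq f := by
  refine Lp.ext ?_
  filter_upwards [coeFn_mulL2 isBddMul_sech (sechL2 f), coeFn_mulL2 isBddMul_sech f,
    coeFn_mulL2 isBddMul_sechSq f] with x h1 h2 h3
  rw [h3]
  refine h1.trans ?_
  change _ * (mulL2 isBddMul_sech f) x = _
  rw [h2, sechSq]
  push_cast
  ring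

lemma norm_L2_sq (f : L2) : ‖f‖ ^ 2 = ∫ x, ‖f x‖ ^ 2 := by
  have h := L2.inner_def (𝕜 := ℂ) f f
  rw [inner_self_eq_norm_sq_to_K] at h
  have h2 : (fun x => inner ℂ (f x) (f x)) = fun x => ((‖f x‖ ^ 2 : ℝ) : ℂ) := by
    funext x
    rw [inner_self_eq_norm_sq_to_K]
    norm_cast
  rw [h2] at h
  have h3 := h.trans integral_ofReal
  exact_mod_cast h3

lemma evenPart_schwartz (h : 𝓢(ℝ, ℂ)) : ∃ k : 𝓢(ℝ, ℂ), (k.toLp 2 : L2) = evenPart (h.toLp 2) := by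
  set h' := compCLMOfContinuousLinearEquiv ℂ (ContinuousLinearEquiv.neg ℝ : ℝ ≃L[ℝ] ℝ) h with hh'
  refine ⟨(1 / 2 : ℂ) • (h + h'), ?_⟩
  rw [evenPart_apply]
  have e1 : reflL2 (h.toLp 2 : L2) = h'.toLp 2 := by
    refine Lp.ext ?_
    filter_upwards [coeFn_reflL2 (h.toLp 2 : L2), ae_comp_neg (p := fun x => (h.toLp 2 volume : L2) x = h x) (h.coeFn_toLp 2 volume),
      h'.coeFn_toLp 2 volume] with x h1 h2 h3
    rw [h1, h2, h3]
    rfl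
  rw [e1]
  exact (map_smul (toLpCLM ℂ ℂ 2 volume) _ _).trans (by rw [map_add]; rfl)

/-- The ladder inequality for the even functions in the domain of `L`. -/
lemma ladder_L2 (h : L2) : 11 * ‖besselL2 (evenPart h)‖ ^ 2 ≤
    20 * ‖evenPart h - (3 : ℂ) • sechL2 (sechL2 (besselL2 (evenPart h)))‖ ^ 2 := by
  have hd : DenseRange (SchwartzMap.toLpCLM ℂ ℂ 2 (volume : Measure ℝ)) :=
    SchwartzMap.denseRange_toLpCLM (by norm_num)
  refine hd.induction_on (p := fun h : L2 => 11 * ‖besselL2 (evenPart h)‖ ^ 2 ≤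
    20 * ‖evenPart h - (3 : ℂ) • sechL2 (sechL2 (besselL2 (evenPart h)))‖ ^ 2) h
    (isClosed_le (by fun_prop) (by fun_prop)) fun f => ?_
  rw [toLpCLM_apply]
  obtain ⟨k, hk⟩ := evenPart_schwartz f
  obtain ⟨φ, hφ, hφk⟩ := exists_schwartz_resolvent k
  rw [← hk, ← hφ, sechL2_sechL2]
  have heven : ∀ x, φ (-x) = φ x := by
    have h1 : reflL2 (φ.toLp 2 : L2) = φ.toLp 2 := by
      rw [hφ, besselL2, reflL2_fmulL2 _ besselSymbol_neg, hk, reflL2_evenPart]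
    have h2 : (fun x => φ (-x)) =ᵐ[volume] φ := by
      have h3 := coeFn_reflL2 (φ.toLp 2 : L2)
      rw [h1] at h3
      filter_upwards [h3, ae_comp_neg (p := fun x => (φ.toLp 2 volume : L2) x = φ x) (φ.coeFn_toLp 2 volume), φ.coeFn_toLp 2 volume] with x a1 a2 a3
      rw [← a3, a1, a2]
    have h4 := (Continuous.ae_eq_iff_eq volume (φ.continuous.comp continuous_neg) φ.continuous).1 h2
    exact fun x => congrFun h4 x
  have key := ladder_schwartz φ heven
  rw [norm_L2_sq, norm_L2_sq]
  refine le_of_eq_of_le ?_ (key.trans (le_of_eq ?_))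
  · congr 1
    refine integral_congr_ae ?_
    filter_upwards [φ.coeFn_toLp 2 volume] with x hx
    rw [hx]
  · congr 1
    refine integral_congr_ae ?_
    filter_upwards [φ.coeFn_toLp 2 volume, k.coeFn_toLp 2 volume,
      Lp.coeFn_sub (k.toLp 2 : L2) ((3 : ℂ) • mulL2 isBddMul_sechSq (φ.toLp 2)),
      Lp.coeFn_smul (3 : ℂ) (mulL2 isBddMul_sechSq (φ.toLp 2 : L2)),
      coeFn_mulL2 isBddMul_sechSq (φ.toLp 2 : L2)] with x h1 h2 h3 h4 h5
    rw [h3, Pi.sub_apply, h4, Pi.smul_apply, h5, h1, h2, hφk, smul_eq_mul]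
    congr 2
    ring

/-! ### The limit operator -/

lemma isUnit_one_sub_mul_swap {R : Type*} [Ring R] {a b : R} (h : IsUnit (1 - a * b)) :
    IsUnit (1 - b * a) := by
  obtain ⟨u, hu1, hu2⟩ := isUnit_iff_exists.1 h
  refine isUnit_iff_exists.2 ⟨1 + b * u * a, ?_, ?_⟩
  · have e : (1 - b * a) * (1 + b * u * a) = 1 - b * a + b * ((1 - a * b) * u) * a := by noncomm_ring
    rw [e, hu1]; noncomm_ring
  · have e : (1 + b * u * a) * (1 - b * a) = 1 - b * a + b * (u * (1 - a * b)) * a := by noncomm_ring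
    rw [e, hu2]; noncomm_ring

lemma reflL2_sechL2 (f : L2) : reflL2 (sechL2 f) = sechL2 (reflL2 f) :=
  reflL2_mulL2 _ (fun x => by rw [neg_div, Real.cosh_neg]) f

lemma reflL2_besselL2 (f : L2) : reflL2 (besselL2 f) = besselL2 (reflL2 f) :=
  reflL2_fmulL2 _ besselSymbol_neg f

/-- The limit `-3 (1 - ∂²)⁻¹ sech²(x/2)` on the even functions, extended by `0` to the odd ones. -/
def limitOp : L2 →L[ℂ] L2 := -((3 : ℂ) • (besselL2 * (sechL2 * (sechL2 * evenPart))))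

/-- The symmetrized form `1 - 3 sech (1 - ∂²)⁻¹ sech` of `1 + limitOp`. -/
def symmOp : L2 →L[ℂ] L2 := 1 - (3 : ℂ) • (sechL2 * (besselL2 * (sechL2 * evenPart)))

lemma symmOp_apply (f : L2) :
    symmOp f = f - (3 : ℂ) • sechL2 (besselL2 (sechL2 (evenPart f))) := rfl

lemma norm_sechL2_apply_le (f : L2) : ‖sechL2 f‖ ≤ ‖f‖ := by
  have := (mulL2 isBddMul_sech).le_of_opNorm_le (norm_mulL2_le isBddMul_sech) f
  rwa [one_mul] at this

/-- With `g` the even part of `f`, `y = (1 - ∂²)⁻¹ sech g` solves `L y = sech b` for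
`b = g - 3 sech y`, so the lower bound for `L` controls `y`, hence `g`, by `b`. On the odd part
`symmOp` is the identity. -/
lemma norm_le_symmOp (f : L2) : ‖f‖ ≤ 9 * ‖symmOp f‖ := by
  set g := evenPart f with hg
  set y := besselL2 (sechL2 g) with hy
  set b := g - (3 : ℂ) • sechL2 y with hb
  have hsg : evenPart (sechL2 g) = sechL2 g := by
    rw [evenPart_comm reflL2_sechL2, hg, evenPart_of_even (reflL2_evenPart f)]
  have h1 := ladder_L2 (sechL2 g)
  rw [hsg, ← hy] at h1
  have h2 : sechL2 g - (3 : ℂ) • sechL2 (sechL2 y) = sechL2 b := by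
    rw [hb, map_sub, map_smul]
  rw [h2] at h1
  have h3 := norm_sechL2_apply_le b
  have h4 : ‖y‖ ≤ 2 * ‖b‖ := by
    refine abs_le_of_sq_le_sq' ?_ (by positivity) |>.2
    have : ‖sechL2 b‖ ^ 2 ≤ ‖b‖ ^ 2 := by gcongr
    nlinarith [sq_nonneg ‖b‖]
  have h5 : ‖g‖ ≤ 7 * ‖b‖ := by
    have e : g = b + (3 : ℂ) • sechL2 y := by rw [hb]; abel
    have h6 := norm_add_le b ((3 : ℂ) • sechL2 y)
    rw [← e, norm_smul] at h6
    have h7 := norm_sechL2_apply_le y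
    norm_num at h6
    linarith
  have e1 : evenPart (symmOp f) = b := by
    rw [symmOp_apply, map_sub, map_smul, evenPart_comm reflL2_sechL2, evenPart_comm reflL2_besselL2,
      evenPart_comm reflL2_sechL2, ← hg, evenPart_of_even (reflL2_evenPart f)]
  have e2 : symmOp f - b = f - g := by
    rw [symmOp_apply, hb, hy]; abel
  have h8 : ‖b‖ ≤ ‖symmOp f‖ := by
    rw [← e1]
    have := evenPart.le_of_opNorm_le norm_evenPart_le (symmOp f)
    rwa [one_mul] at this
  have h9 : ‖f‖ ≤ ‖f - g‖ + ‖g‖ := by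
    have := norm_add_le (f - g) g
    rwa [sub_add_cancel] at this
  rw [← e2] at h9
  have h10 := norm_sub_le (symmOp f) b
  linarith

lemma inner_evenPart (f g : L2) : inner ℂ (evenPart f) g = inner ℂ f (evenPart g) := by
  rw [evenPart_apply, evenPart_apply, inner_smul_left, inner_smul_right, inner_add_left,
    inner_add_right, inner_reflL2]
  congr 1
  simpa using Complex.conj_ofReal 2

lemma inner_sechL2 (f g : L2) : inner ℂ (sechL2 f) g = inner ℂ f (sechL2 g) :=
  inner_mulL2 _ (fun _ => Complex.conj_ofReal _) f g

lemma inner_besselL2 (f g : L2) : inner ℂ (besselL2 f) g = inner ℂ f (besselL2 g) :=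
  inner_fmulL2 _ (fun _ => Complex.conj_ofReal _) f g

lemma inner_symmOp (f g : L2) : inner ℂ (symmOp f) g = inner ℂ f (symmOp g) := by
  rw [symmOp_apply, symmOp_apply, inner_sub_left, inner_sub_right, inner_smul_left,
    inner_smul_right, inner_sechL2, inner_besselL2, inner_sechL2, inner_evenPart,
    evenPart_comm reflL2_sechL2, evenPart_comm reflL2_besselL2, evenPart_comm reflL2_sechL2]
  congr 2
  exact Complex.conj_ofReal 3

/-- A self-adjoint operator that is bounded below is invertible. -/
lemma isUnit_symmOp : IsUnit symmOp := by
  rw [ContinuousLinearMap.isUnit_iff_bijective,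
    ContinuousLinearMap.bijective_iff_dense_range_and_antilipschitz]
  refine ⟨?_, 9, AddMonoidHomClass.antilipschitz_of_bound symmOp fun f => ?_⟩
  · rw [Submodule.topologicalClosure_eq_top_iff, Submodule.eq_bot_iff]
    intro h hh
    have h0 : symmOp h = 0 := by
      rw [← inner_self_eq_zero (𝕜 := ℂ), ← inner_symmOp]
      exact (Submodule.mem_orthogonal _ _).1 hh _ ⟨symmOp h, rfl⟩
    have := norm_le_symmOp h
    rw [h0, norm_zero, mul_zero] at this
    exact norm_le_zero_iff.1 this
  · exact_mod_cast norm_le_symmOp f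

/-- The linearized KdV operator is invertible on the even functions. -/
lemma isUnit_one_add_limitOp : IsUnit (1 + limitOp) := by
  have h := isUnit_symmOp
  have e1 : symmOp = 1 - sechL2 * ((3 : ℂ) • (besselL2 * (sechL2 * evenPart))) := by
    rw [symmOp, mul_smul_comm]
  have e2 : 1 + limitOp = 1 - ((3 : ℂ) • (besselL2 * (sechL2 * evenPart))) * sechL2 := by
    rw [limitOp, ← sub_eq_add_neg, smul_mul_assoc, mul_assoc, mul_assoc]
    have e3 : sechL2 * evenPart = evenPart * sechL2 := by
      ext1 f
      exact (evenPart_comm reflL2_sechL2 f).symm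
    rw [← e3]
  rw [e1] at h
  rw [e2]
  exact isUnit_one_sub_mul_swap h

section

open scoped ContDiff

/-! ### Weak derivatives in `L²` -/

/-- `g'` is the derivative of `g` in `L²(ℝ)`, expressed on the Fourier side. -/
structure IsWeakDeriv (g g' : ℝ → ℂ) : Prop where
  memLp : MemLp g 2 volume
  memLp' : MemLp g' 2 volume
  fourier : fourierL2 g' =ᵐ[volume] fun ξ => 2 * Real.pi * Complex.I * ξ * fourierL2 g ξ

lemma integral_schwartz_mul_fourierInv {g : ℝ → ℂ} (hg : MemLp g 2 volume) (φ : 𝓢(ℝ, ℂ)) :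
    ∫ x, φ x * g x = ∫ ξ, (𝓕⁻ φ : 𝓢(ℝ, ℂ)) ξ * fourierL2 g ξ := by
  have h2 := congrArg (fun T => T (𝓕⁻ φ : 𝓢(ℝ, ℂ))) (Lp.fourier_toTemperedDistribution_eq (hg.toLp g))
  simp only [TemperedDistribution.fourier_apply, Lp.toTemperedDistribution_apply,
    FourierTransform.fourier_fourierInv_eq, smul_eq_mul] at h2
  rw [fourierL2_eq hg, ← h2]
  refine integral_congr_ae ?_
  filter_upwards [hg.coeFn_toLp] with x hx
  rw [hx]

lemma fourierInv_derivCLM (φ : 𝓢(ℝ, ℂ)) (ξ : ℝ) :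
    (𝓕⁻ (derivCLM ℂ ℂ φ) : 𝓢(ℝ, ℂ)) ξ = -(2 * Real.pi * Complex.I * ξ) * (𝓕⁻ φ : 𝓢(ℝ, ℂ)) ξ := by
  rw [fourierInv_coe, fourierInv_coe, Real.fourierInv_eq_fourier_neg, Real.fourierInv_eq_fourier_neg]
  have := congrFun (Real.fourier_deriv (f := φ) φ.integrable φ.differentiable
    (derivCLM ℂ ℂ φ).integrable) (-ξ)
  refine this.trans ?_
  rw [smul_eq_mul]
  push_cast
  ring

lemma MemLp.integrable_schwartz_mul {g : ℝ → ℂ} (hg : MemLp g 2 volume) (φ : 𝓢(ℝ, ℂ)) :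
    Integrable fun x => φ x * g x :=
  (φ.memLp 2).integrable_mul hg

/-- Weak derivatives may be tested against Schwartz functions. -/
lemma isWeakDeriv_iff {g g' : ℝ → ℂ} (hg : MemLp g 2 volume) (hg' : MemLp g' 2 volume) :
    IsWeakDeriv g g' ↔
      ∀ φ : 𝓢(ℝ, ℂ), ∫ x, derivCLM ℂ ℂ φ x * g x = -∫ x, φ x * g' x := by
  have key : ∀ φ : 𝓢(ℝ, ℂ), ∫ x, derivCLM ℂ ℂ φ x * g x
      = -∫ ξ, (𝓕⁻ φ : 𝓢(ℝ, ℂ)) ξ * (2 * Real.pi * Complex.I * ξ * fourierL2 g ξ) := by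
    intro φ
    rw [integral_schwartz_mul_fourierInv hg, ← integral_neg]
    congr 1
    funext ξ
    rw [fourierInv_derivCLM]
    ring
  constructor
  · intro h φ
    rw [key, integral_schwartz_mul_fourierInv hg']
    congr 1
    refine integral_congr_ae ?_
    filter_upwards [h.fourier] with ξ hξ
    rw [hξ]
  · intro h
    refine ⟨hg, hg', ?_⟩
    refine ae_eq_of_integral_contDiff_smul_eq ((Lp.memLp _).locallyIntegrable (by norm_num)) ?_ ?_
    · have h1 : LocallyIntegrable (fun ξ => fourierL2 g ξ) (volume : Measure ℝ) :=
        (Lp.memLp _).locallyIntegrable (by norm_num)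
      rw [← locallyIntegrableOn_univ] at h1 ⊢
      exact h1.continuousOn_mul (by fun_prop) isOpen_univ.isLocallyClosed
    · intro u hu hc
      have hg₁ : HasCompactSupport (Complex.ofRealCLM ∘ u) := hc.comp_left rfl
      have hg₂ : ContDiff ℝ ∞ (Complex.ofRealCLM ∘ u) := by fun_prop
      have h1 := h (𝓕 (hg₁.toSchwartzMap hg₂))
      rw [key, integral_schwartz_mul_fourierInv hg', FourierTransform.fourierInv_fourier_eq] at h1
      have h2 := neg_injective h1
      simpa using h2.symm

/-! ### Smooth functions with bounded derivatives -/

/-- `ψ` has `n` derivatives, all of them bounded. -/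
def HasBddDerivs : ℕ → (ℝ → ℂ) → Prop
  | 0, ψ => Continuous ψ ∧ ∃ C, ∀ x, ‖ψ x‖ ≤ C
  | n + 1, ψ => (∃ C, ∀ x, ‖ψ x‖ ≤ C) ∧ ∃ ψ', (∀ x, HasDerivAt ψ (ψ' x) x) ∧ HasBddDerivs n ψ'

/-- `ψ` is smooth, and bounded together with all its derivatives. -/
def SmoothBdd (ψ : ℝ → ℂ) : Prop := ∀ n, HasBddDerivs n ψ

lemma HasBddDerivs.bdd {n : ℕ} {ψ : ℝ → ℂ} (h : HasBddDerivs n ψ) : ∃ C, ∀ x, ‖ψ x‖ ≤ C := by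
  cases n with
  | zero => exact h.2
  | succ n => exact h.1

lemma HasBddDerivs.continuous {n : ℕ} {ψ : ℝ → ℂ} (h : HasBddDerivs n ψ) : Continuous ψ := by
  cases n with
  | zero => exact h.1
  | succ n =>
    obtain ⟨-, ψ', h1, -⟩ := h
    exact continuous_iff_continuousAt.2 fun x => (h1 x).continuousAt

lemma HasBddDerivs.of_succ {n : ℕ} {ψ : ℝ → ℂ} (h : HasBddDerivs (n + 1) ψ) : HasBddDerivs n ψ := by
  induction n generalizing ψ with
  | zero => exact ⟨h.continuous, h.bdd⟩
  | succ n ih =>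
    obtain ⟨h0, ψ', h1, h2⟩ := h
    exact ⟨h0, ψ', h1, ih h2⟩

lemma HasBddDerivs.add {n : ℕ} {f g : ℝ → ℂ} (hf : HasBddDerivs n f) (hg : HasBddDerivs n g) :
    HasBddDerivs n (fun x => f x + g x) := by
  have hb : ∃ C, ∀ x, ‖f x + g x‖ ≤ C := by
    obtain ⟨C, hC⟩ := hf.bdd
    obtain ⟨D, hD⟩ := hg.bdd
    exact ⟨C + D, fun x => (norm_add_le _ _).trans (add_le_add (hC x) (hD x))⟩
  induction n generalizing f g with
  | zero => exact ⟨hf.continuous.add hg.continuous, hb⟩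
  | succ n ih =>
    obtain ⟨-, f', h1, h2⟩ := hf
    obtain ⟨-, g', h3, h4⟩ := hg
    refine ⟨hb, _, fun x => (h1 x).add (h3 x), ih h2 h4 ?_⟩
    obtain ⟨C, hC⟩ := h2.bdd
    obtain ⟨D, hD⟩ := h4.bdd
    exact ⟨C + D, fun x => (norm_add_le _ _).trans (add_le_add (hC x) (hD x))⟩

lemma HasBddDerivs.mul {n : ℕ} {f g : ℝ → ℂ} (hf : HasBddDerivs n f) (hg : HasBddDerivs n g) :
    HasBddDerivs n (fun x => f x * g x) := by
  have hb : ∃ C, ∀ x, ‖f x * g x‖ ≤ C := by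
    obtain ⟨C, hC⟩ := hf.bdd
    obtain ⟨D, hD⟩ := hg.bdd
    refine ⟨C * D, fun x => ?_⟩
    rw [norm_mul]
    exact mul_le_mul (hC x) (hD x) (norm_nonneg _) ((norm_nonneg _).trans (hC x))
  induction n generalizing f g with
  | zero => exact ⟨hf.continuous.mul hg.continuous, hb⟩
  | succ n ih =>
    have hf0 := hf.of_succ
    have hg0 := hg.of_succ
    obtain ⟨-, f', h1, h2⟩ := hf
    obtain ⟨-, g', h3, h4⟩ := hg
    have hbm : ∀ {u v : ℝ → ℂ}, HasBddDerivs n u → HasBddDerivs n v → ∃ C, ∀ x, ‖u x * v x‖ ≤ C := by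
      intro u v hu hv
      obtain ⟨C, hC⟩ := hu.bdd
      obtain ⟨D, hD⟩ := hv.bdd
      refine ⟨C * D, fun x => ?_⟩
      rw [norm_mul]
      exact mul_le_mul (hC x) (hD x) (norm_nonneg _) ((norm_nonneg _).trans (hC x))
    exact ⟨hb, _, fun x => (h1 x).mul (h3 x),
      (ih h2 hg0 (hbm h2 hg0)).add (ih hf0 h4 (hbm hf0 h4))⟩

lemma SmoothBdd.add {f g : ℝ → ℂ} (hf : SmoothBdd f) (hg : SmoothBdd g) :
    SmoothBdd (fun x => f x + g x) := fun n => (hf n).add (hg n)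

lemma SmoothBdd.mul {f g : ℝ → ℂ} (hf : SmoothBdd f) (hg : SmoothBdd g) :
    SmoothBdd (fun x => f x * g x) := fun n => (hf n).mul (hg n)

lemma smoothBdd_const (c : ℂ) : SmoothBdd fun _ => c := by
  intro n
  induction n generalizing c with
  | zero => exact ⟨continuous_const, ‖c‖, fun _ => le_rfl⟩
  | succ n ih => exact ⟨⟨‖c‖, fun _ => le_rfl⟩, _, fun x => hasDerivAt_const x c, ih 0⟩

lemma SmoothBdd.const_mul {f : ℝ → ℂ} (hf : SmoothBdd f) (c : ℂ) :
    SmoothBdd (fun x => c * f x) := (smoothBdd_const c).mul hf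

lemma SmoothBdd.continuous {f : ℝ → ℂ} (hf : SmoothBdd f) : Continuous f := (hf 0).1

lemma SmoothBdd.isBddMul {f : ℝ → ℂ} (hf : SmoothBdd f) : ∃ C, IsBddMul f C := by
  obtain ⟨C, hC⟩ := (hf 0).2
  exact ⟨C, hf.continuous.aestronglyMeasurable, hC⟩

lemma SmoothBdd.deriv {f : ℝ → ℂ} (hf : SmoothBdd f) :
    ∃ f', (∀ x, HasDerivAt f (f' x) x) ∧ SmoothBdd f' := by
  obtain ⟨-, f', h1, h2⟩ := hf 1
  refine ⟨f', h1, fun n => ?_⟩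
  obtain ⟨-, g, h3, h4⟩ := hf (n + 1)
  have : g = f' := funext fun x => (h3 x).unique (h1 x)
  exact this ▸ h4

/-- A bounded solution of `ψ' = a ψ` is as smooth as `a`. -/
lemma smoothBdd_of_log_deriv {a ψ : ℝ → ℂ} (ha : SmoothBdd a) {C : ℝ} (hψ : ∀ x, ‖ψ x‖ ≤ C)
    (hd : ∀ x, HasDerivAt ψ (a x * ψ x) x) : SmoothBdd ψ := by
  intro n
  induction n with
  | zero => exact ⟨continuous_iff_continuousAt.2 fun x => (hd x).continuousAt, C, hψ⟩
  | succ n ih => exact ⟨⟨C, hψ⟩, _, hd, (ha n).mul ih⟩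

lemma SmoothBdd.iteratedDeriv_bdd {ψ : ℝ → ℂ} (h : SmoothBdd ψ) (n : ℕ) :
    ContDiff ℝ n ψ ∧ ∃ C, ∀ x, ‖iteratedDeriv n ψ x‖ ≤ C := by
  induction n generalizing ψ with
  | zero =>
    refine ⟨contDiff_zero.2 h.continuous, ?_⟩
    simpa using (h 0).2
  | succ n ih =>
    obtain ⟨ψ', h1, h2⟩ := h.deriv
    have e : _root_.deriv ψ = ψ' := funext fun x => (h1 x).deriv
    obtain ⟨h3, h4⟩ := ih h2
    refine ⟨?_, ?_⟩
    · push_cast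
      rw [contDiff_succ_iff_deriv]
      exact ⟨fun x => (h1 x).differentiableAt, by simp, e ▸ h3⟩
    · rw [iteratedDeriv_succ', e]
      exact h4

lemma SmoothBdd.hasTemperateGrowth {ψ : ℝ → ℂ} (h : SmoothBdd ψ) : ψ.HasTemperateGrowth := by
  refine ⟨contDiff_infty.2 fun n => (h.iteratedDeriv_bdd n).1, fun n => ?_⟩
  obtain ⟨C, hC⟩ := (h.iteratedDeriv_bdd n).2
  refine ⟨0, C, fun x => ?_⟩
  rw [norm_iteratedFDeriv_eq_norm_iteratedDeriv]
  simpa using hC x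

/-- The product rule. -/
lemma IsWeakDeriv.mul {g g' ψ ψ' : ℝ → ℂ} (hg : IsWeakDeriv g g') (hψ : SmoothBdd ψ)
    (hψ' : SmoothBdd ψ') (hd : ∀ x, HasDerivAt ψ (ψ' x) x) :
    IsWeakDeriv (fun x => ψ x * g x) (fun x => ψ' x * g x + ψ x * g' x) := by
  obtain ⟨C, hC⟩ := hψ.isBddMul
  obtain ⟨D, hD⟩ := hψ'.isBddMul
  have m1 := hC.memLp hg.memLp
  have m2 := hD.memLp hg.memLp
  have m3 := hC.memLp hg.memLp'
  refine (isWeakDeriv_iff m1 (m2.add m3)).2 fun φ => ?_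
  set η : 𝓢(ℝ, ℂ) := smulLeftCLM ℂ ψ φ with hη
  have eη : ∀ x, η x = ψ x * φ x := fun x =>
    smulLeftCLM_apply_apply hψ.hasTemperateGrowth φ x
  have eη' : ∀ x, derivCLM ℂ ℂ η x = ψ' x * φ x + ψ x * derivCLM ℂ ℂ φ x := by
    intro x
    have h1 : HasDerivAt η (ψ' x * φ x + ψ x * derivCLM ℂ ℂ φ x) x := by
      rw [show (η : ℝ → ℂ) = fun x => ψ x * φ x from funext eη]
      exact (hd x).mul (φ.hasDerivAt x)
    exact h1.deriv
  have h1 := (isWeakDeriv_iff hg.memLp hg.memLp').1 hg η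
  have i1 := MemLp.integrable_schwartz_mul m1 (derivCLM ℂ ℂ φ)
  have i2 := MemLp.integrable_schwartz_mul m2 φ
  have i3 := MemLp.integrable_schwartz_mul m3 φ
  have e1 : ∫ x, derivCLM ℂ ℂ η x * g x
      = (∫ x, φ x * (ψ' x * g x)) + ∫ x, derivCLM ℂ ℂ φ x * (ψ x * g x) := by
    rw [← integral_add i2 i1]
    congr 1
    funext x
    rw [eη']
    ring
  have e2 : ∫ x, η x * g' x = ∫ x, φ x * (ψ x * g' x) := by
    congr 1
    funext x
    rw [eη]
    ring
  have e3 : ∫ x, φ x * (ψ' x * g x + ψ x * g' x)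
      = (∫ x, φ x * (ψ' x * g x)) + ∫ x, φ x * (ψ x * g' x) := by
    rw [← integral_add i2 i3]
    congr 1
    funext x
    ring
  rw [e1, e2] at h1
  simp only [Pi.add_apply]
  rw [e3]
  linear_combination h1

end

/-! ### Sobolev norms and interpolation -/

/-- The `H^r` norm of a square-integrable function, with value `∞` outside `H^r`. -/
def hNorm (r : ℝ) (g : ℝ → ℂ) : ℝ≥0∞ := eLpNorm (besselFourier r g) 2 volume

lemma norm_besselFourier (r : ℝ) (g : ℝ → ℂ) (ξ : ℝ) :
    ‖besselFourier r g ξ‖ = (1 + (2 * Real.pi * ξ) ^ 2) ^ (r / 2) * ‖fourierL2 g ξ‖ := by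
  rw [besselFourier, norm_mul, Complex.norm_real, Real.norm_of_nonneg (by positivity)]

lemma one_le_japanese (ξ : ℝ) : 1 ≤ 1 + (2 * Real.pi * ξ) ^ 2 := by
  linarith [sq_nonneg (2 * Real.pi * ξ)]

lemma continuous_japanese_rpow (r : ℝ) :
    Continuous fun ξ : ℝ => (1 + (2 * Real.pi * ξ) ^ 2) ^ r := by
  refine Continuous.rpow_const (by fun_prop) fun ξ => Or.inl ?_
  linarith [one_le_japanese ξ]

lemma aesm_besselFourier (r : ℝ) (g : ℝ → ℂ) :
    AEStronglyMeasurable (besselFourier r g) volume :=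
  (Complex.continuous_ofReal.comp (continuous_japanese_rpow (r / 2))).aestronglyMeasurable.mul
    (Lp.aestronglyMeasurable (fourierL2 g))

lemma memH_iff {r : ℝ} {g : ℝ → ℂ} (hg : MemLp g 2 volume) : MemH r g ↔ hNorm r g < ∞ :=
  ⟨fun h => h.2.2, fun h => ⟨hg, aesm_besselFourier r g, h⟩⟩

lemma hNorm_congr {r : ℝ} {g h : ℝ → ℂ} (e : g =ᵐ[volume] h) : hNorm r g = hNorm r h := by
  rw [hNorm, besselFourier_congr r e, hNorm]

lemma hNorm_le_mul {r s c : ℝ} {g h : ℝ → ℂ}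
    (H : ∀ᵐ ξ, ‖besselFourier r g ξ‖ ≤ c * ‖besselFourier s h ξ‖) :
    hNorm r g ≤ ENNReal.ofReal c * hNorm s h :=
  eLpNorm_le_mul_eLpNorm_of_ae_le_mul H 2

lemma hNorm_zero {g : ℝ → ℂ} (hg : MemLp g 2 volume) : hNorm 0 g = eLpNorm g 2 volume := by
  rw [← eLpNorm_fourierL2 hg, hNorm]
  refine eLpNorm_congr_norm_ae (Eventually.of_forall fun ξ => ?_)
  rw [norm_besselFourier, zero_div, Real.rpow_zero, one_mul]

lemma hNorm_mono {r s : ℝ} (h : r ≤ s) (g : ℝ → ℂ) : hNorm r g ≤ hNorm s g := by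
  have := hNorm_le_mul (r := r) (s := s) (c := 1) (g := g) (h := g)
    (Eventually.of_forall fun ξ => by
      rw [norm_besselFourier, norm_besselFourier, one_mul]
      gcongr
      exact one_le_japanese ξ)
  simpa using this

lemma hNorm_add_le {r : ℝ} {g h : ℝ → ℂ} (hg : MemLp g 2 volume) (hh : MemLp h 2 volume) :
    hNorm r (fun x => g x + h x) ≤ hNorm r g + hNorm r h := by
  refine (eLpNorm_congr_ae (besselFourier_add r hg hh)).trans_le ?_
  exact eLpNorm_add_le (aesm_besselFourier r g) (aesm_besselFourier r h) (by norm_num)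

lemma hNorm_const_mul {r : ℝ} (c : ℂ) {g : ℝ → ℂ} (hg : MemLp g 2 volume) :
    hNorm r (fun x => c * g x) = ‖c‖ₑ * hNorm r g := by
  refine (eLpNorm_congr_ae (besselFourier_smul r c hg)).trans ?_
  rw [eLpNorm_const_smul, hNorm]

lemma sqrt_japanese_le (k : ℝ) : (1 + k ^ 2) ^ (1 / 2 : ℝ) ≤ 1 + |k| := by
  rw [← Real.sqrt_eq_rpow]
  refine Real.sqrt_le_iff.2 ⟨by positivity, ?_⟩
  nlinarith [sq_abs k, abs_nonneg k]

lemma abs_le_sqrt_japanese (k : ℝ) : |k| ≤ (1 + k ^ 2) ^ (1 / 2 : ℝ) := by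
  rw [← Real.sqrt_eq_rpow]
  exact Real.abs_le_sqrt (by linarith)

lemma norm_two_pi_I (ξ : ℝ) : ‖(2 * Real.pi * Complex.I * ξ : ℂ)‖ = |2 * Real.pi * ξ| := by
  rw [show (2 * Real.pi * Complex.I * ξ : ℂ) = ((2 * Real.pi * ξ : ℝ) : ℂ) * Complex.I by
    push_cast; ring, norm_mul, Complex.norm_I, mul_one, Complex.norm_real, Real.norm_eq_abs]

lemma IsWeakDeriv.hNorm_succ_le {g g' : ℝ → ℂ} (h : IsWeakDeriv g g') (r : ℝ) :
    hNorm (r + 1) g ≤ hNorm r g + hNorm r g' := by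
  have h1 : hNorm (r + 1) g ≤ eLpNorm (fun ξ => (‖besselFourier r g ξ‖ + ‖besselFourier r g' ξ‖ : ℝ))
      2 volume := by
    refine eLpNorm_mono_ae ?_
    filter_upwards [h.fourier] with ξ hξ
    rw [Real.norm_of_nonneg (by positivity), norm_besselFourier, norm_besselFourier,
      norm_besselFourier, hξ, norm_mul, norm_two_pi_I, add_div,
      Real.rpow_add (by linarith [one_le_japanese ξ])]
    have := sqrt_japanese_le (2 * Real.pi * ξ)
    calc _ = (1 + (2 * Real.pi * ξ) ^ 2) ^ (r / 2) * ‖fourierL2 g ξ‖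
          * (1 + (2 * Real.pi * ξ) ^ 2) ^ (1 / 2 : ℝ) := by ring
      _ ≤ (1 + (2 * Real.pi * ξ) ^ 2) ^ (r / 2) * ‖fourierL2 g ξ‖ * (1 + |2 * Real.pi * ξ|) := by
          gcongr
      _ = _ := by ring
  refine h1.trans ((eLpNorm_add_le (aesm_besselFourier r g).norm (aesm_besselFourier r g').norm
    (by norm_num)).trans (le_of_eq ?_))
  rw [eLpNorm_norm, eLpNorm_norm, hNorm, hNorm]

lemma IsWeakDeriv.hNorm_le {g g' : ℝ → ℂ} (h : IsWeakDeriv g g') (r : ℝ) :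
    hNorm r g' ≤ hNorm (r + 1) g := by
  have := hNorm_le_mul (r := r) (s := r + 1) (c := 1) (g := g') (h := g) (by
    filter_upwards [h.fourier] with ξ hξ
    rw [norm_besselFourier, norm_besselFourier, hξ, norm_mul, norm_two_pi_I, add_div,
      Real.rpow_add (by linarith [one_le_japanese ξ]), one_mul]
    have := abs_le_sqrt_japanese (2 * Real.pi * ξ)
    calc _ = (1 + (2 * Real.pi * ξ) ^ 2) ^ (r / 2) * ‖fourierL2 g ξ‖ * |2 * Real.pi * ξ| := by ring
      _ ≤ (1 + (2 * Real.pi * ξ) ^ 2) ^ (r / 2) * ‖fourierL2 g ξ‖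
          * (1 + (2 * Real.pi * ξ) ^ 2) ^ (1 / 2 : ℝ) := by gcongr
      _ = _ := by ring)
  simpa using this

lemma exists_isWeakDeriv {r : ℝ} (hr : 0 ≤ r) {g : ℝ → ℂ} (hg : MemLp g 2 volume)
    (h : hNorm (r + 1) g < ∞) : ∃ g', IsWeakDeriv g g' := by
  have hm : MemLp (fun ξ => 2 * Real.pi * Complex.I * ξ * fourierL2 g ξ) 2 volume := by
    refine MemLp.of_le (g := besselFourier (r + 1) g) ⟨aesm_besselFourier _ g, h⟩
      ((Continuous.aestronglyMeasurable (by fun_prop)).mul (Lp.aestronglyMeasurable _))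
      (Eventually.of_forall fun ξ => ?_)
    rw [norm_besselFourier, norm_mul, norm_two_pi_I]
    gcongr
    refine (abs_le_sqrt_japanese _).trans ?_
    have := one_le_japanese ξ
    gcongr
    linarith
  obtain ⟨g', h1, -⟩ := exists_fourierL2_eq hm
  exact ⟨g', hg, Lp.memLp g', h1⟩

/-- Smooth bounded functions are multipliers of `H^n`, for integers `n`. -/
lemma exists_hNorm_mul_le_nat (n : ℕ) {ψ : ℝ → ℂ} (hψ : SmoothBdd ψ) :
    ∃ C : ℝ, 0 < C ∧ ∀ g : ℝ → ℂ, MemLp g 2 volume →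
      hNorm n (fun x => ψ x * g x) ≤ ENNReal.ofReal C * hNorm n g := by
  induction n generalizing ψ with
  | zero =>
    obtain ⟨C, hC⟩ := hψ.isBddMul
    refine ⟨C + 1, by linarith [hC.nonneg], fun g hg => ?_⟩
    rw [Nat.cast_zero, hNorm_zero (hC.memLp hg), hNorm_zero hg]
    refine eLpNorm_le_mul_eLpNorm_of_ae_le_mul (Eventually.of_forall fun x => ?_) 2
    rw [norm_mul]
    gcongr
    linarith [hC.bound x]
  | succ n ih =>
    obtain ⟨ψ', h1, h2⟩ := hψ.deriv
    obtain ⟨C, hC, hC2⟩ := ih hψ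
    obtain ⟨D, hD, hD2⟩ := ih h2
    obtain ⟨B, hB⟩ := hψ.isBddMul
    obtain ⟨B', hB'⟩ := h2.isBddMul
    refine ⟨C + D + C, by positivity, fun g hg => ?_⟩
    push_cast
    by_cases hfin : hNorm (n + 1) g < ∞
    · obtain ⟨g', hg'⟩ := exists_isWeakDeriv n.cast_nonneg hg hfin
      have a1 := (hg'.mul hψ h2 h1).hNorm_succ_le n
      have a2 := hNorm_add_le (r := n) (hB'.memLp hg) (hB.memLp hg'.memLp')
      have a3 := hC2 g hg
      have a4 := hD2 g hg
      have a5 := hC2 g' hg'.memLp'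
      have a6 := hg'.hNorm_le n
      have a7 := hNorm_mono (show (n : ℝ) ≤ n + 1 by linarith) g
      calc hNorm (n + 1) (fun x => ψ x * g x)
          ≤ hNorm n (fun x => ψ x * g x)
            + (hNorm n (fun x => ψ' x * g x) + hNorm n (fun x => ψ x * g' x)) := by
            exact a1.trans (add_le_add le_rfl a2)
        _ ≤ ENNReal.ofReal C * hNorm (n + 1) g + (ENNReal.ofReal D * hNorm (n + 1) g
            + ENNReal.ofReal C * hNorm (n + 1) g) := by
            refine add_le_add (a3.trans (by gcongr)) (add_le_add (a4.trans (by gcongr))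
              (a5.trans (by gcongr)))
        _ = _ := by
          rw [ENNReal.ofReal_add (by positivity) hC.le, ENNReal.ofReal_add hC.le hD.le]
          ring
    · rw [not_lt_top_iff.1 hfin, ENNReal.mul_top]
      · exact le_top
      · simpa using by positivity

/-- The scale-invariant integral behind the interpolation of weighted norms. -/
lemma exists_interpolation_const {θ : ℝ} (h0 : 0 < θ) (h1 : θ < 1) : ∃ c : ℝ, 0 < c ∧
    ∀ W : ℝ, 0 < W → ∫⁻ s in Set.Ioi (0 : ℝ), ENNReal.ofReal (s ^ (-θ - 1) * (s * W / (1 + s * W)))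
      = ENNReal.ofReal (c * W ^ θ) := by
  set f : ℝ → ℝ := fun u => u ^ (-θ) / (1 + u) with hf
  have hfm : AEStronglyMeasurable f (volume.restrict (Set.Ioi 0)) := by
    refine ContinuousOn.aestronglyMeasurable (fun u hu => ?_) measurableSet_Ioi
    have hu0 : (0 : ℝ) < u := hu
    have h2 : (1 + u) ≠ 0 := by positivity
    exact ((Real.continuousAt_rpow_const u (-θ) (Or.inl hu0.ne')).div (by fun_prop) h2).continuousWithinAt
  have hfi : IntegrableOn f (Set.Ioi 0) := by
    rw [← Set.Ioc_union_Ioi_eq_Ioi (zero_le_one (α := ℝ)), integrableOn_union]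
    constructor
    · have h3 : IntegrableOn (fun u : ℝ => u ^ (-θ)) (Set.Ioc 0 1) :=
        (intervalIntegrable_iff_integrableOn_Ioc_of_le zero_le_one).1
          (intervalIntegral.intervalIntegrable_rpow' (by linarith))
      refine Integrable.mono' h3 (hfm.mono_set fun u hu => hu.1) ?_
      filter_upwards [ae_restrict_mem measurableSet_Ioc] with u hu
      have hu0 : 0 < u := hu.1
      rw [Real.norm_of_nonneg (by positivity)]
      exact div_le_self (by positivity) (by linarith)
    · have h3 : IntegrableOn (fun u : ℝ => u ^ (-θ - 1)) (Set.Ioi 1) :=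
        integrableOn_Ioi_rpow_of_lt (by linarith) one_pos
      refine Integrable.mono' h3 (hfm.mono_set fun u (hu : 1 < u) => zero_lt_one.trans hu) ?_
      filter_upwards [ae_restrict_mem measurableSet_Ioi] with u hu
      have hu0 : 0 < u := zero_lt_one.trans hu
      rw [Real.norm_of_nonneg (by positivity), Real.rpow_sub_one hu0.ne']
      simp only [hf]
      gcongr
      linarith
  have hpos : 0 < ∫ u in Set.Ioi 0, f u := by
    rw [setIntegral_pos_iff_support_of_nonneg_ae _ hfi]
    · have : Set.Ioi (0 : ℝ) ⊆ Function.support f ∩ Set.Ioi 0 := fun u hu => by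
        have hu0 : (0 : ℝ) < u := hu
        exact ⟨by simp only [Function.mem_support, hf]; positivity, hu⟩
      exact lt_of_lt_of_le (by simp) (measure_mono this)
    · filter_upwards [ae_restrict_mem measurableSet_Ioi] with u hu
      have hu0 : (0 : ℝ) < u := hu
      simp only [hf, Pi.zero_apply]
      positivity
  refine ⟨_, hpos, fun W hW => ?_⟩
  have e1 : ∀ s ∈ Set.Ioi (0 : ℝ), s ^ (-θ - 1) * (s * W / (1 + s * W))
      = W ^ (θ + 1) * f (W * s) := by
    intro s hs
    have hs0 : (0 : ℝ) < s := hs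
    simp only [hf]
    rw [Real.mul_rpow hW.le hs0.le, Real.rpow_sub_one hs0.ne', Real.rpow_add_one hW.ne',
      Real.rpow_neg hW.le]
    have : W ^ θ ≠ 0 := by positivity
    field_simp
  have hint : IntegrableOn (fun s => W ^ (θ + 1) * f (W * s)) (Set.Ioi 0) := by
    have := (integrableOn_Ioi_comp_mul_left_iff f 0 hW).2 (by simpa using hfi)
    exact this.const_mul _
  rw [setLIntegral_congr_fun measurableSet_Ioi (fun s hs => by simp only [e1 s hs]; rfl),
    ← ofReal_integral_eq_lintegral_ofReal hint]
  · congr 1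
    rw [integral_const_mul, integral_comp_mul_left_Ioi f 0 hW, mul_zero, smul_eq_mul,
      Real.rpow_add_one hW.ne']
    field_simp
  · filter_upwards [ae_restrict_mem measurableSet_Ioi] with s hs
    have hs0 : (0 : ℝ) < s := hs
    simp only [hf, Pi.zero_apply]
    positivity

/-- Quadratic interpolation between `L²` and a weighted `L²` space: inequalities for all the
weights `s W / (1 + s W)`, `s > 0`, integrate to one for `W ^ θ`. -/
lemma lintegral_rpow_weight_le {θ : ℝ} (h0 : 0 < θ) (h1 : θ < 1) {W : ℝ → ℝ} (hW : Measurable W)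
    (hWpos : ∀ ξ, 0 < W ξ) {u v : ℝ → ℝ≥0∞} (hu : Measurable u) (hv : Measurable v) {B : ℝ≥0∞}
    (hB : B ≠ ∞)
    (h : ∀ s, 0 < s → ∫⁻ ξ, ENNReal.ofReal (s * W ξ / (1 + s * W ξ)) * v ξ
      ≤ B * ∫⁻ ξ, ENNReal.ofReal (s * W ξ / (1 + s * W ξ)) * u ξ) :
    ∫⁻ ξ, ENNReal.ofReal (W ξ ^ θ) * v ξ ≤ B * ∫⁻ ξ, ENNReal.ofReal (W ξ ^ θ) * u ξ := by
  obtain ⟨c, hc, hcW⟩ := exists_interpolation_const h0 h1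
  have key : ∀ w : ℝ → ℝ≥0∞, Measurable w → ENNReal.ofReal c * ∫⁻ ξ, ENNReal.ofReal (W ξ ^ θ) * w ξ
      = ∫⁻ s in Set.Ioi (0 : ℝ), ENNReal.ofReal (s ^ (-θ - 1)) *
        ∫⁻ ξ, ENNReal.ofReal (s * W ξ / (1 + s * W ξ)) * w ξ := by
    intro w hw
    have hm : Measurable fun p : ℝ × ℝ => ENNReal.ofReal (p.1 ^ (-θ - 1)) *
        (ENNReal.ofReal (p.1 * W p.2 / (1 + p.1 * W p.2)) * w p.2) := by fun_prop
    calc ENNReal.ofReal c * ∫⁻ ξ, ENNReal.ofReal (W ξ ^ θ) * w ξ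
        = ∫⁻ ξ, (∫⁻ s in Set.Ioi (0 : ℝ),
            ENNReal.ofReal (s ^ (-θ - 1) * (s * W ξ / (1 + s * W ξ)))) * w ξ := by
          rw [← lintegral_const_mul _ (by fun_prop)]
          congr 1
          funext ξ
          rw [hcW _ (hWpos ξ), ENNReal.ofReal_mul hc.le, mul_assoc]
      _ = ∫⁻ ξ, ∫⁻ s in Set.Ioi (0 : ℝ), ENNReal.ofReal (s ^ (-θ - 1)) *
            (ENNReal.ofReal (s * W ξ / (1 + s * W ξ)) * w ξ) := by
          congr 1
          funext ξ
          rw [← lintegral_mul_const _ (by fun_prop)]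
          refine setLIntegral_congr_fun measurableSet_Ioi fun s hs => ?_
          have hs0 : (0 : ℝ) < s := hs
          rw [ENNReal.ofReal_mul (by positivity), mul_assoc]
      _ = ∫⁻ s in Set.Ioi (0 : ℝ), ∫⁻ ξ, ENNReal.ofReal (s ^ (-θ - 1)) *
            (ENNReal.ofReal (s * W ξ / (1 + s * W ξ)) * w ξ) :=
          lintegral_lintegral_swap (by
            exact (hm.comp measurable_swap).aemeasurable)
      _ = _ := by
          congr 1
          funext s
          rw [lintegral_const_mul _ (by fun_prop)]
  have hc0 : ENNReal.ofReal c ≠ 0 := by simpa using hc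
  rw [← ENNReal.mul_le_mul_iff_right hc0 ENNReal.ofReal_ne_top, key v hv,
    mul_left_comm, key u hu]
  refine (setLIntegral_mono' measurableSet_Ioi fun s hs => ?_).trans
    (le_of_eq (lintegral_const_mul' B _ hB))
  rw [mul_left_comm]
  gcongr
  exact h s hs

/-! ### Smooth bounded functions as multipliers of `H^r` -/

lemma hNorm_sq (r : ℝ) (g : ℝ → ℂ) : hNorm r g ^ 2
    = ∫⁻ ξ, ENNReal.ofReal ((1 + (2 * Real.pi * ξ) ^ 2) ^ r) * ‖fourierL2 g ξ‖ₑ ^ 2 := by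
  rw [hNorm, eLpNorm_two_sq]
  congr 1
  funext ξ
  have h0 : 0 < 1 + (2 * Real.pi * ξ) ^ 2 := by linarith [one_le_japanese ξ]
  rw [besselFourier, enorm_mul, mul_pow, ← ofReal_norm, Complex.norm_real,
    Real.norm_of_nonneg (by positivity), ← ENNReal.ofReal_pow (by positivity), ← Real.rpow_natCast,
    ← Real.rpow_mul h0.le]
  congr 3
  push_cast
  ring

/-- The pointwise inequality behind quadratic interpolation. -/
lemma weight_mul_sq_le {t a b : ℝ} (ht : 0 < t) : t / (1 + t) * (a + b) ^ 2 ≤ 2 * a ^ 2 + 2 * (t * b ^ 2) := by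
  have h1 : t / (1 + t) * (a + b) ^ 2 ≤ t / (1 + t) * (2 * (a ^ 2 + b ^ 2)) := by
    gcongr
    nlinarith [sq_nonneg (a - b)]
  have h2 : t / (1 + t) ≤ 1 := by rw [div_le_one (by positivity)]; linarith
  have h3 : t / (1 + t) ≤ t := div_le_self ht.le (by linarith)
  nlinarith [mul_le_mul_of_nonneg_right h2 (sq_nonneg a), mul_le_mul_of_nonneg_right h3 (sq_nonneg b)]

lemma ENNReal_ofReal_mul_sq (c : ℝ) (hc : 0 ≤ c) (z : ℂ) :
    ENNReal.ofReal c * ‖z‖ₑ ^ 2 = ENNReal.ofReal (c * ‖z‖ ^ 2) := by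
  rw [ENNReal.ofReal_mul hc, ENNReal.ofReal_pow (norm_nonneg z), ofReal_norm]

/-- The inequality between the weights `s W / (1 + s W)`, `W = ⟨k⟩^{2n}`, from the bounds for the
multiplication by `ψ` on `L²` and on `H^n`: `g` is split into `g₀ + g₁` with `ĝ₁ = ĝ / (1 + s W)`, and
`g₀` is estimated in `L²`, `g₁` in `H^n`. -/
lemma interpolation_step {n : ℕ} {ψ : ℝ → ℂ} {M : ℝ} (hM : 0 < M) (hψ : IsBddMul ψ M)
    (hn : ∀ g : ℝ → ℂ, MemLp g 2 volume →
      hNorm n (fun x => ψ x * g x) ≤ ENNReal.ofReal M * hNorm n g)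
    {g : ℝ → ℂ} (hg : MemLp g 2 volume) {s : ℝ} (hs : 0 < s) :
    ∫⁻ ξ, ENNReal.ofReal (s * (1 + (2 * Real.pi * ξ) ^ 2) ^ n / (1 + s * (1 + (2 * Real.pi * ξ) ^ 2) ^ n))
        * ‖fourierL2 (fun x => ψ x * g x) ξ‖ₑ ^ 2
      ≤ ENNReal.ofReal (2 * M ^ 2) * ∫⁻ ξ, ENNReal.ofReal (s * (1 + (2 * Real.pi * ξ) ^ 2) ^ n /
        (1 + s * (1 + (2 * Real.pi * ξ) ^ 2) ^ n)) * ‖fourierL2 g ξ‖ₑ ^ 2 := by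
  set W : ℝ → ℝ := fun ξ => (1 + (2 * Real.pi * ξ) ^ 2) ^ n with hW
  have hW0 : ∀ ξ, 0 < W ξ := fun ξ => by
    have := one_le_japanese ξ
    simp only [hW]
    positivity
  have hWc : Continuous W := by fun_prop
  have hd : ∀ ξ, 0 < 1 + s * W ξ := fun ξ => by have := hW0 ξ; positivity
  have b1 : IsBddMul (fun ξ => ((1 / (1 + s * W ξ) : ℝ) : ℂ)) 1 := by
    refine isBddMul_ofReal (f := fun ξ => 1 / (1 + s * W ξ))
      (continuous_const.div (by fun_prop) fun ξ => (hd ξ).ne') fun ξ => ?_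
    rw [abs_of_pos (one_div_pos.2 (hd ξ)), div_le_one (hd ξ)]
    have := mul_pos hs (hW0 ξ)
    linarith
  have b0 : IsBddMul (fun ξ => ((s * W ξ / (1 + s * W ξ) : ℝ) : ℂ)) 1 := by
    refine isBddMul_ofReal (f := fun ξ => s * W ξ / (1 + s * W ξ))
      (Continuous.div (by fun_prop) (by fun_prop) fun ξ => (hd ξ).ne') fun ξ => ?_
    have := mul_pos hs (hW0 ξ)
    rw [abs_of_pos (div_pos this (hd ξ)), div_le_one (hd ξ)]
    linarith
  -- the splitting into high and low frequencies
  obtain ⟨g₁, hg₁, -⟩ := exists_fourierL2_eq (b1.memLp (Lp.memLp (fourierL2 g)))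
  obtain ⟨g₀, hg₀, -⟩ := exists_fourierL2_eq (b0.memLp (Lp.memLp (fourierL2 g)))
  have hsum : g =ᵐ[volume] (g₀ : ℝ → ℂ) + g₁ := by
    refine fourierL2_injective hg ((Lp.memLp g₀).add (Lp.memLp g₁)) ?_
    rw [fourierL2_add (Lp.memLp g₀) (Lp.memLp g₁)]
    filter_upwards [hg₀, hg₁, Lp.coeFn_add (fourierL2 g₀) (fourierL2 g₁)] with ξ a0 a1 a2
    rw [a2, Pi.add_apply, a0, a1, ← add_mul, ← Complex.ofReal_add, ← add_div, add_comm (s * W ξ),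
      div_self (hd ξ).ne', Complex.ofReal_one, one_mul]
  have m0 := hψ.memLp (Lp.memLp g₀)
  have m1 := hψ.memLp (Lp.memLp g₁)
  have hψsum : fourierL2 (fun x => ψ x * g x)
      = fourierL2 (fun x => ψ x * g₀ x) + fourierL2 (fun x => ψ x * g₁ x) := by
    rw [← fourierL2_add m0 m1]
    refine fourierL2_congr ?_
    filter_upwards [hsum] with x hx
    rw [hx, Pi.add_apply, Pi.add_apply, mul_add]
  have k0 : ∫⁻ ξ, ‖fourierL2 (fun x => ψ x * g₀ x) ξ‖ₑ ^ 2
      ≤ ENNReal.ofReal M ^ 2 * ∫⁻ ξ, ‖fourierL2 g₀ ξ‖ₑ ^ 2 := by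
    rw [← eLpNorm_two_sq, ← eLpNorm_two_sq, eLpNorm_fourierL2 m0, eLpNorm_fourierL2 (Lp.memLp g₀),
      ← mul_pow]
    gcongr
    refine eLpNorm_le_mul_eLpNorm_of_ae_le_mul (Eventually.of_forall fun x => ?_) 2
    rw [norm_mul]
    gcongr
    exact hψ.bound x
  have k1 : ∫⁻ ξ, ENNReal.ofReal (W ξ) * ‖fourierL2 (fun x => ψ x * g₁ x) ξ‖ₑ ^ 2
      ≤ ENNReal.ofReal M ^ 2 * ∫⁻ ξ, ENNReal.ofReal (W ξ) * ‖fourierL2 g₁ ξ‖ₑ ^ 2 := by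
    have h1 : ∀ h : ℝ → ℂ, ∫⁻ ξ, ENNReal.ofReal (W ξ) * ‖fourierL2 h ξ‖ₑ ^ 2 = hNorm n h ^ 2 := by
      intro h
      rw [hNorm_sq]
      simp only [Real.rpow_natCast, hW]
    rw [h1, h1, ← mul_pow]
    gcongr
    exact hn _ (Lp.memLp g₁)
  have hmeas : ∀ h : ℝ → ℂ, Measurable fun ξ => ‖fourierL2 h ξ‖ₑ ^ 2 := fun h =>
    ((Lp.stronglyMeasurable (fourierL2 h)).measurable.enorm).pow_const 2
  have hWm : Measurable W := hWc.measurable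
  calc ∫⁻ ξ, ENNReal.ofReal (s * W ξ / (1 + s * W ξ)) * ‖fourierL2 (fun x => ψ x * g x) ξ‖ₑ ^ 2
      ≤ ∫⁻ ξ, (2 * ‖fourierL2 (fun x => ψ x * g₀ x) ξ‖ₑ ^ 2
        + 2 * ENNReal.ofReal s * (ENNReal.ofReal (W ξ) * ‖fourierL2 (fun x => ψ x * g₁ x) ξ‖ₑ ^ 2)) := by
        refine lintegral_mono_ae ?_
        rw [hψsum]
        filter_upwards [Lp.coeFn_add (fourierL2 fun x => ψ x * g₀ x) (fourierL2 fun x => ψ x * g₁ x)]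
          with ξ hξ
        rw [hξ, Pi.add_apply]
        set a := fourierL2 (fun x => ψ x * g₀ x) ξ
        set b := fourierL2 (fun x => ψ x * g₁ x) ξ
        have hsW := mul_pos hs (hW0 ξ)
        rw [ENNReal_ofReal_mul_sq _ (by positivity), ENNReal_ofReal_mul_sq _ (hW0 ξ).le,
          ← ofReal_norm (E := ℂ), ← ENNReal.ofReal_pow (norm_nonneg _),
          show (2 : ℝ≥0∞) = ENNReal.ofReal 2 by norm_num, ← ENNReal.ofReal_mul (by norm_num),
          ← ENNReal.ofReal_mul (by norm_num), ← ENNReal.ofReal_mul (by positivity),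
          ← ENNReal.ofReal_add (by positivity) (by have := hW0 ξ; positivity)]
        refine ENNReal.ofReal_le_ofReal ?_
        refine le_trans ?_ ((weight_mul_sq_le (a := ‖a‖) (b := ‖b‖) hsW).trans (le_of_eq (by ring)))
        have := norm_add_le a b
        gcongr
    _ = 2 * (∫⁻ ξ, ‖fourierL2 (fun x => ψ x * g₀ x) ξ‖ₑ ^ 2) + 2 * ENNReal.ofReal s *
        ∫⁻ ξ, ENNReal.ofReal (W ξ) * ‖fourierL2 (fun x => ψ x * g₁ x) ξ‖ₑ ^ 2 := by
        have q0 := hmeas (fun x => ψ x * g₀ x)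
        have q1 := hmeas (fun x => ψ x * g₁ x)
        rw [lintegral_add_left (by fun_prop), lintegral_const_mul _ (by fun_prop),
          lintegral_const_mul _ (by fun_prop)]
    _ ≤ 2 * (ENNReal.ofReal M ^ 2 * ∫⁻ ξ, ‖fourierL2 g₀ ξ‖ₑ ^ 2) + 2 * ENNReal.ofReal s *
        (ENNReal.ofReal M ^ 2 * ∫⁻ ξ, ENNReal.ofReal (W ξ) * ‖fourierL2 g₁ ξ‖ₑ ^ 2) := by gcongr
    _ = ENNReal.ofReal (2 * M ^ 2) * ∫⁻ ξ, (‖fourierL2 g₀ ξ‖ₑ ^ 2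
        + ENNReal.ofReal s * (ENNReal.ofReal (W ξ) * ‖fourierL2 g₁ ξ‖ₑ ^ 2)) := by
        have q0 := hmeas g₀
        have q1 := hmeas g₁
        rw [lintegral_add_left (by fun_prop), lintegral_const_mul _ (by fun_prop),
          ENNReal.ofReal_mul (by norm_num), ENNReal.ofReal_pow hM.le]
        norm_num
        ring
    _ = _ := by
        congr 1
        refine lintegral_congr_ae ?_
        filter_upwards [hg₀, hg₁] with ξ a0 a1
        have hsW := mul_pos hs (hW0 ξ)
        have hd' := hd ξ
        have hW1 := hW0 ξ
        change _ = ENNReal.ofReal (s * W ξ / (1 + s * W ξ)) * ‖fourierL2 g ξ‖ₑ ^ 2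
        rw [a0, a1, ENNReal_ofReal_mul_sq (W ξ) hW1.le,
          ENNReal_ofReal_mul_sq (s * W ξ / (1 + s * W ξ)) (by positivity),
          ← ofReal_norm (E := ℂ), ← ENNReal.ofReal_pow (norm_nonneg _), norm_mul, norm_mul,
          Complex.norm_real, Complex.norm_real, Real.norm_of_nonneg (by positivity),
          Real.norm_of_nonneg (by positivity), ← ENNReal.ofReal_mul hs.le,
          ← ENNReal.ofReal_add (by positivity) (by have := hW0 ξ; positivity)]
        congr 1
        field_simp
        ring

/-- Smooth bounded functions are multipliers of `H^r`, for all real `r ≥ 0`. -/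
lemma exists_hNorm_mul_le {r : ℝ} (hr : 0 ≤ r) {ψ : ℝ → ℂ} (hψ : SmoothBdd ψ) :
    ∃ C : ℝ, 0 < C ∧ ∀ g : ℝ → ℂ, MemLp g 2 volume →
      hNorm r (fun x => ψ x * g x) ≤ ENNReal.ofReal C * hNorm r g := by
  rcases hr.eq_or_lt with rfl | hr0
  · simpa using exists_hNorm_mul_le_nat 0 hψ
  obtain ⟨n, hn⟩ := exists_nat_gt r
  have hn0 : (0 : ℝ) < n := hr0.trans hn
  obtain ⟨C, hC, hCn⟩ := exists_hNorm_mul_le_nat n hψ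
  obtain ⟨D, hD⟩ := hψ.isBddMul
  set M := max C D with hMdef
  have hM : 0 < M := hC.trans_le (le_max_left _ _)
  have hψM : IsBddMul ψ M := ⟨hD.aesm, fun x => (hD.bound x).trans (le_max_right _ _)⟩
  refine ⟨2 * M, by positivity, fun g hg => ?_⟩
  have key := lintegral_rpow_weight_le (θ := r / n) (by positivity) ((div_lt_one hn0).2 hn)
    (W := fun ξ => (1 + (2 * Real.pi * ξ) ^ 2) ^ n) (by fun_prop)
    (fun ξ => by have := one_le_japanese ξ; positivity)
    (u := fun ξ => ‖fourierL2 g ξ‖ₑ ^ 2) (v := fun ξ => ‖fourierL2 (fun x => ψ x * g x) ξ‖ₑ ^ 2)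
    ((Lp.stronglyMeasurable (fourierL2 g)).measurable.enorm.pow_const 2)
    ((Lp.stronglyMeasurable (fourierL2 fun x => ψ x * g x)).measurable.enorm.pow_const 2)
    (B := ENNReal.ofReal (2 * M ^ 2)) ENNReal.ofReal_ne_top
    (fun s hs => interpolation_step hM hψM (fun g hg => (hCn g hg).trans (by
      gcongr
      exact le_max_left _ _)) hg hs)
  have e : ∀ ξ : ℝ, ((1 + (2 * Real.pi * ξ) ^ 2) ^ n : ℝ) ^ (r / n)
      = (1 + (2 * Real.pi * ξ) ^ 2) ^ r := by
    intro ξ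
    rw [← Real.rpow_natCast, ← Real.rpow_mul (by linarith [one_le_japanese ξ]),
      mul_div_cancel₀ _ hn0.ne']
  simp only [e] at key
  rw [← hNorm_sq, ← hNorm_sq] at key
  have h2 : hNorm r (fun x => ψ x * g x) ^ 2 ≤ (ENNReal.ofReal (2 * M) * hNorm r g) ^ 2 := by
    refine key.trans ?_
    rw [mul_pow, ← ENNReal.ofReal_pow (by positivity)]
    gcongr
    nlinarith
  exact (ENNReal.pow_le_pow_left_iff two_ne_zero).1 h2

/-! ### Products of exponentials and powers of hyperbolic cosines -/

lemma hasDerivAt_tanh_const_mul (c x : ℝ) :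
    HasDerivAt (fun x => Real.tanh (c * x)) (c * (1 - Real.tanh (c * x) ^ 2)) x := by
  have h0 : HasDerivAt (fun x : ℝ => 2 * c * x) (2 * c) x := by
    simpa using (hasDerivAt_id x).const_mul (2 * c)
  have h1 := (hasDerivAt_halfTanh (2 * c * x)).comp x h0
  have e : (fun x => Real.tanh (c * x)) = halfTanh ∘ fun x => 2 * c * x := by
    funext y
    simp only [Function.comp, halfTanh]
    congr 1
    ring
  rw [e]
  refine h1.congr_deriv ?_
  rw [halfTanh, show 2 * c * x / 2 = c * x by ring]
  ring

lemma smoothBdd_tanh (c : ℝ) : SmoothBdd fun x => (Real.tanh (c * x) : ℂ) := by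
  have hb : ∀ x : ℝ, ‖(Real.tanh (c * x) : ℂ)‖ ≤ 1 := fun x => by
    rw [Complex.norm_real, Real.norm_eq_abs]
    have := abs_halfTanh_le (2 * (c * x))
    rwa [halfTanh, mul_div_cancel_left₀ _ (two_ne_zero)] at this
  have hd : ∀ x : ℝ, HasDerivAt (fun x : ℝ => (Real.tanh (c * x) : ℂ))
      (c * (1 + (-1) * ((Real.tanh (c * x) : ℂ) * (Real.tanh (c * x) : ℂ)))) x := fun x => by
    convert (hasDerivAt_tanh_const_mul c x).ofReal_comp using 1
    push_cast
    ring
  intro n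
  induction n with
  | zero => exact ⟨continuous_iff_continuousAt.2 fun x => (hd x).continuousAt, 1, hb⟩
  | succ n ih =>
    exact ⟨⟨1, hb⟩, _, hd, (smoothBdd_const _ n).mul ((smoothBdd_const 1 n).add
      ((smoothBdd_const (-1) n).mul (ih.mul ih)))⟩

lemma abs_sub_log_two_le_log_cosh (y : ℝ) : |y| - Real.log 2 ≤ Real.log (Real.cosh y) := by
  rw [sub_le_iff_le_add, ← Real.log_mul (Real.cosh_pos y).ne' two_ne_zero,
    Real.le_log_iff_exp_le (by have := Real.cosh_pos y; positivity), ← Real.cosh_abs, Real.cosh_eq]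
  linarith [Real.exp_pos (-|y|)]

lemma log_cosh_le_abs (y : ℝ) : Real.log (Real.cosh y) ≤ |y| := by
  rw [Real.log_le_iff_le_exp (Real.cosh_pos y), ← Real.cosh_abs, Real.cosh_eq]
  have : Real.exp (-|y|) ≤ Real.exp |y| := Real.exp_le_exp.2 (by linarith [abs_nonneg y])
  linarith

lemma mul_log_cosh_le (a y : ℝ) : a * Real.log (Real.cosh y) ≤ a * |y| + |a| * Real.log 2 := by
  have h1 := abs_sub_log_two_le_log_cosh y
  have h2 := log_cosh_le_abs y
  have h3 := Real.log_pos one_lt_two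
  rcases abs_cases a with ⟨h, h'⟩ | ⟨h, h'⟩ <;> rw [h] <;> nlinarith

/-- The function `e^{p x} cosh^a(x) cosh^b(x/2) cosh^d(c x)`. -/
def coshProd (p a b c d x : ℝ) : ℝ :=
  Real.exp (p * x + a * Real.log (Real.cosh x) + b * Real.log (Real.cosh (1 / 2 * x))
    + d * Real.log (Real.cosh (c * x)))

lemma coshProd_pos (p a b c d x : ℝ) : 0 < coshProd p a b c d x := Real.exp_pos _

lemma coshProd_eq (p a b c d x : ℝ) : coshProd p a b c d x
    = Real.exp (p * x) * Real.cosh x ^ a * Real.cosh (x / 2) ^ b * Real.cosh (c * x) ^ d := by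
  rw [coshProd, Real.rpow_def_of_pos (Real.cosh_pos _), Real.rpow_def_of_pos (Real.cosh_pos _),
    Real.rpow_def_of_pos (Real.cosh_pos _), ← Real.exp_add, ← Real.exp_add, ← Real.exp_add,
    show 1 / 2 * x = x / 2 by ring]
  congr 1
  ring

lemma coshProd_mul (p a b c d p' a' b' d' x : ℝ) :
    coshProd p a b c d x * coshProd p' a' b' c d' x
      = coshProd (p + p') (a + a') (b + b') c (d + d') x := by
  rw [coshProd, coshProd, coshProd, ← Real.exp_add]
  congr 1
  ring

lemma coshProd_le (p a b c d x : ℝ) : coshProd p a b c d x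
    ≤ Real.exp ((|a| + |b| + |d|) * Real.log 2) * Real.exp ((|p| + a + b / 2 + d * |c|) * |x|) := by
  rw [coshProd, ← Real.exp_add, Real.exp_le_exp]
  have h1 := mul_log_cosh_le a x
  have h2 := mul_log_cosh_le b (1 / 2 * x)
  have h3 := mul_log_cosh_le d (c * x)
  have h4 : p * x ≤ |p| * |x| := by rw [← abs_mul]; exact le_abs_self _
  rw [abs_mul] at h2 h3
  rw [abs_of_pos (by norm_num : (0 : ℝ) < 1 / 2)] at h2
  linarith

lemma hasDerivAt_log_cosh (c x : ℝ) :
    HasDerivAt (fun x => Real.log (Real.cosh (c * x))) (c * Real.tanh (c * x)) x := by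
  have h0 : HasDerivAt (fun x : ℝ => c * x) c x := by
    simpa using (hasDerivAt_id x).const_mul c
  have h1 := ((Real.hasDerivAt_cosh (c * x)).comp x h0).log (Real.cosh_pos _).ne'
  refine h1.congr_deriv ?_
  rw [Real.tanh_eq_sinh_div_cosh, Function.comp]
  ring

/-- The logarithmic derivative of `coshProd`. -/
def coshProdLogDeriv (p a b c d x : ℝ) : ℂ :=
  p + (a * (Real.tanh (1 * x) : ℂ) + ((b / 2 : ℝ) * (Real.tanh (1 / 2 * x) : ℂ)
    + (d * c : ℝ) * (Real.tanh (c * x) : ℂ)))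

lemma smoothBdd_coshProdLogDeriv (p a b c d : ℝ) : SmoothBdd (coshProdLogDeriv p a b c d) :=
  (smoothBdd_const _).add (((smoothBdd_tanh 1).const_mul _).add
    (((smoothBdd_tanh (1 / 2)).const_mul _).add ((smoothBdd_tanh c).const_mul _)))

lemma hasDerivAt_coshProd (p a b c d x : ℝ) :
    HasDerivAt (fun x => (coshProd p a b c d x : ℂ))
      (coshProdLogDeriv p a b c d x * coshProd p a b c d x) x := by
  have h0 : HasDerivAt (fun x : ℝ => p * x) p x := by
    simpa using (hasDerivAt_id x).const_mul p
  have h1 := (((h0.add ((hasDerivAt_log_cosh 1 x).const_mul a)).add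
    ((hasDerivAt_log_cosh (1 / 2) x).const_mul b)).add
    ((hasDerivAt_log_cosh c x).const_mul d)).exp.ofReal_comp
  have e : (fun x => (coshProd p a b c d x : ℂ)) = fun y => ((Real.exp (((fun x => p * x)
      + (fun y => a * Real.log (Real.cosh (1 * y))) + (fun y => b * Real.log (Real.cosh (1 / 2 * y)))
      + fun y => d * Real.log (Real.cosh (c * y))) y) : ℝ) : ℂ) := by
    funext y
    simp [coshProd]
  rw [e]
  convert h1 using 1
  simp only [coshProdLogDeriv, coshProd, Pi.add_apply, one_mul]
  push_cast
  ring

lemma smoothBdd_coshProd {p a b c d : ℝ} (h : |p| + a + b / 2 + d * |c| ≤ 0) :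
    SmoothBdd fun x => (coshProd p a b c d x : ℂ) := by
  refine smoothBdd_of_log_deriv (smoothBdd_coshProdLogDeriv p a b c d)
    (C := Real.exp ((|a| + |b| + |d|) * Real.log 2)) (fun x => ?_)
    (hasDerivAt_coshProd p a b c d)
  rw [Complex.norm_real, Real.norm_of_nonneg (coshProd_pos _ _ _ _ _ _).le]
  refine (coshProd_le p a b c d x).trans (mul_le_of_le_one_right (Real.exp_pos _).le ?_)
  rw [Real.exp_le_one_iff]
  exact mul_nonpos_of_nonpos_of_nonneg h (abs_nonneg x)

lemma memLp_coshProd {p a b c d : ℝ} (h : |p| + a + b / 2 + d * |c| < 0) :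
    MemLp (fun x => (coshProd p a b c d x : ℂ)) 2 volume := by
  have hcont := (smoothBdd_coshProd h.le).continuous
  obtain ⟨B, hB⟩ : ∃ B, ∀ x : ℝ, (1 + x ^ 2) ≤ B * Real.exp (-(|p| + a + b / 2 + d * |c|) * |x|) := by
    exact ⟨_, one_add_sq_le_exp (by linarith)⟩
  refine MemLp.of_le_mul (c := Real.exp ((|a| + |b| + |d|) * Real.log 2) * B) memLp_inv_one_add_sq
    hcont.aestronglyMeasurable (Eventually.of_forall fun x => ?_)
  rw [Complex.norm_real, Real.norm_of_nonneg (coshProd_pos _ _ _ _ _ _).le,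
    Real.norm_of_nonneg (by positivity), mul_assoc]
  refine (coshProd_le p a b c d x).trans ?_
  gcongr
  rw [← div_eq_mul_inv, le_div_iff₀ (by positivity)]
  calc Real.exp ((|p| + a + b / 2 + d * |c|) * |x|) * (1 + x ^ 2)
      ≤ Real.exp ((|p| + a + b / 2 + d * |c|) * |x|) *
        (B * Real.exp (-(|p| + a + b / 2 + d * |c|) * |x|)) := by gcongr; exact hB x
    _ = B := by
      rw [mul_left_comm, ← Real.exp_add, neg_mul, add_neg_cancel, Real.exp_zero, mul_one]

lemma isWeakDeriv_of_hasDerivAt {g g' : ℝ → ℂ} (hg : MemLp g 2 volume) (hg' : MemLp g' 2 volume)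
    (hd : ∀ x, HasDerivAt g (g' x) x) : IsWeakDeriv g g' := by
  refine (isWeakDeriv_iff hg hg').2 fun φ => ?_
  have := integral_mul_deriv_eq_deriv_mul_of_integrable (u := φ) (v := g) (u' := derivCLM ℂ ℂ φ)
    (v' := g') (fun x _ => φ.hasDerivAt x) (fun x _ => hd x) (MemLp.integrable_schwartz_mul hg' φ)
    (MemLp.integrable_schwartz_mul hg _) (MemLp.integrable_schwartz_mul hg φ)
  rw [this, neg_neg]

lemma hNorm_coshProd_lt_top {p a b c d : ℝ} (h : |p| + a + b / 2 + d * |c| < 0) (r : ℝ) :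
    hNorm r (fun x => (coshProd p a b c d x : ℂ)) < ∞ := by
  have hm := memLp_coshProd h
  have ha := smoothBdd_coshProdLogDeriv p a b c d
  obtain ⟨M, hM⟩ := ha.isBddMul
  have hw := isWeakDeriv_of_hasDerivAt hm (hM.memLp hm) (hasDerivAt_coshProd p a b c d)
  have key : ∀ n : ℕ, hNorm n (fun x => (coshProd p a b c d x : ℂ)) < ∞ := by
    intro n
    induction n with
    | zero =>
      rw [Nat.cast_zero, hNorm_zero hm]
      exact hm.2
    | succ n ih =>
      obtain ⟨C, -, hC⟩ := exists_hNorm_mul_le_nat n ha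
      push_cast
      refine (hw.hNorm_succ_le n).trans_lt (ENNReal.add_lt_top.2 ⟨ih, (hC _ hm).trans_lt ?_⟩)
      exact ENNReal.mul_lt_top ENNReal.ofReal_lt_top ih
  obtain ⟨n, hn⟩ := exists_nat_ge r
  exact (hNorm_mono hn _).trans_lt (key n)

/-! ### Modulation and pairing in the Sobolev scale -/

lemma integrable_coshProd {p a b c d : ℝ} (h : |p| + a + b / 2 + d * |c| < 0) :
    Integrable fun x => (coshProd p a b c d x : ℂ) := by
  have h2 : |p / 2| + a / 2 + b / 2 / 2 + d / 2 * |c| < 0 := by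
    rw [abs_div, abs_two]
    linarith
  have := (memLp_coshProd h2).integrable_mul (memLp_coshProd h2)
  refine this.congr (Eventually.of_forall fun x => ?_)
  rw [Pi.mul_apply, ← Complex.ofReal_mul, coshProd_mul]
  simp only [add_halves]

lemma isBddMul_cexp (K : ℝ) : IsBddMul (fun x : ℝ => Complex.exp (Complex.I * K * x)) 1 :=
  ⟨Continuous.aestronglyMeasurable (by fun_prop), fun x => by
    rw [Complex.norm_exp]
    simp⟩

lemma fourierL2_modulation {g : ℝ → ℂ} (hg : MemLp g 2 volume) (hg1 : Integrable g) (K : ℝ) :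
    fourierL2 (fun x : ℝ => Complex.exp (Complex.I * K * x) * g x) =ᵐ[volume]
      fun ξ => fourierL2 g (ξ - K / (2 * Real.pi)) := by
  have hb := isBddMul_cexp K
  have h1 : Integrable fun x : ℝ => Complex.exp (Complex.I * K * x) * g x :=
    hg1.bdd_mul hb.aesm (Eventually.of_forall hb.bound)
  have ht := (measurePreserving_sub_right (volume : Measure ℝ) (K / (2 * Real.pi))).quasiMeasurePreserving.ae
    (fourierL2_ae_eq_fourier hg hg1)
  filter_upwards [fourierL2_ae_eq_fourier (hb.memLp hg) h1, ht] with ξ h2 h3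
  rw [h2, h3, Real.fourier_real_eq_integral_exp_smul, Real.fourier_real_eq_integral_exp_smul]
  congr 1
  funext x
  rw [smul_eq_mul, smul_eq_mul, ← mul_assoc, ← Complex.exp_add]
  congr 2
  have := Real.pi_ne_zero
  push_cast
  field_simp
  ring

/-- Peetre's inequality. -/
lemma peetre (r k K : ℝ) : (1 + (k + K) ^ 2) ^ (r / 2)
    ≤ 2 ^ (|r| / 2) * (1 + K ^ 2) ^ (r / 2) * (1 + k ^ 2) ^ (|r| / 2) := by
  have h0 : ∀ a b : ℝ, 1 + (a + b) ^ 2 ≤ 2 * (1 + a ^ 2) * (1 + b ^ 2) := fun a b => by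
    nlinarith [sq_nonneg (a - b), sq_nonneg (a * b)]
  have hp : ∀ a : ℝ, 0 < 1 + a ^ 2 := fun a => by positivity
  rcases le_total 0 r with hr | hr
  · rw [abs_of_nonneg hr, ← Real.mul_rpow (by norm_num) (hp K).le,
      ← Real.mul_rpow (by have := hp K; positivity) (hp k).le]
    refine Real.rpow_le_rpow (hp _).le ?_ (by linarith)
    linarith [h0 k K]
  · have h1 : (1 + K ^ 2) ^ (-r / 2) ≤ (2 * (1 + (k + K) ^ 2) * (1 + k ^ 2)) ^ (-r / 2) := by
      refine Real.rpow_le_rpow (hp _).le ?_ (by linarith)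
      have := h0 (k + K) (-k)
      rwa [neg_sq, add_neg_cancel_comm] at this
    rw [Real.mul_rpow (by have := hp (k + K); positivity) (hp k).le,
      Real.mul_rpow (by norm_num) (hp _).le] at h1
    rw [abs_of_nonpos hr]
    have e1 : (1 + (k + K) ^ 2) ^ (r / 2) = ((1 + (k + K) ^ 2) ^ (-r / 2))⁻¹ := by
      rw [← Real.rpow_neg (hp _).le]
      congr 1
      ring
    have e2 : (1 + K ^ 2) ^ (r / 2) = ((1 + K ^ 2) ^ (-r / 2))⁻¹ := by
      rw [← Real.rpow_neg (hp _).le]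
      congr 1
      ring
    have p1 : 0 < (1 + (k + K) ^ 2) ^ (-r / 2) := Real.rpow_pos_of_pos (hp _) _
    have p2 : 0 < (1 + K ^ 2) ^ (-r / 2) := Real.rpow_pos_of_pos (hp _) _
    rw [e1, e2, inv_le_iff_one_le_mul₀ p1]
    have e3 : 2 ^ (-r / 2) * ((1 + K ^ 2) ^ (-r / 2))⁻¹ * (1 + k ^ 2) ^ (-r / 2)
        * (1 + (k + K) ^ 2) ^ (-r / 2) = (2 ^ (-r / 2) * (1 + (k + K) ^ 2) ^ (-r / 2)
        * (1 + k ^ 2) ^ (-r / 2)) / (1 + K ^ 2) ^ (-r / 2) := by ring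
    rw [e3, one_le_div p2]
    exact h1

lemma hNorm_modulation_le (r : ℝ) {g : ℝ → ℂ} (hg : MemLp g 2 volume) (hg1 : Integrable g) (K : ℝ) :
    hNorm r (fun x : ℝ => Complex.exp (Complex.I * K * x) * g x)
      ≤ ENNReal.ofReal (2 ^ (|r| / 2) * (1 + K ^ 2) ^ (r / 2)) * hNorm |r| g := by
  have hmp := measurePreserving_sub_right (volume : Measure ℝ) (K / (2 * Real.pi))
  have h1 : hNorm |r| g = eLpNorm (besselFourier |r| g ∘ fun ξ => ξ - K / (2 * Real.pi)) 2 volume :=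
    (eLpNorm_comp_measurePreserving (aesm_besselFourier _ g) hmp).symm
  rw [h1, hNorm]
  refine eLpNorm_le_mul_eLpNorm_of_ae_le_mul ?_ 2
  filter_upwards [fourierL2_modulation hg hg1 K] with ξ hξ
  rw [norm_besselFourier, Function.comp, norm_besselFourier, hξ, ← mul_assoc]
  gcongr
  have e : 2 * Real.pi * ξ = 2 * Real.pi * (ξ - K / (2 * Real.pi)) + K := by
    have := Real.pi_ne_zero
    field_simp
    ring
  rw [e]
  exact peetre r _ K

lemma hNorm_cos_mul_le (r : ℝ) {g : ℝ → ℂ} (hg : MemLp g 2 volume) (hg1 : Integrable g) (K : ℝ) :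
    hNorm r (fun x => (Real.cos (K * x) : ℂ) * g x)
      ≤ ENNReal.ofReal (2 ^ (|r| / 2) * (1 + K ^ 2) ^ (r / 2)) * hNorm |r| g := by
  have m1 := (isBddMul_cexp K).memLp hg
  have m2 := (isBddMul_cexp (-K)).memLp hg
  have e : (fun x : ℝ => (Real.cos (K * x) : ℂ) * g x) =
      (fun x : ℝ => (1 / 2 : ℂ) * (Complex.exp (Complex.I * K * x) * g x)) +
      fun x : ℝ => (1 / 2 : ℂ) * (Complex.exp (Complex.I * (-K : ℝ) * x) * g x) := by
    funext x
    rw [Pi.add_apply, Complex.ofReal_cos, Complex.cos]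
    push_cast
    rw [show (K : ℂ) * x * Complex.I = Complex.I * K * x by ring,
      show -((K : ℂ) * x) * Complex.I = Complex.I * -K * x by ring]
    ring
  rw [e]
  refine (hNorm_add_le (m1.const_mul _) (m2.const_mul _)).trans ?_
  rw [hNorm_const_mul _ m1, hNorm_const_mul _ m2]
  have h1 := hNorm_modulation_le r hg hg1 K
  have h2 := hNorm_modulation_le r hg hg1 (-K)
  rw [neg_sq] at h2
  have e2 : ‖(1 / 2 : ℂ)‖ₑ = 2⁻¹ := by
    rw [← ofReal_norm]
    simp
  rw [e2, ← mul_add]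
  refine (mul_le_mul_right (add_le_add h1 h2) _).trans (le_of_eq ?_)
  rw [← two_mul, ← mul_assoc, ENNReal.inv_mul_cancel two_ne_zero ENNReal.ofNat_ne_top, one_mul]

/-- The duality between `H^{-r}` and `H^r`. -/
lemma enorm_integral_conj_mul_le (r : ℝ) {w v : ℝ → ℂ} (hw : MemLp w 2 volume)
    (hv : MemLp v 2 volume) :
    ‖∫ x, starRingEnd ℂ (w x) * v x‖ₑ ≤ hNorm (-r) w * hNorm r v := by
  have e1 : ∫ x, starRingEnd ℂ (w x) * v x = inner ℂ (hw.toLp w) (hv.toLp v) := by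
    rw [L2.inner_def]
    refine integral_congr_ae ?_
    filter_upwards [hw.coeFn_toLp, hv.coeFn_toLp] with x h1 h2
    rw [h1, h2, RCLike.inner_apply, mul_comm]
  have e2 : inner ℂ (hw.toLp w) (hv.toLp v)
      = ∫ ξ, starRingEnd ℂ (besselFourier (-r) w ξ) * besselFourier r v ξ := by
    rw [← fourierIso.inner_map_map, fourierIso_apply, fourierIso_apply,
      fourierL2_congr hw.coeFn_toLp, fourierL2_congr hv.coeFn_toLp, L2.inner_def]
    congr 1
    funext ξ
    have h0 : 0 < 1 + (2 * Real.pi * ξ) ^ 2 := by linarith [one_le_japanese ξ]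
    rw [RCLike.inner_apply, besselFourier, besselFourier, map_mul, Complex.conj_ofReal,
      mul_mul_mul_comm, ← Complex.ofReal_mul, ← Real.rpow_add h0, neg_div, neg_add_cancel,
      Real.rpow_zero, Complex.ofReal_one, one_mul, mul_comm]
  rw [e1, e2]
  refine (enorm_integral_le_lintegral_enorm _).trans ?_
  have := ENNReal.lintegral_mul_le_Lp_mul_Lq volume Real.HolderConjugate.two_two
    (aesm_besselFourier (-r) w).enorm (aesm_besselFourier r v).enorm
  rw [hNorm, hNorm, eLpNorm_eq_lintegral_rpow_enorm_toReal two_ne_zero ENNReal.ofNat_ne_top,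
    eLpNorm_eq_lintegral_rpow_enorm_toReal two_ne_zero ENNReal.ofNat_ne_top]
  refine le_trans (le_of_eq ?_) (this.trans (le_of_eq (by norm_num)))
  congr 1
  funext ξ
  rw [enorm_mul, RCLike.enorm_conj, Pi.mul_apply]

/-- Decay of the Fourier transform of a product `u v` with `u` smooth and localized, `v` in `H^r`. -/
lemma enorm_cft_mul_le (r : ℝ) {u : ℝ → ℝ} {v : ℝ → ℂ} (hu : MemLp (fun x => (u x : ℂ)) 2 volume)
    (hu1 : Integrable fun x => (u x : ℂ)) (hv : MemLp v 2 volume) (K : ℝ) :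
    ‖cft (fun x => u x * v x) K‖ₑ ≤ ENNReal.ofReal (2 ^ (|r| / 2) * (1 + K ^ 2) ^ (-r / 2)) *
      hNorm |r| (fun x => (u x : ℂ)) * hNorm r v := by
  have h1 := enorm_integral_conj_mul_le r ((isBddMul_cexp K).memLp hu) hv
  have h2 := hNorm_modulation_le (-r) hu hu1 K
  rw [abs_neg] at h2
  have e : cft (fun x => u x * v x) K
      = ∫ x : ℝ, starRingEnd ℂ (Complex.exp (Complex.I * K * x) * u x) * v x := by
    rw [cft]
    congr 1
    funext x
    rw [map_mul, Complex.conj_ofReal, ← Complex.exp_conj, map_mul, map_mul, Complex.conj_I,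
      Complex.conj_ofReal, Complex.conj_ofReal, ← mul_assoc]
    congr 3
    ring
  rw [e]
  exact h1.trans (by gcongr)

/-! ### Removing a cosine, and gluing the shifted multipliers -/

lemma coshProd_sech (p x : ℝ) :
    coshProd p 0 (-1) 0 0 x = Real.exp (p * x) * (1 / Real.cosh (x / 2)) := by
  rw [coshProd_eq, Real.rpow_zero, Real.rpow_zero, mul_one, mul_one, Real.rpow_neg_one, one_div]

lemma coshProd_sechSq (p x : ℝ) : coshProd p 0 (-2) 0 0 x = Real.exp (p * x) * sechSq x := by
  rw [coshProd_eq, Real.rpow_zero, Real.rpow_zero, mul_one, mul_one, sechSq,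
    Real.rpow_neg (Real.cosh_pos _).le, Real.rpow_two, one_div, inv_pow]

lemma continuous_coshProd (p a b c d : ℝ) : Continuous (coshProd p a b c d) := by
  unfold coshProd
  have h : ∀ c : ℝ, Continuous fun x => Real.log (Real.cosh (c * x)) := fun c =>
    continuous_iff_continuousAt.2 fun x => (hasDerivAt_log_cosh c x).continuousAt
  have h1 := h 1
  simp only [one_mul] at h1
  have h2 := h (1 / 2)
  have h3 := h c
  exact Real.continuous_exp.comp (by fun_prop)

lemma isBddMul_coshProd_sech {p : ℝ} (hp : |p| = 1 / 2) :
    IsBddMul (fun x => (coshProd p 0 (-1) 0 0 x : ℂ)) 2 := by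
  refine isBddMul_ofReal (continuous_coshProd _ _ _ _ _) fun x => ?_
  rw [abs_of_pos (coshProd_pos _ _ _ _ _ _)]
  refine (coshProd_le _ _ _ _ _ _).trans (le_of_eq ?_)
  rw [hp]
  norm_num
  exact Real.exp_log two_pos

/-- The function `sech (x / 2)`. -/
abbrev sechC (x : ℝ) : ℂ := ((1 / Real.cosh (x / 2) : ℝ) : ℂ)

lemma expW_sechC_mul (p : ℝ) (u : ℝ → ℂ) :
    expW p (fun x => sechC x * u x) = fun x => (coshProd p 0 (-1) 0 0 x : ℂ) * u x := by
  funext x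
  rw [expW, coshProd_sech]
  push_cast
  ring

lemma expL2_sechC_mul {u : ℝ → ℂ} (hu : MemLp u 2 volume) :
    ExpL2 (1 / 2) (fun x => sechC x * u x) := by
  constructor <;> rw [expW_sechC_mul]
  · exact (isBddMul_coshProd_sech (abs_of_pos (by norm_num))).memLp hu
  · exact (isBddMul_coshProd_sech (by rw [abs_neg]; exact abs_of_pos (by norm_num))).memLp hu

lemma sechC_eq (x : ℝ) : sechC x = coshProd 0 0 (-1) 0 0 x := by
  rw [coshProd_sech, zero_mul, Real.exp_zero, one_mul]

lemma sechC_neg (x : ℝ) : sechC (-x) = sechC x := by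
  rw [sechC, neg_div, Real.cosh_neg]

lemma sechC_mul_sechC (x : ℝ) : sechC x * sechC x = sechSq x := by
  rw [sechSq]; push_cast; ring

lemma conj_sechC (x : ℝ) : starRingEnd ℂ (sechC x) = sechC x := Complex.conj_ofReal _

lemma memLp_sechC : MemLp sechC 2 volume := by
  rw [show sechC = fun x => (coshProd 0 0 (-1) 0 0 x : ℂ) from funext sechC_eq]
  exact memLp_coshProd (by norm_num)

lemma isBddMul_cos (K : ℝ) : IsBddMul (fun x => (Real.cos (K * x) : ℂ)) 1 :=
  isBddMul_ofReal (by fun_prop) fun x => Real.abs_cos_le_one _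

/-- The vector `sech (x / 2) cos (K x)` of `L²`. -/
def cosVec (K : ℝ) : L2 := ((isBddMul_cos K).memLp memLp_sechC).toLp _

lemma coeFn_cosVec (K : ℝ) : cosVec K =ᵐ[volume] fun x => (Real.cos (K * x) : ℂ) * sechC x :=
  MemLp.coeFn_toLp _

lemma reflL2_cosVec (K : ℝ) : reflL2 (cosVec K) = cosVec K := by
  refine Lp.ext ?_
  filter_upwards [coeFn_reflL2 (cosVec K), ae_comp_neg (coeFn_cosVec K), coeFn_cosVec K]
    with x h1 h2 h3
  rw [h1, h2, h3, sechC_neg, mul_neg, Real.cos_neg]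

lemma cosVec_neg (K : ℝ) : cosVec (-K) = cosVec K := by
  refine Lp.ext ?_
  filter_upwards [coeFn_cosVec (-K), coeFn_cosVec K] with x h1 h2
  rw [h1, h2, neg_mul, Real.cos_neg]

/-- The Fourier transform of an even function is a cosine transform. -/
lemma cft_of_even {G : ℝ → ℂ} (hG : Integrable G) (he : ∀ᵐ x, G (-x) = G x) (K : ℝ) :
    cft G K = ∫ x, (Real.cos (K * x) : ℂ) * G x := by
  have hi : ∀ K : ℝ, Integrable fun x : ℝ => Complex.exp (Complex.I * K * x) * G x := fun K =>
    hG.bdd_mul (isBddMul_cexp K).aesm (Eventually.of_forall (isBddMul_cexp K).bound)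
  have e1 : cft G K = ∫ x : ℝ, Complex.exp (Complex.I * (-K : ℝ) * x) * G x := by
    rw [cft]
    congr 1
    funext x
    congr 2
    push_cast
    ring
  have e2 : cft G K = ∫ x : ℝ, Complex.exp (Complex.I * K * x) * G x := by
    rw [e1, ← integral_neg_eq_self]
    refine integral_congr_ae ?_
    filter_upwards [he] with x hx
    rw [hx]
    congr 2
    push_cast
    ring
  have e3 : cft G K = (1 / 2 : ℂ) * (cft G K + cft G K) := by ring
  rw [e3]
  nth_rewrite 1 [e1]
  rw [e2, ← integral_add (hi _) (hi _), ← integral_const_mul]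
  congr 1
  funext x
  rw [Complex.ofReal_cos, Complex.cos]
  push_cast
  rw [show (K : ℂ) * x * Complex.I = Complex.I * K * x by ring,
    show -((K : ℂ) * x) * Complex.I = Complex.I * -K * x by ring]
  ring

lemma cft_sechC_mul {u : L2} (hu : reflL2 u = u) (K : ℝ) :
    cft (fun x => sechC x * u x) K = inner ℂ (cosVec K) u := by
  have h1 : Integrable (fun x => sechC x * u x) := by
    simpa [expW_zero] using (expL2_sechC_mul (Lp.memLp u)).integrable (η := 0) (by norm_num)
  have h2 : ∀ᵐ x, u (-x) = u x := by
    have := coeFn_reflL2 u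
    rw [hu] at this
    exact this.symm
  rw [cft_of_even h1 (by filter_upwards [h2] with x hx; rw [hx, sechC_neg]), L2.inner_def]
  refine integral_congr_ae ?_
  filter_upwards [coeFn_cosVec K] with x hx
  rw [hx, RCLike.inner_apply, map_mul, conj_sechC, Complex.conj_ofReal]
  ring

/-- The projection along `cosVec K` onto its orthogonal complement. -/
def removeCos (K : ℝ) : L2 →L[ℂ] L2 :=
  1 - (((‖cosVec K‖ ^ 2)⁻¹ : ℝ) : ℂ) • (innerSL ℂ (cosVec K)).smulRight (cosVec K)

lemma removeCos_apply (K : ℝ) (u : L2) : removeCos K u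
    = u - (((‖cosVec K‖ ^ 2)⁻¹ : ℝ) * inner ℂ (cosVec K) u : ℂ) • cosVec K := by
  simp [removeCos, smul_smul]

lemma inner_cosVec_removeCos (K : ℝ) (u : L2) : inner ℂ (cosVec K) (removeCos K u) = 0 := by
  rw [removeCos_apply, inner_sub_right, inner_smul_right, inner_self_eq_norm_sq_to_K]
  by_cases h : cosVec K = 0
  · simp [h]
  · have : (‖cosVec K‖ : ℂ) ≠ 0 := by exact_mod_cast norm_ne_zero_iff.2 h
    push_cast
    field_simp
    simp

lemma reflL2_removeCos {u : L2} (hu : reflL2 u = u) (K : ℝ) :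
    reflL2 (removeCos K u) = removeCos K u := by
  rw [removeCos_apply, map_sub, map_smul, hu, reflL2_cosVec]

lemma norm_removeCos_sub_le (K : ℝ) (u : L2) :
    ‖(((‖cosVec K‖ ^ 2)⁻¹ : ℝ) * inner ℂ (cosVec K) u : ℂ)‖ ≤ ‖cosVec K‖⁻¹ * ‖u‖ := by
  rw [norm_mul, Complex.norm_real, Real.norm_of_nonneg (by positivity)]
  by_cases h : cosVec K = 0
  · simp [h]
  have h0 : 0 < ‖cosVec K‖ := norm_pos_iff.2 h
  calc _ ≤ (‖cosVec K‖ ^ 2)⁻¹ * (‖cosVec K‖ * ‖u‖) := by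
        gcongr
        exact norm_inner_le_norm _ _
    _ = _ := by field_simp

lemma norm_removeCos_apply_le (K : ℝ) (u : L2) : ‖removeCos K u‖ ≤ 2 * ‖u‖ := by
  rw [removeCos_apply]
  refine (norm_sub_le _ _).trans ?_
  rw [norm_smul]
  have h1 := mul_le_mul_of_nonneg_right (norm_removeCos_sub_le K u) (norm_nonneg (cosVec K))
  have h2 : ‖cosVec K‖⁻¹ * ‖u‖ * ‖cosVec K‖ ≤ ‖u‖ := by
    rw [mul_right_comm]
    refine mul_le_of_le_one_left (norm_nonneg u) ?_
    exact inv_mul_le_one_of_le₀ le_rfl (norm_nonneg _)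
  linarith

/-- The function `e^{-x/2}` on the positive half line, extended by `0`. -/
def cutPos (x : ℝ) : ℂ := if 0 < x then (Real.exp (-(1 / 2) * x) : ℂ) else 0

/-- The function `e^{x/2}` on the negative half line, extended by `0`. -/
def cutNeg (x : ℝ) : ℂ := if 0 < x then 0 else (Real.exp (1 / 2 * x) : ℂ)

lemma isBddMul_cutPos : IsBddMul cutPos 1 := by
  refine ⟨(Measurable.ite measurableSet_Ioi (by fun_prop) measurable_const).aestronglyMeasurable,
    fun x => ?_⟩
  unfold cutPos
  split_ifs with h
  · rw [Complex.norm_real, Real.norm_of_nonneg (Real.exp_pos _).le, Real.exp_le_one_iff]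
    linarith
  · simp

lemma isBddMul_cutNeg : IsBddMul cutNeg 1 := by
  refine ⟨(Measurable.ite measurableSet_Ioi measurable_const (by fun_prop)).aestronglyMeasurable,
    fun x => ?_⟩
  unfold cutNeg
  split_ifs with h
  · simp
  · rw [Complex.norm_real, Real.norm_of_nonneg (Real.exp_pos _).le, Real.exp_le_one_iff]
    linarith

/-- The operator `u ↦ n(D) (sech(x/2) u)`, for a multiplier whose symbol is singular on the real
axis: `n` only enters through its restrictions `n₊`, `n₋` to the lines `Im z = ±1/2`, as
`e^{± x/2} n(D) F = n_±(D) (e^{± x/2} F)`; the first identity is used for `x > 0`, the second for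
`x ≤ 0`. -/
def glueOp {np nm : ℝ → ℂ} {M : ℝ} (hp : IsBddMul np M) (hm : IsBddMul nm M) : L2 →L[ℂ] L2 :=
  mulL2 isBddMul_cutPos * (fmulL2 hp *
      mulL2 (isBddMul_coshProd_sech (p := 1 / 2) (abs_of_pos (by norm_num)))) +
    mulL2 isBddMul_cutNeg * (fmulL2 hm *
      mulL2 (isBddMul_coshProd_sech (p := -(1 / 2)) (by rw [abs_neg]; exact abs_of_pos (by norm_num))))

lemma fmulL2_sub {f g : ℝ → ℂ} {M N δ : ℝ} (hf : IsBddMul f M) (hg : IsBddMul g N)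
    (h : ∀ x, ‖f x - g x‖ ≤ δ) : ‖fmulL2 hf - fmulL2 hg‖ ≤ δ := by
  have hfg : IsBddMul (fun x => f x - g x) δ := ⟨hf.aesm.sub hg.aesm, h⟩
  have e : fmulL2 hf - fmulL2 hg = fmulL2 hfg := by
    ext1 u
    refine fourierIso.injective (Lp.ext ?_)
    rw [sub_apply, map_sub, fourierIso_fmulL2, fourierIso_fmulL2,
      fourierIso_fmulL2]
    filter_upwards [Lp.coeFn_sub (mulL2 hf (fourierIso u)) (mulL2 hg (fourierIso u)),
      coeFn_mulL2 hf (fourierIso u), coeFn_mulL2 hg (fourierIso u),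
      coeFn_mulL2 hfg (fourierIso u)] with x h1 h2 h3 h4
    rw [h1, Pi.sub_apply, h2, h3, h4, sub_mul]
  rw [e]
  exact norm_fmulL2_le hfg

lemma norm_glueOp_sub_le {np nm np' nm' : ℝ → ℂ} {M N δ : ℝ} (hp : IsBddMul np M)
    (hm : IsBddMul nm M) (hp' : IsBddMul np' N) (hm' : IsBddMul nm' N) (hδ : 0 ≤ δ)
    (h1 : ∀ x, ‖np x - np' x‖ ≤ δ) (h2 : ∀ x, ‖nm x - nm' x‖ ≤ δ) :
    ‖glueOp hp hm - glueOp hp' hm'‖ ≤ 4 * δ := by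
  have key : ∀ {c e : ℝ → ℂ} (hc : IsBddMul c 1) (he : IsBddMul e 2) (A : L2 →L[ℂ] L2), ‖A‖ ≤ δ →
      ‖mulL2 hc * (A * mulL2 he)‖ ≤ 2 * δ := by
    intro c e hc he A hA
    calc _ ≤ ‖mulL2 hc‖ * (‖A‖ * ‖mulL2 he‖) :=
          (norm_mul_le _ _).trans (by gcongr; exact norm_mul_le _ _)
      _ ≤ 1 * (δ * 2) := by
          gcongr
          · exact norm_mulL2_le hc
          · exact norm_mulL2_le he
      _ = _ := by ring
  have e : glueOp hp hm - glueOp hp' hm' = mulL2 isBddMul_cutPos * ((fmulL2 hp - fmulL2 hp') *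
      mulL2 (isBddMul_coshProd_sech (p := 1 / 2) (abs_of_pos (by norm_num)))) +
      mulL2 isBddMul_cutNeg * ((fmulL2 hm - fmulL2 hm') * mulL2 (isBddMul_coshProd_sech
        (p := -(1 / 2)) (by rw [abs_neg]; exact abs_of_pos (by norm_num)))) := by
    rw [glueOp, glueOp]
    noncomm_ring
  rw [e]
  refine (norm_add_le _ _).trans ?_
  have a1 := key isBddMul_cutPos (isBddMul_coshProd_sech (p := 1 / 2) (abs_of_pos (by norm_num))) _
    (fmulL2_sub hp hp' h1)
  have a2 := key isBddMul_cutNeg (isBddMul_coshProd_sech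
    (p := -(1 / 2)) (by rw [abs_neg]; exact abs_of_pos (by norm_num))) _ (fmulL2_sub hm hm' h2)
  linarith

/-- If `e^{p x} R`, `p = ± 1/2`, are the images of `e^{p x} sech(x/2) u` under the multipliers with
symbols `n p`, then `R = glueOp u`. -/
lemma toLp_eq_glueOp {n : ℝ → ℝ → ℂ} {M : ℝ} (hp : IsBddMul (n (1 / 2)) M)
    (hm : IsBddMul (n (-(1 / 2))) M) {R : ℝ → ℂ} (hR : MemLp R 2 volume) (hR' : ExpL2 (1 / 2) R)
    (u : L2) (h : ∀ p : ℝ, |p| = 1 / 2 → fourierL2 (expW p R) =ᵐ[volume]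
      fun ξ => n p ξ * fourierL2 (expW p fun x => sechC x * u x) ξ) :
    hR.toLp R = glueOp hp hm u := by
  have a1 : |(1 / 2 : ℝ)| = 1 / 2 := abs_of_pos (by norm_num)
  have a2 : |(-(1 / 2) : ℝ)| = 1 / 2 := by rw [abs_neg, a1]
  have h1 := h _ a1
  have h2 := h _ a2
  rw [expW_sechC_mul] at h1 h2
  have e1 := eq_fmulL2_of_fourierL2 hp ((isBddMul_coshProd_sech a1).memLp (Lp.memLp u)) hR'.1 h1
  have e2 := eq_fmulL2_of_fourierL2 hm ((isBddMul_coshProd_sech a2).memLp (Lp.memLp u)) hR'.2 h2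
  set U := fmulL2 hp (mulL2 (isBddMul_coshProd_sech a1) u) with hU
  set V := fmulL2 hm (mulL2 (isBddMul_coshProd_sech a2) u) with hV
  have e3 : glueOp hp hm u = mulL2 isBddMul_cutPos U + mulL2 isBddMul_cutNeg V := rfl
  have e1' : hR'.1.toLp _ = U := e1
  have e2' : hR'.2.toLp _ = V := e2
  refine Lp.ext ?_
  rw [e3]
  filter_upwards [Lp.coeFn_add (mulL2 isBddMul_cutPos U) (mulL2 isBddMul_cutNeg V),
    coeFn_mulL2 isBddMul_cutPos U, coeFn_mulL2 isBddMul_cutNeg V, hR.coeFn_toLp,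
    e1' ▸ hR'.1.coeFn_toLp, e2' ▸ hR'.2.coeFn_toLp] with x b1 b2 b3 b4 b5 b6
  rw [b1, Pi.add_apply, b2, b3, b4, b5, b6, cutPos, cutNeg, expW, expW]
  have c1 : (Real.exp (1 / 2 * x) : ℂ) * (Real.exp (-(1 / 2) * x) : ℂ) = 1 := by
    rw [← Complex.ofReal_mul, ← Real.exp_add, ← add_mul, add_neg_cancel, zero_mul, Real.exp_zero,
      Complex.ofReal_one]
  split_ifs with hx
  · linear_combination (-R x) * c1
  · linear_combination (-R x) * c1

/-! ### The perturbed operator on `L²` -/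

lemma expW_congr {F G : ℝ → ℂ} (h : F =ᵐ[volume] G) (η : ℝ) : expW η F =ᵐ[volume] expW η G := by
  filter_upwards [h] with x hx
  rw [expW, expW, hx]

lemma ExpL2.congr {q : ℝ} {F G : ℝ → ℂ} (hF : ExpL2 q F) (h : F =ᵐ[volume] G) : ExpL2 q G :=
  ⟨(memLp_congr_ae (expW_congr h q)).1 hF.1, (memLp_congr_ae (expW_congr h (-q))).1 hF.2⟩

lemma ExpL2.add {q : ℝ} {F G : ℝ → ℂ} (hF : ExpL2 q F) (hG : ExpL2 q G) :
    ExpL2 q (fun x => F x + G x) := by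
  have e : ∀ η, expW η (fun x => F x + G x) = expW η F + expW η G := fun η => by
    funext x
    simp only [expW, Pi.add_apply, mul_add]
  exact ⟨e q ▸ hF.1.add hG.1, e (-q) ▸ hF.2.add hG.2⟩

lemma expW_mul (η : ℝ) (ψ F : ℝ → ℂ) : expW η (fun x => ψ x * F x) = fun x => ψ x * expW η F x := by
  funext x
  simp only [expW]
  ring

lemma ExpL2.mul {q M : ℝ} {F ψ : ℝ → ℂ} (hF : ExpL2 q F) (hψ : IsBddMul ψ M) :
    ExpL2 q (fun x => ψ x * F x) :=
  ⟨expW_mul q ψ F ▸ hψ.memLp hF.1, expW_mul (-q) ψ F ▸ hψ.memLp hF.2⟩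

lemma ExpL2.const_mul {q : ℝ} {F : ℝ → ℂ} (hF : ExpL2 q F) (c : ℂ) :
    ExpL2 q (fun x => c * F x) :=
  hF.mul (ψ := fun _ => c) (M := ‖c‖) ⟨aestronglyMeasurable_const, fun _ => le_rfl⟩

lemma ExpL2.mono {p q : ℝ} {F : ℝ → ℂ} (hF : ExpL2 q F) (hp : 0 ≤ p) (hpq : p ≤ q) : ExpL2 p F :=
  ⟨hF.memLp (by rwa [abs_of_nonneg hp]), hF.memLp (by rwa [abs_neg, abs_of_nonneg hp])⟩

lemma fourierL2_const_mul (c : ℂ) {g : ℝ → ℂ} (hg : MemLp g 2 volume) :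
    fourierL2 (fun x => c * g x) =ᵐ[volume] fun ξ => c * fourierL2 g ξ := by
  have := fourierL2_smul c hg
  change fourierL2 (c • g) =ᵐ[volume] _
  rw [this]
  exact Lp.coeFn_smul c _

lemma norm_limitSymbol_le {β : ℝ} (hβ' : β < 1 / 3) {Z : ℂ} (hZ : |Z.im| ≤ 1 / 2) :
    ‖limitSymbol β Z‖ ≤ 2 / gammaCoeff β := by
  have hγ := gammaCoeff_pos hβ'
  have h := three_quarters_le_norm hZ
  rw [limitSymbol, norm_neg, norm_inv, norm_mul, Complex.norm_real, Real.norm_of_nonneg hγ.le,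
    inv_le_comm₀ (by nlinarith [sq_nonneg Z.re]) (by positivity), inv_div]
  nlinarith [sq_nonneg Z.re]

lemma isBddMul_limitSymbol {β : ℝ} (hβ' : β < 1 / 3) {p : ℝ} (hp : |p| ≤ 1 / 2) :
    IsBddMul (fun ξ : ℝ => limitSymbol β ((2 * Real.pi * ξ : ℝ) + p * Complex.I))
      (2 / gammaCoeff β) := by
  refine ⟨Measurable.aestronglyMeasurable (by unfold limitSymbol; fun_prop), fun ξ => ?_⟩
  refine norm_limitSymbol_le hβ' ?_
  simpa using hp

/-- `limitSymbol` is regular on the real axis, and there it is a multiple of the symbol of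
`(1 - ∂²)⁻¹`. -/
lemma glueOp_limitSymbol {β : ℝ} (hβ' : β < 1 / 3) (u : L2) :
    ((3 * gammaCoeff β : ℝ) : ℂ) • glueOp
      (isBddMul_limitSymbol hβ' (p := 1 / 2) (abs_of_pos (by norm_num)).le)
      (isBddMul_limitSymbol hβ' (p := -(1 / 2)) (by rw [abs_neg]; exact (abs_of_pos (by norm_num)).le)) u
      = -((3 : ℂ) • besselL2 (sechL2 u)) := by
  have hγ := gammaCoeff_pos hβ'
  obtain ⟨R, hR, hR', h1, h2⟩ := limitSymbol_image hβ' (by norm_num) le_rfl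
    (expL2_sechC_mul (Lp.memLp u))
  have e := toLp_eq_glueOp (n := fun p ξ => limitSymbol β ((2 * Real.pi * ξ : ℝ) + p * Complex.I))
    (isBddMul_limitSymbol hβ' (p := 1 / 2) (abs_of_pos (by norm_num)).le)
    (isBddMul_limitSymbol hβ' (p := -(1 / 2)) (by rw [abs_neg]; exact (abs_of_pos (by norm_num)).le))
    hR hR' u h1
  rw [← e]
  refine fourierIso.injective (Lp.ext ?_)
  rw [map_smul, map_neg, map_smul, besselL2, fourierIso_fmulL2]
  have e1 : fourierIso (hR.toLp R) = fourierL2 R := by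
    rw [fourierIso_apply, fourierL2_congr hR.coeFn_toLp]
  have e2 : fourierIso (sechL2 u) = fourierL2 fun x => sechC x * u x := by
    rw [fourierIso_apply, sechL2, fourierL2_congr (coeFn_mulL2 isBddMul_sech u)]
  rw [e1, e2]
  set v := fourierL2 fun x => sechC x * u x
  filter_upwards [h2, Lp.coeFn_smul ((3 * gammaCoeff β : ℝ) : ℂ) (fourierL2 R),
    Lp.coeFn_neg ((3 : ℂ) • mulL2 isBddMul_besselSymbol v),
    Lp.coeFn_smul (3 : ℂ) (mulL2 isBddMul_besselSymbol v), coeFn_mulL2 isBddMul_besselSymbol v]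
    with ξ a1 a2 a3 a4 a5
  rw [a2, a3, Pi.smul_apply, Pi.neg_apply, a4, Pi.smul_apply, a5, a1, limitSymbol, besselSymbol,
    smul_eq_mul, smul_eq_mul]
  have hγ' : (gammaCoeff β : ℂ) ≠ 0 := by exact_mod_cast hγ.ne'
  rw [mul_inv]
  push_cast
  field_simp

/-- The operator `S f = n(D) (2σ f_e - κ 2σ cos(K x))`, where `n = 1/l`, `f_e` is the even part of `f`
and `κ` is chosen so that the right-hand side has vanishing Fourier transform at `±K`: its
defining property, and its distance to the limit operator. -/
lemma exists_perturbedOp {β K c M δ : ℝ} (hβ' : β < 1 / 3) (hK : 0 < K) (hc : 0 < c) {l : ℂ → ℂ}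
    (hl : DifferentiableOn ℂ l {z | |z.im| < 1}) (hlK : l K = 0) (hlK' : l (-K) = 0)
    (hlb : ∀ z : ℂ, |z.im| ≤ 1 / 2 →
      c ≤ ‖l z‖ ∨ c * ‖z - K‖ ≤ ‖l z‖ ∨ c * ‖z + K‖ ≤ ‖l z‖)
    (hM : ∀ Z : ℂ, |Z.im| = 1 / 2 → ‖(l Z)⁻¹‖ ≤ M) (hδ0 : 0 ≤ δ)
    (hδ : ∀ Z : ℂ, |Z.im| = 1 / 2 → ‖(l Z)⁻¹ - limitSymbol β Z‖ ≤ δ) :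
    ∃ S : L2 →L[ℂ] L2, ‖S - limitOp‖
        ≤ 24 * gammaCoeff β * δ + 3 * (‖cosVec K‖⁻¹ * ‖besselL2 (sechL2 (cosVec K))‖) ∧
      ∀ f : L2, ExpL2 (1 / 2) (S f) ∧ ∀ᵐ ξ : ℝ, l ((2 * Real.pi * ξ : ℝ) : ℂ) * fourierL2 (S f) ξ
        = fourierL2 (fun x => ((3 * gammaCoeff β : ℝ) : ℂ) *
          (sechC x * removeCos K (sechL2 (evenPart f)) x)) ξ := by
  have hγ := gammaCoeff_pos hβ'
  have a1 : |(1 / 2 : ℝ)| = 1 / 2 := abs_of_pos (by norm_num)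
  have a2 : |(-(1 / 2) : ℝ)| = 1 / 2 := by rw [abs_neg, a1]
  have him : ∀ p ξ : ℝ, (((2 * Real.pi * ξ : ℝ) : ℂ) + p * Complex.I).im = p := by intro p ξ; simp
  -- the symbols on the two boundary lines
  have hn : ∀ p : ℝ, |p| = 1 / 2 →
      IsBddMul (fun ξ : ℝ => (l ((2 * Real.pi * ξ : ℝ) + p * Complex.I))⁻¹) M := by
    intro p hp
    refine ⟨Measurable.aestronglyMeasurable (Measurable.inv (Continuous.measurable ?_)), fun ξ =>
      hM _ (by rw [him, hp])⟩
    refine hl.continuousOn.comp_continuous (by fun_prop) fun ξ => ?_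
    change |(((2 * Real.pi * ξ : ℝ) : ℂ) + p * Complex.I).im| < 1
    rw [him, hp]
    norm_num
  set T := glueOp (hn _ a1) (hn _ a2) with hT
  set T₀ := glueOp (isBddMul_limitSymbol hβ' (p := 1 / 2) a1.le)
    (isBddMul_limitSymbol hβ' (p := -(1 / 2)) a2.le) with hT₀
  have hTT : ‖T - T₀‖ ≤ 4 * δ := norm_glueOp_sub_le _ _ _ _ hδ0
    (fun ξ => hδ _ (by rw [him, a1])) (fun ξ => hδ _ (by rw [him, a2]))
  refine ⟨((3 * gammaCoeff β : ℝ) : ℂ) • (T * (removeCos K * (sechL2 * evenPart))), ?_, fun f => ?_⟩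
  · refine ContinuousLinearMap.opNorm_le_bound _ (by positivity) fun f => ?_
    set u := sechL2 (evenPart f) with hu
    have hu1 : ‖u‖ ≤ ‖f‖ := (norm_sechL2_apply_le _).trans (by
      simpa using evenPart.le_of_opNorm_le norm_evenPart_le f)
    -- besides `T - T₀` there is the component of `u` along `cosVec K`, on which `T₀` is small
    have e0 : limitOp f = ((3 * gammaCoeff β : ℝ) : ℂ) • T₀ u := by
      rw [hT₀, glueOp_limitSymbol hβ']
      rfl
    have e1 : (((3 * gammaCoeff β : ℝ) : ℂ) • (T * (removeCos K * (sechL2 * evenPart))) - limitOp) f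
        = ((3 * gammaCoeff β : ℝ) : ℂ) • (T - T₀) (removeCos K u)
          - (((‖cosVec K‖ ^ 2)⁻¹ : ℝ) * inner ℂ (cosVec K) u : ℂ) •
            ((3 * gammaCoeff β : ℝ) : ℂ) • T₀ (cosVec K) := by
      rw [sub_apply, e0, sub_apply]
      change ((3 * gammaCoeff β : ℝ) : ℂ) • T (removeCos K u) - _ = _
      have e2 : T₀ (removeCos K u) = T₀ u - (((‖cosVec K‖ ^ 2)⁻¹ : ℝ) * inner ℂ (cosVec K) u : ℂ) •
          T₀ (cosVec K) := by
        rw [removeCos_apply, map_sub, map_smul]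
      rw [e2]
      module
    rw [e1]
    refine (norm_sub_le _ _).trans ?_
    rw [add_mul]
    refine add_le_add ?_ ?_
    · rw [norm_smul, Complex.norm_real, Real.norm_of_nonneg (by positivity)]
      calc 3 * gammaCoeff β * ‖(T - T₀) (removeCos K u)‖
          ≤ 3 * gammaCoeff β * (4 * δ * (2 * ‖f‖)) := by
            gcongr
            refine ((T - T₀).le_of_opNorm_le hTT _).trans ?_
            gcongr
            exact (norm_removeCos_apply_le K u).trans (by gcongr)
        _ = _ := by ring
    · rw [hT₀, glueOp_limitSymbol hβ', norm_smul, norm_neg, norm_smul]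
      calc _ ≤ ‖cosVec K‖⁻¹ * ‖f‖ * (‖(3 : ℂ)‖ * ‖besselL2 (sechL2 (cosVec K))‖) := by
            gcongr
            exact (norm_removeCos_sub_le K u).trans (by gcongr)
        _ = _ := by norm_num; ring
  · set u := removeCos K (sechL2 (evenPart f)) with hu
    have hue : reflL2 u = u := reflL2_removeCos (by rw [reflL2_sechL2, reflL2_evenPart]) K
    have z1 : cft (fun x => sechC x * u x) K = 0 := by
      rw [cft_sechC_mul hue, hu, inner_cosVec_removeCos]
    have z2 : cft (fun x => sechC x * u x) (-K) = 0 := by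
      have := cft_sechC_mul hue (-K)
      rw [cosVec_neg, hu, inner_cosVec_removeCos] at this
      exact_mod_cast this
    obtain ⟨R, hR, hR', h1, h2⟩ := exists_multiplier_image_of_zeros (by norm_num) le_rfl hK hc
      (expL2_sechC_mul (Lp.memLp u)) z1 z2 hl hlK hlK' hlb
    have e := toLp_eq_glueOp (n := fun p ξ => (l ((2 * Real.pi * ξ : ℝ) + p * Complex.I))⁻¹)
      (hn _ a1) (hn _ a2) hR hR' u h1
    have e2 : (((3 * gammaCoeff β : ℝ) : ℂ) • (T * (removeCos K * (sechL2 * evenPart)))) f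
        =ᵐ[volume] fun x => ((3 * gammaCoeff β : ℝ) : ℂ) * R x := by
      change (((3 * gammaCoeff β : ℝ) : ℂ) • T u : L2) =ᵐ[volume] _
      rw [hT, ← e]
      filter_upwards [Lp.coeFn_smul ((3 * gammaCoeff β : ℝ) : ℂ) (hR.toLp R), hR.coeFn_toLp]
        with x b1 b2
      rw [b1, Pi.smul_apply, b2, smul_eq_mul]
    refine ⟨(hR'.const_mul _).congr e2.symm, ?_⟩
    rw [fourierL2_congr e2]
    filter_upwards [h2, fourierL2_const_mul ((3 * gammaCoeff β : ℝ) : ℂ) hR,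
      fourierL2_const_mul ((3 * gammaCoeff β : ℝ) : ℂ) (isBddMul_sech.memLp (Lp.memLp u))]
      with ξ b1 b2 b3
    rw [b2, b3, ← b1]
    ring

/-! ### Cosine waves in the sech well -/

lemma hNorm_sechC_lt_top (r : ℝ) : hNorm r sechC < ∞ := by
  rw [show sechC = fun x => (coshProd 0 0 (-1) 0 0 x : ℂ) from funext sechC_eq]
  exact hNorm_coshProd_lt_top (by norm_num) r

lemma integrable_sechC : Integrable sechC := by
  rw [show sechC = fun x => (coshProd 0 0 (-1) 0 0 x : ℂ) from funext sechC_eq]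
  exact integrable_coshProd (by norm_num)

lemma sechSq_eq_coshProd : (fun x => (sechSq x : ℂ)) = fun x => (coshProd 0 0 (-2) 0 0 x : ℂ) := by
  funext x
  rw [coshProd_sechSq, zero_mul, Real.exp_zero, one_mul]

lemma memLp_sechSq : MemLp (fun x => (sechSq x : ℂ)) 2 volume := by
  rw [sechSq_eq_coshProd]
  exact memLp_coshProd (by norm_num)

lemma integrable_sechSq : Integrable (fun x => (sechSq x : ℂ)) := by
  rw [sechSq_eq_coshProd]
  exact integrable_coshProd (by norm_num)

/-- The Fourier transform of `sech²(x/2)` decays, as a product of two `H²` functions. -/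
lemma exists_norm_cft_sechSq_le : ∃ C : ℝ, 0 < C ∧ ∀ K : ℝ,
    ‖cft (fun x => (sechSq x : ℂ)) K‖ ≤ C * (1 + K ^ 2)⁻¹ := by
  have hN := hNorm_sechC_lt_top 2
  refine ⟨2 * (hNorm 2 sechC).toReal * (hNorm 2 sechC).toReal + 1, by positivity, fun K => ?_⟩
  have h := enorm_cft_mul_le 2 (u := fun x => 1 / Real.cosh (x / 2)) (v := sechC) memLp_sechC
    integrable_sechC memLp_sechC K
  have e : (fun x : ℝ => ((1 / Real.cosh (x / 2) : ℝ) : ℂ) * sechC x) = fun x => (sechSq x : ℂ) :=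
    funext sechC_mul_sechC
  rw [e, abs_of_pos two_pos] at h
  have h2 := ENNReal.toReal_mono (ENNReal.mul_lt_top (ENNReal.mul_lt_top ENNReal.ofReal_lt_top hN) hN).ne h
  rw [toReal_enorm, ENNReal.toReal_mul, ENNReal.toReal_mul, ENNReal.toReal_ofReal (by positivity),
    neg_div, div_self two_ne_zero, Real.rpow_one, Real.rpow_neg_one] at h2
  refine h2.trans ?_
  have : 0 < (1 + K ^ 2)⁻¹ := by positivity
  nlinarith

/-- `∫ cos²(Kx) sech²(x/2) dx` in terms of the Fourier transform of `sech²(x/2)`. -/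
lemma norm_cosVec_sq (K : ℝ) : ((‖cosVec K‖ ^ 2 : ℝ) : ℂ)
    = (1 / 2) * (cft (fun x => (sechSq x : ℂ)) 0 + cft (fun x => (sechSq x : ℂ)) (2 * K : ℝ)) := by
  have he : ∀ᵐ x : ℝ, (sechSq (-x) : ℂ) = sechSq x := Eventually.of_forall fun x => by rw [sechSq_neg]
  have h0 := cft_of_even integrable_sechSq he 0
  rw [Complex.ofReal_zero] at h0
  have hi : ∀ K : ℝ, Integrable fun x => (Real.cos (K * x) : ℂ) * (sechSq x : ℂ) := fun K =>
    integrable_sechSq.bdd_mul (isBddMul_cos K).aesm (Eventually.of_forall (isBddMul_cos K).bound)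
  rw [h0, cft_of_even integrable_sechSq he, ← integral_add (hi _) (hi _), ← integral_const_mul,
    norm_L2_sq]
  refine Eq.trans (integral_ofReal (𝕜 := ℂ)).symm (integral_congr_ae ?_)
  filter_upwards [coeFn_cosVec K] with x hx
  change ((‖cosVec K x‖ ^ 2 : ℝ) : ℂ) = _
  rw [hx, norm_mul, Complex.norm_real, Complex.norm_real, zero_mul, Real.cos_zero, mul_pow,
    Real.norm_eq_abs, Real.norm_eq_abs, sq_abs, sq_abs, sechSq,
    show 2 * K * x = 2 * (K * x) by ring, Real.cos_two_mul]
  push_cast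
  ring

lemma cft_sechSq_zero : ∃ S : ℝ, 0 < S ∧ cft (fun x => (sechSq x : ℂ)) 0 = S := by
  refine ⟨‖cosVec 0‖ ^ 2, ?_, ?_⟩
  · refine pow_pos (norm_pos_iff.2 fun h => ?_) 2
    have h1 : ∀ᵐ x : ℝ, False := by
      have h2 := coeFn_cosVec 0
      rw [h] at h2
      filter_upwards [h2, Lp.coeFn_zero ℂ 2 (volume : Measure ℝ)] with x a1 a2
      rw [a1, zero_mul, Real.cos_zero, Complex.ofReal_one, one_mul, Pi.zero_apply,
        Complex.ofReal_eq_zero] at a2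
      exact (one_div_pos.2 (Real.cosh_pos (x / 2))).ne' a2
    obtain ⟨x, hx⟩ := h1.exists
    exact hx
  · rw [norm_cosVec_sq]
    norm_num
    ring

lemma norm_besselL2_eq (g : L2) : ENNReal.ofReal ‖besselL2 g‖ = hNorm (-2) g := by
  have h : besselL2 g = fmulL2 isBddMul_besselSymbol g := rfl
  rw [h, norm_fmulL2_apply, Lp.norm_def, ENNReal.ofReal_toReal (Lp.memLp _).2.ne, hNorm]
  refine eLpNorm_congr_norm_ae ?_
  filter_upwards [coeFn_mulL2 isBddMul_besselSymbol (fourierIso g)] with ξ hξ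
  rw [hξ, norm_mul, norm_besselFourier, fourierIso_apply, besselSymbol, Complex.norm_real,
    neg_div, div_self two_ne_zero, Real.rpow_neg_one,
    Real.norm_of_nonneg (by have := one_le_japanese ξ; positivity)]

lemma exists_norm_bessel_cosVec_le : ∃ C : ℝ, 0 < C ∧ ∀ K : ℝ,
    ‖besselL2 (sechL2 (cosVec K))‖ ≤ C * (1 + K ^ 2)⁻¹ := by
  have hN : hNorm 2 (fun x => (sechSq x : ℂ)) < ∞ := by
    rw [sechSq_eq_coshProd]
    exact hNorm_coshProd_lt_top (by norm_num) 2
  refine ⟨2 * (hNorm 2 fun x => (sechSq x : ℂ)).toReal + 1, by positivity, fun K => ?_⟩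
  have h := hNorm_cos_mul_le (-2) memLp_sechSq integrable_sechSq K
  have e : (fun x : ℝ => (Real.cos (K * x) : ℂ) * (sechSq x : ℂ)) =ᵐ[volume] sechL2 (cosVec K) := by
    filter_upwards [coeFn_mulL2 isBddMul_sech (cosVec K), coeFn_cosVec K] with x h1 h2
    rw [sechL2, h1, h2, ← sechC_mul_sechC]
    ring
  rw [hNorm_congr e, abs_neg, abs_of_pos two_pos, ← norm_besselL2_eq] at h
  have h2 := ENNReal.toReal_mono (ENNReal.mul_lt_top ENNReal.ofReal_lt_top hN).ne h
  rw [ENNReal.toReal_ofReal (norm_nonneg _), ENNReal.toReal_mul, ENNReal.toReal_ofReal (by positivity),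
    neg_div, div_self two_ne_zero, Real.rpow_one, Real.rpow_neg_one] at h2
  refine h2.trans ?_
  have : 0 < (1 + K ^ 2)⁻¹ := by positivity
  nlinarith

/-- For high wave numbers `cosVec K` keeps its size, while `(1 - ∂²)⁻¹ sech` makes it small. -/
lemma exists_cosVec_bounds : ∃ K₁ m C : ℝ, 0 < K₁ ∧ 0 < m ∧ 0 < C ∧ ∀ K, K₁ ≤ K →
    m ≤ ‖cosVec K‖ ^ 2 ∧ ‖cosVec K‖⁻¹ * ‖besselL2 (sechL2 (cosVec K))‖ ≤ C * K⁻¹ := by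
  obtain ⟨S, hS, hS0⟩ := cft_sechSq_zero
  obtain ⟨A, hA, hA1⟩ := exists_norm_cft_sechSq_le
  obtain ⟨B, hB, hB1⟩ := exists_norm_bessel_cosVec_le
  have hlow : ∀ K : ℝ, 1 ≤ K → A / (S / 2) ≤ K → S / 4 ≤ ‖cosVec K‖ ^ 2 := by
    intro K hK1 hK2
    have h1 := norm_cosVec_sq K
    have h2 : ‖cft (fun x => (sechSq x : ℂ)) (2 * K : ℝ)‖ ≤ S / 2 := by
      refine (hA1 (2 * K)).trans ?_
      rw [← div_eq_mul_inv, div_le_iff₀ (by positivity)]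
      rw [div_le_iff₀ (by positivity)] at hK2
      nlinarith
    have h3 : ‖cosVec K‖ ^ 2 = 1 / 2 * (S + (cft (fun x => (sechSq x : ℂ)) (2 * K : ℝ)).re) := by
      have := congrArg Complex.re h1
      rw [hS0, Complex.ofReal_re] at this
      rw [this]
      simp
    have h4 := (abs_le.1 ((Complex.abs_re_le_norm _).trans h2)).1
    linarith
  refine ⟨max 1 (A / (S / 2)), S / 4, (√(S / 4))⁻¹ * B, by positivity, by positivity, by positivity,
    fun K hK => ?_⟩
  have hK1 : 1 ≤ K := (le_max_left _ _).trans hK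
  have h1 := hlow K hK1 ((le_max_right _ _).trans hK)
  refine ⟨h1, ?_⟩
  rw [mul_assoc]
  have h5 : √(S / 4) ≤ ‖cosVec K‖ := by
    rw [← Real.sqrt_sq (norm_nonneg (cosVec K))]
    exact Real.sqrt_le_sqrt h1
  have h6 : 0 < √(S / 4) := Real.sqrt_pos.2 (by positivity)
  gcongr
  refine (hB1 K).trans ?_
  gcongr
  nlinarith

/-- A perturbation of an invertible operator, with a uniform bound for the inverse. -/
lemma exists_inverse_of_near {U : L2 →L[ℂ] L2} (hU : IsUnit U) : ∃ δ M : ℝ, 0 < δ ∧ 0 < M ∧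
    ∀ V : L2 →L[ℂ] L2, ‖V - U‖ ≤ δ → ∃ W : L2 →L[ℂ] L2, V * W = 1 ∧ W * V = 1 ∧ ‖W‖ ≤ M := by
  obtain ⟨u, rfl⟩ := hU
  have h1 : ∀ᶠ V in 𝓝 (u : L2 →L[ℂ] L2), IsUnit V := Units.isOpen.mem_nhds u.isUnit
  have h2 : ∀ᶠ V in 𝓝 (u : L2 →L[ℂ] L2), ‖Ring.inverse V‖ < ‖Ring.inverse (u : L2 →L[ℂ] L2)‖ + 1 :=
    (NormedRing.inverse_continuousAt u).norm.eventually_lt_const (lt_add_one _)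
  obtain ⟨δ, hδ, h⟩ := Metric.nhds_basis_closedBall.mem_iff.1 (h1.and h2)
  refine ⟨δ, ‖Ring.inverse (u : L2 →L[ℂ] L2)‖ + 1, hδ, by positivity, fun V hV => ?_⟩
  obtain ⟨a1, a2⟩ := h (mem_closedBall_iff_norm.2 hV)
  exact ⟨Ring.inverse V, Ring.mul_inverse_cancel V a1, Ring.inverse_mul_cancel V a1, a2.le⟩

/-! ### Uniform invertibility -/

/-- What the solution of the linear problem for a given `ε` uses of the symbol `l_ε` with zeros
`±K` and of the perturbed operator `S`; `W` is the inverse of `1 + S`, and `m`, `M` do not depend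
on `ε`. -/
structure IsSolver (β ε K m M : ℝ) (S W : L2 →L[ℂ] L2) : Prop where
  diff : DifferentiableOn ℂ (linSymbolC β ε) {Z | |Z.im| < 1}
  pos : 0 < K
  root : linSymbol β ε K = 0
  uniq : ∀ K', 0 < K' → linSymbol β ε K' = 0 → K' = K
  simple : ∃ c, 0 < c ∧ ∀ Z : ℂ, |Z.im| ≤ 1 / 2 → c ≤ ‖linSymbolC β ε Z‖ ∨
    c * ‖Z - K‖ ≤ ‖linSymbolC β ε Z‖ ∨ c * ‖Z + K‖ ≤ ‖linSymbolC β ε Z‖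
  mass : m ≤ ‖cosVec K‖ ^ 2
  inv_right : (1 + S) * W = 1
  inv_left : W * (1 + S) = 1
  bound : ‖W‖ ≤ M
  expL2 : ∀ f, ExpL2 (1 / 2) (S f)
  fourier : ∀ f : L2, ∀ᵐ ξ : ℝ, linSymbolC β ε ((2 * Real.pi * ξ : ℝ) : ℂ) * fourierL2 (S f) ξ
    = fourierL2 (fun x => ((3 * gammaCoeff β : ℝ) : ℂ) *
      (sechC x * removeCos K (sechL2 (evenPart f)) x)) ξ

/-- For small `ε` the perturbed operator `S` is close to `limitOp`, so `1 + S` is invertible with a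
bound that does not depend on `ε`. -/
lemma exists_isSolver {β : ℝ} (hβ : 0 < β) (hβ' : β < 1 / 3) :
    ∃ ε₀ D m M : ℝ, 0 < ε₀ ∧ 0 < D ∧ 0 < m ∧ 0 < M ∧
      (∀ q, 0 < q → ∃ C, 0 < C ∧ ∀ ε, 0 < ε → ε ≤ ε₀ → ∀ Z : ℂ, q ≤ |Z.im| → |Z.im| ≤ 1 / 2 →
        (1 + Z.re ^ 2) ^ (1 / 4 : ℝ) * ‖(linSymbolC β ε Z)⁻¹‖ ≤ C) ∧
      ∀ ε, 0 < ε → ε ≤ ε₀ → ∃ (K : ℝ) (S W : L2 →L[ℂ] L2), D / ε ≤ K ∧ IsSolver β ε K m M S W := by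
  obtain ⟨ε₁, D, hε₁, hε₁1, hD, hCq, ⟨C, hC, hlim⟩, hmain⟩ := exists_linSymbol_bounds hβ hβ'
  obtain ⟨C₂, hC₂, hinv⟩ := hCq (1 / 2) (by norm_num)
  obtain ⟨K₁, m, B, hK₁, hm, hB, hcos⟩ := exists_cosVec_bounds
  obtain ⟨δ, M, hδ, hM, hnear⟩ := exists_inverse_of_near isUnit_one_add_limitOp
  have hγ := gammaCoeff_pos hβ'
  set A := 24 * gammaCoeff β * C + 3 * (B / D) with hA
  have hA0 : 0 < A := by positivity
  refine ⟨min ε₁ (min (D / K₁) (δ / A)), D, m, M, by positivity, hD, hm, hM, fun q hq => ?_,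
    fun ε hε hε' => ?_⟩
  · obtain ⟨C', hC', h⟩ := hCq q hq
    exact ⟨C', hC', fun ε hε hε' => h ε hε (hε'.trans (min_le_left _ _))⟩
  have h1 : ε ≤ ε₁ := hε'.trans (min_le_left _ _)
  have h2 : ε ≤ D / K₁ := hε'.trans ((min_le_right _ _).trans (min_le_left _ _))
  have h3 : ε ≤ δ / A := hε'.trans ((min_le_right _ _).trans (min_le_right _ _))
  obtain ⟨hd, K, hK, hDK, hroot, huniq, c, hc, hlb⟩ := hmain ε hε h1
  have hKK : K₁ ≤ K := by
    refine le_trans ?_ hDK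
    rw [le_div_iff₀ hε]
    rw [le_div_iff₀ hK₁] at h2
    linarith
  obtain ⟨hmass, hbes⟩ := hcos K hKK
  have hβ1 : β < 1 := by linarith
  have z1 : linSymbolC β ε K = 0 := by rw [linSymbolC_ofReal hβ hβ1, hroot, Complex.ofReal_zero]
  have z2 : linSymbolC β ε (-K) = 0 := by
    rw [← Complex.ofReal_neg, linSymbolC_ofReal hβ hβ1, linSymbol_neg, hroot, Complex.ofReal_zero]
  obtain ⟨S, hS, hchar⟩ := exists_perturbedOp (M := C₂) (δ := C * ε) hβ' hK hc hd z1 z2 hlb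
    (fun Z hZ => by
      refine le_trans ?_ (hinv ε hε h1 Z hZ.ge hZ.le)
      refine le_mul_of_one_le_left (norm_nonneg _) (Real.one_le_rpow ?_ (by norm_num))
      nlinarith [sq_nonneg Z.re]) (by positivity) (fun Z hZ => hlim ε hε h1 Z hZ)
  -- both errors are `O(ε)`: that of the symbol, and that of the cosine, as `K ≥ D / ε`
  obtain ⟨W, hW1, hW2, hW3⟩ := hnear (1 + S) (by
    rw [add_sub_add_left_eq_sub]
    refine hS.trans ?_
    have hK' : K⁻¹ ≤ ε / D := by
      rw [inv_le_comm₀ hK (by positivity), inv_div]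
      exact hDK
    calc _ ≤ 24 * gammaCoeff β * (C * ε) + 3 * (B * (ε / D)) := by
          have := hbes.trans (mul_le_mul_of_nonneg_left hK' hB.le)
          linarith
      _ = ε * A := by rw [hA]; field_simp
      _ ≤ δ := by rwa [le_div_iff₀ hA0] at h3)
  exact ⟨K, S, W, hDK, hd, hK, hroot, huniq, ⟨c, hc, hlb⟩, hmass, hW1, hW2, hW3,
    fun f => (hchar f).1, fun f => (hchar f).2⟩

/-! ### The weight `cosh^q` and the exponential weights -/

/-- The function `cosh(x)^q v(x)`. -/
def coshMul (q : ℝ) (v : ℝ → ℂ) (x : ℝ) : ℂ := ((Real.cosh x ^ q : ℝ) : ℂ) * v x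

lemma coshMul_eq (q : ℝ) (v : ℝ → ℂ) : coshMul q v = fun x => (coshProd 0 q 0 0 0 x : ℂ) * v x := by
  funext x
  rw [coshMul, coshProd_eq]
  simp

lemma expW_eq_coshProd (p : ℝ) (v : ℝ → ℂ) :
    expW p v = fun x => (coshProd p 0 0 0 0 x : ℂ) * v x := by
  funext x
  rw [expW, coshProd_eq]
  simp

lemma coshMul_congr (q : ℝ) {v w : ℝ → ℂ} (h : v =ᵐ[volume] w) : coshMul q v =ᵐ[volume] coshMul q w := by
  filter_upwards [h] with x hx
  rw [coshMul, coshMul, hx]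

lemma expW_eq_mul_coshMul (p q : ℝ) (v : ℝ → ℂ) :
    expW p v = fun x => (coshProd p (-q) 0 0 0 x : ℂ) * coshMul q v x := by
  funext x
  rw [expW_eq_coshProd, coshMul_eq, ← mul_assoc, ← Complex.ofReal_mul, coshProd_mul]
  simp

lemma smoothBdd_expW_weight {p q : ℝ} (h : |p| ≤ q) :
    SmoothBdd fun x => (coshProd p (-q) 0 0 0 x : ℂ) := smoothBdd_coshProd (by simpa using h)

lemma memLp_expW_of_coshMul {p q : ℝ} (h : |p| ≤ q) {v : ℝ → ℂ} (hv : MemLp (coshMul q v) 2 volume) :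
    MemLp (expW p v) 2 volume := by
  obtain ⟨C, hC⟩ := (smoothBdd_expW_weight h).isBddMul
  rw [expW_eq_mul_coshMul p q]
  exact hC.memLp hv

lemma ExpL2.of_coshMul {q : ℝ} (hq : 0 ≤ q) {v : ℝ → ℂ} (hv : MemLp (coshMul q v) 2 volume) :
    ExpL2 q v :=
  ⟨memLp_expW_of_coshMul (abs_of_nonneg hq).le hv,
    memLp_expW_of_coshMul (by rw [abs_neg, abs_of_nonneg hq]) hv⟩

lemma exists_hNorm_expW_le {p q s : ℝ} (h : |p| ≤ q) (hs : 0 ≤ s) : ∃ C : ℝ, 0 < C ∧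
    ∀ v : ℝ → ℂ, MemLp (coshMul q v) 2 volume →
      hNorm s (expW p v) ≤ ENNReal.ofReal C * hNorm s (coshMul q v) := by
  obtain ⟨C, hC, hb⟩ := exists_hNorm_mul_le hs (smoothBdd_expW_weight h)
  refine ⟨C, hC, fun v hv => ?_⟩
  rw [expW_eq_mul_coshMul p q]
  exact hb _ hv

lemma exists_hNorm_le_coshMul {q s : ℝ} (hq : 0 ≤ q) (hs : 0 ≤ s) : ∃ C : ℝ, 0 < C ∧
    ∀ v : ℝ → ℂ, MemLp (coshMul q v) 2 volume →
      hNorm s v ≤ ENNReal.ofReal C * hNorm s (coshMul q v) := by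
  obtain ⟨C, hC, hb⟩ := exists_hNorm_expW_le (p := 0) (q := q) (by rwa [abs_zero]) hs
  refine ⟨C, hC, fun v hv => ?_⟩
  have := hb v hv
  rwa [expW_zero] at this

/-- `cosh^q` is a combination of `e^{qx}` and `e^{-qx}` with smooth bounded coefficients. -/
lemma coshMul_eq_expW (q : ℝ) (v : ℝ → ℂ) : coshMul q v =
    fun x => (1 / 2 * (coshProd q q 0 (2 * q) (-1) x : ℂ)) * expW q v x
      + (1 / 2 * (coshProd (-q) q 0 (2 * q) (-1) x : ℂ)) * expW (-q) v x := by
  funext x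
  have hc := Real.cosh_pos (2 * q * x)
  have h : Real.cosh x ^ q = 1 / 2 * coshProd q q 0 (2 * q) (-1) x * Real.exp (q * x)
      + 1 / 2 * coshProd (-q) q 0 (2 * q) (-1) x * Real.exp (-q * x) := by
    rw [coshProd_eq, coshProd_eq, Real.rpow_zero, Real.rpow_neg_one, mul_one, mul_one]
    have e1 : Real.exp (q * x) * Real.exp (q * x) + Real.exp (-q * x) * Real.exp (-q * x)
        = 2 * Real.cosh (2 * q * x) := by
      rw [← Real.exp_add, ← Real.exp_add, Real.cosh_eq, show q * x + q * x = 2 * q * x by ring,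
        show -q * x + -q * x = -(2 * q * x) by ring]
      ring
    rw [neg_mul] at e1 ⊢
    field_simp
    linear_combination -e1
  rw [coshMul, h, expW, expW]
  push_cast
  ring

lemma smoothBdd_coshMul_weight {p q : ℝ} (h : |p| = q) :
    SmoothBdd fun x => 1 / 2 * (coshProd p q 0 (2 * q) (-1) x : ℂ) := by
  refine (smoothBdd_coshProd ?_).const_mul _
  have hq : 0 ≤ q := h ▸ abs_nonneg p
  rw [h, abs_mul, abs_two, abs_of_nonneg hq]
  linarith

lemma ExpL2.memLp_coshMul {q : ℝ} (hq : 0 ≤ q) {v : ℝ → ℂ} (hv : ExpL2 q v) :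
    MemLp (coshMul q v) 2 volume := by
  obtain ⟨C, hC⟩ := (smoothBdd_coshMul_weight (abs_of_nonneg hq)).isBddMul
  obtain ⟨D, hD⟩ := (smoothBdd_coshMul_weight (p := -q) (by rw [abs_neg, abs_of_nonneg hq])).isBddMul
  rw [coshMul_eq_expW]
  exact (hC.memLp hv.1).add (hD.memLp hv.2)

lemma exists_hNorm_coshMul_le {q s : ℝ} (hq : 0 ≤ q) (hs : 0 ≤ s) : ∃ C : ℝ, 0 < C ∧
    ∀ v : ℝ → ℂ, ExpL2 q v →
      hNorm s (coshMul q v) ≤ ENNReal.ofReal C * (hNorm s (expW q v) + hNorm s (expW (-q) v)) := by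
  have s1 := smoothBdd_coshMul_weight (abs_of_nonneg hq)
  have s2 := smoothBdd_coshMul_weight (p := -q) (q := q) (by rw [abs_neg, abs_of_nonneg hq])
  obtain ⟨C, hC, hC'⟩ := exists_hNorm_mul_le hs s1
  obtain ⟨D, hD, hD'⟩ := exists_hNorm_mul_le hs s2
  obtain ⟨A, hA⟩ := s1.isBddMul
  obtain ⟨B, hB⟩ := s2.isBddMul
  refine ⟨max C D, lt_max_of_lt_left hC, fun v hv => ?_⟩
  rw [coshMul_eq_expW]
  refine (hNorm_add_le (hA.memLp hv.1) (hB.memLp hv.2)).trans ?_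
  rw [mul_add]
  refine add_le_add ((hC' _ hv.1).trans ?_) ((hD' _ hv.2).trans ?_)
  · gcongr
    exact le_max_left _ _
  · gcongr
    exact le_max_right _ _

lemma coshMul_sechSq_mul (q : ℝ) (v : ℝ → ℂ) : coshMul q (fun x => (sechSq x : ℂ) * v x)
    = fun x => (coshProd 0 q (-2) 0 0 x : ℂ) * v x := by
  funext x
  rw [coshMul_eq]
  beta_reduce
  rw [← mul_assoc]
  congr 1
  have := congrFun sechSq_eq_coshProd x
  rw [this, ← Complex.ofReal_mul, coshProd_mul]
  simp

lemma exists_hNorm_coshMul_sechSq_le {q s : ℝ} (hq : q ≤ 1 / 2) (hs : 0 ≤ s) : ∃ C : ℝ, 0 < C ∧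
    ∀ v : ℝ → ℂ, MemLp v 2 volume →
      hNorm s (coshMul q fun x => (sechSq x : ℂ) * v x) ≤ ENNReal.ofReal C * hNorm s v := by
  obtain ⟨C, hC, hb⟩ := exists_hNorm_mul_le hs
    (smoothBdd_coshProd (p := 0) (a := q) (b := -2) (c := 0) (d := 0) (by norm_num; linarith))
  refine ⟨C, hC, fun v hv => ?_⟩
  rw [coshMul_sechSq_mul]
  exact hb v hv

lemma memLp_coshMul_sechSq {q : ℝ} (hq : q ≤ 1 / 2) {v : ℝ → ℂ} (hv : MemLp v 2 volume) :
    MemLp (coshMul q fun x => (sechSq x : ℂ) * v x) 2 volume := by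
  obtain ⟨C, hC⟩ := (smoothBdd_coshProd (p := 0) (a := q) (b := -2) (c := 0) (d := 0)
    (by norm_num; linarith)).isBddMul
  rw [coshMul_sechSq_mul]
  exact hC.memLp hv

lemma coshMul_cos (q K : ℝ) : coshMul q (fun x => (Real.cos (K * x) : ℂ) * (sechSq x : ℂ))
    = fun x => (Real.cos (K * x) : ℂ) * (coshProd 0 q (-2) 0 0 x : ℂ) := by
  have := coshMul_sechSq_mul q fun x => (Real.cos (K * x) : ℂ)
  simp only [mul_comm] at this ⊢
  exact this

lemma memLp_coshMul_cos {q : ℝ} (hq : q ≤ 1 / 2) (K : ℝ) :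
    MemLp (coshMul q fun x => (Real.cos (K * x) : ℂ) * (sechSq x : ℂ)) 2 volume := by
  rw [coshMul_cos]
  exact (isBddMul_cos K).memLp (memLp_coshProd (by norm_num; linarith))

lemma exists_hNorm_coshMul_cos_le {q s : ℝ} (hq : q ≤ 1 / 2) (hs : 0 ≤ s) : ∃ C : ℝ, 0 < C ∧
    ∀ K : ℝ, hNorm s (coshMul q fun x => (Real.cos (K * x) : ℂ) * (sechSq x : ℂ))
      ≤ ENNReal.ofReal (C * (1 + K ^ 2) ^ (s / 2)) := by
  have h : |(0 : ℝ)| + q + (-2) / 2 + 0 * |(0 : ℝ)| < 0 := by norm_num; linarith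
  have hN := hNorm_coshProd_lt_top h s
  refine ⟨2 ^ (s / 2) * ((hNorm s fun x => (coshProd 0 q (-2) 0 0 x : ℂ)).toReal + 1), by positivity,
    fun K => ?_⟩
  rw [coshMul_cos]
  refine (hNorm_cos_mul_le s (memLp_coshProd h) (integrable_coshProd h) K).trans ?_
  rw [abs_of_nonneg hs]
  nth_rewrite 1 [← ENNReal.ofReal_toReal hN.ne]
  rw [← ENNReal.ofReal_mul (by positivity)]
  refine ENNReal.ofReal_le_ofReal ?_
  have : 0 < (2 : ℝ) ^ (s / 2) * (1 + K ^ 2) ^ (s / 2) := by positivity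
  nlinarith

/-- The Fourier transform of a function of `E^s_q` decays like `k^{-s}`. -/
lemma exists_cft_le {q s : ℝ} (hq : 0 < q) (hs : 0 ≤ s) : ∃ C : ℝ, 0 < C ∧
    ∀ (v : ℝ → ℂ) (K : ℝ), MemLp (coshMul q v) 2 volume →
      ‖cft v K‖ₑ ≤ ENNReal.ofReal (C * (1 + K ^ 2) ^ (-s / 2)) * hNorm s (coshMul q v) := by
  have h : |(0 : ℝ)| + (-q) + 0 / 2 + 0 * |(0 : ℝ)| < 0 := by norm_num; linarith
  have hN := hNorm_coshProd_lt_top h s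
  refine ⟨2 ^ (s / 2) * ((hNorm s fun x => (coshProd 0 (-q) 0 0 0 x : ℂ)).toReal + 1), by positivity,
    fun v K hv => ?_⟩
  have e : v = fun x => (coshProd 0 (-q) 0 0 0 x : ℂ) * coshMul q v x := by
    have := expW_eq_mul_coshMul 0 q v
    rwa [expW_zero] at this
  have key := enorm_cft_mul_le s (memLp_coshProd h) (integrable_coshProd h) hv K
  rw [← e, abs_of_nonneg hs] at key
  refine key.trans ?_
  gcongr
  nth_rewrite 1 [← ENNReal.ofReal_toReal hN.ne]
  rw [← ENNReal.ofReal_mul (by positivity)]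
  refine ENNReal.ofReal_le_ofReal ?_
  have : 0 < (2 : ℝ) ^ (s / 2) * (1 + K ^ 2) ^ (-s / 2) := by positivity
  nlinarith

/-! ### The linear problem in `L²` -/

/-- The function `v` with `2σ R + 2κ σ cos(K x) = sech(x/2) v`. -/
def interaction (β K : ℝ) (R : L2) (κ : ℂ) : L2 :=
  ((3 * gammaCoeff β : ℝ) : ℂ) • (sechL2 R + κ • cosVec K)

/-- The linear problem `l_ε(D) R = F - 2σ R - 2κ σ cos(K x)`, for even complex-valued `R`. -/
structure IsSolution (β ε K : ℝ) (F : ℝ → ℂ) (R : L2) (κ : ℂ) : Prop where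
  even : reflL2 R = R
  fourier : ∀ᵐ ξ : ℝ, linSymbolC β ε ((2 * Real.pi * ξ : ℝ) : ℂ) * fourierL2 R ξ
    = fourierL2 (fun x => F x - sechC x * interaction β K R κ x) ξ

lemma reflL2_interaction {R : L2} (hR : reflL2 R = R) (β K : ℝ) (κ : ℂ) :
    reflL2 (interaction β K R κ) = interaction β K R κ := by
  rw [interaction, map_smul, map_add, map_smul, reflL2_sechL2, hR, reflL2_cosVec]

lemma sechC_mul_interaction (β K : ℝ) (R : L2) (κ : ℂ) :
    (fun x => sechC x * interaction β K R κ x) =ᵐ[volume] fun x => ((3 * gammaCoeff β : ℝ) : ℂ) *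
      ((sechSq x : ℂ) * R x + κ * ((Real.cos (K * x) : ℂ) * (sechSq x : ℂ))) := by
  filter_upwards [Lp.coeFn_smul ((3 * gammaCoeff β : ℝ) : ℂ) (sechL2 R + κ • cosVec K),
    Lp.coeFn_add (sechL2 R) (κ • cosVec K), Lp.coeFn_smul κ (cosVec K), coeFn_cosVec K,
    coeFn_mulL2 isBddMul_sech R] with x h1 h2 h3 h4 h5
  rw [interaction, h1, Pi.smul_apply, h2, Pi.add_apply, h3, Pi.smul_apply, h4, sechL2, h5,
    ← sechC_mul_sechC, smul_eq_mul, smul_eq_mul]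
  ring

lemma inner_cosVec_interaction {R : L2} (hR : reflL2 R = R) (β K : ℝ) (κ : ℂ) :
    inner ℂ (cosVec K) (interaction β K R κ) = ((3 * gammaCoeff β : ℝ) : ℂ) *
      (cft (fun x => (sechSq x : ℂ) * R x) K + κ * ((‖cosVec K‖ ^ 2 : ℝ) : ℂ)) := by
  have e : (fun x => (sechSq x : ℂ) * R x) =ᵐ[volume] fun x => sechC x * sechL2 R x := by
    filter_upwards [coeFn_mulL2 isBddMul_sech R] with x h
    rw [sechL2, h, ← sechC_mul_sechC, mul_assoc]
  have e2 : cft (fun x => (sechSq x : ℂ) * R x) K = cft (fun x => sechC x * sechL2 R x) K := by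
    rw [cft, cft]
    refine integral_congr_ae ?_
    filter_upwards [e] with x hx
    rw [hx]
  rw [e2, cft_sechC_mul (by rw [reflL2_sechL2, hR]), interaction, inner_smul_right, inner_add_right,
    inner_smul_right, inner_self_eq_norm_sq_to_K]
  push_cast
  rfl

lemma ExpL2.sub_sechC_mul {q : ℝ} (hq : 0 ≤ q) (hq' : q ≤ 1 / 2) {F : ℝ → ℂ} (hF : ExpL2 q F)
    (u : L2) : ExpL2 q (fun x => F x - sechC x * u x) := by
  have := hF.add (((expL2_sechC_mul (Lp.memLp u)).mono hq hq').const_mul (-1))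
  refine this.congr (Eventually.of_forall fun x => ?_)
  ring

lemma ExpL2.memLp_self {q : ℝ} (hq : 0 ≤ q) {F : ℝ → ℂ} (hF : ExpL2 q F) : MemLp F 2 volume := by
  simpa [expW_zero] using hF.memLp (η := 0) (by simpa using hq)

lemma ExpL2.integrable_self {q : ℝ} (hq : 0 < q) {F : ℝ → ℂ} (hF : ExpL2 q F) : Integrable F := by
  simpa [expW_zero] using hF.integrable (η := 0) (by simpa using hq)

lemma cft_neg_of_even {G : ℝ → ℂ} (hG : Integrable G) (he : ∀ᵐ x, G (-x) = G x) (K : ℝ) :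
    cft G (-K) = cft G K := by
  have := cft_of_even hG he (-K)
  rw [Complex.ofReal_neg] at this
  rw [this, cft_of_even hG he]
  simp only [neg_mul, Real.cos_neg]

lemma integrable_cexp_mul {G : ℝ → ℂ} (hG : Integrable G) (K : ℝ) :
    Integrable fun x : ℝ => Complex.exp (-(Complex.I * K * x)) * G x := by
  have h := isBddMul_cexp (-K)
  refine (hG.bdd_mul h.aesm (Eventually.of_forall h.bound)).congr (Eventually.of_forall fun x => ?_)
  beta_reduce
  congr 2
  push_cast
  ring

lemma cft_sub_sechC_mul {q : ℝ} (hq : 0 < q) {F : ℝ → ℂ} (hF : ExpL2 q F) {u : L2}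
    (hu : reflL2 u = u) (K : ℝ) :
    cft (fun x => F x - sechC x * u x) K = cft F K - inner ℂ (cosVec K) u := by
  have h1 := (expL2_sechC_mul (Lp.memLp u)).integrable_self (by norm_num)
  rw [← cft_sechC_mul hu, cft, cft, cft, ← integral_sub (integrable_cexp_mul (hF.integrable_self hq) K)
    (integrable_cexp_mul h1 K)]
  simp only [mul_sub]

lemma ae_even_of_reflL2 {u : L2} (hu : reflL2 u = u) : ∀ᵐ x, u (-x) = u x := by
  have := coeFn_reflL2 u
  rw [hu] at this
  exact this.symm

section

variable {β ε K m M : ℝ} {S W : L2 →L[ℂ] L2}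

lemma IsSolver.zero_pos (h : IsSolver β ε K m M S W) (hβ : 0 < β) (hβ' : β < 1 / 3) :
    linSymbolC β ε K = 0 := by
  rw [linSymbolC_ofReal hβ (by linarith), h.root, Complex.ofReal_zero]

lemma IsSolver.zero_neg (h : IsSolver β ε K m M S W) (hβ : 0 < β) (hβ' : β < 1 / 3) :
    linSymbolC β ε (-K) = 0 := by
  rw [← Complex.ofReal_neg, linSymbolC_ofReal hβ (by linarith), linSymbol_neg, h.root,
    Complex.ofReal_zero]

lemma IsSolver.ne_zero_ae (h : IsSolver β ε K m M S W) :
    ∀ᵐ ξ : ℝ, linSymbolC β ε ((2 * Real.pi * ξ : ℝ) : ℂ) ≠ 0 := by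
  have hfin : ({K / (2 * Real.pi), -K / (2 * Real.pi)} : Set ℝ).Finite := Set.toFinite _
  have hae : ∀ᵐ ξ : ℝ, ξ ∉ ({K / (2 * Real.pi), -K / (2 * Real.pi)} : Set ℝ) :=
    measure_eq_zero_iff_ae_notMem.1 (hfin.measure_zero volume)
  obtain ⟨c, hc, hlb⟩ := h.simple
  have hπ : (0 : ℝ) < 2 * Real.pi := by positivity
  filter_upwards [hae] with ξ hξ h0
  have n1 : 2 * Real.pi * ξ ≠ K := fun e => hξ (by rw [← e]; left; field_simp)
  have n2 : 2 * Real.pi * ξ ≠ -K := fun e => hξ (by rw [← e]; right; field_simp; simp)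
  have := hlb ((2 * Real.pi * ξ : ℝ) : ℂ) (by rw [Complex.ofReal_im]; norm_num)
  rw [h0, norm_zero] at this
  rcases this with h1 | h1 | h1
  · linarith
  · have : 0 < ‖((2 * Real.pi * ξ : ℝ) : ℂ) - K‖ :=
      norm_pos_iff.2 (sub_ne_zero.2 (by exact_mod_cast n1))
    nlinarith
  · have : 0 < ‖((2 * Real.pi * ξ : ℝ) : ℂ) + K‖ := by
      rw [← sub_neg_eq_add]
      exact norm_pos_iff.2 (sub_ne_zero.2 (by exact_mod_cast n2))
    nlinarith

lemma IsSolver.ae_eq_of_mul (h : IsSolver β ε K m M S W) {f g : ℝ → ℂ} (hf : MemLp f 2 volume)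
    (hg : MemLp g 2 volume) (hfg : ∀ᵐ ξ : ℝ, linSymbolC β ε ((2 * Real.pi * ξ : ℝ) : ℂ) * fourierL2 f ξ
      = linSymbolC β ε ((2 * Real.pi * ξ : ℝ) : ℂ) * fourierL2 g ξ) : f =ᵐ[volume] g := by
  refine fourierL2_injective hf hg ?_
  filter_upwards [hfg, h.ne_zero_ae] with ξ h1 h2
  exact mul_left_cancel₀ h2 h1

lemma IsSolver.reflL2_eq (h : IsSolver β ε K m M S W) (hβ : 0 < β) (hβ' : β < 1 / 3) (R : L2)
    {Φ : ℝ → ℂ} (hΦ : MemLp Φ 2 volume) (he : ∀ᵐ x, Φ (-x) = Φ x)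
    (hR : ∀ᵐ ξ : ℝ, linSymbolC β ε ((2 * Real.pi * ξ : ℝ) : ℂ) * fourierL2 R ξ = fourierL2 Φ ξ) :
    reflL2 R = R := by
  refine Lp.ext (h.ae_eq_of_mul (Lp.memLp _) (Lp.memLp _) ?_)
  have e1 : fourierL2 (reflL2 R) =ᵐ[volume] fun ξ => fourierL2 R (-ξ) := by
    rw [fourierL2_congr (coeFn_reflL2 R)]
    exact fourierL2_comp_neg (Lp.memLp R)
  have e2 : fourierL2 Φ =ᵐ[volume] fun ξ => fourierL2 Φ (-ξ) := by
    nth_rewrite 1 [← fourierL2_congr (show (fun x => Φ (-x)) =ᵐ[volume] Φ from he)]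
    exact fourierL2_comp_neg hΦ
  filter_upwards [e1, e2, hR, ae_comp_neg hR] with ξ h1 h2 h3 h4
  rw [h1, h3, h2, ← h4]
  congr 1
  rw [linSymbolC_ofReal hβ (by linarith), linSymbolC_ofReal hβ (by linarith), mul_neg, linSymbol_neg]

/-- The identity `l R̂ = Φ̂` holds everywhere on the real axis when `R` and `Φ` decay exponentially. -/
lemma IsSolver.mul_cft_eq (h : IsSolver β ε K m M S W) {q : ℝ} (hq : 0 < q) {R Φ : ℝ → ℂ}
    (hR : ExpL2 q R) (hΦ : ExpL2 q Φ)
    (hRΦ : ∀ᵐ ξ : ℝ, linSymbolC β ε ((2 * Real.pi * ξ : ℝ) : ℂ) * fourierL2 R ξ = fourierL2 Φ ξ)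
    (k : ℝ) : linSymbolC β ε k * cft R k = cft Φ k := by
  have hline : Continuous fun ξ : ℝ => ((2 * Real.pi * ξ : ℝ) : ℂ) := by fun_prop
  have c1 : Continuous fun ξ : ℝ => linSymbolC β ε ((2 * Real.pi * ξ : ℝ) : ℂ) :=
    h.diff.continuousOn.comp_continuous hline fun ξ => by
      change |(((2 * Real.pi * ξ : ℝ) : ℂ)).im| < 1
      rw [Complex.ofReal_im]; norm_num
  have c2 : ∀ {G : ℝ → ℂ}, ExpL2 q G → Continuous fun ξ : ℝ => cft G ((2 * Real.pi * ξ : ℝ) : ℂ) :=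
    fun hG => (differentiableOn_cft hG).continuousOn.comp_continuous hline fun ξ => by
      change |(((2 * Real.pi * ξ : ℝ) : ℂ)).im| < q
      rwa [Complex.ofReal_im, abs_zero]
  have e : (fun ξ : ℝ => linSymbolC β ε ((2 * Real.pi * ξ : ℝ) : ℂ) * cft R ((2 * Real.pi * ξ : ℝ) : ℂ))
      = fun ξ : ℝ => cft Φ ((2 * Real.pi * ξ : ℝ) : ℂ) := by
    refine (Continuous.ae_eq_iff_eq volume (c1.mul (c2 hR)) (c2 hΦ)).1 ?_
    filter_upwards [fourierL2_ae_eq_cft hq hR, fourierL2_ae_eq_cft hq hΦ, hRΦ] with ξ h1 h2 h3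
    rw [Pi.mul_apply, ← h1, ← h2, h3]
  have := congrFun e (k / (2 * Real.pi))
  simpa [mul_div_cancel₀] using this

lemma IsSolution.inner_eq {F : ℝ → ℂ} {R : L2} {κ : ℂ} (hs : IsSolution β ε K F R κ)
    (h : IsSolver β ε K m M S W) (hβ : 0 < β) (hβ' : β < 1 / 3) {q : ℝ} (hq : 0 < q)
    (hq' : q ≤ 1 / 2) (hF : ExpL2 q F) (hR : ExpL2 q R) :
    inner ℂ (cosVec K) (interaction β K R κ) = cft F K := by
  have h1 := h.mul_cft_eq hq hR (hF.sub_sechC_mul hq.le hq' _) hs.fourier K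
  rw [h.zero_pos hβ hβ', zero_mul, cft_sub_sechC_mul hq hF (reflL2_interaction hs.even _ _ _)] at h1
  exact (sub_eq_zero.1 h1.symm).symm

end

/-! ### Uniqueness and existence -/

section

variable {β ε K m M : ℝ} {S W : L2 →L[ℂ] L2}

lemma IsSolution.sub {F : ℝ → ℂ} (hF : MemLp F 2 volume) {R₁ R₂ : L2} {κ₁ κ₂ : ℂ}
    (h₁ : IsSolution β ε K F R₁ κ₁) (h₂ : IsSolution β ε K F R₂ κ₂) :
    IsSolution β ε K (fun _ => 0) (R₁ - R₂) (κ₁ - κ₂) := by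
  refine ⟨by rw [map_sub, h₁.even, h₂.even], ?_⟩
  have m1 : ∀ u : L2, MemLp (fun x => F x - sechC x * u x) 2 volume := fun u =>
    hF.sub (isBddMul_sech.memLp (Lp.memLp u))
  have e1 : interaction β K (R₁ - R₂) (κ₁ - κ₂)
      = interaction β K R₁ κ₁ - interaction β K R₂ κ₂ := by
    rw [interaction, interaction, interaction, map_sub]
    module
  have e2 : (fun x => (0 : ℂ) - sechC x * interaction β K (R₁ - R₂) (κ₁ - κ₂) x) =ᵐ[volume]
      (fun x => F x - sechC x * interaction β K R₁ κ₁ x) -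
        fun x => F x - sechC x * interaction β K R₂ κ₂ x := by
    rw [e1]
    filter_upwards [Lp.coeFn_sub (interaction β K R₁ κ₁) (interaction β K R₂ κ₂)] with x hx
    rw [hx, Pi.sub_apply, Pi.sub_apply]
    ring
  have e3 : fourierL2 (R₁ - R₂ : L2) = fourierL2 R₁ - fourierL2 R₂ := by
    rw [← fourierIso_apply, map_sub, fourierIso_apply, fourierIso_apply]
  rw [fourierL2_congr e2, fourierL2_sub (m1 _) (m1 _), e3]
  filter_upwards [h₁.fourier, h₂.fourier, Lp.coeFn_sub (fourierL2 R₁) (fourierL2 R₂),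
    Lp.coeFn_sub (fourierL2 fun x => F x - sechC x * interaction β K R₁ κ₁ x)
      (fourierL2 fun x => F x - sechC x * interaction β K R₂ κ₂ x)] with ξ a1 a2 a3 a4
  rw [a3, a4, Pi.sub_apply, Pi.sub_apply, mul_sub, a1, a2]

lemma IsSolver.cosVec_ne_zero (h : IsSolver β ε K m M S W) (hm : 0 < m) : cosVec K ≠ 0 := by
  intro h0
  have := h.mass
  rw [h0, norm_zero] at this
  norm_num at this
  linarith

lemma removeCos_cosVec (K : ℝ) (h : cosVec K ≠ 0) : removeCos K (cosVec K) = 0 := by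
  have h0 : (‖cosVec K‖ : ℂ) ≠ 0 := by exact_mod_cast norm_ne_zero_iff.2 h
  rw [removeCos_apply, inner_self_eq_norm_sq_to_K, Complex.ofReal_inv, Complex.ofReal_pow]
  change cosVec K - (((‖cosVec K‖ : ℂ) ^ 2)⁻¹ * (‖cosVec K‖ : ℂ) ^ 2) • cosVec K = 0
  rw [inv_mul_cancel₀ (pow_ne_zero 2 h0), one_smul, sub_self]

/-- Uniqueness for the linear problem. -/
lemma IsSolution.eq_zero {R : L2} {κ : ℂ} (hs : IsSolution β ε K (fun _ => 0) R κ)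
    (h : IsSolver β ε K m M S W) (hm : 0 < m) (hβ : 0 < β) (hβ' : β < 1 / 3) {q : ℝ} (hq : 0 < q)
    (hq' : q ≤ 1 / 2) (hR : ExpL2 q R) : R = 0 ∧ κ = 0 := by
  have hγ := gammaCoeff_pos hβ'
  have hc : ((3 * gammaCoeff β : ℝ) : ℂ) ≠ 0 := by exact_mod_cast (by positivity)
  have hcos := h.cosVec_ne_zero hm
  have h0 : ExpL2 q fun _ : ℝ => (0 : ℂ) := by
    have := (hR.const_mul 0)
    simpa using this
  have h1 := hs.inner_eq h hβ hβ' hq hq' h0 hR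
  have h2 : cft (fun _ : ℝ => (0 : ℂ)) K = 0 := by simp [cft]
  rw [h2] at h1
  -- the interaction term is orthogonal to `cosVec K`
  have h3 : interaction β K R κ = ((3 * gammaCoeff β : ℝ) : ℂ) • removeCos K (sechL2 R) := by
    have e1 : removeCos K (interaction β K R κ) = interaction β K R κ := by
      rw [removeCos_apply, h1, mul_zero, zero_smul, sub_zero]
    rw [← e1, interaction, map_smul, map_add, map_smul, removeCos_cosVec K hcos, smul_zero, add_zero]
  -- `R` and `-S R` have the same image under `l`, which has no zeros off `±K`
  have h4 : R + S R = 0 := by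
    have m1 := isBddMul_sech.memLp (Lp.memLp (interaction β K R κ))
    refine Lp.ext ((h.ae_eq_of_mul (Lp.memLp _) (Lp.memLp _) ?_))
    have e2 : fourierL2 (R + S R : L2) = fourierL2 R + fourierL2 (S R) := by
      rw [← fourierIso_apply, map_add, fourierIso_apply, fourierIso_apply]
    have e3 : fourierL2 (0 : L2) = 0 := by rw [← fourierIso_apply, map_zero]
    have e4 : (fun x => ((3 * gammaCoeff β : ℝ) : ℂ) *
        (sechC x * removeCos K (sechL2 (evenPart R)) x)) =ᵐ[volume]
        fun x => sechC x * interaction β K R κ x := by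
      rw [h3, evenPart_of_even hs.even]
      filter_upwards [Lp.coeFn_smul ((3 * gammaCoeff β : ℝ) : ℂ) (removeCos K (sechL2 R))] with x hx
      rw [hx, Pi.smul_apply, smul_eq_mul]
      ring
    have e5 : (fun x => (0 : ℂ) - sechC x * interaction β K R κ x)
        = (-1 : ℂ) • fun x => sechC x * interaction β K R κ x := by
      funext x
      simp
    have e6 := hs.fourier
    rw [e5, fourierL2_smul _ m1] at e6
    have e7 := h.fourier R
    rw [fourierL2_congr e4] at e7
    rw [e2, e3]
    filter_upwards [e6, e7, Lp.coeFn_add (fourierL2 R) (fourierL2 (S R)),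
      Lp.coeFn_smul (-1 : ℂ) (fourierL2 fun x => sechC x * interaction β K R κ x),
      Lp.coeFn_zero ℂ 2 (volume : Measure ℝ)] with ξ a1 a2 a3 a4 a5
    rw [a3, a5, Pi.add_apply, Pi.zero_apply, mul_add, a1, a2, a4, Pi.smul_apply, smul_eq_mul]
    ring
  have h5 : R = 0 := by
    have := congrArg (fun A : L2 →L[ℂ] L2 => A R) h.inv_left
    change W (R + S R) = R at this
    rw [← this, h4, map_zero]
  refine ⟨h5, ?_⟩
  rw [h5, interaction, map_zero, zero_add, inner_smul_right, inner_smul_right] at h1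
  have h6 : inner ℂ (cosVec K) (cosVec K) ≠ 0 := inner_self_ne_zero.2 hcos
  exact (mul_eq_zero.1 ((mul_eq_zero.1 h1).resolve_left hc)).resolve_right h6

lemma isSolution_unique {F : ℝ → ℂ} {R₁ R₂ : L2} {κ₁ κ₂ : ℂ} {q : ℝ}
    (h : IsSolver β ε K m M S W) (hm : 0 < m) (hβ : 0 < β) (hβ' : β < 1 / 3) (hq : 0 < q)
    (hq' : q ≤ 1 / 2) (hF : MemLp F 2 volume) (h₁ : IsSolution β ε K F R₁ κ₁)
    (h₂ : IsSolution β ε K F R₂ κ₂) (hR₁ : ExpL2 q R₁) (hR₂ : ExpL2 q R₂) : R₁ = R₂ ∧ κ₁ = κ₂ := by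
  have hR : ExpL2 q (R₁ - R₂ : L2) := by
    refine (hR₁.add (hR₂.const_mul (-1))).congr ?_
    filter_upwards [Lp.coeFn_sub R₁ R₂] with x hx
    rw [hx, Pi.sub_apply]
    ring
  obtain ⟨a, b⟩ := (h₁.sub hF h₂).eq_zero h hm hβ hβ' hq hq' hR
  exact ⟨sub_eq_zero.1 a, sub_eq_zero.1 b⟩

/-- Existence for the linear problem: the solution is `W R₀`, where `R₀` solves the problem without
the term `2σ R`. -/
lemma exists_isSolution (h : IsSolver β ε K m M S W) (hm : 0 < m) (hβ : 0 < β) (hβ' : β < 1 / 3)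
    {q : ℝ} (hq : 0 < q) (hq' : q ≤ 1 / 2) {F : ℝ → ℂ} (hF : ExpL2 q F)
    (he : ∀ᵐ x, F (-x) = F x) :
    ∃ (R R₀ : L2) (κ : ℂ), IsSolution β ε K F R κ ∧ ExpL2 q R ∧ R = W R₀ ∧
      cft (fun x => F x - sechC x * ((cft F K / (‖cosVec K‖ ^ 2 : ℝ)) • cosVec K : L2) x) K = 0 ∧
      cft (fun x => F x - sechC x * ((cft F K / (‖cosVec K‖ ^ 2 : ℝ)) • cosVec K : L2) x) (-K) = 0 ∧
      ∀ᵐ ξ : ℝ, linSymbolC β ε ((2 * Real.pi * ξ : ℝ) : ℂ) * fourierL2 R₀ ξ = fourierL2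
        (fun x => F x - sechC x * ((cft F K / (‖cosVec K‖ ^ 2 : ℝ)) • cosVec K : L2) x) ξ := by
  have hγ := gammaCoeff_pos hβ'
  have hc : ((3 * gammaCoeff β : ℝ) : ℂ) ≠ 0 := by exact_mod_cast (by positivity)
  have hcos := h.cosVec_ne_zero hm
  have hn : ((‖cosVec K‖ ^ 2 : ℝ) : ℂ) ≠ 0 := by
    exact_mod_cast pow_ne_zero 2 (norm_ne_zero_iff.2 hcos)
  set μ := cft F K / (‖cosVec K‖ ^ 2 : ℝ) with hμ
  set Φ : ℝ → ℂ := fun x => F x - sechC x * (μ • cosVec K : L2) x with hΦdef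
  have hu : reflL2 (μ • cosVec K) = μ • cosVec K := by rw [map_smul, reflL2_cosVec]
  have hΦ : ExpL2 q Φ := hF.sub_sechC_mul hq.le hq' _
  have heΦ : ∀ᵐ x, Φ (-x) = Φ x := by
    filter_upwards [he, ae_even_of_reflL2 hu] with x h1 h2
    simp only [hΦdef]
    rw [h1, h2, sechC_neg]
  -- `μ` is chosen for the source to vanish at the zeros `±K` of the symbol
  have z1 : cft Φ K = 0 := by
    rw [hΦdef, cft_sub_sechC_mul hq hF hu, inner_smul_right, inner_self_eq_norm_sq_to_K, hμ]
    change cft F K - cft F K / ((‖cosVec K‖ ^ 2 : ℝ) : ℂ) * ((‖cosVec K‖ : ℂ) ^ 2) = 0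
    rw [← Complex.ofReal_pow, div_mul_cancel₀ _ hn, sub_self]
  have z2 : cft Φ (-K) = 0 := by rw [cft_neg_of_even (hΦ.integrable_self hq) heΦ, z1]
  obtain ⟨c, hc0, hlb⟩ := h.simple
  obtain ⟨G, hG, hG', -, hlG⟩ := exists_multiplier_image_of_zeros hq hq' h.pos hc0 hΦ z1 z2 h.diff
    (h.zero_pos hβ hβ') (h.zero_neg hβ hβ') hlb
  set R₀ : L2 := hG.toLp G with hR₀
  have eR₀ : R₀ =ᵐ[volume] G := hG.coeFn_toLp
  have hl₀ : ∀ᵐ ξ : ℝ, linSymbolC β ε ((2 * Real.pi * ξ : ℝ) : ℂ) * fourierL2 R₀ ξ = fourierL2 Φ ξ := by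
    rw [fourierL2_congr eR₀]
    exact hlG
  have hinv : W R₀ + S (W R₀) = R₀ := by
    have := congrArg (fun A : L2 →L[ℂ] L2 => A R₀) h.inv_right
    exact this
  have hRexp : ExpL2 q (W R₀) := by
    refine ((hG'.congr eR₀.symm).add (((h.expL2 (W R₀)).mono hq.le hq').const_mul (-1))).congr ?_
    filter_upwards [Lp.coeFn_add (W R₀) (S (W R₀))] with x hx
    rw [hinv] at hx
    rw [hx, Pi.add_apply]
    ring
  -- the symmetry of `R` follows from that of `R₀` and of the range of `S`
  have heven : reflL2 (W R₀) = W R₀ := by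
    have a1 := h.reflL2_eq hβ hβ' R₀ (hΦ.memLp_self hq.le) heΦ hl₀
    set u := removeCos K (sechL2 (evenPart (W R₀))) with hu'
    have hue : reflL2 u = u := reflL2_removeCos (by rw [reflL2_sechL2, reflL2_evenPart]) K
    have a2 := h.reflL2_eq hβ hβ' (S (W R₀))
      ((isBddMul_sech.memLp (Lp.memLp u)).const_mul ((3 * gammaCoeff β : ℝ) : ℂ))
      (by filter_upwards [ae_even_of_reflL2 hue] with x hx; rw [hx, neg_div, Real.cosh_neg])
      (h.fourier (W R₀))
    have a3 := congrArg reflL2 hinv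
    rw [map_add, a1, a2] at a3
    exact add_right_cancel (a3.trans hinv.symm)
  -- `κ` collects the multiples of the cosine removed from `F` and from `2σ R`
  refine ⟨W R₀, R₀, μ / ((3 * gammaCoeff β : ℝ) : ℂ)
    - ((‖cosVec K‖ ^ 2)⁻¹ : ℝ) * inner ℂ (cosVec K) (sechL2 (W R₀)), ⟨heven, ?_⟩, hRexp, rfl, z1, z2,
    hl₀⟩
  have m1 := hΦ.memLp_self hq.le
  set u := removeCos K (sechL2 (evenPart (W R₀))) with hu'
  have m2 : MemLp (fun x => ((3 * gammaCoeff β : ℝ) : ℂ) * (sechC x * u x)) 2 volume :=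
    (isBddMul_sech.memLp (Lp.memLp u)).const_mul _
  set κ : ℂ := μ / ((3 * gammaCoeff β : ℝ) : ℂ)
    - ((‖cosVec K‖ ^ 2)⁻¹ : ℝ) * inner ℂ (cosVec K) (sechL2 (W R₀)) with hκ
  have e1 : interaction β K (W R₀) κ = μ • cosVec K + ((3 * gammaCoeff β : ℝ) : ℂ) • u := by
    rw [interaction, hu', evenPart_of_even heven, removeCos_apply, hκ, smul_add, smul_smul, mul_sub,
      mul_div_cancel₀ _ hc, smul_sub, smul_smul, sub_smul]
    abel
  have e2 : (fun x => F x - sechC x * interaction β K (W R₀) κ x) =ᵐ[volume]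
      Φ - fun x => ((3 * gammaCoeff β : ℝ) : ℂ) * (sechC x * u x) := by
    rw [e1]
    filter_upwards [Lp.coeFn_add (μ • cosVec K) (((3 * gammaCoeff β : ℝ) : ℂ) • u),
      Lp.coeFn_smul ((3 * gammaCoeff β : ℝ) : ℂ) u] with x a1 a2
    rw [a1, Pi.add_apply, a2, Pi.sub_apply, Pi.smul_apply, smul_eq_mul, hΦdef]
    ring
  have e3 : fourierL2 (W R₀) = fourierL2 R₀ - fourierL2 (S (W R₀)) := by
    rw [← fourierIso_apply, ← fourierIso_apply, ← fourierIso_apply, ← map_sub]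
    congr 1
    exact eq_sub_of_add_eq hinv
  rw [fourierL2_congr e2, fourierL2_sub m1 m2, e3]
  filter_upwards [hl₀, h.fourier (W R₀), Lp.coeFn_sub (fourierL2 R₀) (fourierL2 (S (W R₀))),
    Lp.coeFn_sub (fourierL2 Φ) (fourierL2 fun x => ((3 * gammaCoeff β : ℝ) : ℂ) * (sechC x * u x))]
    with ξ a1 a2 a3 a4
  rw [a3, a4, Pi.sub_apply, Pi.sub_apply, mul_sub, a1, a2]

end

/-! ### Estimates in the weighted Sobolev norms -/

/-- The gain of half a derivative. -/
lemma exists_multiplier_est {q s C : ℝ} (hq : 0 < q) (hq' : q ≤ 1 / 2) (hs : 0 ≤ s) (hC : 0 < C) :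
    ∃ A : ℝ, 0 < A ∧ ∀ {β ε K m M : ℝ} {S W : L2 →L[ℂ] L2}, 0 < β → β < 1 / 3 →
      IsSolver β ε K m M S W →
      (∀ Z : ℂ, q ≤ |Z.im| → |Z.im| ≤ 1 / 2 →
        (1 + Z.re ^ 2) ^ (1 / 4 : ℝ) * ‖(linSymbolC β ε Z)⁻¹‖ ≤ C) →
      ∀ Φ R : ℝ → ℂ, ExpL2 q Φ → cft Φ K = 0 → cft Φ (-K) = 0 → MemLp R 2 volume →
        (∀ᵐ ξ : ℝ, linSymbolC β ε ((2 * Real.pi * ξ : ℝ) : ℂ) * fourierL2 R ξ = fourierL2 Φ ξ) →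
        hNorm (s + 1 / 2) (coshMul q R) ≤ ENNReal.ofReal A * hNorm s (coshMul q Φ) := by
  obtain ⟨A₁, hA₁, h1⟩ := exists_hNorm_coshMul_le (s := s + 1 / 2) hq.le (by positivity)
  obtain ⟨A₂, hA₂, h2⟩ := exists_hNorm_expW_le (p := q) (q := q) (abs_of_pos hq).le hs
  obtain ⟨A₃, hA₃, h3⟩ := exists_hNorm_expW_le (p := -q) (q := q) (by rw [abs_neg, abs_of_pos hq]) hs
  refine ⟨A₁ * (C * A₂ + C * A₃), by positivity, fun hβ hβ' h hsym Φ R hΦ z1 z2 hR hl => ?_⟩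
  rename_i β ε K m M S W
  obtain ⟨c, hc, hlb⟩ := h.simple
  obtain ⟨G, hG, hG', hline, hlG⟩ := exists_multiplier_image_of_zeros hq hq' h.pos hc hΦ z1 z2 h.diff
    (h.zero_pos hβ hβ') (h.zero_neg hβ hβ') hlb
  have hRG : R =ᵐ[volume] G := h.ae_eq_of_mul hR hG (by
    filter_upwards [hl, hlG] with ξ a b
    rw [a, b])
  have hp : ∀ p : ℝ, |p| = q → hNorm (s + 1 / 2) (expW p G) ≤ ENNReal.ofReal C * hNorm s (expW p Φ) := by
    intro p hp
    refine hNorm_le_mul ?_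
    filter_upwards [hline p hp] with ξ hξ
    have hre : (((2 * Real.pi * ξ : ℝ) : ℂ) + p * Complex.I).re = 2 * Real.pi * ξ := by simp
    have him : (((2 * Real.pi * ξ : ℝ) : ℂ) + p * Complex.I).im = p := by simp
    have hb := hsym (((2 * Real.pi * ξ : ℝ) : ℂ) + p * Complex.I) (by rw [him, hp])
      (by rw [him, hp]; exact hq')
    rw [hre] at hb
    have h0 : 0 < 1 + (2 * Real.pi * ξ) ^ 2 := by linarith [one_le_japanese ξ]
    rw [norm_besselFourier, norm_besselFourier, hξ, norm_mul,
      show (s + 1 / 2) / 2 = 1 / 4 + s / 2 by ring, Real.rpow_add h0]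
    calc _ = ((1 + (2 * Real.pi * ξ) ^ 2) ^ (1 / 4 : ℝ) *
          ‖(linSymbolC β ε (((2 * Real.pi * ξ : ℝ) : ℂ) + p * Complex.I))⁻¹‖) *
          ((1 + (2 * Real.pi * ξ) ^ 2) ^ (s / 2) * ‖fourierL2 (expW p Φ) ξ‖) := by ring
      _ ≤ _ := by gcongr
  have hcΦ := hΦ.memLp_coshMul hq.le
  rw [hNorm_congr (coshMul_congr q hRG)]
  calc hNorm (s + 1 / 2) (coshMul q G)
      ≤ ENNReal.ofReal A₁ * (hNorm (s + 1 / 2) (expW q G) + hNorm (s + 1 / 2) (expW (-q) G)) := h1 G hG'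
    _ ≤ ENNReal.ofReal A₁ * (ENNReal.ofReal C * (ENNReal.ofReal A₂ * hNorm s (coshMul q Φ)) +
        ENNReal.ofReal C * (ENNReal.ofReal A₃ * hNorm s (coshMul q Φ))) := by
        gcongr
        · exact (hp q (abs_of_pos hq)).trans (by gcongr; exact h2 Φ hcΦ)
        · exact (hp (-q) (by rw [abs_neg, abs_of_pos hq])).trans (by gcongr; exact h3 Φ hcΦ)
    _ = _ := by
        rw [ENNReal.ofReal_mul hA₁.le, ENNReal.ofReal_add (by positivity) (by positivity),
          ENNReal.ofReal_mul hC.le, ENNReal.ofReal_mul hC.le]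
        ring

lemma coshMul_add (q : ℝ) (v w : ℝ → ℂ) :
    coshMul q (fun x => v x + w x) = fun x => coshMul q v x + coshMul q w x := by
  funext x
  simp only [coshMul, mul_add]

lemma coshMul_const_mul (q : ℝ) (c : ℂ) (v : ℝ → ℂ) :
    coshMul q (fun x => c * v x) = fun x => c * coshMul q v x := by
  funext x
  simp only [coshMul]
  ring

lemma exists_source_le {q s : ℝ} (hq : q ≤ 1 / 2) (hs : 0 ≤ s) : ∃ A : ℝ, 0 < A ∧
    ∀ (F R : ℝ → ℂ) (K : ℝ) (α μ : ℂ), MemLp (coshMul q F) 2 volume → MemLp R 2 volume →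
      hNorm s (coshMul q fun x => F x + (α * ((sechSq x : ℂ) * R x) +
        μ * ((Real.cos (K * x) : ℂ) * (sechSq x : ℂ))))
      ≤ hNorm s (coshMul q F) + (‖α‖ₑ * (ENNReal.ofReal A * hNorm s R) +
        ‖μ‖ₑ * ENNReal.ofReal (A * (1 + K ^ 2) ^ (s / 2))) := by
  obtain ⟨A, hA, h1⟩ := exists_hNorm_coshMul_sechSq_le hq hs
  obtain ⟨B, hB, h2⟩ := exists_hNorm_coshMul_cos_le hq hs
  refine ⟨max A B, by positivity, fun F R K α μ hF hR => ?_⟩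
  have m1 := memLp_coshMul_sechSq hq hR
  have m2 := memLp_coshMul_cos hq K
  rw [coshMul_add, coshMul_add, coshMul_const_mul, coshMul_const_mul]
  refine (hNorm_add_le hF ((m1.const_mul α).add (m2.const_mul μ))).trans ?_
  gcongr
  refine (hNorm_add_le (m1.const_mul α) (m2.const_mul μ)).trans ?_
  rw [hNorm_const_mul α m1, hNorm_const_mul μ m2]
  gcongr
  · exact (h1 R hR).trans (by gcongr; exact le_max_left _ _)
  · refine (h2 K).trans (ENNReal.ofReal_le_ofReal ?_)
    gcongr
    exact le_max_right _ _

/-- A solution of the linear problem in the weighted spaces, together with the bound in `L²` that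
starts the regularity argument. The constants `C` and `A` do not depend on `ε`. -/
structure LocalizedSolution (β m M q C A ε K : ℝ) (S W : L2 →L[ℂ] L2) (F : ℝ → ℂ) (R : L2)
    (κ : ℂ) : Prop where
  solver : IsSolver β ε K m M S W
  symbol : ∀ Z : ℂ, q ≤ |Z.im| → |Z.im| ≤ 1 / 2 →
    (1 + Z.re ^ 2) ^ (1 / 4 : ℝ) * ‖(linSymbolC β ε Z)⁻¹‖ ≤ C
  memF : ExpL2 q F
  even : ∀ᵐ x, F (-x) = F x
  sol : IsSolution β ε K F R κ
  memR : ExpL2 q R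
  base : hNorm 0 R ≤ ENNReal.ofReal A * hNorm 0 (coshMul q F)

lemma ofReal_norm_L2 (f : L2) : ENNReal.ofReal ‖f‖ = hNorm 0 f := by
  rw [hNorm_zero (Lp.memLp f), Lp.norm_def, ENNReal.ofReal_toReal (Lp.memLp f).2.ne]

/-- Existence with a bound in `L²` that does not depend on `ε`. -/
lemma exists_localizedSolution {β m M q C : ℝ} (hβ : 0 < β) (hβ' : β < 1 / 3) (hm : 0 < m)
    (hM : 0 < M) (hq : 0 < q) (hq' : q ≤ 1 / 2) (hC : 0 < C) :
    ∃ A : ℝ, 0 < A ∧ ∀ {ε K : ℝ} {S W : L2 →L[ℂ] L2}, IsSolver β ε K m M S W →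
      (∀ Z : ℂ, q ≤ |Z.im| → |Z.im| ≤ 1 / 2 →
        (1 + Z.re ^ 2) ^ (1 / 4 : ℝ) * ‖(linSymbolC β ε Z)⁻¹‖ ≤ C) →
      ∀ F : ℝ → ℂ, ExpL2 q F → (∀ᵐ x, F (-x) = F x) →
        ∃ (R : L2) (κ : ℂ), LocalizedSolution β m M q C A ε K S W F R κ := by
  obtain ⟨A₁, hA₁, h1⟩ := exists_hNorm_le_coshMul hq.le le_rfl
  obtain ⟨A₂, hA₂, h2⟩ := exists_multiplier_est hq hq' le_rfl hC
  obtain ⟨A₃, hA₃, h3⟩ := exists_source_le hq' le_rfl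
  obtain ⟨A₄, hA₄, h4⟩ := exists_cft_le hq le_rfl
  refine ⟨M * (A₁ * (A₂ * (1 + A₄ / m * A₃))), by positivity, fun h hsym F hF he => ?_⟩
  rename_i ε K S W
  obtain ⟨R, R₀, κ, hsol, hR, hW, z1, z2, hl⟩ := exists_isSolution h hm hβ hβ' hq hq' hF he
  refine ⟨R, κ, h, hsym, hF, he, hsol, hR, ?_⟩
  set μ : ℂ := cft F K / (‖cosVec K‖ ^ 2 : ℝ) with hμ
  set Φ : ℝ → ℂ := fun x => F x - sechC x * (μ • cosVec K : L2) x with hΦdef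
  have hcF := hF.memLp_coshMul hq.le
  have hΦ : ExpL2 q Φ := hF.sub_sechC_mul hq.le hq' _
  have eΦ : Φ =ᵐ[volume] fun x => F x + (0 * ((sechSq x : ℂ) * R x) +
      (-μ) * ((Real.cos (K * x) : ℂ) * (sechSq x : ℂ))) := by
    filter_upwards [Lp.coeFn_smul μ (cosVec K), coeFn_cosVec K] with x a1 a2
    rw [hΦdef]
    beta_reduce
    rw [a1, Pi.smul_apply, a2, ← sechC_mul_sechC, smul_eq_mul]
    ring
  have hμ1 : ‖-μ‖ₑ ≤ ENNReal.ofReal (A₄ / m) * hNorm 0 (coshMul q F) := by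
    have b1 := h4 F K hcF
    rw [neg_zero, zero_div, Real.rpow_zero, mul_one] at b1
    have b2 : ‖-μ‖ ≤ m⁻¹ * ‖cft F K‖ := by
      rw [norm_neg, hμ, norm_div, Complex.norm_real, Real.norm_of_nonneg (by positivity),
        div_eq_inv_mul]
      gcongr
      exact h.mass
    rw [← ofReal_norm]
    refine (ENNReal.ofReal_le_ofReal b2).trans ?_
    rw [ENNReal.ofReal_mul (by positivity), ofReal_norm, div_eq_inv_mul,
      ENNReal.ofReal_mul (by positivity), mul_assoc]
    gcongr
  have hR₀ : ExpL2 q R₀ → hNorm 0 R₀ ≤ ENNReal.ofReal A₁ * (ENNReal.ofReal A₂ *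
      (hNorm 0 (coshMul q F) + ENNReal.ofReal (A₄ / m) * hNorm 0 (coshMul q F) * ENNReal.ofReal A₃)) := by
    intro hR₀
    refine (h1 R₀ (hR₀.memLp_coshMul hq.le)).trans ?_
    gcongr
    refine (hNorm_mono (by norm_num : (0 : ℝ) ≤ 0 + 1 / 2) _).trans ?_
    refine (h2 hβ hβ' h hsym Φ R₀ hΦ z1 z2 (Lp.memLp R₀) hl).trans ?_
    gcongr
    rw [hNorm_congr (coshMul_congr q eΦ)]
    refine (h3 F R K 0 (-μ) hcF (Lp.memLp R)).trans ?_
    rw [enorm_zero, zero_mul, zero_add, zero_div, Real.rpow_zero, mul_one]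
    gcongr
  have hR₀exp : ExpL2 q R₀ := by
    obtain ⟨c, hc, hlb⟩ := h.simple
    obtain ⟨G, hG, hG', -, hlG⟩ := exists_multiplier_image_of_zeros hq hq' h.pos hc hΦ z1 z2 h.diff
      (h.zero_pos hβ hβ') (h.zero_neg hβ hβ') hlb
    refine hG'.congr (h.ae_eq_of_mul hG (Lp.memLp R₀) ?_)
    filter_upwards [hl, hlG] with ξ a b
    rw [a, b]
  rw [← ofReal_norm_L2 R, hW]
  refine (ENNReal.ofReal_le_ofReal (W.le_of_opNorm_le h.bound R₀)).trans ?_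
  rw [ENNReal.ofReal_mul hM.le, ENNReal.ofReal_mul hM.le, ofReal_norm_L2, mul_assoc]
  gcongr
  refine (hR₀ hR₀exp).trans (le_of_eq ?_)
  rw [ENNReal.ofReal_mul hA₁.le, ENNReal.ofReal_mul hA₂.le,
    ENNReal.ofReal_add zero_le_one (by positivity), ENNReal.ofReal_mul (by positivity),
    ENNReal.ofReal_one]
  ring

/-! ### Uniform regularity -/

section

variable {β m M q C A : ℝ}

/-- The coefficient of the cosine decays like `K^{-s}`. -/
lemma exists_coeff_le {s : ℝ} (hβ : 0 < β) (hβ' : β < 1 / 3) (hm : 0 < m) (hq : 0 < q)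
    (hq' : q ≤ 1 / 2) (hs : 0 ≤ s) : ∃ B : ℝ, 0 < B ∧
    ∀ {ε K : ℝ} {S W : L2 →L[ℂ] L2} {F : ℝ → ℂ} {R : L2} {κ : ℂ},
      LocalizedSolution β m M q C A ε K S W F R κ →
      ‖κ‖ₑ ≤ ENNReal.ofReal (B * (1 + K ^ 2) ^ (-s / 2)) * (hNorm s (coshMul q F) + hNorm s R) := by
  have hγ := gammaCoeff_pos hβ'
  obtain ⟨A₁, hA₁, h1⟩ := exists_cft_le hq hs
  obtain ⟨A₂, hA₂, h2⟩ := exists_hNorm_coshMul_sechSq_le hq' hs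
  set g := 3 * gammaCoeff β with hg
  have hg0 : 0 < g := by positivity
  refine ⟨m⁻¹ * (A₁ * (g⁻¹ + A₂)), by positivity, fun h => ?_⟩
  rename_i ε K S W F R κ
  have hcos := h.solver.cosVec_ne_zero hm
  have hn : (0 : ℝ) < ‖cosVec K‖ ^ 2 := pow_pos (norm_pos_iff.2 hcos) 2
  -- solvability at `K` determines `κ` by the Fourier coefficients of `F` and of `sech² R` at `K`
  have e := h.sol.inner_eq h.solver hβ hβ' hq hq' h.memF h.memR
  rw [inner_cosVec_interaction h.sol.even] at e
  set x := cft (fun x => (sechSq x : ℂ) * R x) K with hx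
  set y := cft F K with hy
  have hgC : (g : ℂ) ≠ 0 := by exact_mod_cast hg0.ne'
  have hnC : ((‖cosVec K‖ ^ 2 : ℝ) : ℂ) ≠ 0 := by exact_mod_cast hn.ne'
  have eκ : κ = ((‖cosVec K‖ ^ 2 : ℝ) : ℂ)⁻¹ * ((g : ℂ)⁻¹ * y - x) := by
    rw [← e]
    field_simp
    ring
  have b1 : ‖κ‖ ≤ m⁻¹ * (g⁻¹ * ‖y‖ + ‖x‖) := by
    rw [eκ, norm_mul, norm_inv, Complex.norm_real, Real.norm_of_nonneg hn.le]
    refine mul_le_mul (inv_anti₀ hm h.solver.mass) ?_ (norm_nonneg _) (by positivity)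
    refine (norm_sub_le _ _).trans ?_
    rw [norm_mul, norm_inv, Complex.norm_real, Real.norm_of_nonneg hg0.le]
  have hy1 := h1 F K (h.memF.memLp_coshMul hq.le)
  have hx1 := (h1 _ K (memLp_coshMul_sechSq hq' (Lp.memLp R))).trans
    (mul_le_mul_right (h2 R (Lp.memLp R)) _)
  rw [← hy] at hy1
  rw [← hx] at hx1
  set X := hNorm s (coshMul q F)
  set Y := hNorm s R
  set w := (1 + K ^ 2) ^ (-s / 2) with hw
  have hw0 : 0 < w := by positivity
  rw [← ofReal_norm]
  calc ENNReal.ofReal ‖κ‖ ≤ ENNReal.ofReal (m⁻¹ * (g⁻¹ * ‖y‖ + ‖x‖)) := ENNReal.ofReal_le_ofReal b1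
    _ = ENNReal.ofReal m⁻¹ * (ENNReal.ofReal g⁻¹ * ‖y‖ₑ + ‖x‖ₑ) := by
        rw [ENNReal.ofReal_mul (by positivity), ENNReal.ofReal_add (by positivity) (norm_nonneg _),
          ENNReal.ofReal_mul (by positivity), ofReal_norm, ofReal_norm]
    _ ≤ ENNReal.ofReal m⁻¹ * (ENNReal.ofReal g⁻¹ * (ENNReal.ofReal (A₁ * w) * X) +
        ENNReal.ofReal (A₁ * w) * (ENNReal.ofReal A₂ * Y)) := by gcongr
    _ ≤ ENNReal.ofReal m⁻¹ * (ENNReal.ofReal g⁻¹ * (ENNReal.ofReal (A₁ * w) * (X + Y)) +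
        ENNReal.ofReal (A₁ * w) * (ENNReal.ofReal A₂ * (X + Y))) := by
        gcongr
        · exact le_self_add
        · exact le_add_self
    _ = _ := by
        rw [show m⁻¹ * (A₁ * (g⁻¹ + A₂)) * w = m⁻¹ * ((A₁ * w) * (g⁻¹ + A₂)) by ring,
          ENNReal.ofReal_mul (p := m⁻¹) (by positivity), ENNReal.ofReal_mul (p := A₁ * w) (by positivity),
          ENNReal.ofReal_add (by positivity) hA₂.le]
        ring

/-- The solution gains half a derivative over its source. The cosine term has an `H^s` norm of order
`K^s`, which is compensated by the decay of its coefficient. -/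
lemma exists_regularity_step {s : ℝ} (hβ : 0 < β) (hβ' : β < 1 / 3) (hm : 0 < m) (hq : 0 < q)
    (hq' : q ≤ 1 / 2) (hs : 0 ≤ s) (hC : 0 < C) : ∃ B : ℝ, 0 < B ∧
    ∀ {ε K : ℝ} {S W : L2 →L[ℂ] L2} {F : ℝ → ℂ} {R : L2} {κ : ℂ},
      LocalizedSolution β m M q C A ε K S W F R κ →
      hNorm (s + 1 / 2) (coshMul q R)
        ≤ ENNReal.ofReal B * (hNorm s (coshMul q F) + hNorm s R) := by
  have hγ := gammaCoeff_pos hβ'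
  obtain ⟨A₁, hA₁, h1⟩ := exists_multiplier_est hq hq' hs hC
  obtain ⟨A₂, hA₂, h2⟩ := exists_source_le hq' hs
  obtain ⟨A₃, hA₃, h3⟩ := exists_coeff_le (M := M) (C := C) (A := A) hβ hβ' hm hq hq' hs
  set g := 3 * gammaCoeff β with hg
  have hg0 : 0 < g := by positivity
  refine ⟨A₁ * (1 + g * A₂ + g * (A₃ * A₂)), by positivity, fun h => ?_⟩
  rename_i ε K S W F R κ
  set Φ : ℝ → ℂ := fun x => F x - sechC x * interaction β K R κ x with hΦdef
  have hu := reflL2_interaction h.sol.even β K κ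
  have hΦ : ExpL2 q Φ := h.memF.sub_sechC_mul hq.le hq' _
  have heΦ : ∀ᵐ x, Φ (-x) = Φ x := by
    filter_upwards [h.even, ae_even_of_reflL2 hu] with x a1 a2
    simp only [hΦdef]
    rw [a1, a2, sechC_neg]
  have z1 : cft Φ K = 0 := by
    rw [hΦdef, cft_sub_sechC_mul hq h.memF hu,
      h.sol.inner_eq h.solver hβ hβ' hq hq' h.memF h.memR, sub_self]
  have z2 : cft Φ (-K) = 0 := by rw [cft_neg_of_even (hΦ.integrable_self hq) heΦ, z1]
  have eΦ : Φ =ᵐ[volume] fun x => F x + ((-g : ℂ) * ((sechSq x : ℂ) * R x) +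
      (-g * κ) * ((Real.cos (K * x) : ℂ) * (sechSq x : ℂ))) := by
    filter_upwards [sechC_mul_interaction β K R κ] with x hx
    rw [hΦdef]
    beta_reduce
    rw [hx]
    ring
  have e1 : ‖(-g : ℂ)‖ₑ = ENNReal.ofReal g := by
    rw [← ofReal_norm, norm_neg, Complex.norm_real, Real.norm_of_nonneg hg0.le]
  have key := h2 F R K (-g) (-g * κ) (h.memF.memLp_coshMul hq.le) (Lp.memLp R)
  rw [← hNorm_congr (coshMul_congr q eΦ), enorm_mul, e1] at key
  have hκ := h3 h
  set X := hNorm s (coshMul q F)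
  set Y := hNorm s R
  have hK : (0 : ℝ) < 1 + K ^ 2 := by positivity
  refine (h1 hβ hβ' h.solver h.symbol Φ R hΦ z1 z2 (Lp.memLp R) h.sol.fourier).trans ?_
  rw [ENNReal.ofReal_mul hA₁.le, mul_assoc]
  gcongr
  refine key.trans ?_
  calc X + (ENNReal.ofReal g * (ENNReal.ofReal A₂ * Y) +
        ENNReal.ofReal g * ‖κ‖ₑ * ENNReal.ofReal (A₂ * (1 + K ^ 2) ^ (s / 2)))
      ≤ (X + Y) + (ENNReal.ofReal g * (ENNReal.ofReal A₂ * (X + Y)) +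
        ENNReal.ofReal g * (ENNReal.ofReal (A₃ * (1 + K ^ 2) ^ (-s / 2)) * (X + Y)) *
          ENNReal.ofReal (A₂ * (1 + K ^ 2) ^ (s / 2))) := by
        gcongr
        · exact le_self_add
        · exact le_add_self
    _ = (X + Y) + (ENNReal.ofReal g * (ENNReal.ofReal A₂ * (X + Y)) +
        ENNReal.ofReal g * ENNReal.ofReal (A₃ * A₂) * (X + Y)) := by
        have e2 : ENNReal.ofReal (A₃ * A₂) = ENNReal.ofReal (A₃ * (1 + K ^ 2) ^ (-s / 2)) *
            ENNReal.ofReal (A₂ * (1 + K ^ 2) ^ (s / 2)) := by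
          rw [← ENNReal.ofReal_mul (by positivity), mul_mul_mul_comm, ← Real.rpow_add hK, neg_div,
            neg_add_cancel, Real.rpow_zero, mul_one]
        rw [e2]
        ring
    _ = _ := by
        rw [ENNReal.ofReal_add (by positivity) (by positivity),
          ENNReal.ofReal_add (by positivity) (by positivity), ENNReal.ofReal_mul hg0.le,
          ENNReal.ofReal_mul hg0.le, ENNReal.ofReal_one]
        ring

/-- Iterating the gain from `L²` up to `H^r`. -/
lemma exists_regularity_nat {r : ℝ} (hβ : 0 < β) (hβ' : β < 1 / 3) (hm : 0 < m) (hq : 0 < q)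
    (hq' : q ≤ 1 / 2) (hr : 0 ≤ r) (hC : 0 < C) (hA : 0 < A) (n : ℕ) : ∃ B : ℝ, 0 < B ∧
    ∀ {ε K : ℝ} {S W : L2 →L[ℂ] L2} {F : ℝ → ℂ} {R : L2} {κ : ℂ},
      LocalizedSolution β m M q C A ε K S W F R κ →
      hNorm (min ((n : ℝ) / 2) r) R ≤ ENNReal.ofReal B * hNorm r (coshMul q F) := by
  induction n with
  | zero =>
    refine ⟨A, hA, fun h => ?_⟩
    rw [Nat.cast_zero, zero_div, min_eq_left hr]
    exact h.base.trans (by gcongr; exact hNorm_mono hr _)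
  | succ n ih =>
    obtain ⟨B, hB, hb⟩ := ih
    have hs : 0 ≤ min ((n : ℝ) / 2) r := by positivity
    obtain ⟨B₁, hB₁, hb₁⟩ := exists_regularity_step (M := M) (A := A) hβ hβ' hm hq hq' hs hC
    obtain ⟨B₂, hB₂, hb₂⟩ := exists_hNorm_le_coshMul (s := min ((n : ℝ) / 2) r + 1 / 2) hq.le
      (by positivity)
    refine ⟨B₂ * (B₁ * (1 + B)), by positivity, fun h => ?_⟩
    rename_i ε K S W F R κ
    have h1 : min (((n + 1 : ℕ) : ℝ) / 2) r ≤ min ((n : ℝ) / 2) r + 1 / 2 := by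
      rw [min_add]
      refine min_le_min ?_ (by linarith)
      push_cast
      linarith
    calc hNorm (min (((n + 1 : ℕ) : ℝ) / 2) r) R ≤ hNorm (min ((n : ℝ) / 2) r + 1 / 2) R := hNorm_mono h1 _
      _ ≤ ENNReal.ofReal B₂ * hNorm (min ((n : ℝ) / 2) r + 1 / 2) (coshMul q R) :=
          hb₂ R (h.memR.memLp_coshMul hq.le)
      _ ≤ ENNReal.ofReal B₂ * (ENNReal.ofReal B₁ * (hNorm r (coshMul q F) +
          ENNReal.ofReal B * hNorm r (coshMul q F))) := by
          gcongr
          refine (hb₁ h).trans ?_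
          gcongr
          · exact hNorm_mono (min_le_right _ _) _
          · exact hb h
      _ = _ := by
          rw [ENNReal.ofReal_mul hB₂.le, ENNReal.ofReal_mul hB₁.le,
            ENNReal.ofReal_add zero_le_one hB.le, ENNReal.ofReal_one]
          ring

/-- The regularity of the solution, with bounds that are uniform in `ε`. -/
lemma exists_regularity {r : ℝ} (hβ : 0 < β) (hβ' : β < 1 / 3) (hm : 0 < m) (hq : 0 < q)
    (hq' : q ≤ 1 / 2) (hr : 0 ≤ r) (hC : 0 < C) (hA : 0 < A) : ∃ B : ℝ, 0 < B ∧
    ∀ {ε K : ℝ} {S W : L2 →L[ℂ] L2} {F : ℝ → ℂ} {R : L2} {κ : ℂ},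
      LocalizedSolution β m M q C A ε K S W F R κ →
      hNorm (r + 1 / 2) (coshMul q R) ≤ ENNReal.ofReal B * hNorm r (coshMul q F) ∧
      ‖κ‖ₑ ≤ ENNReal.ofReal (B * (1 + K ^ 2) ^ (-r / 2)) * hNorm r (coshMul q F) := by
  obtain ⟨n, hn⟩ := exists_nat_ge (2 * r)
  obtain ⟨B, hB, hb⟩ := exists_regularity_nat (M := M) hβ hβ' hm hq hq' hr hC hA n
  rw [min_eq_right (by linarith)] at hb
  obtain ⟨B₁, hB₁, hb₁⟩ := exists_regularity_step (M := M) (A := A) hβ hβ' hm hq hq' hr hC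
  obtain ⟨B₂, hB₂, hb₂⟩ := exists_coeff_le (M := M) (C := C) (A := A) hβ hβ' hm hq hq' hr
  refine ⟨max B₁ B₂ * (1 + B), by positivity, fun h => ?_⟩
  rename_i ε K S W F R κ
  set X := hNorm r (coshMul q F)
  have e : ∀ t : ℝ, 0 ≤ t → ENNReal.ofReal t * (X + ENNReal.ofReal B * X)
      = ENNReal.ofReal (t * (1 + B)) * X := fun t ht => by
    rw [ENNReal.ofReal_mul ht, ENNReal.ofReal_add zero_le_one hB.le, ENNReal.ofReal_one]
    ring
  constructor
  · refine (hb₁ h).trans ((mul_le_mul_right (add_le_add_right (hb h) _) _).trans ?_)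
    rw [e _ hB₁.le]
    gcongr
    exact le_max_left _ _
  · refine (hb₂ h).trans ((mul_le_mul_right (add_le_add_right (hb h) _) _).trans ?_)
    rw [e _ (by positivity), mul_right_comm]
    gcongr
    exact le_max_right _ _

end

/-! ### Real solutions -/

lemma coeFn_toComplexL2 (f : Lp ℝ 2 (volume : Measure ℝ)) :
    toComplexL2 f =ᵐ[volume] fun x => (f x : ℂ) :=
  ContinuousLinearMap.coeFn_compLp _ f

lemma coshWeighted_eq (q : ℝ) (f : Lp ℝ 2 (volume : Measure ℝ)) :
    coshWeighted q f = coshMul q fun x => (f x : ℂ) := by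
  funext x
  rw [coshWeighted, coshMul, Complex.ofReal_mul]

lemma EvenSobolev.ofReal_norm {r q : ℝ} (f : EvenSobolev r q) :
    ENNReal.ofReal ‖f‖ = hNorm r (coshMul q fun x => (f.fn x : ℂ)) := by
  rw [← coshWeighted_eq]
  have e : ‖f‖ = ‖f.memH.2.toLp (besselFourier r (coshWeighted q f.fn))‖ := rfl
  rw [e, Lp.norm_toLp, ENNReal.ofReal_toReal f.memH.2.2.ne, hNorm]

lemma EvenSobolev.expL2 {r q : ℝ} (hq : 0 ≤ q) (f : EvenSobolev r q) :
    ExpL2 q fun x => (f.fn x : ℂ) :=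
  ExpL2.of_coshMul hq (coshWeighted_eq q f.fn ▸ f.memH.1)

lemma EvenSobolev.even {r q : ℝ} (f : EvenSobolev r q) : ∀ᵐ x, (f.fn (-x) : ℂ) = f.fn x := by
  have h : ∀ᵐ x : ℝ, f.fn (-x) = f.fn x := f.property.1
  filter_upwards [h] with x hx
  rw [hx]

lemma reflL2_toComplexL2 {f : Lp ℝ 2 (volume : Measure ℝ)} (h : ∀ᵐ x, f (-x) = f x) :
    reflL2 (toComplexL2 f) = toComplexL2 f := by
  refine Lp.ext ?_
  filter_upwards [coeFn_reflL2 (toComplexL2 f), ae_comp_neg (coeFn_toComplexL2 f),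
    coeFn_toComplexL2 f, h] with x h1 h2 h3 h4
  rw [h1, h2, h3, h4]

/-- The linear problem in terms of the Fourier transform. -/
lemma linearProblem_iff {β : ℝ} (hβ : 0 < β) (hβ' : β < 1 / 3) {ε K a : ℝ}
    {R G : Lp ℝ 2 (volume : Measure ℝ)} (hR : ∀ᵐ x, R (-x) = R x) :
    LinearProblem β ε K R a G ↔ IsSolution β ε K (fun x => (G x : ℂ)) (toComplexL2 R) a := by
  have hsrc : (fun x => (G x : ℂ) - sechC x * interaction β K (toComplexL2 R) a x) =ᵐ[volume]
      fun x => (G x : ℂ) - (((2 * soliton β x * R x : ℝ) : ℂ)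
        + ((2 * a * soliton β x * Real.cos (K * x) : ℝ) : ℂ)) := by
    filter_upwards [sechC_mul_interaction β K (toComplexL2 R) a, coeFn_toComplexL2 R] with x h1 h2
    rw [h1, h2, soliton, ← sechSq, gammaCoeff]
    push_cast
    ring
  have hm : MemLp (fun x => (G x : ℂ) - sechC x * interaction β K (toComplexL2 R) a x) 2 volume := by
    have h1 : MemLp (fun x => (G x : ℂ)) 2 volume :=
      (memLp_congr_ae (coeFn_toComplexL2 G)).1 (Lp.memLp _)
    exact h1.sub (isBddMul_sech.memLp (Lp.memLp _))
  have hsym : ∀ ξ : ℝ, (linSymbol β ε (2 * Real.pi * ξ) : ℂ)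
      = linSymbolC β ε ((2 * Real.pi * ξ : ℝ) : ℂ) := fun ξ =>
    (linSymbolC_ofReal hβ (by linarith) ε _).symm
  constructor
  · rintro ⟨LR, h1, h2⟩
    refine ⟨reflL2_toComplexL2 hR, ?_⟩
    have e : LR =ᵐ[volume] fun x => (G x : ℂ) - sechC x * interaction β K (toComplexL2 R) a x := by
      filter_upwards [h2, hsrc] with x a1 a2
      rw [a2, ← a1]
      ring
    rw [← fourierL2_congr e, fourierL2_coe, fourierL2_coe]
    filter_upwards [h1] with ξ hξ
    rw [hξ, hsym]
  · intro h
    refine ⟨hm.toLp _, ?_, ?_⟩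
    · have h1 := h.fourier
      rw [← fourierL2_congr hm.coeFn_toLp, fourierL2_coe, fourierL2_coe] at h1
      filter_upwards [h1] with ξ hξ
      rw [← hξ, hsym]
    · filter_upwards [hm.coeFn_toLp, hsrc] with x h1 h2
      rw [h1, h2]
      ring

lemma reflL2_star (R : L2) : reflL2 (star R) = star (reflL2 R) := by
  refine Lp.ext ?_
  filter_upwards [coeFn_reflL2 (star R), ae_comp_neg (Lp.coeFn_star R), Lp.coeFn_star (reflL2 R),
    coeFn_reflL2 R] with x h1 h2 h3 h4
  rw [h1, h2, h3, Pi.star_apply, Pi.star_apply, h4]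

/-- The complex conjugate of a solution is a solution when the right-hand side is real. -/
lemma IsSolution.conj {β ε K : ℝ} (hβ : 0 < β) (hβ' : β < 1 / 3) {F : ℝ → ℂ}
    (hF : MemLp F 2 volume) (hFr : ∀ x, starRingEnd ℂ (F x) = F x) {R : L2} {κ : ℂ}
    (h : IsSolution β ε K F R κ) : IsSolution β ε K F (star R) (starRingEnd ℂ κ) := by
  refine ⟨by rw [reflL2_star, h.even], ?_⟩
  set Φ : ℝ → ℂ := fun x => F x - sechC x * interaction β K R κ x with hΦ
  have hm : MemLp Φ 2 volume := hF.sub (isBddMul_sech.memLp (Lp.memLp _))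
  have e1 : (fun x => F x - sechC x * interaction β K (star R) (starRingEnd ℂ κ) x) =ᵐ[volume]
      fun x => starRingEnd ℂ (Φ x) := by
    filter_upwards [sechC_mul_interaction β K R κ,
      sechC_mul_interaction β K (star R) (starRingEnd ℂ κ), Lp.coeFn_star R] with x a1 a2 a3
    rw [hΦ]
    beta_reduce
    rw [a1, a2, a3, map_sub, hFr, map_mul, map_add, map_mul, map_mul, map_mul, Complex.conj_ofReal,
      Complex.conj_ofReal, Complex.conj_ofReal]
    rfl
  have e2 : fourierL2 (star R : L2) =ᵐ[volume] fun ξ => starRingEnd ℂ (fourierL2 R (-ξ)) := by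
    have : (star R : L2) =ᵐ[volume] fun x => starRingEnd ℂ (R x) := Lp.coeFn_star R
    rw [fourierL2_congr this]
    exact fourierL2_conj (Lp.memLp R)
  rw [fourierL2_congr e1]
  filter_upwards [e2, fourierL2_conj hm, ae_comp_neg h.fourier] with ξ a1 a2 a3
  rw [a1, a2, ← a3, map_mul, linSymbolC_ofReal hβ (by linarith), linSymbolC_ofReal hβ (by linarith),
    mul_neg, linSymbol_neg, Complex.conj_ofReal]

/-- The real part of an element of `L²`. -/
def reL2 (R : L2) : Lp ℝ 2 (volume : Measure ℝ) := Complex.reCLM.compLp R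

lemma coeFn_reL2 (R : L2) : reL2 R =ᵐ[volume] fun x => (R x).re :=
  ContinuousLinearMap.coeFn_compLp _ R

lemma toComplexL2_reL2 {R : L2} (hR : star R = R) : toComplexL2 (reL2 R) = R := by
  refine Lp.ext ?_
  have h := Lp.coeFn_star R
  rw [hR] at h
  filter_upwards [coeFn_toComplexL2 (reL2 R), coeFn_reL2 R, h] with x h1 h2 h3
  rw [h1, h2]
  exact Complex.conj_eq_iff_re.1 h3.symm

lemma reL2_toComplexL2 (f : Lp ℝ 2 (volume : Measure ℝ)) : reL2 (toComplexL2 f) = f := by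
  refine Lp.ext ?_
  filter_upwards [coeFn_reL2 (toComplexL2 f), coeFn_toComplexL2 f] with x h1 h2
  rw [h1, h2, Complex.ofReal_re]

lemma toComplexL2_add (f g : Lp ℝ 2 (volume : Measure ℝ)) :
    toComplexL2 (f + g) = toComplexL2 f + toComplexL2 g :=
  (Complex.ofRealCLM.compLpₗ 2 volume).map_add f g

lemma toComplexL2_smul (c : ℝ) (f : Lp ℝ 2 (volume : Measure ℝ)) :
    toComplexL2 (c • f) = (c : ℂ) • toComplexL2 f :=
  ((Complex.ofRealCLM.compLpₗ 2 volume).map_smul c f).trans (by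
    refine Lp.ext ?_
    filter_upwards [Lp.coeFn_smul c (toComplexL2 f), Lp.coeFn_smul (c : ℂ) (toComplexL2 f)]
      with x h1 h2
    refine h1.trans (Eq.trans ?_ h2.symm)
    simp)

lemma LinearProblem.add {β ε K a₁ a₂ : ℝ} {R₁ R₂ G₁ G₂ : Lp ℝ 2 (volume : Measure ℝ)}
    (h₁ : LinearProblem β ε K R₁ a₁ G₁) (h₂ : LinearProblem β ε K R₂ a₂ G₂) :
    LinearProblem β ε K (R₁ + R₂) (a₁ + a₂) (G₁ + G₂) := by
  obtain ⟨L₁, h1, h2⟩ := h₁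
  obtain ⟨L₂, h3, h4⟩ := h₂
  refine ⟨L₁ + L₂, ?_, ?_⟩
  · rw [IsMultiplierImage, toComplexL2_add, FourierTransform.fourier_add,
      FourierTransform.fourier_add]
    filter_upwards [h1, h3, Lp.coeFn_add (𝓕 L₁ : L2) (𝓕 L₂ : L2),
      Lp.coeFn_add (𝓕 (toComplexL2 R₁) : L2) (𝓕 (toComplexL2 R₂) : L2)] with ξ a1 a2 a3 a4
    rw [a3, a4, Pi.add_apply, Pi.add_apply, a1, a2, mul_add]
  · filter_upwards [h2, h4, Lp.coeFn_add L₁ L₂, Lp.coeFn_add R₁ R₂, Lp.coeFn_add G₁ G₂]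
      with x a1 a2 a3 a4 a5
    rw [a3, a4, a5, Pi.add_apply, Pi.add_apply, Pi.add_apply, Complex.ofReal_add (G₁ x), ← a1, ← a2]
    push_cast
    ring

lemma LinearProblem.smul {β ε K a : ℝ} (c : ℝ) {R G : Lp ℝ 2 (volume : Measure ℝ)}
    (h : LinearProblem β ε K R a G) : LinearProblem β ε K (c • R) (c * a) (c • G) := by
  obtain ⟨L, h1, h2⟩ := h
  refine ⟨(c : ℂ) • L, ?_, ?_⟩
  · rw [IsMultiplierImage, toComplexL2_smul, FourierTransform.fourier_smul,
      FourierTransform.fourier_smul]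
    filter_upwards [h1, Lp.coeFn_smul (c : ℂ) (𝓕 L : L2),
      Lp.coeFn_smul (c : ℂ) (𝓕 (toComplexL2 R) : L2)] with ξ a1 a2 a3
    rw [a2, a3, Pi.smul_apply, Pi.smul_apply, a1, smul_eq_mul, smul_eq_mul]
    ring
  · filter_upwards [h2, Lp.coeFn_smul (c : ℂ) L, Lp.coeFn_smul c R, Lp.coeFn_smul c G]
      with x a1 a2 a3 a4
    rw [a2, a3, a4, Pi.smul_apply, Pi.smul_apply, Pi.smul_apply, smul_eq_mul, smul_eq_mul, smul_eq_mul,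
      Complex.ofReal_mul c (G x), ← a1]
    push_cast
    ring

/-! ### The solution operators -/

lemma ExpL2.star {q : ℝ} {R : L2} (h : ExpL2 q R) : ExpL2 q (star R : L2) := by
  have key : ∀ p : ℝ, MemLp (expW p R) 2 volume → MemLp (expW p (Star.star R : L2)) 2 volume := by
    intro p hp
    have e : expW p (Star.star R : L2) =ᵐ[volume] fun x => starRingEnd ℂ (expW p R x) := by
      filter_upwards [Lp.coeFn_star R] with x hx
      simp only [expW, hx, Pi.star_apply, map_mul, Complex.conj_ofReal]
      rfl
    rw [memLp_congr_ae e]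
    exact hp.star
  exact ⟨key q h.1, key (-q) h.2⟩

/-- Localized right-hand sides have localized solutions, with bounds uniform in `ε`. The solution
is real because it is unique and its complex conjugate is a solution too. -/
lemma exists_solution {β : ℝ} (hβ : 0 < β) (hβ' : β < 1 / 3) :
    ∃ ε₀ : ℝ, 0 < ε₀ ∧ ∀ r : ℝ, 0 ≤ r → ∀ q : ℝ, 0 < q → q ≤ 1 / 2 →
      ∃ C : ℝ, 0 < C ∧ ∀ ε : ℝ, 0 < ε → ε ≤ ε₀ →
        ∃ K : ℝ, (0 < K ∧ linSymbol β ε K = 0 ∧ ∀ K', 0 < K' → linSymbol β ε K' = 0 → K' = K) ∧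
          ∀ G : EvenSobolev r q, ∃ (R : EvenSobolev (r + 1 / 2) q) (a : ℝ),
            (∀ (R' : EvenSobolev (r + 1 / 2) q) (a' : ℝ),
              LinearProblem β ε K R'.fn a' G.fn ↔ R' = R ∧ a' = a) ∧
            ‖R‖ ≤ C * ‖G‖ ∧ |a| ≤ C * ε ^ r * ‖G‖ := by
  obtain ⟨ε₀, D, m, M, hε₀, hD, hm, hM, hsym, hsolver⟩ := exists_isSolver hβ hβ'
  refine ⟨ε₀, hε₀, fun r hr q hq hq' => ?_⟩
  obtain ⟨C₀, hC₀, hC⟩ := hsym q hq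
  obtain ⟨A, hA, hloc⟩ := exists_localizedSolution (M := M) hβ hβ' hm hM hq hq' hC₀
  obtain ⟨B, hB, hreg⟩ := exists_regularity (M := M) hβ hβ' hm hq hq' hr hC₀ hA
  refine ⟨B * (1 + D ^ (-r)), by positivity, fun ε hε hεε => ?_⟩
  obtain ⟨K, S, W, hK, h⟩ := hsolver ε hε hεε
  refine ⟨K, ⟨h.pos, h.root, h.uniq⟩, fun G => ?_⟩
  set F : ℝ → ℂ := fun x => (G.fn x : ℂ) with hF
  have hFexp : ExpL2 q F := G.expL2 hq.le
  have hFm : MemLp F 2 volume := hFexp.memLp_self hq.le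
  obtain ⟨R, κ, hl⟩ := hloc h (hC ε hε hεε) F hFexp G.even
  obtain ⟨hstar, hconj⟩ := isSolution_unique h hm hβ hβ' hq hq' hFm
    (hl.sol.conj hβ hβ' hFm fun x => Complex.conj_ofReal _) hl.sol hl.memR.star hl.memR
  have hκ : ((κ.re : ℝ) : ℂ) = κ := Complex.conj_eq_iff_re.1 hconj
  have hre := toComplexL2_reL2 hstar
  have hcoe : (fun x => (reL2 R x : ℂ)) =ᵐ[volume] R := by
    have := coeFn_toComplexL2 (reL2 R)
    rw [hre] at this
    exact this.symm
  have heven : ∀ᵐ x, reL2 R (-x) = reL2 R x := by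
    filter_upwards [ae_even_of_reflL2 hl.sol.even, coeFn_reL2 R, ae_comp_neg (coeFn_reL2 R)]
      with x h1 h2 h3
    rw [h2, h3, h1]
  obtain ⟨hb1, hb2⟩ := hreg hl
  have hG : hNorm r (coshMul q F) = ENNReal.ofReal ‖G‖ := G.ofReal_norm.symm
  rw [hG] at hb1 hb2
  have hcosh : coshMul q R =ᵐ[volume] coshWeighted q (reL2 R) := by
    rw [coshWeighted_eq]
    exact (coshMul_congr q hcoe).symm
  have hmem : MemH (r + 1 / 2) (coshWeighted q (reL2 R)) := by
    refine MemH.congr ?_ hcosh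
    rw [memH_iff (hl.memR.memLp_coshMul hq.le)]
    exact hb1.trans_lt (ENNReal.mul_lt_top ENNReal.ofReal_lt_top ENNReal.ofReal_lt_top)
  let R₁ : EvenSobolev (r + 1 / 2) q := ⟨reL2 R, heven, hmem⟩
  have hR₁ : R₁.fn = reL2 R := rfl
  refine ⟨R₁, κ.re, fun R' a' => ?_, ?_, ?_⟩
  · have he : ∀ᵐ x : ℝ, R'.fn (-x) = R'.fn x := R'.property.1
    rw [linearProblem_iff hβ hβ' he]
    constructor
    · intro h'
      have hR'exp : ExpL2 q (toComplexL2 R'.fn) :=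
        (R'.expL2 hq.le).congr (coeFn_toComplexL2 R'.fn).symm
      obtain ⟨e1, e2⟩ := isSolution_unique h hm hβ hβ' hq hq' hFm h' hl.sol hR'exp hl.memR
      refine ⟨Subtype.ext ?_, ?_⟩
      · change R'.fn = reL2 R
        rw [← e1, reL2_toComplexL2]
      · rw [← e2, Complex.ofReal_re]
    · rintro ⟨rfl, rfl⟩
      rw [hR₁, hre, hκ]
      exact hl.sol
  · have h1 : ENNReal.ofReal ‖R₁‖ ≤ ENNReal.ofReal (B * ‖G‖) := by
      rw [R₁.ofReal_norm, hR₁, ENNReal.ofReal_mul hB.le, hNorm_congr (coshMul_congr q hcoe)]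
      exact hb1
    refine ((ENNReal.ofReal_le_ofReal_iff (by positivity)).1 h1).trans ?_
    gcongr
    exact le_mul_of_one_le_right hB.le (le_add_of_nonneg_right (by positivity))
  · rw [← ENNReal.ofReal_mul (by positivity), ← ofReal_norm,
      ENNReal.ofReal_le_ofReal_iff (by positivity)] at hb2
    refine (Complex.abs_re_le_norm κ).trans (hb2.trans ?_)
    have hKr : (1 + K ^ 2) ^ (-r / 2) ≤ D ^ (-r) * ε ^ r := by
      calc (1 + K ^ 2) ^ (-r / 2) ≤ ((D / ε) ^ 2) ^ (-r / 2) := by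
            refine Real.rpow_le_rpow_of_nonpos (by positivity) ?_ (by linarith)
            have : (D / ε) ^ 2 ≤ K ^ 2 := by gcongr
            linarith
        _ = D ^ (-r) * ε ^ r := by
            rw [← Real.rpow_natCast, ← Real.rpow_mul (by positivity), Real.div_rpow hD.le hε.le,
              show ((2 : ℕ) : ℝ) * (-r / 2) = -r by push_cast; ring, Real.rpow_neg hε.le,
              div_inv_eq_mul]
    refine mul_le_mul_of_nonneg_right ?_ (norm_nonneg G)
    rw [mul_assoc]
    refine mul_le_mul_of_nonneg_left (hKr.trans ?_) hB.le
    gcongr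
    linarith

end Whitham

end

theorem proposition4p4 (β : ℝ) (hβ : 0 < β) (hβ' : β < 1 / 3) :
    ∃ ε₀ : ℝ, 0 < ε₀ ∧ ∃ q₀ : ℝ, 0 < q₀ ∧
      ∀ r : ℝ, 0 ≤ r → ∀ q : ℝ, 0 < q → q ≤ q₀ →
        ∃ C : ℝ, 0 < C ∧ ∀ ε : ℝ, 0 < ε → ε ≤ ε₀ →
          ∃ K : ℝ, (0 < K ∧ Whitham.linSymbol β ε K = 0 ∧
              ∀ K' : ℝ, 0 < K' → Whitham.linSymbol β ε K' = 0 → K' = K) ∧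
            ∃ (𝓡 : Whitham.EvenSobolev r q →L[ℝ] Whitham.EvenSobolev (r + 1 / 2) q)
              (𝓐 : Whitham.EvenSobolev r q →L[ℝ] ℝ),
              (∀ (R : Whitham.EvenSobolev (r + 1 / 2) q) (a : ℝ) (G : Whitham.EvenSobolev r q),
                Whitham.LinearProblem β ε K R.fn a G.fn ↔ R = 𝓡 G ∧ a = 𝓐 G) ∧
              ‖𝓡‖ ≤ C ∧ ‖𝓐‖ ≤ C * ε ^ r := by
  obtain ⟨ε₀, hε₀, h⟩ := Whitham.exists_solution hβ hβ'
  refine ⟨ε₀, hε₀, 1 / 2, by norm_num, fun r hr q hq hq' => ?_⟩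
  obtain ⟨C, hC, h⟩ := h r hr q hq hq'
  refine ⟨C, hC, fun ε hε hε' => ?_⟩
  obtain ⟨K, hK, h⟩ := h ε hε hε'
  refine ⟨K, hK, ?_⟩
  choose R a hiff hR ha using h
  have hsol : ∀ G, Whitham.LinearProblem β ε K (R G).fn (a G) G.fn := fun G =>
    (hiff G _ _).2 ⟨rfl, rfl⟩
  -- Uniqueness turns the linearity of the problem into linearity of its solution.
  have hadd : ∀ G₁ G₂, R (G₁ + G₂) = R G₁ + R G₂ ∧ a (G₁ + G₂) = a G₁ + a G₂ := fun G₁ G₂ => by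
    obtain ⟨h1, h2⟩ := (hiff (G₁ + G₂) (R G₁ + R G₂) (a G₁ + a G₂)).1 ((hsol G₁).add (hsol G₂))
    exact ⟨h1.symm, h2.symm⟩
  have hsmul : ∀ (c : ℝ) G, R (c • G) = c • R G ∧ a (c • G) = c • a G := fun c G => by
    obtain ⟨h1, h2⟩ := (hiff (c • G) (c • R G) (c * a G)).1 ((hsol G).smul c)
    exact ⟨h1.symm, h2.symm⟩
  let 𝓡 : Whitham.EvenSobolev r q →ₗ[ℝ] Whitham.EvenSobolev (r + 1 / 2) q :=
    { toFun := R, map_add' := fun G₁ G₂ => (hadd G₁ G₂).1, map_smul' := fun c G => (hsmul c G).1 }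
  let 𝓐 : Whitham.EvenSobolev r q →ₗ[ℝ] ℝ :=
    { toFun := a, map_add' := fun G₁ G₂ => (hadd G₁ G₂).2, map_smul' := fun c G => (hsmul c G).2 }
  exact ⟨𝓡.mkContinuous C hR, 𝓐.mkContinuous (C * ε ^ r) ha, fun R' a' G => hiff G R' a',
    𝓡.mkContinuous_norm_le hC.le _, 𝓐.mkContinuous_norm_le (by positivity) _⟩
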